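/- Let $\Bbbk$ be an algebraically closed field of characteristic zero, and for $q\in\Bbbk^\times$ let $\Bbbk_q[u,v]=\Bbbk\langle u,v\rangle/(vu-quv)$, graded with $\deg u=\deg v=1$. For a graded algebra $A$ put $A^{(2)}=\bigoplus_i A_{2i}$, and for an action of a Hopf algebra $H$ put $A^H=\{a : ha=\epsilon(h)a \text{ for all } h\in H\}$. For a group $\Gamma$ with $\Gamma\cong A_4,\ S_4,\ A_5$ or the dihedral group $D_{2n}$ of order $2n$ ($n\ge 2$), a binary polyhedral group of $\Gamma$ is a subgroup $\widetilde\Gamma\le \mathrm{SL}_2(\Bbbk)$ containing $-1$, with a surjection $p:\widetilde\Gamma\to\Gamma$ of kernel $\{\pm1\}$; it acts on the commutative polynomial ring $\Bbbk[u,v]$ by linear substitutions, and the action on $\Bbbk[u,v]^{(2)}$ factors through $\Gamma$. (1) Let $H$ be a semisimple Hopf algebra over $\Bbbk$, let $A$ be $\Bbbk[u,v]$ or $\Bbbk_{-1}[u,v]$, and let $A$ be a graded left $H$-module algebra such that the action is inner faithful (no nonzero Hopf ideal of $H$ annihilates $A$) and has trivial homological determinant. Suppose that the left McKay quiver of the $H$-module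 $A_1$ (its vertices are the simple left $H$-modules $V_i$ up to isomorphism, and the number of arrows $i\to j$ is the multiplicity of $V_i$ in $A_1\otimes V_j$) is the double of the extended Dynkin diagram $\widetilde{\mathbb E}_6$, $\widetilde{\mathbb E}_7$ or $\widetilde{\mathbb E}_8$, and let $\Gamma$ be $A_4$, $S_4$ or $A_5$, respectively. (2) Or let $n\ge2$, let $H=\mathcal B(\widetilde D_{2n})$ be the Hopf algebra of dimension $4n$ generated by $a,s_+,s_-$ with relations $a^2=1$, $as_\pm=s_\pm a$, $s_\pm^2=1$, $(s_+s_-)^n=a$, where $a$ is grouplike and, with $e_0=\frac12(1+a)$, $e_1=\frac12(1-a)$, $$\Delta(s_\pm)=s_\pm\otimes e_0s_\pm+s_\mp\otimes e_1s_\pm,\qquad \epsilon(s_\pm)=1,\qquad S(s_\pm)=e_0s_\pm+e_1s_\mp .$$ Let $A=\Bbbk_{-1}[u,v]$ be a graded left $H$-module algebra such that the action is inner faithful with trivial homological determinant, and let $\Gamma=D_{2n}$. Then, in each case, a binary polyhedral group of $\Gamma$ exists in $\mathrm{SL}_2(\Bbbk)$, and for every one, $p:\widetilde\Gamma\to\Gamma$,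 the following hold. There are a central grouplike element $g\in H$ of order two and a surjective homomorphism of Hopf algebras $\pi:H\to\Bbbk\Gamma$ with kernel $H(g-1)$, such that the action of $H$ on $A^{(2)}$ factors through $\pi$ and $A^{(2)}\cong\Bbbk[u,v]^{(2)}$ as graded $\Gamma$-module algebras. Moreover $A^H\cong\Bbbk[u,v]^{\widetilde\Gamma}$ as graded algebras. -/

import Mathlib

open scoped TensorProduct

noncomputable section

/-! ### The graded algebras -/

/-- The relation `v u = q u v` on the free algebra on `u = ι 0`, `v = ι 1`. -/
inductive SkewPlaneRel (k : Type*) [Field k] (q : k) :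
    FreeAlgebra k (Fin 2) → FreeAlgebra k (Fin 2) → Prop
  | vu : SkewPlaneRel k q (FreeAlgebra.ι k 1 * FreeAlgebra.ι k 0)
      (q • (FreeAlgebra.ι k 0 * FreeAlgebra.ι k 1))

/-- The skew polynomial ring `k_q[u,v] = k⟨u,v⟩ / (v u - q u v)`. -/
def SkewPlane (k : Type*) [Field k] (q : k) : Type _ := RingQuot (SkewPlaneRel k q)

namespace SkewPlane

variable (k : Type*) [Field k] (q : k)

instance : Ring (SkewPlane k q) := inferInstanceAs (Ring (RingQuot (SkewPlaneRel k q)))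
instance : Algebra k (SkewPlane k q) := inferInstanceAs (Algebra k (RingQuot (SkewPlaneRel k q)))

/-- The generators `u = gen 0` and `v = gen 1`. -/
def gen (i : Fin 2) : SkewPlane k q :=
  RingQuot.mkAlgHom k (SkewPlaneRel k q) (FreeAlgebra.ι k i)

/-- The grading with `u, v` in degree one: the component of degree `n` is spanned by the products
of `n` generators. -/
def grading (n : ℕ) : Submodule k (SkewPlane k q) :=
  (Submodule.span k (Set.range (gen k q))) ^ n

instance : SetLike.GradedMonoid (grading k q) :=
  Submodule.nat_power_gradedMonoid (Submodule.span k (Set.range (gen k q)))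

/-- The augmentation `A → A / A_{≥ 1} = k`. -/
def augmentation : SkewPlane k q →ₐ[k] k :=
  RingQuot.liftAlgHom k ⟨FreeAlgebra.lift k (fun _ : Fin 2 => (0 : k)), by
    rintro _ _ ⟨⟩
    simp⟩

end SkewPlane

/-- The `d`-th Veronese subring `⨁ₙ A_{nd}` of a graded algebra. -/
def veronese {k A : Type*} [Field k] [Ring A] [Algebra k A] (𝒜 : ℕ → Submodule k A)
    [SetLike.GradedMonoid 𝒜] (d : ℕ) : Subalgebra k A where
  carrier := (⨆ n : ℕ, 𝒜 (n * d) : Submodule k A)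
  add_mem' ha hb := Submodule.add_mem _ ha hb
  mul_mem' {a b} ha hb := by
    have h1 : ∀ (n : ℕ) (x : A), x ∈ 𝒜 (n * d) → ∀ y ∈ (⨆ m : ℕ, 𝒜 (m * d) : Submodule k A),
        x * y ∈ (⨆ m : ℕ, 𝒜 (m * d) : Submodule k A) := by
      intro n x hx y hy
      refine Submodule.iSup_induction (fun m : ℕ => 𝒜 (m * d))
        (motive := fun y => x * y ∈ (⨆ m : ℕ, 𝒜 (m * d) : Submodule k A)) hy ?_ ?_ ?_
      · intro m z hz
        refine Submodule.mem_iSup_of_mem (n + m) ?_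
        rw [add_mul]
        exact SetLike.mul_mem_graded hx hz
      · rw [mul_zero]; exact Submodule.zero_mem _
      · intro z w hz hw
        rw [mul_add]; exact Submodule.add_mem _ hz hw
    refine Submodule.iSup_induction (fun m : ℕ => 𝒜 (m * d))
      (motive := fun x => x * b ∈ (⨆ m : ℕ, 𝒜 (m * d) : Submodule k A)) ha ?_ ?_ ?_
    · intro m z hz
      exact h1 m z hz b hb
    · rw [zero_mul]; exact Submodule.zero_mem _
    · intro z w hz hw
      rw [add_mul]; exact Submodule.add_mem _ hz hw
  algebraMap_mem' r := by
    refine Submodule.mem_iSup_of_mem 0 ?_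
    rw [zero_mul, Algebra.algebraMap_eq_smul_one]
    exact Submodule.smul_mem _ _ SetLike.GradedOne.one_mem

/-! ### Modules over a Hopf algebra -/

/-- The tensor product of two `H`-modules, with `h` acting through `Δ(h)`. -/
def tensorRep {k H V W : Type*} [Field k] [Ring H] [Bialgebra k H]
    [AddCommGroup V] [Module k V] [AddCommGroup W] [Module k W]
    (ρ : H →ₐ[k] Module.End k V) (σ : H →ₐ[k] Module.End k W) :
    H →ₐ[k] Module.End k (V ⊗[k] W) :=
  (Module.endTensorEndAlgHom (R := k) (S := k) (A := k) (M := V) (N := W)).comp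
    ((Algebra.TensorProduct.map ρ σ).comp (Bialgebra.comulAlgHom k H))

/-- `Hom_H(V, W)`. -/
def intertwiners {k H V W : Type*} [Field k] [Ring H] [Algebra k H]
    [AddCommGroup V] [Module k V] [AddCommGroup W] [Module k W]
    (ρ : H →ₐ[k] Module.End k V) (σ : H →ₐ[k] Module.End k W) : Submodule k (V →ₗ[k] W) where
  carrier := {f | ∀ h v, f (ρ h v) = σ h (f v)}
  add_mem' hf hg h v := by simp [hf h v, hg h v]
  zero_mem' h v := by simp
  smul_mem' c f hf h v := by simp [hf h v]

/-- Finite-dimensional simple left `H`-modules, on the model spaces `k^d`. -/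
structure SimpleRep (k H : Type*) [Field k] [Ring H] [Algebra k H] where
  dim : ℕ
  rep : H →ₐ[k] Module.End k (Fin dim → k)
  dim_pos : 0 < dim
  simple : ∀ U : Submodule k (Fin dim → k), (∀ h, ∀ x ∈ U, rep h x ∈ U) → U = ⊥ ∨ U = ⊤

/-- Isomorphism of simple modules. -/
instance SimpleRep.setoid (k H : Type*) [Field k] [Ring H] [Algebra k H] :
    Setoid (SimpleRep k H) where
  r S T := ∃ f : (Fin S.dim → k) ≃ₗ[k] (Fin T.dim → k), ∀ h v, f (S.rep h v) = T.rep h (f v)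
  iseqv :=
    { refl := fun S => ⟨LinearEquiv.refl k _, fun _ _ => rfl⟩
      symm := by
        rintro S T ⟨f, hf⟩
        refine ⟨f.symm, fun h v => ?_⟩
        rw [LinearEquiv.symm_apply_eq, hf, LinearEquiv.apply_symm_apply]
      trans := by
        rintro S T U ⟨f, hf⟩ ⟨g, hg⟩
        refine ⟨f.trans g, fun h v => ?_⟩
        simp only [LinearEquiv.trans_apply, hf, hg] }

/-- The set of isomorphism classes of (finite-dimensional) simple left `H`-modules: the basis of
the Grothendieck ring, and the vertex set of the McKay quiver. -/
def SimpleClass (k H : Type*) [Field k] [Ring H] [Algebra k H] : Type _ :=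
  Quotient (SimpleRep.setoid k H)

/-- The number of arrows `i → j` in the left McKay quiver of the module `Y`: the coefficient
`m i j` in `[Y] [Vⱼ] = ∑ᵢ (m i j) [Vᵢ]`, that is, the multiplicity of the simple module `Vᵢ` in
`Y ⊗ Vⱼ`. For `H` semisimple and `k` algebraically closed it is the dimension of
`Hom_H(Vᵢ, Y ⊗ Vⱼ)`. -/
def mcKayArrows {k H Y : Type*} [Field k] [Ring H] [Bialgebra k H] [AddCommGroup Y] [Module k Y]
    (ρ : H →ₐ[k] Module.End k Y) (i j : SimpleClass k H) : ℕ :=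
  Module.finrank k (intertwiners (Quotient.out i).rep (tensorRep ρ (Quotient.out j).rep))

open Classical in
/-- The McKay quiver of `Y` is (the double of) the simple graph `G`. -/
def HasMcKayGraph {k H Y : Type*} [Field k] [Ring H] [Bialgebra k H] [AddCommGroup Y] [Module k Y]
    (ρ : H →ₐ[k] Module.End k Y) {ι : Type*} (G : SimpleGraph ι) : Prop :=
  ∃ e : SimpleClass k H ≃ ι, ∀ i j, mcKayArrows ρ i j = if G.Adj (e i) (e j) then 1 else 0

/-- The extended Dynkin diagram `Ẽ₆`: three arms of length two at the vertex `0`. -/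
def affineE6 : SimpleGraph (Fin 7) :=
  SimpleGraph.fromEdgeSet {s(0, 1), s(1, 2), s(0, 3), s(3, 4), s(0, 5), s(5, 6)}

/-- The extended Dynkin diagram `Ẽ₇`: a path `0 - 1 - ⋯ - 6`, with `7` attached to the middle. -/
def affineE7 : SimpleGraph (Fin 8) :=
  SimpleGraph.fromEdgeSet {s(0, 1), s(1, 2), s(2, 3), s(3, 4), s(4, 5), s(5, 6), s(3, 7)}

/-- The extended Dynkin diagram `Ẽ₈`: a path `0 - 1 - ⋯ - 7`, with `8` attached to `5`. -/
def affineE8 : SimpleGraph (Fin 9) :=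
  SimpleGraph.fromEdgeSet
    {s(0, 1), s(1, 2), s(2, 3), s(3, 4), s(4, 5), s(5, 6), s(6, 7), s(5, 8)}

/-! ### Hopf actions on graded algebras -/

/-- A graded left `H`-module algebra structure on the graded algebra `A`. -/
structure GradedHopfAction (k H : Type*) {A : Type*} [Field k] [Ring H] [HopfAlgebra k H]
    [Ring A] [Algebra k A] (𝒜 : ℕ → Submodule k A) where
  /-- the module structure -/
  act : H →ₐ[k] Module.End k A
  /-- `h (a b) = ∑ h₁(a) h₂(b)` -/
  act_mul : ∀ (h : H) (a b : A),
    act h (a * b) = LinearMap.mul' k A (tensorRep act act h (a ⊗ₜ b))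
  /-- `h (1) = ε(h) 1` -/
  act_one : ∀ h : H, act h 1 = algebraMap k A (Coalgebra.counit h)
  /-- each homogeneous component is a submodule -/
  act_mem : ∀ (h : H) (n : ℕ) (a : A), a ∈ 𝒜 n → act h a ∈ 𝒜 n

namespace GradedHopfAction

variable {k H A : Type*} [Field k] [Ring H] [HopfAlgebra k H] [Ring A] [Algebra k A]
  {𝒜 : ℕ → Submodule k A}

/-- The `H`-module `Aₙ`. -/
def component (ρ : GradedHopfAction k H 𝒜) (n : ℕ) : H →ₐ[k] Module.End k (𝒜 n) where
  toFun h := (ρ.act h).restrict (fun a ha => ρ.act_mem h n a ha)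
  map_one' := by ext a; simp
  map_mul' g h := by ext a; simp
  map_zero' := by ext a; simp
  map_add' g h := by ext a; simp
  commutes' r := by ext a; simp [Module.algebraMap_end_apply]

/-- The action is inner faithful: no nonzero Hopf ideal of `H` annihilates `A`. -/
def InnerFaithful (ρ : GradedHopfAction k H 𝒜) : Prop :=
  ∀ I : Ideal H, I.IsTwoSided → I.IsHopfIdeal k → (∀ x ∈ I, ρ.act x = 0) → I = ⊥

/-- The fixed subring `A^H = {a | h a = ε(h) a for all h}`. -/
def fixedSubring (ρ : GradedHopfAction k H 𝒜) : Subalgebra k A where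
  carrier := {a | ∀ h, ρ.act h a = Coalgebra.counit (R := k) h • a}
  add_mem' ha hb h := by rw [map_add, ha h, hb h, smul_add]
  mul_mem' {a b} ha hb h := by
    have key : ∀ t : H ⊗[k] H,
        LinearMap.mul' k A (Module.endTensorEndAlgHom (R := k) (S := k) (A := k) (M := A) (N := A)
          (Algebra.TensorProduct.map ρ.act ρ.act t) (a ⊗ₜ b)) =
        (LinearMap.mul' k k (TensorProduct.map Coalgebra.counit Coalgebra.counit t)) • (a * b) := by
      intro t
      induction t using TensorProduct.induction_on with
      | zero => simp
      | tmul x y =>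
        simp [Module.endTensorEndAlgHom_apply, ha x, hb y, smul_smul, mul_comm]
      | add x y hx hy => simp only [map_add, LinearMap.add_apply, hx, hy, add_smul]
    rw [ρ.act_mul]
    refine (key _).trans ?_
    congr 1
    have h1 : TensorProduct.map Coalgebra.counit Coalgebra.counit (Coalgebra.comul (R := k) h) =
        (1 : k) ⊗ₜ[k] Coalgebra.counit (R := k) h := by
      rw [← LinearMap.lTensor_comp_rTensor, LinearMap.comp_apply,
        Coalgebra.rTensor_counit_comul, LinearMap.lTensor_tmul]
    refine (congrArg (LinearMap.mul' k k) h1).trans ?_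
    rw [LinearMap.mul'_apply, one_mul]
  algebraMap_mem' r h := by
    rw [Algebra.algebraMap_eq_smul_one, map_smul, ρ.act_one, Algebra.algebraMap_eq_smul_one,
      smul_comm]

end GradedHopfAction

/-! ### Homological determinant, in dimension two -/

/-- Two-cocycles of the bar complex computing `Ext_A(k, k)`, for an augmented algebra `A`. -/
def barCocycles {k A : Type*} [Field k] [Ring A] [Algebra k A] (ε : A →ₐ[k] k) :
    Submodule k (Module.Dual k (A ⊗[k] A)) where
  carrier := {f | ∀ a b c : A,
    ε a * f (b ⊗ₜ c) - f ((a * b) ⊗ₜ c) + f (a ⊗ₜ (b * c)) - f (a ⊗ₜ b) * ε c = 0}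
  add_mem' {f g} hf hg a b c := by
    simp only [LinearMap.add_apply]
    linear_combination hf a b c + hg a b c
  zero_mem' a b c := by simp
  smul_mem' r f hf a b c := by
    simp only [LinearMap.smul_apply, smul_eq_mul]
    linear_combination r * hf a b c

/-- Two-coboundaries of the bar complex. -/
def barCoboundaries {k A : Type*} [Field k] [Ring A] [Algebra k A] (ε : A →ₐ[k] k) :
    Submodule k (Module.Dual k (A ⊗[k] A)) where
  carrier := {f | ∃ g : Module.Dual k A, ∀ a b : A,
    f (a ⊗ₜ b) = ε a * g b - g (a * b) + g a * ε b}
  add_mem' := by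
    rintro f f' ⟨g, hg⟩ ⟨g', hg'⟩
    refine ⟨g + g', fun a b => ?_⟩
    simp only [LinearMap.add_apply, hg, hg']; ring
  zero_mem' := ⟨0, fun a b => by simp⟩
  smul_mem' := by
    rintro r f ⟨g, hg⟩
    refine ⟨r • g, fun a b => ?_⟩
    simp only [LinearMap.smul_apply, smul_eq_mul, hg]; ring

namespace GradedHopfAction

variable {k H A : Type*} [Field k] [Ring H] [HopfAlgebra k H] [Ring A] [Algebra k A]
  {𝒜 : ℕ → Submodule k A}

/-- The left action of `H` on two-cochains: `(h f)(x) = f(S(h) x)`. -/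
def barAct (ρ : GradedHopfAction k H 𝒜) (h : H) (f : Module.Dual k (A ⊗[k] A)) :
    Module.Dual k (A ⊗[k] A) :=
  f ∘ₗ tensorRep ρ.act ρ.act (HopfAlgebra.antipode k h)

/-- `χ` is the homological determinant of the action of `H` on the algebra `A` of dimension two:
`χ = η ∘ S`, where `h 𝔢 = η(h) 𝔢` for a nonzero class `𝔢` in `Ext²_A(k, k)`. -/
def IsHomologicalDet (ρ : GradedHopfAction k H 𝒜) (ε : A →ₐ[k] k) (χ : H → k) : Prop :=
  ∃ f ∈ barCocycles ε, f ∉ barCoboundaries ε ∧ ∃ η : H → k,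
    (∀ h, ρ.barAct h f - η h • f ∈ barCoboundaries ε) ∧
    ∀ h, χ h = η (HopfAlgebra.antipode k h)

/-- The homological determinant is trivial, i.e. equal to the counit. -/
def HasTrivialHomologicalDet (ρ : GradedHopfAction k H 𝒜) (ε : A →ₐ[k] k) : Prop :=
  ρ.IsHomologicalDet ε (fun h => Coalgebra.counit (R := k) h)

end GradedHopfAction

/-! ### Binary polyhedral groups and their action on `k[u,v]` -/

/-- `p` exhibits the subgroup `Γ̃` of `SL₂(k)` as the binary polyhedral group of `Γ`: it contains
`-1`, and `p` identifies `Γ̃ / {±1}` with `Γ`. -/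
def IsBinaryCover {k : Type*} [Field k] {Γ : Type*} [Group Γ]
    (Γt : Subgroup (Matrix.SpecialLinearGroup (Fin 2) k)) (p : Γt →* Γ) : Prop :=
  -1 ∈ Γt ∧ Function.Surjective p ∧
    ∀ g : Γt, p g = 1 ↔ (g : Matrix.SpecialLinearGroup (Fin 2) k) = 1 ∨
      (g : Matrix.SpecialLinearGroup (Fin 2) k) = -1

/-- The natural action of `SL₂(k)` on `k[u,v]` by linear substitutions, where `k u ⊕ k v` is the
defining representation: `g u = g₀₀ u + g₁₀ v`, `g v = g₀₁ u + g₁₁ v`. -/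
def substAct {k : Type*} [Field k] (g : Matrix.SpecialLinearGroup (Fin 2) k) :
    MvPolynomial (Fin 2) k →ₐ[k] MvPolynomial (Fin 2) k :=
  MvPolynomial.aeval fun j => ∑ i, MvPolynomial.C (g i j) * MvPolynomial.X i

/-- The invariant ring `k[u,v]^Γ̃`. -/
def polyInvariants {k : Type*} [Field k] (Γt : Subgroup (Matrix.SpecialLinearGroup (Fin 2) k)) :
    Subalgebra k (MvPolynomial (Fin 2) k) where
  carrier := {f | ∀ g ∈ Γt, substAct g f = f}
  add_mem' ha hb g hg := by rw [map_add, ha g hg, hb g hg]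
  mul_mem' ha hb g hg := by rw [map_mul, ha g hg, hb g hg]
  algebraMap_mem' r g _ := AlgHom.commutes _ r

/-- The second Veronese ring `k[u,v]^(2)`. -/
abbrev polyVeronese (k : Type*) [Field k] : Subalgebra k (MvPolynomial (Fin 2) k) :=
  veronese (MvPolynomial.homogeneousSubmodule (Fin 2) k) 2

/-! ### The conclusions -/

/-- `π` realises an exact sequence of Hopf algebras `k → k ℤ₂ → H → k Γ → k`, with `ℤ₂` generated
by a central grouplike element `g` of order two. -/
def IsCentralExtension {k H Γ : Type*} [Field k] [Ring H] [HopfAlgebra k H] [Group Γ]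
    (g : H) (π : H →ₐc[k] MonoidAlgebra k Γ) : Prop :=
  IsGroupLikeElem k g ∧ g ∈ Subring.center H ∧ g ≠ 1 ∧ g * g = 1 ∧
    Function.Surjective π ∧ ∀ x : H, π x = 0 ↔ ∃ y : H, x = y * (g - 1)

/-- `B` and `C` are isomorphic as graded algebras, for the gradings induced from the ambient
graded algebras. -/
def GradedAlgIso {k A T : Type*} [Field k] [Ring A] [Algebra k A] [Ring T] [Algebra k T]
    (𝒜 : ℕ → Submodule k A) (𝒯 : ℕ → Submodule k T) {B : Subalgebra k A} {C : Subalgebra k T}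
    (φ : B ≃ₐ[k] C) : Prop :=
  ∀ (n : ℕ) (x : B), (x : A) ∈ 𝒜 n ↔ (φ x : T) ∈ 𝒯 n

/-- `A^(2)` and `k[u,v]^(2)` are isomorphic as graded `Γ`-module algebras. The group `Γ` acts on
`A^(2)` by the action `α` through which, via `π : H → k Γ`, the action of `H` factors; it acts
on `k[u,v]^(2)` by the action `β` through which, via `p : Γ̃ → Γ`, the action of `Γ̃` factors. -/
def VeroneseIso {k H A Γ : Type*} [Field k] [Ring H] [HopfAlgebra k H] [Ring A] [Algebra k A]
    {𝒜 : ℕ → Submodule k A} [SetLike.GradedMonoid 𝒜] [Group Γ] (ρ : GradedHopfAction k H 𝒜)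
    (π : H →ₐc[k] MonoidAlgebra k Γ)
    (Γt : Subgroup (Matrix.SpecialLinearGroup (Fin 2) k)) (p : Γt →* Γ) : Prop :=
  ∃ (α : Γ →* (veronese 𝒜 2 ≃ₐ[k] veronese 𝒜 2)) (β : Γ →* (polyVeronese k ≃ₐ[k] polyVeronese k))
    (φ : veronese 𝒜 2 ≃ₐ[k] polyVeronese k),
    (∀ (h : H) (a : veronese 𝒜 2),
      ρ.act h (a : A) = (π h).coeff.sum fun x c => c • (α x a : A)) ∧
    (∀ (g : Γt) (f : polyVeronese k),
      (β (p g) f : MvPolynomial (Fin 2) k) = substAct (g : Matrix.SpecialLinearGroup (Fin 2) k) f) ∧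
    GradedAlgIso 𝒜 (MvPolynomial.homogeneousSubmodule (Fin 2) k) φ ∧
    ∀ (x : Γ) (a : veronese 𝒜 2), φ (α x a) = β x (φ a)

/-- The fixed subring `A^H` is the Kleinian singularity of the polyhedral group `Γ`, equivariantly
on the second Veronese ring: the binary polyhedral group `Γ̃` of `Γ` exists in `SL₂(k)`, and
for every realisation `p : Γ̃ → Γ` of it, `H` is a central extension of `k Γ` such that
`A^(2) ≅ k[u,v]^(2)` as graded `Γ`-module algebras, and `A^H ≅ k[u,v]^Γ̃` as graded algebras. -/
def IsKleinianAction {k H A : Type*} [Field k] [Ring H] [HopfAlgebra k H] [Ring A] [Algebra k A]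
    {𝒜 : ℕ → Submodule k A} [SetLike.GradedMonoid 𝒜] (ρ : GradedHopfAction k H 𝒜)
    (Γ : Type*) [Group Γ] : Prop :=
  (∃ (Γt : Subgroup (Matrix.SpecialLinearGroup (Fin 2) k)) (p : Γt →* Γ), IsBinaryCover Γt p) ∧
  ∀ (Γt : Subgroup (Matrix.SpecialLinearGroup (Fin 2) k)) (p : Γt →* Γ), IsBinaryCover Γt p →
    (∃ (g : H) (π : H →ₐc[k] MonoidAlgebra k Γ),
      IsCentralExtension g π ∧ VeroneseIso ρ π Γt p) ∧
    ∃ ψ : ρ.fixedSubring ≃ₐ[k] polyInvariants Γt,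
      GradedAlgIso 𝒜 (MvPolynomial.homogeneousSubmodule (Fin 2) k) ψ

/-! ### The Hopf algebras `B(D̃₂ₙ)` -/

namespace DefDihedral

variable (n : ℕ)

/-- The involutive automorphism of the dihedral group of order `4n` that exchanges the two
generating reflections `s₊ = sr 0` and `s₋ = sr 1`. -/
def swap : DihedralGroup (2 * n) →* DihedralGroup (2 * n) where
  toFun
    | .r i => .r (-i)
    | .sr i => .sr (1 - i)
  map_one' := by
    show DihedralGroup.r (-0) = DihedralGroup.r 0
    rw [neg_zero]
  map_mul' := by
    rintro (i | i) (j | j) <;> simp <;> ring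

end DefDihedral

/-- Masuoka's Hopf algebra `B(D̃₂ₙ)`, of dimension `4n`. As an algebra it is generated by
`a, s₊, s₋` subject to `a² = 1`, `a s± = s± a`, `s±² = 1`, `(s₊ s₋)ⁿ = a`; these relations present
the group algebra of the dihedral group of order `4n`, with reflections `s₊ = sr 0`, `s₋ = sr 1`
and `a = r n` the rotation by `π`. The Hopf structure, defined below, is not that of the group
algebra. -/
def BDihedral (k : Type*) [Field k] (n : ℕ) : Type _ := MonoidAlgebra k (DihedralGroup (2 * n))

namespace BDihedral

variable (k : Type*) [Field k] (n : ℕ)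

instance : Ring (BDihedral k n) := inferInstanceAs (Ring (MonoidAlgebra k (DihedralGroup (2 * n))))
instance : Algebra k (BDihedral k n) :=
  inferInstanceAs (Algebra k (MonoidAlgebra k (DihedralGroup (2 * n))))

/-- The basis element of a group element. -/
def of : DihedralGroup (2 * n) →* BDihedral k n := MonoidAlgebra.of k (DihedralGroup (2 * n))

/-- Algebra homomorphisms out of `B(D̃₂ₙ)`. -/
def lift {A : Type*} [Ring A] [Algebra k A] (f : DihedralGroup (2 * n) →* A) :
    BDihedral k n →ₐ[k] A :=
  MonoidAlgebra.lift k A (DihedralGroup (2 * n)) f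

theorem lift_of {A : Type*} [Ring A] [Algebra k A] (f : DihedralGroup (2 * n) →* A)
    (x : DihedralGroup (2 * n)) : lift k n f (of k n x) = f x := by
  exact MonoidAlgebra.lift_of (R := k) f x

theorem linearMap_ext {V : Type*} [AddCommGroup V] [Module k V] {f g : BDihedral k n →ₗ[k] V}
    (h : ∀ x, f (of k n x) = g (of k n x)) : f = g := by
  refine MonoidAlgebra.lhom_ext' fun x => LinearMap.ext_ring ?_
  exact h x

/-- The generator `a`. -/
def a : BDihedral k n := of k n (.r (n : ZMod (2 * n)))
/-- The generator `s₊`. -/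
def sPlus : BDihedral k n := of k n (.sr 0)
/-- The generator `s₋`. -/
def sMinus : BDihedral k n := of k n (.sr 1)
/-- `e₀ = (1 + a) / 2` -/
def e₀ : BDihedral k n := (2⁻¹ : k) • (1 + a k n)
/-- `e₁ = (1 - a) / 2` -/
def e₁ : BDihedral k n := (2⁻¹ : k) • (1 - a k n)

theorem two_n : (n : ZMod (2 * n)) + n = 0 := by
  have : ((2 * n : ℕ) : ZMod (2 * n)) = 0 := ZMod.natCast_self _
  push_cast at this
  rw [← this]; ring

theorem neg_n : -(n : ZMod (2 * n)) = n := by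
  rw [neg_eq_iff_add_eq_zero]; exact two_n n

theorem a_sq : a k n * a k n = 1 := by
  rw [a, ← map_mul, DihedralGroup.r_mul_r, two_n]
  exact map_one _

theorem a_comm (x : DihedralGroup (2 * n)) : a k n * of k n x = of k n x * a k n := by
  rw [a, ← map_mul, ← map_mul]
  congr 1
  rcases x with i | i
  · simp [add_comm]
  · rw [DihedralGroup.r_mul_sr, DihedralGroup.sr_mul_r, sub_eq_add_neg, neg_n]

theorem sPlus_sq : sPlus k n * sPlus k n = 1 := by
  rw [sPlus, ← map_mul, DihedralGroup.sr_mul_self, map_one]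
theorem sMinus_sq : sMinus k n * sMinus k n = 1 := by
  rw [sMinus, ← map_mul, DihedralGroup.sr_mul_self, map_one]
theorem sPlus_sMinus_pow : (sPlus k n * sMinus k n) ^ n = a k n := by
  rw [sPlus, sMinus, a, ← map_mul, ← map_pow, DihedralGroup.sr_mul_sr, DihedralGroup.r_pow]
  simp

theorem e₀_comm (x : DihedralGroup (2 * n)) : e₀ k n * of k n x = of k n x * e₀ k n := by
  simp only [e₀, smul_mul_assoc, mul_smul_comm, add_mul, mul_add, one_mul, mul_one, a_comm]
theorem e₁_comm (x : DihedralGroup (2 * n)) : e₁ k n * of k n x = of k n x * e₁ k n := by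
  simp only [e₁, smul_mul_assoc, mul_smul_comm, sub_mul, mul_sub, one_mul, mul_one, a_comm]

theorem e₀_e₁ : e₀ k n * e₁ k n = 0 := by
  have h : (1 + a k n) * (1 - a k n) = 0 := by
    rw [add_mul, mul_sub, one_mul, one_mul, mul_sub, mul_one, a_sq]; abel
  rw [e₀, e₁, smul_mul_assoc, mul_smul_comm, h, smul_zero, smul_zero]
theorem e₁_e₀ : e₁ k n * e₀ k n = 0 := by
  have h : (1 - a k n) * (1 + a k n) = 0 := by
    rw [sub_mul, mul_add, one_mul, one_mul, mul_add, mul_one, a_sq]; abel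
  rw [e₀, e₁, smul_mul_assoc, mul_smul_comm, h, smul_zero, smul_zero]

theorem of_mul_inv (x : DihedralGroup (2 * n)) : of k n x * of k n x⁻¹ = 1 := by
  rw [← map_mul, mul_inv_cancel, map_one]
theorem of_inv_mul (x : DihedralGroup (2 * n)) : of k n x⁻¹ * of k n x = 1 := by
  rw [← map_mul, inv_mul_cancel, map_one]

def counitAlg : BDihedral k n →ₐ[k] k := lift k n 1

/-- On the basis, `S(g) = e₀ g⁻¹ + e₁ ḡ⁻¹`. -/
def antipodeLin : BDihedral k n →ₗ[k] BDihedral k n :=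
  Finsupp.linearCombination k (fun x => e₀ k n * of k n x⁻¹ +
    e₁ k n * of k n (DefDihedral.swap n x)⁻¹) ∘ₗ (MonoidAlgebra.coeffLinearEquiv k).toLinearMap

theorem counitAlg_of (x : DihedralGroup (2 * n)) : counitAlg k n (of k n x) = 1 :=
  lift_of k n _ x

theorem antipodeLin_of (x : DihedralGroup (2 * n)) : antipodeLin k n (of k n x) =
    e₀ k n * of k n x⁻¹ + e₁ k n * of k n (DefDihedral.swap n x)⁻¹ := by
  refine (Finsupp.linearCombination_single k (1 : k) x).trans ?_
  exact one_smul _ _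

theorem counitAlg_e₁ : counitAlg k n (e₁ k n) = 0 := by
  rw [e₁, map_smul, map_sub, map_one, a, counitAlg_of, sub_self, smul_zero]

variable [CharZero k]

theorem e₀_add_e₁ : e₀ k n + e₁ k n = 1 := by
  have h : (2⁻¹ : k) + 2⁻¹ = 1 := by norm_num
  simp only [e₀, e₁, smul_add, smul_sub]
  calc _ = ((2⁻¹ : k) + 2⁻¹) • (1 : BDihedral k n) := by rw [add_smul]; abel
    _ = 1 := by rw [h, one_smul]

theorem a_eq : a k n = e₀ k n - e₁ k n := by
  have h : (2⁻¹ : k) + 2⁻¹ = 1 := by norm_num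
  simp only [e₀, e₁, smul_add, smul_sub]
  calc a k n = ((2⁻¹ : k) + 2⁻¹) • a k n := by rw [h, one_smul]
    _ = _ := by rw [add_smul]; abel

theorem e₀_sq : e₀ k n * e₀ k n = e₀ k n := by
  have := congrArg (e₀ k n * ·) (e₀_add_e₁ k n)
  simpa [mul_add, e₀_e₁] using this
theorem e₁_sq : e₁ k n * e₁ k n = e₁ k n := by
  have := congrArg (e₁ k n * ·) (e₀_add_e₁ k n)
  simpa [mul_add, e₁_e₀] using this

/-- On the basis, `Δ(g) = g ⊗ e₀ g + ḡ ⊗ e₁ g`, where `g ↦ ḡ` exchanges `s₊` and `s₋`. -/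
def comulHom : DihedralGroup (2 * n) →* BDihedral k n ⊗[k] BDihedral k n where
  toFun g := of k n g ⊗ₜ (e₀ k n * of k n g) +
    of k n (DefDihedral.swap n g) ⊗ₜ (e₁ k n * of k n g)
  map_one' := by
    simp only [map_one, mul_one, ← TensorProduct.tmul_add, e₀_add_e₁]
    rfl
  map_mul' x y := by
    have h (p q : BDihedral k n) (hp : p * of k n x = of k n x * p) :
        q * of k n x * (p * of k n y) = q * p * (of k n x * of k n y) := by
      rw [mul_assoc, ← mul_assoc (of k n x), ← hp]; simp only [mul_assoc]
    simp only [add_mul, mul_add, Algebra.TensorProduct.tmul_mul_tmul, map_mul,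
      h _ _ (e₀_comm k n x), h _ _ (e₁_comm k n x), e₀_sq, e₁_sq, e₀_e₁, e₁_e₀, zero_mul,
      TensorProduct.tmul_zero, add_zero, zero_add]

def comulAlg : BDihedral k n →ₐ[k] BDihedral k n ⊗[k] BDihedral k n := lift k n (comulHom k n)

theorem comulAlg_of (x : DihedralGroup (2 * n)) : comulAlg k n (of k n x) =
    of k n x ⊗ₜ (e₀ k n * of k n x) + of k n (DefDihedral.swap n x) ⊗ₜ (e₁ k n * of k n x) :=
  lift_of k n _ x

theorem swap_swap (x : DihedralGroup (2 * n)) :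
    DefDihedral.swap n (DefDihedral.swap n x) = x := by
  rcases x with i | i <;> simp [DefDihedral.swap]

theorem swap_a : DefDihedral.swap n (.r (n : ZMod (2 * n))) = .r (n : ZMod (2 * n)) := by
  show DihedralGroup.r (-(n : ZMod (2 * n))) = _
  rw [neg_n]

theorem comulAlg_a : comulAlg k n (a k n) = a k n ⊗ₜ a k n := by
  rw [a, comulAlg_of, swap_a, ← TensorProduct.tmul_add, ← add_mul, e₀_add_e₁, one_mul]

theorem a_mul_e₀ : a k n * e₀ k n = e₀ k n := by
  rw [a_eq, sub_mul, e₀_sq, e₁_e₀, sub_zero]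
theorem a_mul_e₁ : a k n * e₁ k n = - e₁ k n := by
  rw [a_eq, sub_mul, e₁_sq, e₀_e₁, zero_sub]

theorem comulAlg_e₀ : comulAlg k n (e₀ k n) = e₀ k n ⊗ₜ e₀ k n + e₁ k n ⊗ₜ e₁ k n := by
  have h : (2⁻¹ : k) • ((1 : BDihedral k n ⊗[k] BDihedral k n) + a k n ⊗ₜ a k n) =
      e₀ k n ⊗ₜ e₀ k n + e₁ k n ⊗ₜ e₁ k n := by
    rw [Algebra.TensorProduct.one_def, ← e₀_add_e₁ k n, a_eq]
    simp only [TensorProduct.add_tmul, TensorProduct.tmul_add, TensorProduct.sub_tmul,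
      TensorProduct.tmul_sub]
    rw [inv_smul_eq_iff₀ two_ne_zero, two_smul]
    abel
  rw [← h, e₀, map_smul, map_add, map_one, comulAlg_a]

theorem comulAlg_e₁ : comulAlg k n (e₁ k n) = e₀ k n ⊗ₜ e₁ k n + e₁ k n ⊗ₜ e₀ k n := by
  have h : (2⁻¹ : k) • ((1 : BDihedral k n ⊗[k] BDihedral k n) - a k n ⊗ₜ a k n) =
      e₀ k n ⊗ₜ e₁ k n + e₁ k n ⊗ₜ e₀ k n := by
    rw [Algebra.TensorProduct.one_def, ← e₀_add_e₁ k n, a_eq]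
    simp only [TensorProduct.add_tmul, TensorProduct.tmul_add, TensorProduct.sub_tmul,
      TensorProduct.tmul_sub]
    rw [inv_smul_eq_iff₀ two_ne_zero, two_smul]
    abel
  rw [← h, e₁, map_smul, map_sub, map_one, comulAlg_a]


theorem counitAlg_e₀ : counitAlg k n (e₀ k n) = 1 := by
  have h : (2⁻¹ : k) * (1 + 1) = 1 := by norm_num
  rw [e₀, map_smul, map_add, map_one, a, counitAlg_of, smul_eq_mul, h]
instance : Bialgebra k (BDihedral k n) :=
  Bialgebra.ofAlgHom (comulAlg k n) (counitAlg k n)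
    (by
      refine AlgHom.toLinearMap_injective (linearMap_ext k n fun x => ?_)
      simp only [AlgHom.toLinearMap_apply, AlgHom.comp_apply, comulAlg_of, map_add,
        Algebra.TensorProduct.map_tmul, AlgHom.id_apply, map_mul, comulAlg_e₀, comulAlg_e₁,
        swap_swap, TensorProduct.add_tmul, TensorProduct.tmul_add, add_mul, mul_add,
        Algebra.TensorProduct.tmul_mul_tmul, ← mul_assoc, e₀_sq, e₁_sq, e₀_e₁, e₁_e₀, zero_mul,
        TensorProduct.tmul_zero, add_zero, zero_add]
      have hassoc (x y z : BDihedral k n) : (Algebra.TensorProduct.assoc k k k (BDihedral k n)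
          (BDihedral k n) (BDihedral k n)).toAlgHom ((x ⊗ₜ y) ⊗ₜ z) = x ⊗ₜ (y ⊗ₜ z) := rfl
      rw [hassoc, hassoc, hassoc, hassoc]
      abel)
    (by
      refine AlgHom.toLinearMap_injective (linearMap_ext k n fun x => ?_)
      simp [comulAlg_of, counitAlg_of, ← TensorProduct.tmul_add, ← add_mul, e₀_add_e₁])
    (by
      refine AlgHom.toLinearMap_injective (linearMap_ext k n fun x => ?_)
      simp [comulAlg_of, counitAlg_of, counitAlg_e₀, counitAlg_e₁])

theorem antipodeLin_e_mul (x : DihedralGroup (2 * n)) :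
    antipodeLin k n (e₀ k n * of k n x) = e₀ k n * of k n x⁻¹ ∧
    antipodeLin k n (e₁ k n * of k n x) = e₁ k n * of k n (DefDihedral.swap n x)⁻¹ := by
  have h : antipodeLin k n (a k n * of k n x) =
      e₀ k n * of k n x⁻¹ - e₁ k n * of k n (DefDihedral.swap n x)⁻¹ := by
    rw [a, ← map_mul, antipodeLin_of, map_mul, swap_a, mul_inv_rev, mul_inv_rev, map_mul, map_mul]
    have : of k n (DihedralGroup.r (n : ZMod (2 * n)))⁻¹ = a k n := by
      rw [DihedralGroup.inv_r, neg_n]; rfl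
    rw [this, ← a_comm, ← a_comm, ← mul_assoc, ← mul_assoc]
    have h0 : e₀ k n * a k n = e₀ k n := by rw [a, e₀_comm, ← a, a_mul_e₀]
    have h1 : e₁ k n * a k n = - e₁ k n := by rw [a, e₁_comm, ← a, a_mul_e₁]
    rw [h0, h1, neg_mul, sub_eq_add_neg]
  constructor
  · rw [e₀, smul_mul_assoc, add_mul, one_mul, map_smul, map_add, h, antipodeLin_of,
      inv_smul_eq_iff₀ two_ne_zero, two_smul, ← e₀]
    abel
  · rw [e₁, smul_mul_assoc, sub_mul, one_mul, map_smul, map_sub, h, antipodeLin_of,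
      inv_smul_eq_iff₀ two_ne_zero, two_smul, ← e₁]
    abel

instance : HopfAlgebra k (BDihedral k n) where
  antipode := antipodeLin k n
  mul_antipode_rTensor_comul := linearMap_ext k n fun x => by
    show LinearMap.mul' k _ ((antipodeLin k n).rTensor _ (comulAlg k n (of k n x))) =
      algebraMap k _ (counitAlg k n (of k n x))
    have h (p q : BDihedral k n) (y z : DihedralGroup (2 * n))
        (hq : q * of k n y = of k n y * q) :
        p * of k n y * (q * of k n z) = p * q * (of k n y * of k n z) := by
      rw [mul_assoc, ← mul_assoc (of k n y), ← hq]; simp only [mul_assoc]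
    simp only [comulAlg_of, counitAlg_of, map_add, LinearMap.rTensor_tmul, LinearMap.mul'_apply,
      antipodeLin_of, swap_swap, map_one, add_mul, h _ _ _ _ (e₀_comm k n _),
      h _ _ _ _ (e₁_comm k n _), e₀_sq, e₁_sq, e₀_e₁, e₁_e₀, zero_mul, of_inv_mul, mul_one,
      add_zero, zero_add, e₀_add_e₁]
  mul_antipode_lTensor_comul := linearMap_ext k n fun x => by
    show LinearMap.mul' k _ ((antipodeLin k n).lTensor _ (comulAlg k n (of k n x))) =
      algebraMap k _ (counitAlg k n (of k n x))
    simp only [comulAlg_of, counitAlg_of, map_add, LinearMap.lTensor_tmul, LinearMap.mul'_apply,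
      (antipodeLin_e_mul k n _).1, (antipodeLin_e_mul k n _).2, map_one]
    rw [← mul_assoc, ← mul_assoc, ← e₀_comm, ← e₁_comm, mul_assoc, mul_assoc, of_mul_inv,
      of_mul_inv, mul_one, mul_one, e₀_add_e₁]

theorem comul_sPlus : Coalgebra.comul (R := k) (sPlus k n) =
    sPlus k n ⊗ₜ (e₀ k n * sPlus k n) + sMinus k n ⊗ₜ (e₁ k n * sPlus k n) := by
  refine (comulAlg_of k n _).trans ?_
  simp [sPlus, sMinus, DefDihedral.swap]

theorem comul_sMinus : Coalgebra.comul (R := k) (sMinus k n) =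
    sMinus k n ⊗ₜ (e₀ k n * sMinus k n) + sPlus k n ⊗ₜ (e₁ k n * sMinus k n) := by
  refine (comulAlg_of k n _).trans ?_
  simp [sPlus, sMinus, DefDihedral.swap]

theorem antipode_sPlus : HopfAlgebra.antipode k (sPlus k n) =
    e₀ k n * sPlus k n + e₁ k n * sMinus k n := by
  refine (antipodeLin_of k n _).trans ?_
  simp [sPlus, sMinus, DefDihedral.swap]

theorem antipode_sMinus : HopfAlgebra.antipode k (sMinus k n) =
    e₀ k n * sMinus k n + e₁ k n * sPlus k n := by
  refine (antipodeLin_of k n _).trans ?_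
  simp [sPlus, sMinus, DefDihedral.swap]

end BDihedral

end

/-!
Write `A = k_q[u,v]` with `q = ±1`, and `c` for the `2 × 2` matrix of functionals on `H` by which
`H` acts on `A₁`. The theorem holds because products of two entries of `c` commute, so that on
`A^(2)` the Hopf algebra acts through an honest group, and because `A^(2)` is commutative.

The homological determinant is read off from the kernel of `A₁ ⊗ A₁ → A₂`, the line spanned by
`v ⊗ u - q u ⊗ v`: if it is trivial, then `H` fixes this line pointwise (`relationChar_eq_one`).
Together with the antipode this says that the entries of `c` satisfy the relations of `SL_q(2)`
(`quantumSLRelations_coef`); in particular they commute up to sign. Inner faithfulness says that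
the algebra that they generate in `H^*` separates the points of `H` (`eq_zero_of_coefAlgebra`).

Next comes a central grouplike `g` of order two that acts on `A₁` by `-1`. If the McKay quiver is
bipartite, then the element that acts by `1` on the even and by `-1` on the odd simple modules is
one (`exists_isGroupLikeElem`). In `B(D̃₂ₙ)` the grouplike `a` is one, as follows from a computation
with the three matrices by which `a`, `s₊`, `s₋` act on `A₁` (`BDihedral.actsByNegOne_a`). The
products of an even number of entries of `c` separate the points of `H / H (g - 1)`. These products
commute, so the quotient is cocommutative, and as it is finite-dimensional over an algebraically
closed field of characteristic zero, it is a group algebra `k G` (`exists_isCentralExtension`). The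
values at `x ∈ G` of the products of two entries of `c` are, up to fixed scalars, those of a matrix
in `SL₂(k)`, unique up to sign (`exists_isLift`), and all these matrices form a binary cover of `G`
(`exists_binaryCover`).

A representation of `A` by `2 × 2` matrices over `k[x,y]`, which is diagonal on even elements, gives
a linear isomorphism `A ≅ k[x,y]` that is multiplicative on `A^(2)` (`polyEquiv`, `veroneseEquiv`).
It carries the action of `x ∈ G` on `A^(2)` to the substitution by a lift of `x`
(`IsLift.veroneseEquiv_act`). As `g` and `-1` force invariants to be even, the invariants correspond
too (`isKleinianAction`). That every binary cover may be used, not only the one just constructed,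
rests on the fact that any two are conjugate up to an automorphism of the group
(`HasUniqueBinaryCover`): a pair of matrices in `SL₂(k)` without a common eigenvector is determined
up to conjugation by the traces of the two and of their product (`SLTwo.exists_conj`), and the
traces are determined by the orders of the elements, up to an automorphism.

It remains to identify `G` from the McKay quiver. The dimensions of the simple modules form an
eigenvector of the adjacency matrix for the eigenvalue `2`, which locates the trivial module. The
even simple characters are functions on `G`, orthogonal to the trivial one if they differ from it,
and the square of the adjacency matrix describes their products with `t`, the squared trace of a
lift (`exists_evenCharacters`). So the moments of `t` are known.
They give the order of `G` and the numbers of elements of orders two and three that are needed, and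
the equation satisfied by `t` restricts the orders of all elements
(`IsTraceSq.alternatingGroup_four` and its analogues). The Sylow theorems then
leave `A₄`, `S₄` and `A₅` only.
-/


/-! ### The even part of the skew plane is commutative -/

namespace SkewPlane

open MvPolynomial

section Basic

variable {k : Type*} [Field k] {q : k}

theorem gen_one_mul_gen_zero :
    gen k q 1 * gen k q 0 = q • (gen k q 0 * gen k q 1) := by
  have h := RingQuot.mkAlgHom_rel k (SkewPlaneRel.vu (k := k) (q := q))
  rw [map_mul, map_smul, map_mul] at h
  exact h

theorem mkAlgHom_surjective :
    Function.Surjective (RingQuot.mkAlgHom k (SkewPlaneRel k q)) :=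
  RingQuot.mkAlgHom_surjective k _

/-- The algebra homomorphism sending `u`, `v` to elements satisfying the defining relation. -/
noncomputable def liftHom {B : Type*} [Ring B] [Algebra k B] (x : Fin 2 → B)
    (h : x 1 * x 0 = q • (x 0 * x 1)) : SkewPlane k q →ₐ[k] B :=
  RingQuot.liftAlgHom k ⟨FreeAlgebra.lift k x, by
    rintro _ _ ⟨⟩
    simpa using h⟩

@[simp] theorem liftHom_gen {B : Type*} [Ring B] [Algebra k B] (x : Fin 2 → B)
    (h : x 1 * x 0 = q • (x 0 * x 1)) (i : Fin 2) : liftHom x h (gen k q i) = x i := by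
  refine (RingQuot.liftAlgHom_mkAlgHom_apply _ _ _ _).trans ?_
  simp

@[simp] theorem augmentation_gen (i : Fin 2) : augmentation k q (gen k q i) = 0 := by
  refine (RingQuot.liftAlgHom_mkAlgHom_apply _ _ _ _).trans ?_
  simp

/-- A subalgebra containing both generators is everything. -/
theorem eq_top_of_gen_mem (S : Subalgebra k (SkewPlane k q)) (h : ∀ i, gen k q i ∈ S) :
    S = ⊤ := by
  refine eq_top_iff.2 fun a _ => ?_
  obtain ⟨x, rfl⟩ := mkAlgHom_surjective (k := k) (q := q) a
  induction x using FreeAlgebra.induction with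
  | grade0 r => rw [AlgHom.commutes]; exact S.algebraMap_mem r
  | grade1 i => exact h i
  | mul x y hx hy => rw [map_mul]; exact S.mul_mem (hx trivial) (hy trivial)
  | add x y hx hy => rw [map_add]; exact S.add_mem (hx trivial) (hy trivial)

theorem gen_mem_grading (i : Fin 2) : gen k q i ∈ grading k q 1 := by
  rw [grading, pow_one]
  exact Submodule.subset_span ⟨i, rfl⟩

theorem iSup_grading : ⨆ n, grading k q n = ⊤ := by
  have h := eq_top_of_gen_mem (veronese (grading k q) 1) (fun i =>
    Submodule.mem_iSup_of_mem (p := fun n : ℕ => grading k q (n * 1)) 1 (gen_mem_grading i))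
  refine eq_top_iff.2 fun a _ => ?_
  have ha : a ∈ veronese (grading k q) 1 := by rw [h]; trivial
  have : a ∈ (⨆ n : ℕ, grading k q (n * 1) : Submodule k (SkewPlane k q)) := ha
  simpa using this

theorem grading_succ (n : ℕ) :
    grading k q (n + 1) = Submodule.span k (Set.range (gen k q)) * grading k q n := pow_succ' _ _

/-- To check that a property holds in degree `n + 1`, it suffices to check products of a generator
and an element of degree `n`. -/
theorem grading_succ_le {n : ℕ} {N : Submodule k (SkewPlane k q)}
    (h : ∀ i, ∀ b ∈ grading k q n, gen k q i * b ∈ N) : grading k q (n + 1) ≤ N := by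
  rw [grading_succ, Submodule.mul_le]
  intro x hx b hb
  induction hx using Submodule.span_induction with
  | mem x hx => obtain ⟨i, rfl⟩ := hx; exact h i b hb
  | zero => rw [zero_mul]; exact N.zero_mem
  | add x y _ _ hx hy => rw [add_mul]; exact N.add_mem hx hy
  | smul c x _ hx => rw [smul_mul_assoc]; exact N.smul_mem _ hx

theorem gen_zero_pow_mul_gen_one_pow_mem (i j : ℕ) :
    gen k q 0 ^ i * gen k q 1 ^ j ∈ grading k q (i + j) :=
  SetLike.mul_mem_graded
    (by simpa using SetLike.pow_mem_graded i (gen_mem_grading (k := k) (q := q) 0))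
    (by simpa using SetLike.pow_mem_graded j (gen_mem_grading (k := k) (q := q) 1))

/-- The ordered monomials `uⁱ vʲ` span. -/
theorem span_monomials : Submodule.span k
    (Set.range fun p : ℕ × ℕ => gen k q 0 ^ p.1 * gen k q 1 ^ p.2) = ⊤ := by
  set T := Submodule.span k
    (Set.range fun p : ℕ × ℕ => gen k q 0 ^ p.1 * gen k q 1 ^ p.2) with hT
  have hv : ∀ i : ℕ, gen k q 1 * gen k q 0 ^ i = q ^ i • (gen k q 0 ^ i * gen k q 1) := by
    intro i
    induction i with
    | zero => simp
    | succ i ih =>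
      rw [pow_succ, ← mul_assoc, ih, smul_mul_assoc, mul_assoc, gen_one_mul_gen_zero,
        mul_smul_comm, smul_smul, pow_succ, mul_assoc]
  -- The elements whose left multiplication preserves the span form a subalgebra.
  let S : Subalgebra k (SkewPlane k q) :=
    { carrier := {a | ∀ b ∈ T, a * b ∈ T}
      mul_mem' := fun {a b} ha hb c hc => by rw [mul_assoc]; exact ha _ (hb _ hc)
      add_mem' := fun {a b} ha hb c hc => by rw [add_mul]; exact T.add_mem (ha _ hc) (hb _ hc)
      algebraMap_mem' := fun r c hc => by
        rw [Algebra.algebraMap_eq_smul_one, smul_mul_assoc, one_mul]; exact T.smul_mem _ hc }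
  have hgen : ∀ i, gen k q i ∈ S := by
    intro i b hb
    induction hb using Submodule.span_induction with
    | mem x hx =>
      obtain ⟨⟨m, n⟩, rfl⟩ := hx
      fin_cases i
      · exact Submodule.subset_span ⟨(m + 1, n), by simp [pow_succ', mul_assoc]⟩
      · have : gen k q 1 * (gen k q 0 ^ m * gen k q 1 ^ n) =
            q ^ m • (gen k q 0 ^ m * gen k q 1 ^ (n + 1)) := by
          rw [← mul_assoc, hv, smul_mul_assoc, mul_assoc, pow_succ' _ n]
        show gen k q 1 * (gen k q 0 ^ m * gen k q 1 ^ n) ∈ T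
        rw [this]
        exact T.smul_mem _ (Submodule.subset_span ⟨(m, n + 1), rfl⟩)
    | zero => rw [mul_zero]; exact T.zero_mem
    | add x y _ _ hx hy => rw [mul_add]; exact T.add_mem hx hy
    | smul c x _ hx => rw [mul_smul_comm]; exact T.smul_mem _ hx
  have hS := eq_top_of_gen_mem S hgen
  refine eq_top_iff.2 fun a _ => ?_
  have ha : a ∈ S := by rw [hS]; trivial
  simpa using ha 1 (Submodule.subset_span ⟨(0, 0), by simp⟩)

/-- Every element is the sum of an even and an odd one. -/
theorem exists_even_add_odd (a : SkewPlane k q) : ∃ b ∈ veronese (grading k q) 2,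
    ∃ c ∈ (⨆ n : ℕ, grading k q (n * 2 + 1) : Submodule k (SkewPlane k q)), a = b + c := by
  have ha : a ∈ (⨆ n, grading k q n) := by rw [iSup_grading]; trivial
  have hle : (⨆ n, grading k q n) ≤ (⨆ n : ℕ, grading k q (n * 2)) ⊔
      (⨆ n : ℕ, grading k q (n * 2 + 1)) := by
    refine iSup_le fun n => ?_
    rcases Nat.even_or_odd' n with ⟨m, rfl | rfl⟩
    · exact le_sup_of_le_left (le_iSup_of_le m (by rw [mul_comm]))
    · exact le_sup_of_le_right (le_iSup_of_le m (by rw [mul_comm]))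
  obtain ⟨b, hb, c, hc, h⟩ := Submodule.mem_sup.1 (hle ha)
  exact ⟨b, hb, c, hc, h.symm⟩

end Basic

section Model

variable {k : Type*} [Field k] {q α : k} (hα : α * α = q) (hq : q * q = 1)

include hα hq in
theorem ne_zero_of_sq : α ≠ 0 := by
  rintro rfl
  apply zero_ne_one (α := k)
  rw [← hq, ← hα]
  ring

include hα hq in
theorem mul_inv_eq_inv : q * α = α⁻¹ := by
  have h0 := ne_zero_of_sq hα hq
  apply mul_right_cancel₀ h0
  rw [inv_mul_cancel₀ h0, mul_assoc, hα, hq]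

/-- The representation of `k_q[u,v]`, for `q = α² = ±1`, by `2 × 2` matrices over the commutative
polynomial ring: `u ↦ x P`, `v ↦ y Q` with antidiagonal `P`, `Q` such that `Q P = q P Q`. -/
noncomputable def matrixModel :
    SkewPlane k q →ₐ[k] Matrix (Fin 2) (Fin 2) (MvPolynomial (Fin 2) k) :=
  liftHom ![!![0, X 0; X 0, 0], !![0, C α * X 1; C α⁻¹ * X 1, 0]] (by
    have h0 := ne_zero_of_sq hα hq
    have h1 : q * α⁻¹ = α := by rw [← hα, mul_assoc, mul_inv_cancel₀ h0, mul_one]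
    have h2 := mul_inv_eq_inv hα hq
    have h3 : (C q * C α⁻¹ : MvPolynomial (Fin 2) k) = C α := by rw [← C_mul, h1]
    have h4 : (C q * C α : MvPolynomial (Fin 2) k) = C α⁻¹ := by rw [← C_mul, h2]
    ext i j : 1
    fin_cases i <;> fin_cases j
    · simp [Matrix.mul_apply, Fin.sum_univ_two, MvPolynomial.smul_eq_C_mul]
      linear_combination -(X 0 * X 1) * h3
    · simp [Matrix.mul_apply, Fin.sum_univ_two]
    · simp [Matrix.mul_apply, Fin.sum_univ_two]
    · simp [Matrix.mul_apply, Fin.sum_univ_two, MvPolynomial.smul_eq_C_mul]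
      linear_combination -(X 0 * X 1) * h4)

theorem matrixModel_zero :
    matrixModel hα hq (gen k q 0) = !![0, X 0; X 0, 0] := by
  simp [matrixModel]

theorem matrixModel_one :
    matrixModel hα hq (gen k q 1) = !![0, C α * X 1; C α⁻¹ * X 1, 0] := by
  simp [matrixModel]

/-- The matrix model is graded: an element of degree `n` has entries homogeneous of degree `n`. -/
theorem matrixModel_isHomogeneous {n : ℕ} {a : SkewPlane k q} (ha : a ∈ grading k q n)
    (i j : Fin 2) : (matrixModel hα hq a i j).IsHomogeneous n := by
  induction n generalizing a i j with
  | zero =>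
    rw [grading, pow_zero, Submodule.mem_one] at ha
    obtain ⟨r, rfl⟩ := ha
    rw [AlgHom.commutes, Matrix.algebraMap_matrix_apply]
    split_ifs
    · exact isHomogeneous_C _ _
    · exact isHomogeneous_zero _ _ _
  | succ n ih =>
    let N : Submodule k (SkewPlane k q) :=
      (homogeneousSubmodule (Fin 2) k (n + 1)).comap
        ((Matrix.entryLinearMap k (MvPolynomial (Fin 2) k) i j).comp
          (matrixModel hα hq).toLinearMap)
    refine (grading_succ_le (N := N) fun l b hb => ?_) ha
    show (matrixModel hα hq (gen k q l * b) i j).IsHomogeneous (n + 1)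
    rw [map_mul, Matrix.mul_apply, add_comm n 1]
    refine IsHomogeneous.sum _ _ _ fun m _ => IsHomogeneous.mul ?_ (ih hb _ _)
    fin_cases l
    · show ((matrixModel hα hq (gen k q 0)) i m).IsHomogeneous 1
      rw [matrixModel_zero]
      fin_cases i <;> fin_cases m <;> simp [isHomogeneous_X, isHomogeneous_zero]
    · show ((matrixModel hα hq (gen k q 1)) i m).IsHomogeneous 1
      rw [matrixModel_one]
      fin_cases i <;> fin_cases m <;>
        simp [isHomogeneous_C_mul_X, isHomogeneous_zero]

/-- Elements of even degree are represented by diagonal matrices, those of odd degree by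
antidiagonal ones. -/
theorem matrixModel_eq_zero {n : ℕ} {a : SkewPlane k q} (ha : a ∈ grading k q n)
    (i j : Fin 2) (hij : (i : ℕ) + j + n ≡ 1 [MOD 2]) : matrixModel hα hq a i j = 0 := by
  induction n generalizing a i j with
  | zero =>
    rw [grading, pow_zero, Submodule.mem_one] at ha
    obtain ⟨r, rfl⟩ := ha
    rw [AlgHom.commutes, Matrix.algebraMap_matrix_apply, if_neg]
    rintro rfl
    rw [Nat.ModEq] at hij
    omega
  | succ n ih =>
    let N : Submodule k (SkewPlane k q) := LinearMap.ker
        ((Matrix.entryLinearMap k (MvPolynomial (Fin 2) k) i j).comp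
          (matrixModel hα hq).toLinearMap)
    refine (grading_succ_le (N := N) fun l b hb => ?_) ha
    show matrixModel hα hq (gen k q l * b) i j = 0
    rw [map_mul, Matrix.mul_apply]
    refine Finset.sum_eq_zero fun m _ => ?_
    rw [Nat.ModEq] at hij
    by_cases him : i = m
    · subst him
      have : matrixModel hα hq (gen k q l) i i = 0 := by
        fin_cases l
        · show matrixModel hα hq (gen k q 0) i i = 0
          rw [matrixModel_zero]; fin_cases i <;> rfl
        · show matrixModel hα hq (gen k q 1) i i = 0
          rw [matrixModel_one]; fin_cases i <;> rfl
      rw [this, zero_mul]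
    · rw [ih hb m j, mul_zero]
      rw [Nat.ModEq]
      have : (i : ℕ) ≠ m := fun h => him (Fin.ext h)
      omega

/-- The linear isomorphism `k_q[u,v] ≅ k[x,y]`, before it is known to be one: the sum of the entries
in the first row of the matrix model. It rescales the ordered monomials. -/
noncomputable def toPoly : SkewPlane k q →ₗ[k] MvPolynomial (Fin 2) k :=
  (Matrix.entryLinearMap k (MvPolynomial (Fin 2) k) (0 : Fin 2) (0 : Fin 2) +
    Matrix.entryLinearMap k (MvPolynomial (Fin 2) k) (0 : Fin 2) (1 : Fin 2)).comp
    (matrixModel hα hq).toLinearMap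

theorem toPoly_apply (a : SkewPlane k q) :
    toPoly hα hq a = matrixModel hα hq a 0 0 + matrixModel hα hq a 0 1 := rfl

theorem matrixModel_pow_zero (i : ℕ) : ∃ P : Matrix (Fin 2) (Fin 2) (MvPolynomial (Fin 2) k),
    matrixModel hα hq (gen k q 0) ^ i = (X 0 ^ i : MvPolynomial (Fin 2) k) • P ∧
      (P = 1 ∨ P = !![0, 1; 1, 0]) := by
  induction i with
  | zero => exact ⟨1, by simp, Or.inl rfl⟩
  | succ i ih =>
    obtain ⟨P, hP, h⟩ := ih
    refine ⟨P * !![0, 1; 1, 0], ?_, ?_⟩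
    · have : (!![0, X 0; X 0, 0] : Matrix (Fin 2) (Fin 2) (MvPolynomial (Fin 2) k)) =
          (X 0 : MvPolynomial (Fin 2) k) • !![0, 1; 1, 0] := by
        ext a b : 1; fin_cases a <;> fin_cases b <;> simp
      rw [pow_succ, hP, matrixModel_zero, this, smul_mul_smul_comm, pow_succ]
    · rcases h with rfl | rfl
      · right; rw [one_mul]
      · left
        ext a b : 1; fin_cases a <;> fin_cases b <;> simp [Matrix.mul_apply, Fin.sum_univ_two]

theorem matrixModel_pow_one (j : ℕ) : ∃ Q : Matrix (Fin 2) (Fin 2) (MvPolynomial (Fin 2) k),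
    matrixModel hα hq (gen k q 1) ^ j = (X 1 ^ j : MvPolynomial (Fin 2) k) • Q ∧
      (Q = 1 ∨ Q = !![0, C α; C α⁻¹, 0]) := by
  have h0 := ne_zero_of_sq hα hq
  induction j with
  | zero => exact ⟨1, by simp, Or.inl rfl⟩
  | succ i ih =>
    obtain ⟨P, hP, h⟩ := ih
    refine ⟨P * !![0, C α; C α⁻¹, 0], ?_, ?_⟩
    · have : (!![0, C α * X 1; C α⁻¹ * X 1, 0] :
            Matrix (Fin 2) (Fin 2) (MvPolynomial (Fin 2) k)) =
          (X 1 : MvPolynomial (Fin 2) k) • !![0, C α; C α⁻¹, 0] := by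
        ext a b : 1; fin_cases a <;> fin_cases b <;> simp [mul_comm]
      rw [pow_succ, hP, matrixModel_one, this, smul_mul_smul_comm, pow_succ]
    · rcases h with rfl | rfl
      · right; rw [one_mul]
      · left
        ext a b : 1
        fin_cases a <;> fin_cases b <;>
          simp [Matrix.mul_apply, Fin.sum_univ_two, ← C_mul, h0]

/-- Up to nonzero scalars `toPoly` takes the ordered monomials `uⁱ vʲ` to the monomials `xⁱ yʲ`;
this is why it is bijective. -/
theorem toPoly_monomial (p : ℕ × ℕ) : ∃ c : k, c ≠ 0 ∧
    toPoly hα hq (gen k q 0 ^ p.1 * gen k q 1 ^ p.2) = c • (X 0 ^ p.1 * X 1 ^ p.2) := by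
  have h0 := ne_zero_of_sq hα hq
  obtain ⟨P, hP, hP'⟩ := matrixModel_pow_zero hα hq p.1
  obtain ⟨Q, hQ, hQ'⟩ := matrixModel_pow_one hα hq p.2
  have key : ∃ c : k, c ≠ 0 ∧ (P * Q) 0 0 + (P * Q) 0 1 = C c := by
    rcases hP' with rfl | rfl <;> rcases hQ' with rfl | rfl
    · exact ⟨1, one_ne_zero, by simp⟩
    · exact ⟨α, h0, by simp⟩
    · exact ⟨1, one_ne_zero, by simp⟩
    · exact ⟨α⁻¹, inv_ne_zero h0, by simp [Matrix.mul_apply, Fin.sum_univ_two]⟩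
  obtain ⟨c, hc, hPQ⟩ := key
  refine ⟨c, hc, ?_⟩
  rw [toPoly_apply, map_mul, map_pow, map_pow, hP, hQ, smul_mul_smul_comm, Matrix.smul_apply,
    Matrix.smul_apply, ← smul_add, hPQ, smul_eq_mul, MvPolynomial.smul_eq_C_mul, mul_comm]

theorem toPoly_bijective : Function.Bijective (toPoly hα hq) := by
  choose c hc h using toPoly_monomial hα hq
  have hmon : ∀ m : Fin 2 →₀ ℕ,
      (X 0 ^ m 0 * X 1 ^ m 1 : MvPolynomial (Fin 2) k) = monomial m 1 := by
    intro m
    rw [monomial_eq, C_1, one_mul, Finsupp.prod_fintype _ _ (fun i => pow_zero _),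
      Fin.prod_univ_two]
  let Ω : MvPolynomial (Fin 2) k →ₗ[k] SkewPlane k q :=
    (basisMonomials (Fin 2) k).constr k fun m =>
      (c (m 0, m 1))⁻¹ • (gen k q 0 ^ m 0 * gen k q 1 ^ m 1)
  have hΩ : ∀ m : Fin 2 →₀ ℕ, Ω (X 0 ^ m 0 * X 1 ^ m 1) =
      (c (m 0, m 1))⁻¹ • (gen k q 0 ^ m 0 * gen k q 1 ^ m 1) := by
    intro m
    have := (basisMonomials (Fin 2) k).constr_basis k (fun m =>
      (c (m 0, m 1))⁻¹ • (gen k q 0 ^ m 0 * gen k q 1 ^ m 1)) m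
    rw [coe_basisMonomials] at this
    rw [hmon]
    exact this
  constructor
  · have hid : Ω.comp (toPoly hα hq) = LinearMap.id := by
      refine LinearMap.ext_on_range (v := fun p : ℕ × ℕ => gen k q 0 ^ p.1 * gen k q 1 ^ p.2)
        span_monomials fun p => ?_
      let m : Fin 2 →₀ ℕ := Finsupp.equivFunOnFinite.symm ![p.1, p.2]
      have := hΩ m
      simp only [m, Finsupp.equivFunOnFinite_symm_apply_apply, Matrix.cons_val_zero,
        Matrix.cons_val_one] at this
      rw [LinearMap.comp_apply, h, map_smul, this, smul_smul, mul_inv_cancel₀ (hc p), one_smul]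
      rfl
    exact Function.LeftInverse.injective (g := Ω) fun a => LinearMap.congr_fun hid a
  · intro f
    induction f using MvPolynomial.induction_on' with
    | monomial m r =>
      refine ⟨(r * (c (m 0, m 1))⁻¹) • (gen k q 0 ^ m 0 * gen k q 1 ^ m 1), ?_⟩
      have := h (m 0, m 1)
      dsimp only at this
      rw [map_smul, this, smul_smul, mul_assoc, inv_mul_cancel₀ (hc _), mul_one, hmon,
        MvPolynomial.smul_monomial, smul_eq_mul, mul_one]
    | add f g hf hg =>
      obtain ⟨x, hx⟩ := hf
      obtain ⟨y, hy⟩ := hg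
      exact ⟨x + y, by rw [map_add, hx, hy]⟩

/-- The linear isomorphism `k_q[u,v] ≅ k[x,y]` given by `toPoly`. -/
noncomputable def polyEquiv : SkewPlane k q ≃ₗ[k] MvPolynomial (Fin 2) k :=
  LinearEquiv.ofBijective (toPoly hα hq) (toPoly_bijective hα hq)

theorem polyEquiv_apply (a : SkewPlane k q) :
    polyEquiv hα hq a = matrixModel hα hq a 0 0 + matrixModel hα hq a 0 1 := rfl

theorem map_polyEquiv_grading (n : ℕ) :
    (grading k q n).map (polyEquiv hα hq).toLinearMap = homogeneousSubmodule (Fin 2) k n := by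
  apply le_antisymm
  · rintro _ ⟨a, ha, rfl⟩
    exact (matrixModel_isHomogeneous hα hq ha 0 0).add (matrixModel_isHomogeneous hα hq ha 0 1)
  · intro f hf
    rw [f.as_sum]
    refine Submodule.sum_mem _ fun m hm => ?_
    obtain ⟨c, hc, h⟩ := toPoly_monomial hα hq (m 0, m 1)
    have hd : m 0 + m 1 = n := by
      rw [← Fin.sum_univ_two (f := fun i => m i), ← Finsupp.degree_eq_sum]
      by_contra hne
      exact (mem_support_iff.1 hm) (hf.coeff_eq_zero hne)
    refine ⟨(f.coeff m * c⁻¹) • (gen k q 0 ^ m 0 * gen k q 1 ^ m 1),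
      Submodule.smul_mem _ _ (hd ▸ gen_zero_pow_mul_gen_one_pow_mem _ _), ?_⟩
    have hmon : (X 0 ^ m 0 * X 1 ^ m 1 : MvPolynomial (Fin 2) k) = monomial m 1 := by
      rw [monomial_eq, C_1, one_mul, Finsupp.prod_fintype _ _ (fun i => pow_zero _),
        Fin.prod_univ_two]
    refine (map_smul (toPoly hα hq) _ _).trans ?_
    refine (congrArg _ h).trans ?_
    rw [smul_smul, mul_assoc, inv_mul_cancel₀ hc, mul_one, hmon,
        MvPolynomial.smul_monomial, smul_eq_mul, mul_one]

theorem mem_grading_iff (n : ℕ) (a : SkewPlane k q) :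
    a ∈ grading k q n ↔ polyEquiv hα hq a ∈ homogeneousSubmodule (Fin 2) k n := by
  rw [← map_polyEquiv_grading hα hq, Submodule.mem_map_equiv]
  simp

theorem matrixModel_even {a : SkewPlane k q} (ha : a ∈ veronese (grading k q) 2) :
    matrixModel hα hq a 0 1 = 0 ∧ matrixModel hα hq a 1 0 = 0 := by
  have ha' : a ∈ (⨆ n : ℕ, grading k q (n * 2) : Submodule k (SkewPlane k q)) := ha
  refine Submodule.iSup_induction _ (motive := fun a => matrixModel hα hq a 0 1 = 0 ∧
    matrixModel hα hq a 1 0 = 0) ha' ?_ ?_ ?_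
  · intro n a ha
    constructor <;> apply matrixModel_eq_zero hα hq ha <;> simp [Nat.ModEq]
  · simp
  · rintro a b ⟨h1, h2⟩ ⟨h3, h4⟩
    rw [map_add, Matrix.add_apply, Matrix.add_apply, h1, h2, h3, h4, add_zero]
    exact ⟨rfl, rfl⟩

theorem polyEquiv_even {a : SkewPlane k q} (ha : a ∈ veronese (grading k q) 2) :
    polyEquiv hα hq a = matrixModel hα hq a 0 0 := by
  rw [polyEquiv_apply, (matrixModel_even hα hq ha).1, add_zero]

theorem mem_veronese_iff (a : SkewPlane k q) :
    a ∈ veronese (grading k q) 2 ↔ polyEquiv hα hq a ∈ polyVeronese k := by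
  have h : (⨆ n : ℕ, homogeneousSubmodule (Fin 2) k (n * 2)) =
      (⨆ n : ℕ, grading k q (n * 2) : Submodule k (SkewPlane k q)).map
        (polyEquiv hα hq).toLinearMap := by
    rw [Submodule.map_iSup]
    simp_rw [map_polyEquiv_grading hα hq]
  show a ∈ (⨆ n : ℕ, grading k q (n * 2) : Submodule k (SkewPlane k q)) ↔
    polyEquiv hα hq a ∈ (⨆ n : ℕ, homogeneousSubmodule (Fin 2) k (n * 2))
  rw [h, Submodule.mem_map_equiv]
  simp

/-- Although `polyEquiv` is not multiplicative, it is so on even elements: those are represented by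
diagonal matrices, and `polyEquiv` is their upper left entry. -/
theorem polyEquiv_mul_even {a b : SkewPlane k q} (ha : a ∈ veronese (grading k q) 2)
    (hb : b ∈ veronese (grading k q) 2) :
    polyEquiv hα hq (a * b) = polyEquiv hα hq a * polyEquiv hα hq b := by
  rw [polyEquiv_even hα hq ha, polyEquiv_even hα hq hb, polyEquiv_even hα hq (mul_mem ha hb),
    map_mul, Matrix.mul_apply, Fin.sum_univ_two, (matrixModel_even hα hq ha).1, zero_mul, add_zero]

/-- The isomorphism of graded algebras `k_q[u,v]^(2) ≅ k[x,y]^(2)`: the upper left entry of the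
matrix model, which is multiplicative on diagonal matrices. -/
noncomputable def veroneseEquiv : veronese (grading k q) 2 ≃ₐ[k] polyVeronese k :=
  AlgEquiv.ofBijective
    { toFun := fun a => ⟨polyEquiv hα hq a, (mem_veronese_iff hα hq _).1 a.2⟩
      map_one' := Subtype.ext (by
        show polyEquiv hα hq 1 = 1
        rw [polyEquiv_even hα hq (one_mem _), map_one, Matrix.one_apply_eq])
      map_mul' := fun a b => Subtype.ext (polyEquiv_mul_even hα hq a.2 b.2)
      map_zero' := Subtype.ext (map_zero _)
      map_add' := fun a b => Subtype.ext (map_add _ _ _)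
      commutes' := fun r => Subtype.ext (by
        show polyEquiv hα hq (algebraMap k _ r) = algebraMap k _ r
        rw [polyEquiv_even hα hq (Subalgebra.algebraMap_mem _ r), AlgHom.commutes,
          Matrix.algebraMap_matrix_apply, if_pos rfl]) }
    ⟨fun a b h => by
        have h' : polyEquiv hα hq a = polyEquiv hα hq b := by
          have := Subtype.ext_iff.1 h
          exact this
        exact Subtype.ext ((polyEquiv hα hq).injective h'),
      fun f => ⟨⟨(polyEquiv hα hq).symm f, (mem_veronese_iff hα hq _).2 (by simp)⟩,
        Subtype.ext (by simp)⟩⟩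

theorem gen_mul_gen_mem_grading (i j : Fin 2) : gen k q i * gen k q j ∈ grading k q 2 :=
  SetLike.mul_mem_graded (gen_mem_grading i) (gen_mem_grading j)

theorem gen_mul_gen_mem (i j : Fin 2) : gen k q i * gen k q j ∈ veronese (grading k q) 2 :=
  Submodule.mem_iSup_of_mem (p := fun n : ℕ => grading k q (n * 2)) 1 (gen_mul_gen_mem_grading i j)

theorem polyEquiv_gen_mul_gen (i j : Fin 2) : polyEquiv hα hq (gen k q i * gen k q j) =
    C (α ^ (i : ℕ) * α⁻¹ ^ (j : ℕ)) * (X i * X j) := by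
  have h0 := ne_zero_of_sq hα hq
  rw [polyEquiv_even hα hq (gen_mul_gen_mem i j), map_mul]
  fin_cases i <;> fin_cases j
  · show (matrixModel hα hq (gen k q 0) * matrixModel hα hq (gen k q 0)) 0 0 = _
    simp [matrixModel_zero, Matrix.mul_apply, Fin.sum_univ_two]
  · show (matrixModel hα hq (gen k q 0) * matrixModel hα hq (gen k q 1)) 0 0 = _
    simp [matrixModel_zero, matrixModel_one, Matrix.mul_apply, Fin.sum_univ_two]
    ring
  · show (matrixModel hα hq (gen k q 1) * matrixModel hα hq (gen k q 0)) 0 0 = _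
    simp [matrixModel_zero, matrixModel_one, Matrix.mul_apply, Fin.sum_univ_two]
    ring
  · show (matrixModel hα hq (gen k q 1) * matrixModel hα hq (gen k q 1)) 0 0 = _
    have : (C α * C α⁻¹ : MvPolynomial (Fin 2) k) = 1 := by
      rw [← C_mul, mul_inv_cancel₀ h0, C_1]
    simp only [matrixModel_one, Matrix.mul_apply, Fin.sum_univ_two]
    simp [h0]
    linear_combination (X 1 * X 1) * this

theorem polyEquiv_gen (i : Fin 2) : polyEquiv hα hq (gen k q i) = C (α ^ (i : ℕ)) * X i := by
  rw [polyEquiv_apply]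
  fin_cases i
  · show matrixModel hα hq (gen k q 0) 0 0 + matrixModel hα hq (gen k q 0) 0 1 = _
    simp [matrixModel_zero]
  · show matrixModel hα hq (gen k q 1) 0 0 + matrixModel hα hq (gen k q 1) 0 1 = _
    simp [matrixModel_one]

include hα hq in
theorem linearIndependent_gen : LinearIndependent k (gen k q) := by
  have h0 := ne_zero_of_sq hα hq
  rw [Fintype.linearIndependent_iff]
  intro c hc i
  have h := congrArg (polyEquiv hα hq) hc
  rw [map_sum, map_zero] at h
  simp only [map_smul, polyEquiv_gen, Fin.sum_univ_two] at h
  have hi := congrArg (coeff (Finsupp.single i 1)) h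
  fin_cases i <;>
    simpa [coeff_X, Finsupp.single_left_inj, h0] using hi

include hα hq in
/-- The only relation between the products of two generators is the defining one. -/
theorem sum_gen_mul_gen_eq_zero {r : Fin 2 → Fin 2 → k}
    (h : ∑ i, ∑ j, r i j • (gen k q i * gen k q j) = 0) :
    r 0 0 = 0 ∧ r 1 1 = 0 ∧ r 0 1 + q * r 1 0 = 0 := by
  have h0 := ne_zero_of_sq hα hq
  have h := congrArg (polyEquiv hα hq) h
  simp only [map_sum, map_smul, polyEquiv_gen_mul_gen, map_zero] at h
  have hX : ∀ i j : Fin 2, (X i * X j : MvPolynomial (Fin 2) k) =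
      monomial (Finsupp.single i 1 + Finsupp.single j 1) 1 := by
    intro i j; rw [X, X, monomial_mul, one_mul]
  have h' : ∀ m : Fin 2 →₀ ℕ, ∑ i : Fin 2, ∑ j : Fin 2, r i j * ((α ^ (i : ℕ) * α⁻¹ ^ (j : ℕ)) *
      (if Finsupp.single i 1 + Finsupp.single j 1 = m then 1 else 0)) = 0 := by
    intro m
    have := congrArg (coeff m) h
    simpa only [coeff_sum, coeff_smul, coeff_C_mul, hX, coeff_monomial, coeff_zero,
      smul_eq_mul] using this
  have e1 := h' (Finsupp.single 0 1 + Finsupp.single 0 1)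
  have e2 := h' (Finsupp.single 1 1 + Finsupp.single 1 1)
  have e3 := h' (Finsupp.single 0 1 + Finsupp.single 1 1)
  simp [Fin.sum_univ_two, Finsupp.ext_iff, Finsupp.single_apply, h0] at e1 e2 e3
  refine ⟨e1, e2, ?_⟩
  rw [← hα]
  field_simp at e3
  linear_combination e3

end Model
end SkewPlane


/-! ### Pairs of elements of `SL₂` are determined by their traces -/

namespace SLTwo

open Matrix

variable {k : Type*} [Field k]

/-- The matrix of an element of `SL₂(k)`. -/
def mat : SpecialLinearGroup (Fin 2) k →* Matrix (Fin 2) (Fin 2) k where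
  toFun M := M
  map_one' := rfl
  map_mul' _ _ := rfl

theorem mat_apply (M : SpecialLinearGroup (Fin 2) k) (i j : Fin 2) : mat M i j = M i j := rfl

theorem mat_injective : Function.Injective (mat (k := k)) := Subtype.val_injective

theorem mat_neg (M : SpecialLinearGroup (Fin 2) k) : mat (-M) = -mat M :=
  SpecialLinearGroup.coe_neg M

theorem det_mat (M : SpecialLinearGroup (Fin 2) k) : (mat M).det = 1 := M.det_coe

/-- The trace of an element of `SL₂(k)`. -/
def tr (M : SpecialLinearGroup (Fin 2) k) : k := (mat M).trace

theorem tr_neg (M : SpecialLinearGroup (Fin 2) k) : tr (-M) = - tr M := by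
  simp [tr, mat_neg, Matrix.trace_neg]

theorem tr_one : tr (1 : SpecialLinearGroup (Fin 2) k) = 2 := by
  simp [tr]

theorem tr_mul_comm (M N : SpecialLinearGroup (Fin 2) k) : tr (M * N) = tr (N * M) := by
  rw [tr, tr, map_mul, map_mul, Matrix.trace_mul_comm]

theorem tr_conj (s M : SpecialLinearGroup (Fin 2) k) : tr (s * M * s⁻¹) = tr M := by
  rw [tr_mul_comm, ← mul_assoc, inv_mul_cancel, one_mul]

/-- The Cayley–Hamilton theorem. -/
theorem coe_sq (M : SpecialLinearGroup (Fin 2) k) :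
    mat M * mat M = tr M • mat M - 1 := by
  have hd := det_mat M
  rw [Matrix.det_fin_two] at hd
  ext i j
  fin_cases i <;> fin_cases j <;>
    simp [Matrix.mul_apply, Fin.sum_univ_two, tr, Matrix.trace_fin_two]
  · linear_combination -hd
  · ring
  · ring
  · linear_combination -hd

theorem coe_pow_three (M : SpecialLinearGroup (Fin 2) k) :
    mat (M ^ 3) =
      (tr M ^ 2 - 1) • mat M - tr M • 1 := by
  rw [map_pow, pow_succ, pow_two, coe_sq, sub_mul, smul_mul_assoc, coe_sq,
    one_mul]
  module

theorem coe_pow_four (M : SpecialLinearGroup (Fin 2) k) :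
    mat (M ^ 4) =
      (tr M ^ 3 - 2 * tr M) • mat M - (tr M ^ 2 - 1) • 1 := by
  rw [pow_succ, map_mul, coe_pow_three, sub_mul, smul_mul_assoc, coe_sq,
    smul_mul_assoc, one_mul]
  module

theorem coe_pow_five (M : SpecialLinearGroup (Fin 2) k) :
    mat (M ^ 5) =
      (tr M ^ 4 - 3 * tr M ^ 2 + 1) • mat M -
        (tr M ^ 3 - 2 * tr M) • 1 := by
  rw [pow_succ, map_mul, coe_pow_four, sub_mul, smul_mul_assoc, coe_sq,
    smul_mul_assoc, one_mul]
  module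

theorem tr_sq (M : SpecialLinearGroup (Fin 2) k) : tr (M ^ 2) = tr M ^ 2 - 2 := by
  have : mat (M ^ 2) =
      tr M • mat M - 1 := by
    rw [map_pow, pow_two, coe_sq]
  rw [tr, this, Matrix.trace_sub, Matrix.trace_smul, Matrix.trace_one, Fintype.card_fin, ← tr,
    smul_eq_mul]
  push_cast
  ring

theorem eq_or_eq_neg_of_smul_eq {M : SpecialLinearGroup (Fin 2) k} {a b : k}
    (h : a • mat M = b • (1 : Matrix (Fin 2) (Fin 2) k)) (ha : a ≠ 0) :
    M = 1 ∨ M = -1 := by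
  have hM : mat M = (a⁻¹ * b) • (1 : Matrix (Fin 2) (Fin 2) k) := by
    rw [mul_smul, ← h, smul_smul, inv_mul_cancel₀ ha, one_smul]
  have hd := det_mat M
  rw [hM, Matrix.det_smul, Matrix.det_one, mul_one, Fintype.card_fin] at hd
  rcases sq_eq_one_iff.1 hd with h | h
  · left; apply mat_injective; rw [hM, h, map_one, one_smul]
  · right; apply mat_injective; rw [hM, h, mat_neg, map_one, neg_one_smul]

/-- If a polynomial in `M` with nonzero leading coefficient `a` is scalar then so is `M`. -/
theorem coeff_eq_zero {M N : SpecialLinearGroup (Fin 2) k} {a b : k}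
    (h : mat N = a • mat M - b • 1)
    (hN : N = 1 ∨ N = -1) (hM : ¬ (M = 1 ∨ M = -1)) : a = 0 := by
  by_contra ha
  apply hM
  have : ∃ c : k, mat N = c • 1 := by
    rcases hN with rfl | rfl
    · exact ⟨1, by simp⟩
    · exact ⟨-1, by rw [mat_neg, map_one, neg_one_smul]⟩
  obtain ⟨c, hc⟩ := this
  refine eq_or_eq_neg_of_smul_eq (a := a) (b := c + b) ?_ ha
  rw [add_smul, ← hc, h]
  abel

theorem tr_eq_zero_of_sq {M : SpecialLinearGroup (Fin 2) k} (h : M ^ 2 = 1 ∨ M ^ 2 = -1)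
    (hM : ¬ (M = 1 ∨ M = -1)) : tr M = 0 := by
  refine coeff_eq_zero (b := 1) ?_ h hM
  rw [map_pow, pow_two, coe_sq, one_smul]

theorem tr_of_pow_three {M : SpecialLinearGroup (Fin 2) k} (h : M ^ 3 = 1 ∨ M ^ 3 = -1)
    (hM : ¬ (M = 1 ∨ M = -1)) : tr M ^ 2 = 1 :=
  sub_eq_zero.1 (coeff_eq_zero (coe_pow_three M) h hM)

theorem tr_of_pow_five {M : SpecialLinearGroup (Fin 2) k} (h : M ^ 5 = 1 ∨ M ^ 5 = -1)
    (hM : ¬ (M = 1 ∨ M = -1)) : tr M ^ 4 - 3 * tr M ^ 2 + 1 = 0 :=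
  coeff_eq_zero (coe_pow_five M) h hM

theorem eq_neg_one_iff_coe {M : SpecialLinearGroup (Fin 2) k} :
    M = -1 ↔ mat M = -1 := by
  constructor
  · rintro rfl; rw [mat_neg, map_one]
  · intro h; apply mat_injective; rw [h, mat_neg, map_one]

theorem eq_one_iff_coe {M : SpecialLinearGroup (Fin 2) k} :
    M = 1 ↔ mat M = 1 := by
  constructor
  · rintro rfl; rw [map_one]
  · intro h; apply mat_injective; rw [h, map_one]

theorem sq_eq_neg_one {M : SpecialLinearGroup (Fin 2) k} (h : tr M = 0) : M ^ 2 = -1 := by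
  rw [eq_neg_one_iff_coe, map_pow, pow_two, coe_sq, h]
  simp

theorem tr_of_pow_four {M : SpecialLinearGroup (Fin 2) k} (h : M ^ 4 = 1 ∨ M ^ 4 = -1)
    (hM : ¬ (M = 1 ∨ M = -1)) (hM2 : ¬ (M ^ 2 = 1 ∨ M ^ 2 = -1)) : tr M ^ 2 = 2 := by
  have h4 := coeff_eq_zero (coe_pow_four M) h hM
  have h0 : tr M ≠ 0 := fun h0 => hM2 (Or.inr (sq_eq_neg_one h0))
  apply mul_right_cancel₀ h0
  linear_combination h4

theorem pow_three_of_tr {M : SpecialLinearGroup (Fin 2) k} (h : tr M ^ 2 = 1) :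
    M ^ 3 = 1 ∨ M ^ 3 = -1 := by
  rcases sq_eq_one_iff.1 h with h1 | h1
  · right
    rw [eq_neg_one_iff_coe, coe_pow_three, h1]; simp
  · left
    rw [eq_one_iff_coe, coe_pow_three, h1]; simp

theorem pow_four_of_tr {M : SpecialLinearGroup (Fin 2) k} (h : tr M ^ 2 = 2) :
    M ^ 4 = -1 := by
  have h1 : tr M ^ 3 - 2 * tr M = 0 := by linear_combination tr M * h
  rw [eq_neg_one_iff_coe, coe_pow_four, h, h1, zero_smul, zero_sub]
  norm_num

theorem pow_five_of_tr {M : SpecialLinearGroup (Fin 2) k}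
    (h : tr M ^ 4 - 3 * tr M ^ 2 + 1 = 0) : M ^ 5 = 1 ∨ M ^ 5 = -1 := by
  have h1 : (tr M ^ 3 - 2 * tr M) ^ 2 = 1 := by
    linear_combination (tr M ^ 2 - 1) * h
  rcases sq_eq_one_iff.1 h1 with h1 | h1
  · right
    rw [eq_neg_one_iff_coe, coe_pow_five, h, h1]; simp
  · left
    rw [eq_one_iff_coe, coe_pow_five, h, h1]; simp

/-- In characteristic zero a nontrivial unipotent element has infinite order. -/
theorem eq_of_tr_sq_eq_four [CharZero k] {M : SpecialLinearGroup (Fin 2) k} {n : ℕ} (hn : n ≠ 0)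
    (h : tr M ^ 2 = 4) (hM : M ^ n = 1 ∨ M ^ n = -1) : M = 1 ∨ M = -1 := by
  have h2 : ∀ M : SpecialLinearGroup (Fin 2) k, tr M = 2 → M ^ n = 1 ∨ M ^ n = -1 → M = 1 := by
    intro M h hM
    set N : Matrix (Fin 2) (Fin 2) k := mat M - 1 with hN
    have hM1 : mat M = 1 + N := by rw [hN]; abel
    have hNN : N * N = 0 := by
      rw [hN, sub_mul, mul_sub, coe_sq, h, one_mul, mul_one]
      module
    have hpow : ∀ m : ℕ, mat M ^ m = 1 + (m : k) • N := by
      intro m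
      induction m with
      | zero => simp
      | succ m ih =>
        rw [pow_succ, ih, hM1, add_mul, one_mul, mul_add, mul_one, smul_mul_assoc, hNN]
        push_cast
        module
    have htr : N.trace = 0 := by
      rw [hN, Matrix.trace_sub, Matrix.trace_one, ← tr, h]; simp
    have hz : (n : k) • N = 0 := by
      have hn' := hpow n
      rw [← map_pow] at hn'
      rcases hM with hM | hM
      · rw [hM, map_one] at hn'
        simpa using hn'.symm
      · exfalso
        have := congrArg Matrix.trace hn'
        rw [hM, Matrix.trace_add, Matrix.trace_smul, htr, mat_neg, map_one] at this
        simp [Matrix.trace_neg] at this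
        have h4 : (4 : k) = 0 := by linear_combination -this
        norm_num at h4
    rw [eq_one_iff_coe, hM1, (smul_eq_zero.1 hz).resolve_left (Nat.cast_ne_zero.2 hn), add_zero]
  have h4 : tr M = 2 ∨ tr M = -2 := by
    have : (tr M - 2) * (tr M + 2) = 0 := by linear_combination h
    rcases mul_eq_zero.1 this with h | h
    · left; linear_combination h
    · right; linear_combination h
  rcases h4 with h4 | h4
  · exact Or.inl (h2 M h4 hM)
  · right
    rw [← neg_eq_iff_eq_neg]
    refine h2 (-M) (by rw [tr_neg, h4, neg_neg]) ?_
    rcases Nat.even_or_odd n with he | ho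
    · rwa [he.neg_pow]
    · rw [ho.neg_pow, neg_eq_iff_eq_neg, neg_inj, or_comm]; exact hM

/-- An eigenvalue is a root of the characteristic polynomial. -/
theorem eigenvalue_eq {M : SpecialLinearGroup (Fin 2) k} {w : Fin 2 → k} (hw : w ≠ 0) {c : k}
    (h : mat M *ᵥ w = c • w) : c ^ 2 - tr M * c + 1 = 0 := by
  have h1 := congrArg (· *ᵥ w) (coe_sq M)
  simp only [← Matrix.mulVec_mulVec, h, Matrix.mulVec_smul, Matrix.sub_mulVec, Matrix.smul_mulVec,
    Matrix.one_mulVec] at h1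
  have h2 : (c ^ 2 - tr M * c + 1) • w = 0 := by
    have : (c ^ 2 - tr M * c + 1) • w = c • c • w - (tr M • c • w - w) := by module
    rw [this, h1, sub_self]
  exact (smul_eq_zero.1 h2).resolve_right hw

theorem exists_eigenvector [IsAlgClosed k] (M : SpecialLinearGroup (Fin 2) k) {c : k}
    (hc : c ^ 2 - tr M * c + 1 = 0) :
    ∃ w : Fin 2 → k, w ≠ 0 ∧ mat M *ᵥ w = c • w := by
  have hd := det_mat M
  rw [Matrix.det_fin_two] at hd
  have : (mat M - c • 1).det = 0 := by
    rw [Matrix.det_fin_two]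
    simp [tr, Matrix.trace_fin_two] at hc ⊢
    linear_combination hd + hc
  obtain ⟨w, hw, h⟩ := Matrix.exists_mulVec_eq_zero_iff.2 this
  refine ⟨w, hw, ?_⟩
  rw [Matrix.sub_mulVec, Matrix.smul_mulVec, Matrix.one_mulVec] at h
  exact sub_eq_zero.1 h

/-- In the basis `w`, `A w`, for an eigenvector `w` of `B`, the matrices of `A` and `B` depend on
the traces of `A`, `B`, `A B` and the eigenvalue only. -/
theorem exists_normalForm [IsAlgClosed k] (A B : SpecialLinearGroup (Fin 2) k) {c : k}
    (hc : c ^ 2 - tr B * c + 1 = 0)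
    (h : tr A ^ 2 + tr B ^ 2 + tr (A * B) ^ 2 - tr A * tr B * tr (A * B) ≠ 4) :
    ∃ P : Matrix (Fin 2) (Fin 2) k, P.det ≠ 0 ∧
      mat A * P = P * !![0, -1; 1, tr A] ∧
      mat B * P =
        P * !![c, tr (A * B) - tr A * (tr B - c); 0, tr B - c] := by
  obtain ⟨w, hw, hB⟩ := exists_eigenvector B hc
  set Aw := mat A *ᵥ w with hAw
  set P : Matrix (Fin 2) (Fin 2) k := !![w 0, Aw 0; w 1, Aw 1] with hP
  have hdet : P.det ≠ 0 := by
    intro h0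
    -- otherwise `w` is a common eigenvector of `A` and `B`
    have hex : ∃ r : k, mat A *ᵥ w = r • w := by
      rw [hP, Matrix.det_fin_two_of] at h0
      by_cases h00 : w 0 = 0
      · have h01 : w 1 ≠ 0 := fun h01 => hw (by ext i; fin_cases i <;> simp [h00, h01])
        refine ⟨Aw 1 / w 1, ?_⟩
        rw [← hAw]
        ext i
        fin_cases i
        · simp [h00]
          simpa [h00, h01] using h0
        · simp [h01]
      · refine ⟨Aw 0 / w 0, ?_⟩
        rw [← hAw]
        ext i
        fin_cases i
        · simp [h00]
        · simp
          field_simp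
          linear_combination h0
    obtain ⟨r, hr⟩ := hex
    have e1 := eigenvalue_eq hw hr
    have e2 := eigenvalue_eq (M := A * B) (c := r * c) hw (by
      rw [map_mul, ← Matrix.mulVec_mulVec, hB, Matrix.mulVec_smul, hr,
        smul_smul, mul_comm])
    have hr0 : r ≠ 0 := by rintro rfl; simp at e1
    have hc0 : c ≠ 0 := by rintro rfl; simp at hc
    apply h
    have t1 : tr A = r + r⁻¹ := by field_simp; linear_combination -e1
    have t2 : tr B = c + c⁻¹ := by field_simp; linear_combination -hc
    have t3 : tr (A * B) = r * c + (r * c)⁻¹ := by field_simp; linear_combination -e2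
    rw [t1, t2, t3]
    field_simp
    ring
  have hAsq : mat A *ᵥ Aw = tr A • Aw - w := by
    have := congrArg (· *ᵥ w) (coe_sq A)
    simp only [← Matrix.mulVec_mulVec, Matrix.sub_mulVec, Matrix.smul_mulVec,
      Matrix.one_mulVec] at this
    exact this
  have hA : mat A * P = P * !![0, -1; 1, tr A] := by
    have e0 := congrFun hAsq 0
    have e1 := congrFun hAsq 1
    have f0 := congrFun hAw 0
    have f1 := congrFun hAw 1
    simp [Matrix.mulVec, dotProduct, Fin.sum_univ_two] at e0 e1 f0 f1
    ext i j
    fin_cases i <;> fin_cases j <;> simp [hP, Matrix.mul_apply, Fin.sum_univ_two]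
    · linear_combination -f0
    · linear_combination e0
    · linear_combination -f1
    · linear_combination e1
  refine ⟨P, hdet, hA, ?_⟩
  set B1 := P⁻¹ * mat B * P with hB1
  have hu : IsUnit P.det := isUnit_iff_ne_zero.2 hdet
  have hPB : mat B * P = P * B1 := by
    rw [hB1, ← mul_assoc, ← mul_assoc, Matrix.mul_nonsing_inv _ hu, one_mul]
  have hcol : ∀ i, (mat B * P) i 0 = (P * !![c, 0; 0, 0]) i 0 := by
    intro i
    have e := congrFun hB i
    simp [Matrix.mulVec, dotProduct, Fin.sum_univ_two] at e
    fin_cases i <;> simp [hP, Matrix.mul_apply, Fin.sum_univ_two] at e ⊢ <;>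
      linear_combination e
  have hcol1 : ∀ i, B1 i 0 = !![c, 0; 0, 0] i 0 := by
    intro i
    have : B1 = P⁻¹ * (mat B * P) := by rw [hB1, mul_assoc]
    rw [this, Matrix.mul_apply]
    simp_rw [hcol]
    rw [← Matrix.mul_apply, ← mul_assoc, Matrix.nonsing_inv_mul _ hu, one_mul]
  have htr : B1.trace = tr B := by
    rw [hB1, Matrix.trace_mul_comm, ← mul_assoc, Matrix.mul_nonsing_inv _ hu, one_mul, tr]
  have htr2 : (!![0, -1; 1, tr A] * B1).trace = tr (A * B) := by
    have hA1 : !![0, -1; 1, tr A] = P⁻¹ * mat A * P := by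
      rw [mul_assoc, hA, ← mul_assoc, Matrix.nonsing_inv_mul _ hu, one_mul]
    rw [hA1, hB1, tr, map_mul]
    have : P⁻¹ * mat A * P * (P⁻¹ * mat B * P) =
        P⁻¹ * (mat A * (P * P⁻¹) * mat B) * P := by noncomm_ring
    rw [this, Matrix.mul_nonsing_inv _ hu, mul_one, Matrix.trace_mul_comm, ← mul_assoc,
      Matrix.mul_nonsing_inv _ hu, one_mul]
  have c0 := hcol1 0
  have c1 := hcol1 1
  simp at c0 c1
  rw [Matrix.trace_fin_two, c0] at htr
  rw [Matrix.trace_fin_two, Matrix.mul_apply, Matrix.mul_apply, Fin.sum_univ_two,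
    Fin.sum_univ_two, c0, c1] at htr2
  simp at htr2
  rw [hPB]
  congr 1
  have c3 : B1 1 1 = tr B - c := by linear_combination htr
  ext i j
  fin_cases i <;> fin_cases j <;> simp [c0, c1, c3]
  rw [c3] at htr2
  linear_combination htr2

/-- Two pairs in `SL₂(k)` with the same traces of `A`, `B` and `A B` are conjugate, if they have no
common eigenvector. -/
theorem exists_conj [IsAlgClosed k] [NeZero (2 : k)] {A B A' B' : SpecialLinearGroup (Fin 2) k}
    (hA : tr A = tr A') (hB : tr B = tr B') (hAB : tr (A * B) = tr (A' * B'))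
    (h : tr A ^ 2 + tr B ^ 2 + tr (A * B) ^ 2 - tr A * tr B * tr (A * B) ≠ 4) :
    ∃ s : SpecialLinearGroup (Fin 2) k, s * A * s⁻¹ = A' ∧ s * B * s⁻¹ = B' := by
  obtain ⟨c, hc⟩ : ∃ c : k, c ^ 2 - tr B * c + 1 = 0 := by
    obtain ⟨d, hd⟩ := IsAlgClosed.exists_pow_nat_eq (tr B ^ 2 - 4) (n := 2) two_pos
    obtain ⟨c, hc⟩ := exists_quadratic_eq_zero (a := (1 : k)) (b := -tr B) (c := 1) one_ne_zero
      ⟨d, by rw [discrim, ← pow_two, hd]; ring⟩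
    exact ⟨c, by linear_combination hc⟩
  obtain ⟨P, hP, hPA, hPB⟩ := exists_normalForm A B hc h
  obtain ⟨P', hP', hPA', hPB'⟩ := exists_normalForm A' B' (c := c) (by rw [← hB, hc])
    (by rw [← hA, ← hB, ← hAB]; exact h)
  rw [← hA] at hPA'
  rw [← hA, ← hB, ← hAB] at hPB'
  obtain ⟨d, hd⟩ := IsAlgClosed.exists_pow_nat_eq (P'.det * P.det)⁻¹ (n := 2) two_pos
  have hdet : (d • (P' * P.adjugate)).det = 1 := by
    rw [Matrix.det_smul, Fintype.card_fin, hd, Matrix.det_mul, Matrix.det_adjugate,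
      Fintype.card_fin, pow_one, inv_mul_cancel₀ (mul_ne_zero hP' hP)]
  -- `adj P` conjugates to the normal form, up to the factor `det P`
  have key : ∀ X Y X' : Matrix (Fin 2) (Fin 2) k, X * P = P * Y → X' * P' = P' * Y →
      (P' * P.adjugate) * X = X' * (P' * P.adjugate) := by
    intro X Y X' h1 h2
    have h3 : P.adjugate * X = Y * P.adjugate := by
      have : P.det • (P.adjugate * X) = P.det • (Y * P.adjugate) := by
        calc P.det • (P.adjugate * X) = P.adjugate * X * (P * P.adjugate) := by
              rw [Matrix.mul_adjugate, mul_smul_comm, mul_one]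
          _ = P.adjugate * (X * P) * P.adjugate := by noncomm_ring
          _ = (P.adjugate * P) * Y * P.adjugate := by rw [h1]; noncomm_ring
          _ = _ := by rw [Matrix.adjugate_mul, smul_mul_assoc, one_mul, smul_mul_assoc]
      exact smul_right_injective _ hP this
    rw [mul_assoc, h3, ← mul_assoc, ← h2, mul_assoc]
  obtain ⟨s, hs⟩ : ∃ s : SpecialLinearGroup (Fin 2) k, mat s = d • (P' * P.adjugate) :=
    ⟨⟨_, hdet⟩, rfl⟩
  refine ⟨s, ?_, ?_⟩
  · rw [mul_inv_eq_iff_eq_mul]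
    apply mat_injective
    rw [map_mul, map_mul, hs, smul_mul_assoc, mul_smul_comm, key _ _ _ hPA hPA']
  · rw [mul_inv_eq_iff_eq_mul]
    apply mat_injective
    rw [map_mul, map_mul, hs, smul_mul_assoc, mul_smul_comm, key _ _ _ hPB hPB']

end SLTwo


/-! ### Uniqueness of binary polyhedral groups -/

namespace IsBinaryCover

open SLTwo

variable {k : Type*} [Field k] {Γ : Type*} [Group Γ]
  {Γt : Subgroup (Matrix.SpecialLinearGroup (Fin 2) k)} {p : Γt →* Γ}

/-- The element `-M` of a binary cover. -/
def neg (h : IsBinaryCover Γt p) (M : Γt) : Γt :=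
  ⟨-M, by rw [← neg_one_mul]; exact mul_mem h.1 M.2⟩

theorem map_neg (h : IsBinaryCover Γt p) (M : Γt) : p (h.neg M) = p M := by
  have : h.neg M = ⟨-1, h.1⟩ * M := Subtype.ext (by
    show -(M : Matrix.SpecialLinearGroup (Fin 2) k) = -1 * M
    rw [neg_one_mul])
  rw [this, map_mul, (h.2.2 ⟨-1, h.1⟩).2 (Or.inr rfl), one_mul]

theorem pow_eq_one_iff (h : IsBinaryCover Γt p) (M : Γt) (n : ℕ) :
    p M ^ n = 1 ↔ (M : Matrix.SpecialLinearGroup (Fin 2) k) ^ n = 1 ∨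
      (M : Matrix.SpecialLinearGroup (Fin 2) k) ^ n = -1 := by
  rw [← map_pow, h.2.2, SubmonoidClass.coe_pow]

theorem eq_one_iff (h : IsBinaryCover Γt p) (M : Γt) :
    p M = 1 ↔ (M : Matrix.SpecialLinearGroup (Fin 2) k) = 1 ∨
      (M : Matrix.SpecialLinearGroup (Fin 2) k) = -1 := h.2.2 M

theorem eq_or_eq_neg (h : IsBinaryCover Γt p) {M N : Γt} (hMN : p M = p N) :
    M = N ∨ M = h.neg N := by
  have h1 : p (M * N⁻¹) = 1 := by rw [map_mul, map_inv, hMN, mul_inv_cancel]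
  rcases (h.eq_one_iff _).1 h1 with h2 | h2
  · left
    exact mul_inv_eq_one.1 (Subtype.ext h2)
  · right
    apply Subtype.ext
    show (M : Matrix.SpecialLinearGroup (Fin 2) k) = -N
    have h3 : (M : Matrix.SpecialLinearGroup (Fin 2) k) *
      (N : Matrix.SpecialLinearGroup (Fin 2) k)⁻¹ = -1 := h2
    rw [mul_inv_eq_iff_eq_mul] at h3
    rw [h3, neg_one_mul]

theorem tr_sq_eq (h : IsBinaryCover Γt p) {M N : Γt} (hMN : p M = p N) :
    tr (M : Matrix.SpecialLinearGroup (Fin 2) k) ^ 2 =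
      tr (N : Matrix.SpecialLinearGroup (Fin 2) k) ^ 2 := by
  rcases h.eq_or_eq_neg hMN with rfl | rfl
  · rfl
  · show tr (-(N : Matrix.SpecialLinearGroup (Fin 2) k)) ^ 2 = _
    rw [tr_neg, neg_sq]

theorem tr_of_sq (h : IsBinaryCover Γt p) (M : Γt) (h1 : p M ≠ 1) (h2 : p M ^ 2 = 1) :
    tr (M : Matrix.SpecialLinearGroup (Fin 2) k) = 0 :=
  tr_eq_zero_of_sq ((h.pow_eq_one_iff M 2).1 h2) (mt (h.eq_one_iff M).2 h1)

theorem tr_of_pow_three (h : IsBinaryCover Γt p) (M : Γt) (h1 : p M ≠ 1) (h3 : p M ^ 3 = 1) :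
    tr (M : Matrix.SpecialLinearGroup (Fin 2) k) ^ 2 = 1 :=
  SLTwo.tr_of_pow_three ((h.pow_eq_one_iff M 3).1 h3) (mt (h.eq_one_iff M).2 h1)

theorem tr_of_pow_four (h : IsBinaryCover Γt p) (M : Γt) (h2 : p M ^ 2 ≠ 1) (h4 : p M ^ 4 = 1) :
    tr (M : Matrix.SpecialLinearGroup (Fin 2) k) ^ 2 = 2 :=
  SLTwo.tr_of_pow_four ((h.pow_eq_one_iff M 4).1 h4)
    (mt (h.eq_one_iff M).2 (fun h1 => h2 (by rw [h1, one_pow])))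
    (mt (h.pow_eq_one_iff M 2).2 h2)

theorem tr_of_pow_five (h : IsBinaryCover Γt p) (M : Γt) (h1 : p M ≠ 1) (h5 : p M ^ 5 = 1) :
    (tr (M : Matrix.SpecialLinearGroup (Fin 2) k) ^ 2) ^ 2 -
      3 * tr (M : Matrix.SpecialLinearGroup (Fin 2) k) ^ 2 + 1 = 0 := by
  rw [← pow_mul]
  exact SLTwo.tr_of_pow_five ((h.pow_eq_one_iff M 5).1 h5) (mt (h.eq_one_iff M).2 h1)

end IsBinaryCover

/-- Any two binary covers of `Γ` in `SL₂(k)` are conjugate, up to an automorphism of `Γ`. -/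
def HasUniqueBinaryCover (k : Type*) [Field k] (Γ : Type*) [Group Γ] : Prop :=
  ∀ (Γ₁ : Subgroup (Matrix.SpecialLinearGroup (Fin 2) k)) (p₁ : Γ₁ →* Γ)
    (Γ₂ : Subgroup (Matrix.SpecialLinearGroup (Fin 2) k)) (p₂ : Γ₂ →* Γ),
    IsBinaryCover Γ₁ p₁ → IsBinaryCover Γ₂ p₂ →
    ∃ (θ : Γ ≃* Γ) (s : Matrix.SpecialLinearGroup (Fin 2) k), ∀ M : Γ₁, ∃ N : Γ₂,
      (N : Matrix.SpecialLinearGroup (Fin 2) k) = s * M * s⁻¹ ∧ p₂ N = θ (p₁ M)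

namespace HasUniqueBinaryCover

open SLTwo Matrix

variable {k : Type*} [Field k] [IsAlgClosed k] [CharZero k] {Γ : Type*} [Group Γ]

/-- It suffices to compare the traces of lifts of two generators and of their product. -/
theorem of_traces (a b : Γ) (hgen : Subgroup.closure {a, b} = ⊤)
    (H : ∀ (Γ₁ : Subgroup (SpecialLinearGroup (Fin 2) k)) (p₁ : Γ₁ →* Γ)
      (Γ₂ : Subgroup (SpecialLinearGroup (Fin 2) k)) (p₂ : Γ₂ →* Γ),
      IsBinaryCover Γ₁ p₁ → IsBinaryCover Γ₂ p₂ → ∃ (θ : Γ ≃* Γ) (A B : Γ₁) (A' B' : Γ₂),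
        p₁ A = a ∧ p₁ B = b ∧ p₂ A' = θ a ∧ p₂ B' = θ b ∧
        tr (A : SpecialLinearGroup (Fin 2) k) = tr (A' : SpecialLinearGroup (Fin 2) k) ∧
        tr (B : SpecialLinearGroup (Fin 2) k) = tr (B' : SpecialLinearGroup (Fin 2) k) ∧
        tr (A * B : SpecialLinearGroup (Fin 2) k) = tr (A' * B' : SpecialLinearGroup (Fin 2) k) ∧
        tr (A : SpecialLinearGroup (Fin 2) k) ^ 2 + tr (B : SpecialLinearGroup (Fin 2) k) ^ 2 +
          tr (A * B : SpecialLinearGroup (Fin 2) k) ^ 2 -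
          tr (A : SpecialLinearGroup (Fin 2) k) * tr (B : SpecialLinearGroup (Fin 2) k) *
            tr (A * B : SpecialLinearGroup (Fin 2) k) ≠ 4) :
    HasUniqueBinaryCover k Γ := by
  intro Γ₁ p₁ Γ₂ p₂ h₁ h₂
  obtain ⟨θ, A, B, A', B', hA, hB, hA', hB', tA, tB, tAB, hne⟩ := H Γ₁ p₁ Γ₂ p₂ h₁ h₂
  obtain ⟨s, sA, sB⟩ := exists_conj tA tB tAB hne
  refine ⟨θ, s, ?_⟩
  -- the elements of `Γ` one of whose lifts behaves as required
  have key : ∀ x ∈ Subgroup.closure {a, b}, ∃ (M : Γ₁) (N : Γ₂), p₁ M = x ∧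
      (N : SpecialLinearGroup (Fin 2) k) = s * M * s⁻¹ ∧ p₂ N = θ x := by
    intro x hx
    induction hx using Subgroup.closure_induction with
    | mem x hx =>
      rcases hx with rfl | rfl
      · exact ⟨A, A', hA, sA.symm, hA'⟩
      · exact ⟨B, B', hB, sB.symm, hB'⟩
    | one => exact ⟨1, 1, map_one _, by simp, by simp⟩
    | mul x y _ _ hx hy =>
      obtain ⟨M, N, e1, e2, e3⟩ := hx
      obtain ⟨M', N', f1, f2, f3⟩ := hy
      refine ⟨M * M', N * N', by rw [map_mul, e1, f1], ?_, by rw [map_mul, e3, f3, map_mul]⟩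
      rw [Subgroup.coe_mul, Subgroup.coe_mul, e2, f2]
      group
    | inv x _ hx =>
      obtain ⟨M, N, e1, e2, e3⟩ := hx
      refine ⟨M⁻¹, N⁻¹, by rw [map_inv, e1], ?_, by rw [map_inv, e3, map_inv]⟩
      rw [Subgroup.coe_inv, Subgroup.coe_inv, e2]
      group
  intro M
  obtain ⟨M', N', e1, e2, e3⟩ := key (p₁ M) (by rw [hgen]; trivial)
  rcases h₁.eq_or_eq_neg e1.symm with rfl | rfl
  · exact ⟨N', e2, e3⟩
  · refine ⟨h₂.neg N', ?_, by rw [h₂.map_neg, e3]⟩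
    show -(N' : SpecialLinearGroup (Fin 2) k) =
      s * (-(M' : SpecialLinearGroup (Fin 2) k)) * s⁻¹
    rw [e2, mul_neg, neg_mul]

/-- The case of generators `a`, `b` of orders two and three: the square of the trace of a lift of
`a b` has to be the same, after an automorphism. -/
theorem of_two_three (a b : Γ) (hgen : Subgroup.closure {a, b} = ⊤)
    (ha : a ≠ 1) (ha2 : a ^ 2 = 1) (hb : b ≠ 1) (hb3 : b ^ 3 = 1)
    (H : ∀ (Γ₁ : Subgroup (SpecialLinearGroup (Fin 2) k)) (p₁ : Γ₁ →* Γ)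
      (Γ₂ : Subgroup (SpecialLinearGroup (Fin 2) k)) (p₂ : Γ₂ →* Γ),
      IsBinaryCover Γ₁ p₁ → IsBinaryCover Γ₂ p₂ → ∃ θ : Γ ≃* Γ, ∀ (C : Γ₁) (C' : Γ₂),
        p₁ C = a * b → p₂ C' = θ (a * b) →
        tr (C : SpecialLinearGroup (Fin 2) k) ^ 2 = tr (C' : SpecialLinearGroup (Fin 2) k) ^ 2 ∧
        tr (C : SpecialLinearGroup (Fin 2) k) ^ 2 ≠ 3) :
    HasUniqueBinaryCover k Γ := by
  refine of_traces a b hgen fun Γ₁ p₁ Γ₂ p₂ h₁ h₂ => ?_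
  obtain ⟨θ, hθ⟩ := H Γ₁ p₁ Γ₂ p₂ h₁ h₂
  -- a lift of an element of order three with trace one
  have lift3 : ∀ (Γ₁ : Subgroup (SpecialLinearGroup (Fin 2) k)) (p₁ : Γ₁ →* Γ),
      IsBinaryCover Γ₁ p₁ → ∀ x : Γ, x ≠ 1 → x ^ 3 = 1 → ∃ B : Γ₁, p₁ B = x ∧
        tr (B : SpecialLinearGroup (Fin 2) k) = 1 := by
    intro Γ₁ p₁ h₁ x hx hx3
    obtain ⟨B, rfl⟩ := h₁.2.1 x
    rcases sq_eq_one_iff.1 (h₁.tr_of_pow_three B hx hx3) with h | h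
    · exact ⟨B, rfl, h⟩
    · refine ⟨h₁.neg B, h₁.map_neg B, ?_⟩
      show tr (-(B : SpecialLinearGroup (Fin 2) k)) = 1
      rw [tr_neg, h, neg_neg]
  obtain ⟨B, hB, tB⟩ := lift3 Γ₁ p₁ h₁ b hb hb3
  obtain ⟨B', hB', tB'⟩ := lift3 Γ₂ p₂ h₂ (θ b) (by simpa using hb)
    (by rw [← map_pow, hb3, map_one])
  obtain ⟨A, hA⟩ := h₁.2.1 a
  obtain ⟨A', hA'⟩ := h₂.2.1 (θ a)
  have tA := h₁.tr_of_sq A (by rw [hA]; exact ha) (by rw [hA]; exact ha2)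
  have tA' := h₂.tr_of_sq A' (by rw [hA']; simpa using ha)
    (by rw [hA', ← map_pow, ha2, map_one])
  obtain ⟨h1, h2⟩ := hθ (A * B) (A' * B') (by rw [map_mul, hA, hB])
    (by rw [map_mul, hA', hB', map_mul])
  rw [Subgroup.coe_mul] at h1 h2
  rw [Subgroup.coe_mul] at h1
  have hne : tr (A : SpecialLinearGroup (Fin 2) k) ^ 2 +
      tr (B : SpecialLinearGroup (Fin 2) k) ^ 2 + tr (A * B : SpecialLinearGroup (Fin 2) k) ^ 2 -
      tr (A : SpecialLinearGroup (Fin 2) k) * tr (B : SpecialLinearGroup (Fin 2) k) *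
        tr (A * B : SpecialLinearGroup (Fin 2) k) ≠ 4 := by
    rw [tA, tB]
    intro h
    exact h2 (by linear_combination h)
  rcases sq_eq_sq_iff_eq_or_eq_neg.1 h1 with h | h
  · exact ⟨θ, A, B, A', B', hA, hB, hA', hB', by rw [tA, tA'], by rw [tB, tB'], h, hne⟩
  · refine ⟨θ, A, B, h₂.neg A', B', hA, hB, by rw [h₂.map_neg, hA'], hB', ?_, by rw [tB, tB'],
      ?_, hne⟩
    · show _ = tr (-(A' : SpecialLinearGroup (Fin 2) k))
      rw [tr_neg, tA, tA', neg_zero]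
    · show _ = tr (-(A' : SpecialLinearGroup (Fin 2) k) * (B' : SpecialLinearGroup (Fin 2) k))
      rw [neg_mul, tr_neg, h]

end HasUniqueBinaryCover

namespace HasUniqueBinaryCover

open SLTwo Matrix Equiv

variable (k : Type*) [Field k] [IsAlgClosed k] [CharZero k]

/-- `A₄` is generated by elements `a`, `b` of orders two and three whose product has order three, so
that its lifts have squared trace `1`. -/
theorem alternatingGroup_four : HasUniqueBinaryCover k (alternatingGroup (Fin 4)) := by
  let a : alternatingGroup (Fin 4) := ⟨swap 0 1 * swap 2 3, Perm.mem_alternatingGroup.2 (by decide)⟩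
  let b : alternatingGroup (Fin 4) := ⟨swap 1 2 * swap 2 3, Perm.mem_alternatingGroup.2 (by decide)⟩
  have hgen : Subgroup.closure {a, b} = ⊤ := by
    have hw : ∀ x : alternatingGroup (Fin 4), ∃ (i : Fin 3) (j : Fin 2) (l : Fin 3),
        x = b ^ (i : ℕ) * a ^ (j : ℕ) * b ^ (l : ℕ) := by decide
    refine eq_top_iff.2 fun x _ => ?_
    obtain ⟨i, j, l, rfl⟩ := hw x
    have ha : a ∈ Subgroup.closure {a, b} := Subgroup.subset_closure (by simp)
    have hb : b ∈ Subgroup.closure {a, b} := Subgroup.subset_closure (by simp)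
    exact mul_mem (mul_mem (pow_mem hb _) (pow_mem ha _)) (pow_mem hb _)
  refine of_two_three a b hgen (by decide) (by decide) (by decide) (by decide)
    fun Γ₁ p₁ Γ₂ p₂ h₁ h₂ => ⟨MulEquiv.refl _, fun C C' hC hC' => ?_⟩
  have hab1 : a * b ≠ 1 := by decide
  have hab3 : (a * b) ^ 3 = 1 := by decide
  rw [MulEquiv.refl_apply] at hC'
  rw [h₁.tr_of_pow_three C (hC ▸ hab1) (hC ▸ hab3), h₂.tr_of_pow_three C' (hC' ▸ hab1)
    (hC' ▸ hab3)]
  exact ⟨rfl, by norm_num⟩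

/-- `S₄` is generated by elements `a`, `b` of orders two and three whose product has order four, so
that its lifts have squared trace `2`. -/
theorem perm_four : HasUniqueBinaryCover k (Perm (Fin 4)) := by
  let a : Perm (Fin 4) := swap 0 1
  let b : Perm (Fin 4) := swap 1 2 * swap 2 3
  have hab2 : (a * b) ^ 2 ≠ 1 := by decide
  have hab4 : (a * b) ^ 4 = 1 := by decide
  have hgen : Subgroup.closure {a, b} = ⊤ := by
    set S := Subgroup.closure {a, b} with hS
    have ha : a ∈ S := Subgroup.subset_closure (by simp)
    have hb : b ∈ S := Subgroup.subset_closure (by simp)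
    have h3 : 3 ∣ Nat.card S := by
      have h : orderOf (⟨b, hb⟩ : S) = 3 := by
        rw [Subgroup.orderOf_mk]
        exact orderOf_eq_prime (by decide) (by decide)
      exact h ▸ orderOf_dvd_natCard _
    have h4 : 4 ∣ Nat.card S := by
      have h : orderOf (⟨a * b, mul_mem ha hb⟩ : S) = 2 ^ (1 + 1) := by
        rw [Subgroup.orderOf_mk]
        exact orderOf_eq_prime_pow hab2 hab4
      have h' := orderOf_dvd_natCard (⟨a * b, mul_mem ha hb⟩ : S)
      rw [h] at h'
      exact h'
    have h24 : Nat.card S * S.index = 24 := by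
      rw [Subgroup.card_mul_index, Nat.card_perm, Nat.card_eq_fintype_card, Fintype.card_fin]; rfl
    obtain ⟨m, hm⟩ : 12 ∣ Nat.card S := Nat.Coprime.mul_dvd_of_dvd_of_dvd (by norm_num) h3 h4
    rw [hm] at h24
    have h2 : m * S.index = 2 := by linarith
    by_cases hi : S.index = 2
    · have := Equiv.Perm.eq_alternatingGroup_of_index_eq_two hi
      rw [this] at ha
      exact absurd (Perm.mem_alternatingGroup.1 ha) (by decide)
    · have hd : S.index ∣ 2 := ⟨m, by rw [mul_comm, h2]⟩
      rcases (Nat.dvd_prime Nat.prime_two).1 hd with h | h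
      · exact Subgroup.index_eq_one.1 h
      · exact absurd h hi
  refine of_two_three a b hgen (by decide) (by decide) (by decide) (by decide)
    fun Γ₁ p₁ Γ₂ p₂ h₁ h₂ => ⟨MulEquiv.refl _, fun C C' hC hC' => ?_⟩
  rw [MulEquiv.refl_apply] at hC'
  rw [h₁.tr_of_pow_four C (hC ▸ hab2) (hC ▸ hab4), h₂.tr_of_pow_four C' (hC' ▸ hab2)
    (hC' ▸ hab4)]
  exact ⟨rfl, by norm_num⟩

/-- `A₅` is generated by elements `a`, `b` of orders two and three whose product has order five. The
squared trace of its lifts is one of two conjugate numbers, which are exchanged by an outer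
automorphism. -/
theorem alternatingGroup_five : HasUniqueBinaryCover k (alternatingGroup (Fin 5)) := by
  let a : alternatingGroup (Fin 5) := ⟨swap 0 1 * swap 2 3, Perm.mem_alternatingGroup.2 (by decide)⟩
  let b : alternatingGroup (Fin 5) := ⟨swap 1 2 * swap 2 4, Perm.mem_alternatingGroup.2 (by decide)⟩
  have ha1 : a ≠ 1 := by decide
  have ha2 : a ^ 2 = 1 := by decide
  have hb1 : b ≠ 1 := by decide
  have hb3 : b ^ 3 = 1 := by decide
  have hab1 : a * b ≠ 1 := by decide
  have hab5 : (a * b) ^ 5 = 1 := by decide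
  have hgen : Subgroup.closure {a, b} = ⊤ := by
    set S := Subgroup.closure {a, b} with hS
    have ha : a ∈ S := Subgroup.subset_closure (by simp)
    have hb : b ∈ S := Subgroup.subset_closure (by simp)
    have hdvd : ∀ (p : ℕ) [Fact p.Prime] (x : alternatingGroup (Fin 5)), x ∈ S → x ^ p = 1 →
        x ≠ 1 → p ∣ Nat.card S := by
      intro p _ x hx h1 h2
      have h : orderOf (⟨x, hx⟩ : S) = p := by
        rw [Subgroup.orderOf_mk]
        exact orderOf_eq_prime h1 h2
      exact h ▸ orderOf_dvd_natCard _
    have h2 := hdvd 2 a ha ha2 ha1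
    have h3 := hdvd 3 b hb hb3 hb1
    have h5 := have : Fact (Nat.Prime 5) := ⟨by norm_num⟩
      hdvd 5 (a * b) (mul_mem ha hb) hab5 hab1
    have h60 : Nat.card S * S.index = 60 := by
      rw [Subgroup.card_mul_index, nat_card_alternatingGroup, Nat.card_eq_fintype_card,
        Fintype.card_fin]; rfl
    obtain ⟨m, hm⟩ : 30 ∣ Nat.card S :=
      Nat.Coprime.mul_dvd_of_dvd_of_dvd (m := 6) (by norm_num)
        (Nat.Coprime.mul_dvd_of_dvd_of_dvd (m := 2) (by norm_num) h2 h3) h5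
    rw [hm] at h60
    have h2 : m * S.index = 2 := by linarith
    have hd : S.index ∣ 2 := ⟨m, by rw [mul_comm, h2]⟩
    rcases (Nat.dvd_prime Nat.prime_two).1 hd with h | h
    · exact Subgroup.index_eq_one.1 h
    · have := Subgroup.normal_of_index_eq_two h
      rcases this.eq_bot_or_eq_top with h | h
      · rw [h, Subgroup.mem_bot] at ha
        exact absurd ha ha1
      · exact h
  refine of_two_three a b hgen ha1 ha2 hb1 hb3 fun Γ₁ p₁ Γ₂ p₂ h₁ h₂ => ?_
  -- the squares of the traces of lifts of `a b` are two roots of `X² - 3 X + 1`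
  obtain ⟨C₁, hC₁⟩ := h₁.2.1 (a * b)
  obtain ⟨C₂, hC₂⟩ := h₂.2.1 (a * b)
  set t₁ := tr (C₁ : SpecialLinearGroup (Fin 2) k) ^ 2 with ht₁
  set t₂ := tr (C₂ : SpecialLinearGroup (Fin 2) k) ^ 2 with ht₂
  have e₁ : t₁ ^ 2 - 3 * t₁ + 1 = 0 := h₁.tr_of_pow_five C₁ (hC₁ ▸ hab1) (hC₁ ▸ hab5)
  have e₂ : t₂ ^ 2 - 3 * t₂ + 1 = 0 := h₂.tr_of_pow_five C₂ (hC₂ ▸ hab1) (hC₂ ▸ hab5)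
  have hne : t₁ ≠ 3 := by
    intro h; rw [h] at e₁; norm_num at e₁
  by_cases h : t₁ = t₂
  · refine ⟨MulEquiv.refl _, fun C C' hC hC' => ?_⟩
    rw [MulEquiv.refl_apply] at hC'
    rw [h₁.tr_sq_eq (hC.trans hC₁.symm), h₂.tr_sq_eq (hC'.trans hC₂.symm)]
    exact ⟨h, hne⟩
  · -- conjugation by an odd permutation takes `a b` to a conjugate of `(a b)²`
    let σ : Perm (Fin 5) := swap 3 4
    let τ : alternatingGroup (Fin 5) :=
      ⟨swap 1 2 * swap 2 3, Perm.mem_alternatingGroup.2 (by decide)⟩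
    let θ : alternatingGroup (Fin 5) ≃* alternatingGroup (Fin 5) := MulAut.conjNormal σ
    have hθ : θ (a * b) = τ * (a * b) ^ 2 * τ⁻¹ := by
      apply Subtype.ext
      rw [MulAut.conjNormal_apply]
      decide
    obtain ⟨T, hT⟩ := h₂.2.1 τ
    refine ⟨θ, fun C C' hC hC' => ?_⟩
    have h3 : p₂ C' = p₂ (T * C₂ ^ 2 * T⁻¹) := by
      rw [hC', hθ, map_mul, map_mul, map_inv, map_pow, hT, hC₂]
    rw [h₁.tr_sq_eq (hC.trans hC₁.symm), h₂.tr_sq_eq h3]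
    refine ⟨?_, hne⟩
    have h4 : tr ((T * C₂ ^ 2 * T⁻¹ : Γ₂) : SpecialLinearGroup (Fin 2) k) = t₂ - 2 := by
      rw [Subgroup.coe_mul, Subgroup.coe_mul, Subgroup.coe_inv, tr_conj, SubmonoidClass.coe_pow,
        tr_sq]
    rw [h4]
    have h5 : (t₁ - t₂) * (t₁ + t₂ - 3) = 0 := by linear_combination e₁ - e₂
    have h6 := (mul_eq_zero.1 h5).resolve_left (sub_ne_zero.2 h)
    show t₁ = _
    linear_combination h6 - e₂

end HasUniqueBinaryCover

/-- The automorphism `r i ↦ r (u i)`, `sr i ↦ sr (u i)` of a dihedral group. -/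
def DihedralGroup.unitAut {n : ℕ} (u : (ZMod n)ˣ) : DihedralGroup n ≃* DihedralGroup n where
  toFun
    | .r i => .r (u * i)
    | .sr i => .sr (u * i)
  invFun
    | .r i => .r (↑u⁻¹ * i)
    | .sr i => .sr (↑u⁻¹ * i)
  left_inv := by rintro (i | i) <;> simp
  right_inv := by rintro (i | i) <;> simp
  map_mul' := by rintro (i | i) (j | j) <;> simp [mul_add, mul_sub]

namespace SLTwo

open Matrix

variable {k : Type*} [Field k] [IsAlgClosed k]

theorem exists_eigenvalue [NeZero (2 : k)] (M : SpecialLinearGroup (Fin 2) k) :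
    ∃ c : k, c ^ 2 - tr M * c + 1 = 0 := by
  obtain ⟨d, hd⟩ := IsAlgClosed.exists_pow_nat_eq (tr M ^ 2 - 4) (n := 2) two_pos
  obtain ⟨c, hc⟩ := exists_quadratic_eq_zero (a := (1 : k)) (b := -tr M) (c := 1) one_ne_zero
    ⟨d, by rw [discrim, ← pow_two, hd]; ring⟩
  exact ⟨c, by linear_combination hc⟩

theorem eigenvalue_pow (M : SpecialLinearGroup (Fin 2) k) {c : k}
    (hc : c ^ 2 - tr M * c + 1 = 0) (m : ℕ) :
    (c ^ m) ^ 2 - tr (M ^ m) * c ^ m + 1 = 0 := by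
  obtain ⟨w, hw, h⟩ := exists_eigenvector M hc
  refine eigenvalue_eq hw ?_
  induction m with
  | zero => simp
  | succ m ih =>
    rw [pow_succ', map_mul, ← Matrix.mulVec_mulVec, ih, Matrix.mulVec_smul, h, smul_smul, pow_succ]

end SLTwo

namespace IsBinaryCover

open SLTwo Matrix

variable {k : Type*} [Field k] [IsAlgClosed k] [CharZero k] {Γ : Type*} [Group Γ]
  {Γt : Subgroup (SpecialLinearGroup (Fin 2) k)} {p : Γt →* Γ}

/-- The square of an eigenvalue of a lift of an element of order `n` is a primitive `n`-th root of
unity. -/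
theorem isPrimitiveRoot (h : IsBinaryCover Γt p) (M : Γt) (h0 : orderOf (p M) ≠ 0) {c : k}
    (hc : c ^ 2 - tr (M : SpecialLinearGroup (Fin 2) k) * c + 1 = 0) :
    IsPrimitiveRoot (c ^ 2) (orderOf (p M)) := by
  have key : ∀ m : ℕ, (c ^ 2) ^ m = 1 ↔ p M ^ m = 1 := by
    intro m
    have hm := eigenvalue_pow _ hc m
    have hc0 : c ^ m ≠ 0 := by
      intro h; rw [h] at hm; simp at hm
    rw [← pow_mul, mul_comm 2 m, pow_mul]
    constructor
    · intro h1
      have ht : tr ((M : SpecialLinearGroup (Fin 2) k) ^ m) ^ 2 = 4 := by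
        have h2 : tr ((M : SpecialLinearGroup (Fin 2) k) ^ m) * c ^ m = 2 := by
          linear_combination h1 - hm
        calc tr ((M : SpecialLinearGroup (Fin 2) k) ^ m) ^ 2
            = tr ((M : SpecialLinearGroup (Fin 2) k) ^ m) ^ 2 * (c ^ m) ^ 2 := by
              rw [h1, mul_one]
          _ = 4 := by rw [← mul_pow, h2]; norm_num
      have hfin := (h.pow_eq_one_iff M (m * orderOf (p M))).1
        (by rw [mul_comm, pow_mul, pow_orderOf_eq_one, one_pow])
      rw [pow_mul] at hfin
      exact (h.pow_eq_one_iff M m).2 (eq_of_tr_sq_eq_four h0 ht hfin)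
    · intro h1
      rcases (h.pow_eq_one_iff M m).1 h1 with h2 | h2
      · rw [h2, tr_one] at hm
        have : (c ^ m - 1) ^ 2 = 0 := by linear_combination hm
        rw [sub_eq_zero.1 (pow_eq_zero_iff two_ne_zero |>.1 this), one_pow]
      · rw [h2, tr_neg, tr_one] at hm
        have : (c ^ m + 1) ^ 2 = 0 := by linear_combination hm
        rw [eq_neg_of_add_eq_zero_left (pow_eq_zero_iff two_ne_zero |>.1 this), neg_one_sq]
  exact ⟨(key _).2 (pow_orderOf_eq_one _), fun l hl => orderOf_dvd_of_pow_eq_one ((key l).1 hl)⟩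

end IsBinaryCover

namespace HasUniqueBinaryCover

open SLTwo Matrix

/-- The traces of the lifts of the reflections `s` and `s r` vanish, and the trace of a lift of the
rotation `r` is determined up to sign by the square of an eigenvalue, a primitive `n`-th root of
unity. The automorphisms `r ↦ r^j` relate all such roots. -/
theorem dihedralGroup (k : Type*) [Field k] [IsAlgClosed k] [CharZero k] (n : ℕ) (hn : 2 ≤ n) :
    HasUniqueBinaryCover k (DihedralGroup n) := by
  have : NeZero n := ⟨by omega⟩
  have hone : (1 : ZMod n) ≠ 0 := by
    have : Fact (1 < n) := ⟨hn⟩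
    exact one_ne_zero
  have hgen : Subgroup.closure {DihedralGroup.sr (0 : ZMod n), .r 1} = ⊤ := by
    refine eq_top_iff.2 fun x _ => ?_
    have hs : DihedralGroup.sr (0 : ZMod n) ∈
        Subgroup.closure {DihedralGroup.sr (0 : ZMod n), .r 1} :=
      Subgroup.subset_closure (by simp)
    have hr : ∀ i : ZMod n, DihedralGroup.r i ∈
        Subgroup.closure {DihedralGroup.sr (0 : ZMod n), .r 1} := by
      intro i
      have h1 : DihedralGroup.r (1 : ZMod n) ∈
        Subgroup.closure {DihedralGroup.sr (0 : ZMod n), .r 1} :=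
        Subgroup.subset_closure (by simp)
      have := pow_mem h1 i.val
      rwa [DihedralGroup.r_one_pow, ZMod.natCast_zmod_val] at this
    rcases x with i | i
    · exact hr i
    · have := mul_mem hs (hr i)
      rwa [DihedralGroup.sr_mul_r, zero_add] at this
  refine of_traces (.sr 0) (.r 1) hgen fun Γ₁ p₁ Γ₂ p₂ h₁ h₂ => ?_
  obtain ⟨A, hA⟩ := h₁.2.1 (.sr 0)
  obtain ⟨C, hC⟩ := h₁.2.1 (.r 1)
  obtain ⟨A', hA'⟩ := h₂.2.1 (.sr 0)
  obtain ⟨D, hD⟩ := h₂.2.1 (.r 1)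
  have ord : orderOf (DihedralGroup.r (1 : ZMod n)) = n := DihedralGroup.orderOf_r_one
  obtain ⟨c, hc⟩ := exists_eigenvalue (C : SpecialLinearGroup (Fin 2) k)
  obtain ⟨d, hd⟩ := exists_eigenvalue (D : SpecialLinearGroup (Fin 2) k)
  have pc := h₁.isPrimitiveRoot C (by rw [hC, ord]; omega) hc
  have pd := h₂.isPrimitiveRoot D (by rw [hD, ord]; omega) hd
  rw [hC, ord] at pc
  rw [hD, ord] at pd
  obtain ⟨j, -, hj, hcd⟩ := pd.isPrimitiveRoot_iff.1 pc
  -- an automorphism of the dihedral group that makes the eigenvalues agree up to sign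
  let u := ZMod.unitOfCoprime j hj
  let θ := DihedralGroup.unitAut u
  have hθs : θ (.sr 0) = .sr 0 := by
    show DihedralGroup.sr (_ * 0) = _
    rw [mul_zero]
  have hθr : θ (.r 1) = .r (j : ZMod n) := by
    show DihedralGroup.r (_ * 1) = _
    rw [mul_one, ZMod.coe_unitOfCoprime]
  have hDj : p₂ (D ^ j) = .r (j : ZMod n) := by rw [map_pow, hD, DihedralGroup.r_one_pow]
  have hsr : ∀ i : ZMod n, DihedralGroup.sr i ≠ 1 := fun i h => by
    rw [DihedralGroup.one_def] at h; exact DihedralGroup.noConfusion rfl (heq_of_eq h)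
  have hsr2 : ∀ i : ZMod n, DihedralGroup.sr i ^ 2 = 1 := fun i => by
    rw [pow_two, DihedralGroup.sr_mul_self]
  have tA := h₁.tr_of_sq A (by rw [hA]; exact hsr 0) (by rw [hA]; exact hsr2 0)
  have tA' := h₂.tr_of_sq A' (by rw [hA']; exact hsr 0) (by rw [hA']; exact hsr2 0)
  have hAC : p₁ (A * C) = .sr 1 := by rw [map_mul, hA, hC, DihedralGroup.sr_mul_r, zero_add]
  have tAC := h₁.tr_of_sq (A * C) (by rw [hAC]; exact hsr _) (by rw [hAC]; exact hsr2 _)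
  have hne : tr (A : SpecialLinearGroup (Fin 2) k) ^ 2 +
      tr (C : SpecialLinearGroup (Fin 2) k) ^ 2 + tr (A * C : SpecialLinearGroup (Fin 2) k) ^ 2 -
      tr (A : SpecialLinearGroup (Fin 2) k) * tr (C : SpecialLinearGroup (Fin 2) k) *
        tr (A * C : SpecialLinearGroup (Fin 2) k) ≠ 4 := by
    rw [Subgroup.coe_mul] at tAC
    rw [tA, tAC]
    intro h
    have h4 : tr (C : SpecialLinearGroup (Fin 2) k) ^ 2 = 4 := by linear_combination h
    have hfin := (h₁.pow_eq_one_iff C n).1 (by rw [hC, DihedralGroup.r_one_pow_n])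
    have h1 := (h₁.eq_one_iff C).2 (eq_of_tr_sq_eq_four (NeZero.ne n) h4 hfin)
    rw [hC, DihedralGroup.one_def, DihedralGroup.r.injEq] at h1
    exact hone h1
  -- the lift of `θ (r 1)` that has the trace of `C`
  obtain ⟨B', hB', tB'⟩ : ∃ B' : Γ₂, p₂ B' = .r (j : ZMod n) ∧
      tr (C : SpecialLinearGroup (Fin 2) k) = tr (B' : SpecialLinearGroup (Fin 2) k) := by
    have hdj := eigenvalue_pow _ hd j
    have hc0 : c ≠ 0 := by rintro rfl; simp at hc
    have hsq : c ^ 2 = (d ^ j) ^ 2 := by rw [← hcd, ← pow_mul, ← pow_mul, mul_comm]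
    rcases sq_eq_sq_iff_eq_or_eq_neg.1 hsq with h | h
    · refine ⟨D ^ j, hDj, ?_⟩
      rw [SubmonoidClass.coe_pow]
      rw [← h] at hdj
      apply mul_right_cancel₀ hc0
      linear_combination hdj - hc
    · refine ⟨h₂.neg (D ^ j), by rw [h₂.map_neg, hDj], ?_⟩
      show _ = tr (-((D ^ j : Γ₂) : SpecialLinearGroup (Fin 2) k))
      rw [tr_neg, SubmonoidClass.coe_pow]
      rw [show d ^ j = -c by rw [h, neg_neg]] at hdj
      apply mul_right_cancel₀ hc0
      linear_combination hdj - hc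
  have hAB' : p₂ (A' * B') = .sr (j : ZMod n) := by
    rw [map_mul, hA', hB', DihedralGroup.sr_mul_r, zero_add]
  have tAB' := h₂.tr_of_sq (A' * B') (by rw [hAB']; exact hsr _) (by rw [hAB']; exact hsr2 _)
  refine ⟨θ, A, C, A', B', hA, hC, by rw [hA', hθs], by rw [hB', hθr], by rw [tA, tA'], tB', ?_,
    hne⟩
  rw [Subgroup.coe_mul] at tAC tAB'
  rw [tAC, tAB']

end HasUniqueBinaryCover


/-! ### Recognising `A₄`, `S₄` and `A₅` -/

namespace FiniteGroup

open Equiv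

variable {G : Type*} [Group G]

theorem mem_sylow_of_orderOf_eq {p : ℕ} [Fact p.Prime] {x : G} (hx : orderOf x = p) :
    ∃ P : Sylow p G, x ∈ (P : Subgroup G) := by
  have hz : IsPGroup p (Subgroup.zpowers x) := by
    refine IsPGroup.of_card (n := 1) ?_
    rw [Nat.card_zpowers, hx, pow_one]
  obtain ⟨P, hP⟩ := hz.exists_le_sylow
  exact ⟨P, hP (Subgroup.mem_zpowers x)⟩

/-- If two Sylow `p`-subgroups of `G` meet trivially, then no element of order `p` normalises every
Sylow `p`-subgroup: it would lie in all of them. -/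
theorem not_mem_ker_of_orderOf_eq {p : ℕ} [Fact p.Prime] (P Q : Sylow p G)
    (hPQ : (P : Subgroup G) ⊓ Q = ⊥) {x : G} (hx : orderOf x = p) :
    x ∉ (MulAction.toPermHom G (Sylow p G)).ker := by
  intro hk
  have hmem : ∀ R : Sylow p G, x ∈ (R : Subgroup G) := by
    intro R
    have hR : x • R = R := by
      have := DFunLike.congr_fun (MonoidHom.mem_ker.1 hk) R
      simpa using this
    have hz : IsPGroup p (Subgroup.zpowers x) := by
      refine IsPGroup.of_card (n := 1) ?_
      rw [Nat.card_zpowers, hx, pow_one]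
    have h1 : x ∈ Subgroup.zpowers x ⊓ Subgroup.normalizer (R : Set G) :=
      ⟨Subgroup.mem_zpowers x, Sylow.smul_eq_iff_mem_normalizer.1 hR⟩
    rw [hz.inf_normalizer_sylow] at h1
    exact h1.2
  have : x ∈ (P : Subgroup G) ⊓ Q := ⟨hmem P, hmem Q⟩
  rw [hPQ, Subgroup.mem_bot] at this
  rw [this, orderOf_one] at hx
  exact (Fact.out : p.Prime).one_lt.ne hx

variable [Finite G]

/-- The kernel of the action on the Sylow `p`-subgroups lies in a normaliser, so that its order
times the number of Sylow `p`-subgroups divides the order of `G`. -/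
theorem card_ker_mul_card_sylow_dvd (p : ℕ) [Fact p.Prime] :
    Nat.card (MulAction.toPermHom G (Sylow p G)).ker * Nat.card (Sylow p G) ∣ Nat.card G := by
  obtain ⟨P⟩ : Nonempty (Sylow p G) := inferInstance
  have hle : (MulAction.toPermHom G (Sylow p G)).ker ≤ Subgroup.normalizer (P : Set G) := by
    intro x hx
    refine Sylow.smul_eq_iff_mem_normalizer.1 ?_
    have := DFunLike.congr_fun (MonoidHom.mem_ker.1 hx) P
    simpa using this
  rw [Sylow.card_eq_index_normalizer P,
    ← Subgroup.card_mul_index (Subgroup.normalizer (P : Set G))]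
  exact mul_dvd_mul_right (Subgroup.card_dvd_of_le hle) _

/-- A finite group embedded in the symmetric group of degree `m` as a subgroup of index two is the
alternating group. -/
theorem nonempty_mulEquiv_alternatingGroup {α : Type*} [Finite α] {m : ℕ} (hm : Nat.card α = m)
    (f : G →* Perm α) (hf : Function.Injective f) (hc : 2 * Nat.card G = m.factorial) :
    Nonempty (G ≃* alternatingGroup (Fin m)) := by
  let e : α ≃ Fin m := Finite.equivFinOfCardEq hm
  let f' : G →* Perm (Fin m) := (e.permCongrHom).toMonoidHom.comp f
  have hf' : Function.Injective f' := e.permCongrHom.injective.comp hf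
  have hr : f'.range = alternatingGroup (Fin m) := by
    refine Perm.eq_alternatingGroup_of_index_eq_two ?_
    have h1 := Subgroup.card_mul_index f'.range
    rw [← Nat.card_congr (MonoidHom.ofInjective hf').toEquiv, Nat.card_perm, Nat.card_fin, ← hc,
      mul_comm] at h1
    exact Nat.eq_of_mul_eq_mul_right Nat.card_pos h1
  exact ⟨(MonoidHom.ofInjective hf').trans (MulEquiv.subgroupCongr hr)⟩

/-- A subgroup of order three that is the unique one contains at most two elements of order
three. -/
theorem card_orderOf_eq_three_le {K : Subgroup G} (hK : Nat.card K = 3)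
    (h : ∀ x : G, orderOf x = 3 → x ∈ K) : Nat.card {x : G // orderOf x = 3} ≤ 2 := by
  have hinj : Function.Injective
      (fun x : Option {x : G // orderOf x = 3} => (x.elim 1 (fun y => ⟨y, h y y.2⟩) : K)) := by
    rintro (_ | x) (_ | y) hxy
    · rfl
    · have := congrArg Subtype.val hxy
      have h2 := y.2
      rw [← show (1 : G) = y from this, orderOf_one] at h2
      omega
    · have := congrArg Subtype.val hxy
      have h2 := x.2
      rw [show (x : G) = 1 from this, orderOf_one] at h2
      omega
    · have := congrArg Subtype.val hxy
      exact congrArg some (Subtype.ext this)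
  have := Nat.card_le_card_of_injective _ hinj
  rw [hK, Finite.card_option] at this
  omega

/-- A group of order `12` or `24` with more than two elements of order three has four Sylow
`3`-subgroups. The kernel of its action on them has order at most two. -/
theorem card_sylow_three {m : ℕ} (hm : m = 4 ∨ m = 8) (hG : Nat.card G = 3 * m)
    (h3 : 2 < Nat.card {x : G // orderOf x = 3}) :
    Nat.card (Sylow 3 G) = 4 ∧ ¬ 3 ∣ Nat.card (MulAction.toPermHom G (Sylow 3 G)).ker := by
  have : Fact (Nat.Prime 3) := ⟨by norm_num⟩
  have hcard : ∀ P : Sylow 3 G, Nat.card (P : Subgroup G) = 3 := by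
    intro P
    rw [P.card_eq_multiplicity, hG]
    have : (3 * m).factorization 3 = 1 := by
      rw [Nat.factorization_mul (by norm_num) (by omega), Finsupp.add_apply,
        Nat.factorization_eq_zero_of_not_dvd (n := m) (by omega), Nat.Prime.factorization_self]
      norm_num
    rw [this, pow_one]
  have hne : Nat.card (Sylow 3 G) ≠ 1 := by
    intro h1
    have hs : Subsingleton (Sylow 3 G) := (Nat.card_eq_one_iff_unique.1 h1).1
    obtain ⟨P⟩ : Nonempty (Sylow 3 G) := inferInstance
    have := card_orderOf_eq_three_le (hcard P) fun x hx => by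
      obtain ⟨Q, hQ⟩ := mem_sylow_of_orderOf_eq hx
      rwa [Subsingleton.elim P Q]
    omega
  have h4 : Nat.card (Sylow 3 G) = 4 := by
    obtain ⟨P⟩ : Nonempty (Sylow 3 G) := inferInstance
    have hd := P.card_dvd_index
    have hi : (P : Subgroup G).index = m := by
      have := Subgroup.card_mul_index (P : Subgroup G)
      rw [hcard, hG] at this
      omega
    rw [hi] at hd
    have hmod := card_sylow_modEq_one 3 G
    have hle := Nat.le_of_dvd (by omega) hd
    rw [Nat.ModEq] at hmod
    generalize Nat.card (Sylow 3 G) = s at *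
    rcases hm with rfl | rfl <;> interval_cases s <;> omega
  refine ⟨h4, fun hdvd => ?_⟩
  obtain ⟨x, hx⟩ := exists_prime_orderOf_dvd_card' 3 hdvd
  have : Nontrivial (Sylow 3 G) := by
    rw [← Finite.one_lt_card_iff_nontrivial]; omega
  obtain ⟨P, Q, hPQ⟩ := exists_pair_ne (Sylow 3 G)
  refine not_mem_ker_of_orderOf_eq P Q ?_ (x := x) (by rw [Subgroup.orderOf_coe, hx]) x.2
  -- distinct subgroups of the same prime order meet trivially
  by_contra hbot
  have hd := Subgroup.card_dvd_of_le (inf_le_left : (P : Subgroup G) ⊓ Q ≤ P)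
  rw [hcard, Nat.dvd_prime (by norm_num)] at hd
  rcases hd with hd | hd
  · exact hbot (Subgroup.eq_bot_of_card_le _ hd.le)
  · refine hPQ (Sylow.ext ?_)
    have e1 : (P : Subgroup G) ⊓ Q = P :=
      Subgroup.eq_of_le_of_card_ge inf_le_left (by rw [hd, hcard])
    have e2 : (P : Subgroup G) ⊓ Q = Q :=
      Subgroup.eq_of_le_of_card_ge inf_le_right (by rw [hd, hcard])
    rw [← e1, e2]

/-- The action on the four Sylow `3`-subgroups is faithful. -/
theorem nonempty_mulEquiv_alternatingGroup_four (hG : Nat.card G = 12)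
    (h3 : 2 < Nat.card {x : G // orderOf x = 3}) :
    Nonempty (G ≃* alternatingGroup (Fin 4)) := by
  have : Fact (Nat.Prime 3) := ⟨by norm_num⟩
  obtain ⟨h4, hk⟩ := card_sylow_three (Or.inl rfl) hG h3
  refine nonempty_mulEquiv_alternatingGroup h4 (MulAction.toPermHom G (Sylow 3 G)) ?_
    (by rw [hG]; rfl)
  rw [← MonoidHom.ker_eq_bot_iff]
  have hd := card_ker_mul_card_sylow_dvd (G := G) 3
  rw [h4, hG, show 12 = 3 * 4 by norm_num, Nat.mul_dvd_mul_iff_right (by norm_num),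
    Nat.dvd_prime (by norm_num)] at hd
  refine Subgroup.eq_bot_of_card_le _ ?_
  rcases hd with hd | hd
  · exact hd.le
  · exact absurd (by rw [hd]) hk

/-- The action on the four Sylow `3`-subgroups is faithful: an involution in the kernel would be
central, and its product with an element of order three would have order six. -/
theorem nonempty_mulEquiv_perm_four (hG : Nat.card G = 24)
    (h3 : 2 < Nat.card {x : G // orderOf x = 3}) (h34 : ∀ x : G, x ^ 3 = 1 ∨ x ^ 4 = 1) :
    Nonempty (G ≃* Perm (Fin 4)) := by
  have : Fact (Nat.Prime 3) := ⟨by norm_num⟩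
  obtain ⟨h4, hk⟩ := card_sylow_three (Or.inr rfl) hG h3
  have hinj : Function.Injective (MulAction.toPermHom G (Sylow 3 G)) := by
    rw [← MonoidHom.ker_eq_bot_iff]
    have hd := card_ker_mul_card_sylow_dvd (G := G) 3
    rw [h4, hG, show 24 = 6 * 4 by norm_num, Nat.mul_dvd_mul_iff_right (by norm_num)] at hd
    by_contra hbot
    have hK2 : Nat.card (MulAction.toPermHom G (Sylow 3 G)).ker = 2 := by
      have h1 : Nat.card (MulAction.toPermHom G (Sylow 3 G)).ker ≠ 1 := fun h =>
        hbot (Subgroup.eq_bot_of_card_le _ h.le)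
      have hle := Nat.le_of_dvd (by norm_num) hd
      generalize Nat.card (MulAction.toPermHom G (Sylow 3 G)).ker = s at *
      interval_cases s <;> omega
    -- the kernel would consist of `1` and a central involution `a`
    have : Fact (Nat.Prime 2) := ⟨by norm_num⟩
    obtain ⟨a, ha⟩ := exists_prime_orderOf_dvd_card' 2 (dvd_of_eq hK2.symm)
    obtain ⟨b, hb⟩ : ∃ b : G, orderOf b = 3 :=
      exists_prime_orderOf_dvd_card' 3 (by rw [hG]; norm_num)
    have hcomm : Commute (a : G) b := by
      have hmem : b * a * b⁻¹ ∈ (MulAction.toPermHom G (Sylow 3 G)).ker :=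
        (MonoidHom.normal_ker _).conj_mem _ a.2 b
      have hne : (⟨b * a * b⁻¹, hmem⟩ : (MulAction.toPermHom G (Sylow 3 G)).ker) ≠ 1 := by
        intro h
        have h1 : b * a * b⁻¹ = 1 := Subtype.ext_iff.1 h
        rw [conj_eq_one_iff] at h1
        rw [show a = 1 from Subtype.ext h1, orderOf_one] at ha
        omega
      have hne' : a ≠ 1 := by
        intro h
        rw [h, orderOf_one] at ha
        omega
      obtain ⟨y, -, hy⟩ :=
        (Nat.card_eq_two_iff' (1 : (MulAction.toPermHom G (Sylow 3 G)).ker)).1 hK2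
      have h2 := (hy _ hne).trans (hy _ hne').symm
      have h3 : b * a * b⁻¹ = a := Subtype.ext_iff.1 h2
      exact (eq_mul_of_mul_inv_eq h3).symm
    have ha' : orderOf (a : G) = 2 := by rw [Subgroup.orderOf_coe, ha]
    have h6 := hcomm.orderOf_mul_eq_mul_orderOf_of_coprime (by rw [ha', hb]; norm_num)
    rw [ha', hb] at h6
    rcases h34 (a * b) with h | h
    · have := orderOf_dvd_of_pow_eq_one h
      rw [h6] at this
      omega
    · have := orderOf_dvd_of_pow_eq_one h
      rw [h6] at this
      omega
  let e : Sylow 3 G ≃ Fin 4 := Finite.equivFinOfCardEq h4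
  refine ⟨MulEquiv.ofBijective ((e.permCongrHom).toMonoidHom.comp (MulAction.toPermHom G _)) ?_⟩
  rw [Nat.bijective_iff_injective_and_card]
  exact ⟨e.permCongrHom.injective.comp hinj, by rw [hG, Nat.card_perm, Nat.card_fin]; rfl⟩

/-- If every element of `G` has order `1`, `2`, `3` or `5` and `4` is the exact power of `2`
dividing `|G|`, then the Sylow `2`-subgroups are the centralisers of their involutions, so that
distinct ones meet trivially. -/
theorem sylow_two_inf_eq_bot (hG : Nat.card G = 60)
    (h235 : ∀ x : G, x ^ 2 = 1 ∨ x ^ 3 = 1 ∨ x ^ 5 = 1) (P Q : Sylow 2 G) (hPQ : P ≠ Q) :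
    (P : Subgroup G) ⊓ Q = ⊥ := by
  have : Fact (Nat.Prime 2) := ⟨by norm_num⟩
  have hfac : (60 : ℕ).factorization 2 = 2 := by
    rw [show 60 = 2 ^ 2 * 15 by norm_num, Nat.factorization_mul (by norm_num) (by norm_num),
      Finsupp.add_apply, Nat.factorization_eq_zero_of_not_dvd (n := 15) (by norm_num),
      Nat.Prime.factorization_pow (by norm_num)]
    simp
  have hcard : ∀ P : Sylow 2 G, Nat.card (P : Subgroup G) = 4 := by
    intro P
    rw [P.card_eq_multiplicity, hG, hfac]
    norm_num
  rw [Subgroup.eq_bot_iff_forall]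
  intro a ha
  by_contra ha1
  have ha2 : orderOf a = 2 := by
    have hd := Subgroup.orderOf_dvd_natCard (P : Subgroup G) ha.1
    rw [hcard] at hd
    rcases h235 a with h | h | h
    · exact orderOf_eq_prime h ha1
    · have h3 := orderOf_eq_prime h ha1
      rw [h3] at hd; omega
    · have : Fact (Nat.Prime 5) := ⟨by norm_num⟩
      have h3 := orderOf_eq_prime h ha1
      rw [h3] at hd; omega
  -- the product of `a` and a commuting element of odd prime order `q` would have order `2 q`
  have hodd : ∀ q : ℕ, q.Prime → q ≠ 2 → ¬ q ∣ Nat.card (Subgroup.centralizer {a}) := by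
    intro q hq hq2 hd
    have : Fact q.Prime := ⟨hq⟩
    obtain ⟨b, hb⟩ := exists_prime_orderOf_dvd_card' q hd
    have hb' : orderOf (b : G) = q := by rw [Subgroup.orderOf_coe, hb]
    have hcomm : Commute a b := (Subgroup.mem_centralizer_singleton_iff.1 b.2).symm
    have h6 := hcomm.orderOf_mul_eq_mul_orderOf_of_coprime
      (by rw [ha2, hb']; exact (Nat.coprime_primes (by norm_num) hq).2 hq2.symm)
    rw [ha2, hb'] at h6
    have hq2' := hq.two_le
    rcases h235 (a * b) with h | h | h
    all_goals
      have h7 := orderOf_dvd_of_pow_eq_one h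
      rw [h6] at h7
    · have := Nat.le_of_dvd (by norm_num) h7
      omega
    · exact absurd (dvd_trans (dvd_mul_right 2 q) h7) (by norm_num)
    · exact absurd (dvd_trans (dvd_mul_right 2 q) h7) (by norm_num)
  have h4 : Nat.card (Subgroup.centralizer {a}) ∣ 4 := by
    have hd := Subgroup.card_subgroup_dvd_card (Subgroup.centralizer {a})
    rw [hG, show 60 = 4 * 15 by norm_num] at hd
    refine Nat.Coprime.dvd_of_dvd_mul_right ?_ hd
    rw [show 15 = 3 * 5 by norm_num]
    exact Nat.Coprime.mul_right
      (((Nat.Prime.coprime_iff_not_dvd (by norm_num)).2 (hodd 3 (by norm_num) (by norm_num))).symm)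
      (((Nat.Prime.coprime_iff_not_dvd (by norm_num)).2 (hodd 5 (by norm_num) (by norm_num))).symm)
  have hle : ∀ R : Sylow 2 G, a ∈ (R : Subgroup G) →
      (R : Subgroup G) = Subgroup.centralizer {a} := by
    intro R haR
    refine Subgroup.eq_of_le_of_card_ge ?_ (by rw [hcard]; exact Nat.le_of_dvd (by norm_num) h4)
    intro x hx
    have hc : IsMulCommutative (R : Subgroup G) :=
      IsPGroup.isMulCommutative_of_card_eq_prime_sq (p := 2) (by rw [hcard]; norm_num)
    have := hc.is_comm.comm (⟨x, hx⟩ : (R : Subgroup G)) ⟨a, haR⟩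
    exact Subgroup.mem_centralizer_singleton_iff.2 (Subtype.ext_iff.1 this)
  exact hPQ (Sylow.ext ((hle P ha.1).trans (hle Q ha.2).symm))

/-- The Sylow `2`-subgroups have order four and meet trivially, so that `15` involutions make five
of them, on which `G` acts faithfully. -/
theorem nonempty_mulEquiv_alternatingGroup_five (hG : Nat.card G = 60)
    (h2 : Nat.card {x : G // orderOf x = 2} = 15) (h3 : 2 < Nat.card {x : G // orderOf x = 3})
    (h235 : ∀ x : G, x ^ 2 = 1 ∨ x ^ 3 = 1 ∨ x ^ 5 = 1) :
    Nonempty (G ≃* alternatingGroup (Fin 5)) := by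
  have : Fact (Nat.Prime 2) := ⟨by norm_num⟩
  have : Fact (Nat.Prime 3) := ⟨by norm_num⟩
  have hfac : (60 : ℕ).factorization 2 = 2 := by
    rw [show 60 = 2 ^ 2 * 15 by norm_num, Nat.factorization_mul (by norm_num) (by norm_num),
      Finsupp.add_apply, Nat.factorization_eq_zero_of_not_dvd (n := 15) (by norm_num),
      Nat.Prime.factorization_pow (by norm_num)]
    simp
  have hcard : ∀ P : Sylow 2 G, Nat.card (P : Subgroup G) = 4 := by
    intro P
    rw [P.card_eq_multiplicity, hG, hfac]
    norm_num
  -- the involutions are the disjoint union of the sets `P \ {1}`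
  have h5 : Nat.card (Sylow 2 G) = 5 := by
    choose f hf using fun x : {x : G // orderOf x = 2} => mem_sylow_of_orderOf_eq x.2
    let e : {x : G // orderOf x = 2} ≃ (P : Sylow 2 G) × {y : (P : Subgroup G) // y ≠ 1} :=
      { toFun := fun x => ⟨f x, ⟨⟨x, hf x⟩, fun h => by
          have h1 : (x : G) = 1 := Subtype.ext_iff.1 h
          have h2 := x.2
          rw [h1, orderOf_one] at h2
          omega⟩⟩
        invFun := fun y => ⟨y.2.1, by
          have hd := Subgroup.orderOf_dvd_natCard (y.1 : Subgroup G) y.2.1.2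
          have hne : (y.2.1 : G) ≠ 1 := fun h => y.2.2 (Subtype.ext h)
          rw [hcard] at hd
          rcases h235 y.2.1 with h | h | h
          · exact orderOf_eq_prime h hne
          · have h3 := orderOf_eq_prime h hne
            rw [h3] at hd; omega
          · have : Fact (Nat.Prime 5) := ⟨by norm_num⟩
            have h3 := orderOf_eq_prime h hne
            rw [h3] at hd; omega⟩
        left_inv := fun x => rfl
        right_inv := by
          rintro ⟨P, ⟨y, hy⟩, hy1⟩
          have hP : ∀ R : Sylow 2 G, y ∈ (R : Subgroup G) → R = P := by
            intro R hR
            by_contra hne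
            have := sylow_two_inf_eq_bot hG h235 R P hne
            have hm : y ∈ (R : Subgroup G) ⊓ P := ⟨hR, hy⟩
            rw [this, Subgroup.mem_bot] at hm
            exact hy1 (Subtype.ext hm)
          have key : ∀ (R : Sylow 2 G) (hR : y ∈ (R : Subgroup G))
              (h1 : (⟨y, hR⟩ : (R : Subgroup G)) ≠ 1),
              (⟨R, ⟨⟨y, hR⟩, h1⟩⟩ : (P : Sylow 2 G) × {y : (P : Subgroup G) // y ≠ 1}) =
                ⟨P, ⟨⟨y, hy⟩, hy1⟩⟩ := by
            intro R hR h1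
            obtain rfl := hP R hR
            rfl
          exact key _ _ _ }
    have : Fintype (Sylow 2 G) := Fintype.ofFinite _
    have hc := Nat.card_congr e
    rw [h2, Nat.card_sigma] at hc
    have h3 : ∀ P : Sylow 2 G, Nat.card {y : (P : Subgroup G) // y ≠ 1} = 3 := by
      intro P
      classical
      have : Fintype (P : Subgroup G) := Fintype.ofFinite _
      have h4 := hcard P
      rw [Nat.card_eq_fintype_card] at h4 ⊢
      rw [Fintype.card_subtype_compl, h4, Fintype.card_subtype_eq]
    simp only [h3, Finset.sum_const, Finset.card_univ, smul_eq_mul] at hc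
    rw [Nat.card_eq_fintype_card]
    omega
  refine nonempty_mulEquiv_alternatingGroup h5 (MulAction.toPermHom G (Sylow 2 G)) ?_
    (by rw [hG]; rfl)
  rw [← MonoidHom.ker_eq_bot_iff]
  have hd := card_ker_mul_card_sylow_dvd (G := G) 2
  rw [h5, hG, show 60 = 12 * 5 by norm_num, Nat.mul_dvd_mul_iff_right (by norm_num)] at hd
  have hk : ¬ 2 ∣ Nat.card (MulAction.toPermHom G (Sylow 2 G)).ker := by
    intro hdvd
    obtain ⟨x, hx⟩ := exists_prime_orderOf_dvd_card' 2 hdvd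
    have : Nontrivial (Sylow 2 G) := by
      rw [← Finite.one_lt_card_iff_nontrivial]; omega
    obtain ⟨P, Q, hPQ⟩ := exists_pair_ne (Sylow 2 G)
    exact not_mem_ker_of_orderOf_eq P Q (sylow_two_inf_eq_bot hG h235 P Q hPQ) (x := x)
      (by rw [Subgroup.orderOf_coe, hx]) x.2
  have hK3 : Nat.card (MulAction.toPermHom G (Sylow 2 G)).ker ≠ 3 := by
    intro h
    have hP : IsPGroup 3 (MulAction.toPermHom G (Sylow 2 G)).ker :=
      IsPGroup.of_card (n := 1) (by rw [h, pow_one])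
    -- a normal subgroup of order three is the only Sylow `3`-subgroup
    have hfac3 : (60 : ℕ).factorization 3 = 1 := by
      rw [show 60 = 3 * 20 by norm_num, Nat.factorization_mul (by norm_num) (by norm_num),
        Finsupp.add_apply, Nat.factorization_eq_zero_of_not_dvd (n := 20) (by norm_num),
        Nat.Prime.factorization_self (by norm_num)]
    have := card_orderOf_eq_three_le h fun x hx => by
      obtain ⟨Q, hQ⟩ := mem_sylow_of_orderOf_eq hx
      have hle : (MulAction.toPermHom G (Sylow 2 G)).ker ≤ Q := hP.le_sylow_of_normal Q
      have heq := Subgroup.eq_of_le_of_card_ge hle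
        (by rw [h, Q.card_eq_multiplicity, hG, hfac3, pow_one])
      rwa [heq]
    omega
  refine Subgroup.eq_bot_of_card_le _ ?_
  have hle := Nat.le_of_dvd (by norm_num) hd
  generalize Nat.card (MulAction.toPermHom G (Sylow 2 G)).ker = s at *
  interval_cases s <;> omega

end FiniteGroup


/-! ### The convolution algebra and corepresentations -/

/-- The convolution algebra `H^*` of all linear functionals on a coalgebra. -/
abbrev ConvDual (k H : Type*) [Field k] [AddCommGroup H] [Module k H] : Type _ :=
  WithConv (H →ₗ[k] k)

/-- The transpose of the antipode. -/
noncomputable def ConvDual.antipode {k H : Type*} [Field k] [Ring H] [HopfAlgebra k H]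
    (c : ConvDual k H) : ConvDual k H :=
  WithConv.toConv (c.ofConv ∘ₗ HopfAlgebra.antipode k (A := H))

theorem ConvDual.sum_apply {k H ι : Type*} [Field k] [AddCommGroup H] [Module k H] (s : Finset ι)
    (f : ι → ConvDual k H) (h : H) : (∑ l ∈ s, f l).ofConv h = ∑ l ∈ s, f l h := by
  have := map_sum (WithConv.linearEquiv k (H →ₗ[k] k)) f s
  exact (congrArg (fun g : H →ₗ[k] k => g h) this).trans (LinearMap.sum_apply _ _ _)

/-- If the functionals in `E` separate the points of `V` and those in `F` separate the points of
`W`, then the functionals `e ⊗ f` separate the points of `V ⊗ W`. -/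
theorem TensorProduct.eq_zero_of_separating {k V W : Type*} [Field k] [AddCommGroup V] [Module k V]
    [AddCommGroup W] [Module k W] {E : Set (V →ₗ[k] k)} {F : Set (W →ₗ[k] k)}
    (hE : ∀ v, (∀ e ∈ E, e v = 0) → v = 0) (hF : ∀ w, (∀ f ∈ F, f w = 0) → w = 0)
    {t : V ⊗[k] W} (ht : ∀ e ∈ E, ∀ f ∈ F, LinearMap.mul' k k (TensorProduct.map e f t) = 0) :
    t = 0 := by
  classical
  have key : ∀ (e : V →ₗ[k] k) (f : W →ₗ[k] k) (s : V ⊗[k] W),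
      LinearMap.mul' k k (TensorProduct.map e f s) = e (TensorProduct.rid k V (f.lTensor V s)) ∧
      LinearMap.mul' k k (TensorProduct.map e f s) = f (TensorProduct.lid k W (e.rTensor W s)) := by
    intro e f s
    induction s using TensorProduct.induction_on with
    | zero => simp
    | tmul x y => simp [mul_comm]
    | add x y hx hy => simp only [map_add, ← hx.1, ← hy.1, ← hx.2, ← hy.2, and_self]
  have h1 : ∀ f ∈ F, TensorProduct.rid k V (f.lTensor V t) = 0 := fun f hf =>
    hE _ fun e he => by rw [← (key e f t).1, ht e he f hf]
  have h2 : ∀ e : V →ₗ[k] k, TensorProduct.lid k W (e.rTensor W t) = 0 := fun e =>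
    hF _ fun f hf => by rw [← (key e f t).2, (key e f t).1, h1 f hf, map_zero]
  let b := Module.Basis.ofVectorSpace k V
  refine (TensorProduct.equivFinsuppOfBasisLeft (N := W) b).injective ?_
  rw [map_zero]
  ext i
  rw [TensorProduct.equivFinsuppOfBasisLeft_apply, h2 (b.coord i)]
  rfl

section Rep

variable {k H : Type*} [Field k] [Ring H]

theorem tensorRep_apply [Bialgebra k H] {V W ι : Type*} [AddCommGroup V] [Module k V]
    [AddCommGroup W] [Module k W] (ρ : H →ₐ[k] Module.End k V) (σ : H →ₐ[k] Module.End k W)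
    {h : H} (r : Coalgebra.Repr k h ι) (v : V) (w : W) :
    tensorRep ρ σ h (v ⊗ₜ w) = ∑ i ∈ r.index, ρ (r.left i) v ⊗ₜ[k] σ (r.right i) w := by
  show Module.endTensorEndAlgHom (R := k) (S := k) (A := k) (M := V) (N := W)
    (Algebra.TensorProduct.map ρ σ (Coalgebra.comul (R := k) h)) (v ⊗ₜ w) = _
  rw [← r.eq]
  simp only [map_sum, Algebra.TensorProduct.map_tmul, LinearMap.sum_apply,
    Module.endTensorEndAlgHom_apply, TensorProduct.AlgebraTensorModule.map_tmul]

theorem ConvDual.mul_apply_mul [Bialgebra k H] {ι κ : Type*} (c d : ConvDual k H) {h h' : H}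
    (r : Coalgebra.Repr k h ι) (s : Coalgebra.Repr k h' κ) :
    (c * d) (h * h') = ∑ i ∈ r.index, ∑ j ∈ s.index,
      c (r.left i * s.left j) * d (r.right i * s.right j) := by
  rw [LinearMap.convMul_apply, Bialgebra.comul_mul, ← r.eq, ← s.eq]
  simp [Finset.sum_mul_sum]

theorem ConvDual.one_apply [Bialgebra k H] (h : H) :
    (1 : ConvDual k H) h = Coalgebra.counit (R := k) h := rfl

/-- A square matrix of functionals is a corepresentation if it is the matrix of a representation
of `H`. -/
structure IsCorep [Algebra k H] {ι : Type*} [Fintype ι] [DecidableEq ι]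
    (X : Matrix ι ι (ConvDual k H)) : Prop where
  mul : ∀ i j h h', X i j (h * h') = ∑ l, X i l h * X l j h'
  one : ∀ i j, X i j (1 : H) = if i = j then 1 else 0

namespace IsCorep

variable {ι κ : Type*} [Fintype ι] [DecidableEq ι] [Fintype κ] [DecidableEq κ]

theorem kronecker [Bialgebra k H] {X : Matrix ι ι (ConvDual k H)} {Y : Matrix κ κ (ConvDual k H)}
    (hX : IsCorep X) (hY : IsCorep Y) :
    IsCorep (Matrix.of fun p q : ι × κ => X p.1 q.1 * Y p.2 q.2) where
  mul p q h h' := by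
    let r := Coalgebra.Repr.arbitrary k h
    let s := Coalgebra.Repr.arbitrary k h'
    simp only [Matrix.of_apply]
    rw [ConvDual.mul_apply_mul _ _ r s]
    simp only [hX.mul, hY.mul, Coalgebra.Repr.convMul_apply r, Coalgebra.Repr.convMul_apply s,
      Finset.sum_mul_sum, Fintype.sum_prod_type]
    have e : ∀ (i) (j), ∑ x, ∑ y, X p.1 x (r.left i) * X x q.1 (s.left j) *
        (Y p.2 y (r.right i) * Y y q.2 (s.right j)) = ∑ x, ∑ y, X p.1 x (r.left i) *
          Y p.2 y (r.right i) * (X x q.1 (s.left j) * Y y q.2 (s.right j)) :=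
      fun i j => Finset.sum_congr rfl fun x _ => Finset.sum_congr rfl fun y _ => by ring
    simp only [e]
    simp only [Finset.sum_comm (s := s.index) (t := Finset.univ),
      Finset.sum_comm (s := r.index) (t := Finset.univ)]
  one p q := by
    simp only [Matrix.of_apply]
    rw [LinearMap.convMul_apply, Bialgebra.comul_one, Algebra.TensorProduct.one_def]
    simp only [TensorProduct.map_tmul, LinearMap.mul'_apply]
    rw [show (X p.1 q.1).ofConv 1 = _ from hX.one p.1 q.1,
      show (Y p.2 q.2).ofConv 1 = _ from hY.one p.2 q.2]
    by_cases h1 : p.1 = q.1 <;> by_cases h2 : p.2 = q.2 <;> simp [h1, h2, Prod.ext_iff]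

/-- The trivial corepresentation. -/
theorem unit [Bialgebra k H] : IsCorep (Matrix.of fun _ _ : Unit => (1 : ConvDual k H)) where
  mul i j h h' := by simp
  one i j := by simp

/-- The antipode inverts a corepresentation. -/
theorem antipode_mul [HopfAlgebra k H] {X : Matrix ι ι (ConvDual k H)} (hX : IsCorep X) :
    X.map ConvDual.antipode * X = 1 := by
  ext i j h
  rw [Matrix.mul_apply]
  let r := Coalgebra.Repr.arbitrary k h
  have h1 := congrArg (X i j) (HopfAlgebra.sum_antipode_mul_eq_smul r)
  rw [map_sum, map_smul, show (X i j).ofConv 1 = _ from hX.one i j] at h1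
  rw [ConvDual.sum_apply]
  simp only [Coalgebra.Repr.convMul_apply r, Matrix.map_apply]
  rw [Finset.sum_comm]
  refine Eq.trans (Finset.sum_congr rfl fun x _ => ?_) (h1.trans ?_)
  · exact (hX.mul i j _ _).symm
  · by_cases h : i = j
    · subst h
      simp
    · simp [h]

theorem mul_antipode [HopfAlgebra k H] {X : Matrix ι ι (ConvDual k H)} (hX : IsCorep X) :
    X * X.map ConvDual.antipode = 1 := by
  ext i j h
  rw [Matrix.mul_apply]
  let r := Coalgebra.Repr.arbitrary k h
  have h1 := congrArg (X i j) (HopfAlgebra.sum_mul_antipode_eq_smul r)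
  rw [map_sum, map_smul, show (X i j).ofConv 1 = _ from hX.one i j] at h1
  rw [ConvDual.sum_apply]
  simp only [Coalgebra.Repr.convMul_apply r, Matrix.map_apply]
  rw [Finset.sum_comm]
  refine Eq.trans (Finset.sum_congr rfl fun x _ => ?_) (h1.trans ?_)
  · exact (hX.mul i j _ _).symm
  · by_cases h : i = j
    · subst h
      simp
    · simp [h]

/-- The inverse of a Kronecker product is the Kronecker product of the inverses, with the factors
of each entry in the opposite order. -/
theorem antipode_kronecker [HopfAlgebra k H] {X : Matrix ι ι (ConvDual k H)}
    {Y : Matrix κ κ (ConvDual k H)} (hX : IsCorep X) (hY : IsCorep Y) (p q : ι × κ) :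
    (X p.1 q.1 * Y p.2 q.2).antipode = (Y p.2 q.2).antipode * (X p.1 q.1).antipode := by
  let Z : Matrix (ι × κ) (ι × κ) (ConvDual k H) := Matrix.of fun p q => X p.1 q.1 * Y p.2 q.2
  let W : Matrix (ι × κ) (ι × κ) (ConvDual k H) :=
    Matrix.of fun p q => (Y p.2 q.2).antipode * (X p.1 q.1).antipode
  have e1 : ∀ a b, ∑ x, X a x * (X x b).antipode = if a = b then 1 else 0 := fun a b =>
    (congrFun (congrFun hX.mul_antipode a) b).trans (Matrix.one_apply ..)
  have e2 : ∀ a b, ∑ x, Y a x * (Y x b).antipode = if a = b then 1 else 0 := fun a b =>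
    (congrFun (congrFun hY.mul_antipode a) b).trans (Matrix.one_apply ..)
  have hZW : Z * W = 1 := by
    refine funext fun a => funext fun b => (Matrix.mul_apply ..).trans ?_
    simp only [Z, W, Matrix.of_apply, Fintype.sum_prod_type]
    have e3 : ∀ x y, X a.1 x * Y a.2 y * ((Y y b.2).antipode * (X x b.1).antipode) =
        X a.1 x * (Y a.2 y * (Y y b.2).antipode) * (X x b.1).antipode := fun x y => by
      simp only [mul_assoc]
    simp only [e3, ← Finset.mul_sum, ← Finset.sum_mul, e2]
    refine Eq.trans ?_ (Matrix.one_apply ..).symm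
    by_cases h2 : a.2 = b.2
    · simp only [h2, if_true, mul_one, e1, Prod.ext_iff, and_true]
    · simp [h2, Prod.ext_iff]
  have hW : Z.map ConvDual.antipode = W :=
    left_inv_eq_right_inv (hX.kronecker hY).antipode_mul hZW
  exact congrFun (congrFun hW p) q

end IsCorep

end Rep


/-! ### The homological determinant and the action on the relation -/

section Cocycle

variable {k A : Type*} [Field k] [Ring A] [Algebra k A] {ε : A →ₐ[k] k}
  {f : Module.Dual k (A ⊗[k] A)}

/-- The operator `(b, t) ↦ (a b, ε(a) t + f(a ⊗ b))` on `A × k`. When `f` is a cocycle these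
operators are multiplicative in `a` up to multiples of `cocycleNil`. -/
noncomputable def cocycleOp (ε : A →ₐ[k] k) (f : Module.Dual k (A ⊗[k] A)) :
    A →ₗ[k] Module.End k (A × k) where
  toFun a :=
    { toFun := fun p => (a * p.1, ε a * p.2 + f (a ⊗ₜ p.1))
      map_add' := fun p p' => by
        simp only [Prod.fst_add, Prod.snd_add, mul_add, TensorProduct.tmul_add, map_add,
          Prod.mk_add_mk]
        congr 1; ring
      map_smul' := fun c p => by
        simp only [Prod.smul_fst, Prod.smul_snd, mul_smul_comm, TensorProduct.tmul_smul, map_smul,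
          RingHom.id_apply, Prod.smul_mk, smul_add] }
  map_add' a b := by
    ext p <;> simp [add_mul, TensorProduct.add_tmul]
  map_smul' c a := by
    ext p <;> simp [← TensorProduct.smul_tmul', mul_assoc]

/-- The operator `(b, t) ↦ (0, ε(b))` on `A × k`. -/
noncomputable def cocycleNil (ε : A →ₐ[k] k) : Module.End k (A × k) :=
  (LinearMap.inr k A k) ∘ₗ ε.toLinearMap ∘ₗ (LinearMap.fst k A k)

theorem cocycleOp_apply (a b : A) (t : k) :
    cocycleOp ε f a (b, t) = (a * b, ε a * t + f (a ⊗ₜ b)) := rfl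

theorem cocycleNil_apply (b : A) (t : k) : cocycleNil (k := k) ε (b, t) = (0, ε b) := rfl

theorem cocycleOp_mul (hf : f ∈ barCocycles ε) (a b : A) :
    cocycleOp ε f a * cocycleOp ε f b = cocycleOp ε f (a * b) + f (a ⊗ₜ b) • cocycleNil ε := by
  refine LinearMap.ext fun ⟨c, t⟩ => ?_
  rw [Module.End.mul_apply, LinearMap.add_apply, LinearMap.smul_apply, cocycleOp_apply,
    cocycleOp_apply, cocycleOp_apply, cocycleNil_apply]
  refine Prod.ext (by simp [mul_assoc]) ?_
  simp only [Prod.snd_add, Prod.smul_snd, smul_eq_mul, map_mul]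
  linear_combination hf a b c

theorem cocycleNil_mul (a : A) :
    cocycleNil ε * cocycleOp ε f a = ε a • cocycleNil (k := k) ε := by
  refine LinearMap.ext fun ⟨c, t⟩ => ?_
  rw [Module.End.mul_apply, LinearMap.smul_apply, cocycleOp_apply, cocycleNil_apply,
    cocycleNil_apply]
  refine Prod.ext (by simp) (by simp)

theorem mul_cocycleNil (a : A) :
    cocycleOp ε f a * cocycleNil ε = ε a • cocycleNil (k := k) ε := by
  refine LinearMap.ext fun ⟨c, t⟩ => ?_
  rw [Module.End.mul_apply, LinearMap.smul_apply, cocycleNil_apply, cocycleOp_apply]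
  refine Prod.ext (by simp) (by simp)

theorem cocycleNil_sq : cocycleNil ε * cocycleNil (k := k) ε = 0 := by
  refine LinearMap.ext fun ⟨c, t⟩ => ?_
  rw [Module.End.mul_apply, cocycleNil_apply, cocycleNil_apply]
  simp

theorem cocycleOp_one (hf : f ∈ barCocycles ε) :
    cocycleOp ε f 1 = 1 + f (1 ⊗ₜ 1) • cocycleNil (k := k) ε := by
  refine LinearMap.ext fun ⟨c, t⟩ => ?_
  rw [LinearMap.add_apply, LinearMap.smul_apply, cocycleOp_apply, cocycleNil_apply]
  refine Prod.ext (by simp) ?_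
  have := hf 1 1 c
  simp only [map_one, one_mul] at this
  simp only [Prod.snd_add, Prod.smul_snd, smul_eq_mul, map_one, Module.End.one_apply]
  linear_combination this

end Cocycle

namespace SkewPlane

variable {k : Type*} [Field k] {q : k}

/-- The relation `v ⊗ u - q u ⊗ v`, which spans the kernel of `A₁ ⊗ A₁ → A₂`. -/
noncomputable def relation (k : Type*) [Field k] (q : k) : SkewPlane k q ⊗[k] SkewPlane k q :=
  gen k q 1 ⊗ₜ gen k q 0 - q • (gen k q 0 ⊗ₜ gen k q 1)

theorem coboundary_relation {f : Module.Dual k (SkewPlane k q ⊗[k] SkewPlane k q)}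
    (hf : f ∈ barCoboundaries (augmentation k q)) : f (relation k q) = 0 := by
  obtain ⟨g, hg⟩ := hf
  rw [relation, map_sub, map_smul, hg, hg, gen_one_mul_gen_zero]
  simp

/-- A cocycle that vanishes on the relation is a coboundary: it deforms the action of `A` on itself
to an action on `A × k`, because the relation is the only one to be checked. -/
theorem mem_barCoboundaries {f : Module.Dual k (SkewPlane k q ⊗[k] SkewPlane k q)}
    (hf : f ∈ barCocycles (augmentation k q)) (h0 : f (relation k q) = 0) :
    f ∈ barCoboundaries (augmentation k q) := by
  set ε := augmentation k q
  set N := cocycleNil (k := k) ε with hN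
  have hrel : cocycleOp ε f (gen k q 1) * cocycleOp ε f (gen k q 0) =
      q • (cocycleOp ε f (gen k q 0) * cocycleOp ε f (gen k q 1)) := by
    rw [relation, map_sub, map_smul, sub_eq_zero] at h0
    rw [cocycleOp_mul hf, cocycleOp_mul hf, gen_one_mul_gen_zero, map_smul, smul_add, h0,
      smul_eq_mul, mul_smul]
  let Φ : SkewPlane k q →ₐ[k] Module.End k (SkewPlane k q × k) :=
    liftHom (fun i => cocycleOp ε f (gen k q i)) hrel
  -- `Φ` agrees with `cocycleOp` up to multiples of `N`, since this holds on the generators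
  let S : Subalgebra k (SkewPlane k q) :=
    { carrier := {a | ∃ t : k, Φ a = cocycleOp ε f a + t • N}
      add_mem' := by
        rintro a b ⟨s, hs⟩ ⟨t, ht⟩
        exact ⟨s + t, by rw [map_add, map_add, hs, ht, add_smul]; abel⟩
      mul_mem' := by
        rintro a b ⟨s, hs⟩ ⟨t, ht⟩
        refine ⟨f (a ⊗ₜ b) + s * ε b + t * ε a, ?_⟩
        rw [map_mul, hs, ht, add_mul, mul_add, mul_add, cocycleOp_mul hf, smul_mul_assoc,
          smul_mul_assoc, mul_smul_comm, mul_smul_comm, cocycleNil_mul, mul_cocycleNil,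
          cocycleNil_sq, add_smul, add_smul, mul_smul, mul_smul]
        simp only [smul_zero, add_zero]
        abel
      algebraMap_mem' := fun r => by
        refine ⟨-(r * f (1 ⊗ₜ 1)), ?_⟩
        rw [AlgHom.commutes, Algebra.algebraMap_eq_smul_one, Algebra.algebraMap_eq_smul_one,
          map_smul, cocycleOp_one hf]
        module }
  have hS : S = ⊤ := eq_top_of_gen_mem S fun i => ⟨0, by
    rw [zero_smul, add_zero]; exact liftHom_gen _ _ i⟩
  have hmem : ∀ a, ∃ t : k, Φ a = cocycleOp ε f a + t • N := fun a => by
    have : a ∈ S := by rw [hS]; trivial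
    exact this
  -- the coefficient of `N` is read off from the vector `(1, 0)`
  let g : Module.Dual k (SkewPlane k q) :=
    LinearMap.snd k _ k ∘ₗ LinearMap.applyₗ ((1 : SkewPlane k q), (0 : k)) ∘ₗ
      (Φ.toLinearMap - cocycleOp ε f)
  have hN1 : (N (1, 0)).2 = 1 := by rw [hN, cocycleNil_apply, map_one]
  have hg : ∀ a, Φ a = cocycleOp ε f a + g a • N := by
    intro a
    obtain ⟨t, ht⟩ := hmem a
    have : g a = t := by
      show ((Φ a - cocycleOp ε f a) (1, 0)).2 = t
      rw [ht, add_sub_cancel_left, LinearMap.smul_apply, Prod.smul_snd, hN1, smul_eq_mul, mul_one]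
    rw [this, ht]
  refine ⟨-g, fun a b => ?_⟩
  have h1 := map_mul Φ a b
  rw [hg, hg, hg, add_mul, mul_add, mul_add, cocycleOp_mul hf, smul_mul_assoc,
    smul_mul_assoc, mul_smul_comm, mul_smul_comm, cocycleNil_mul, mul_cocycleNil,
    cocycleNil_sq] at h1
  have h2 := congrArg (fun T : Module.End k (SkewPlane k q × k) => (T (1, 0)).2) h1
  simp only [LinearMap.add_apply, LinearMap.smul_apply, Prod.snd_add, Prod.smul_snd, ← hN, hN1,
    smul_eq_mul, LinearMap.zero_apply, mul_one, Prod.snd_zero, mul_zero, add_zero] at h2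
  simp only [LinearMap.neg_apply]
  linear_combination -h2

/-- The coordinate of the linear part along a generator. -/
noncomputable def coord (k : Type*) [Field k] (q : k) (i : Fin 2) : SkewPlane k q →ₗ[k] k :=
  (TrivSqZeroExt.sndHom k k) ∘ₗ (liftHom (B := TrivSqZeroExt k k)
    (fun j => TrivSqZeroExt.inr (if i = j then 1 else 0))
    (by simp)).toLinearMap

theorem coord_gen (i j : Fin 2) : coord k q i (gen k q j) = if i = j then 1 else 0 := by
  by_cases h : i = j <;> simp [coord, h]

theorem eq_sum_coord {a : SkewPlane k q} (ha : a ∈ grading k q 1) :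
    a = ∑ i, coord k q i a • gen k q i := by
  rw [grading, pow_one] at ha
  obtain ⟨c, rfl⟩ := (Submodule.mem_span_range_iff_exists_fun k).1 ha
  simp [coord_gen]

end SkewPlane

namespace GradedHopfAction

open SkewPlane

variable {k H : Type*} [Field k] [Ring H] [HopfAlgebra k H] {q : k}
  (ρ : GradedHopfAction k H (SkewPlane.grading k q))

/-- The matrix coefficients of `H` on `A₁`: `h gⱼ = ∑ᵢ cᵢⱼ(h) gᵢ`. -/
noncomputable def coef : Matrix (Fin 2) (Fin 2) (ConvDual k H) := Matrix.of fun i j =>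
  WithConv.toConv (coord k q i ∘ₗ LinearMap.applyₗ (gen k q j) ∘ₗ ρ.act.toLinearMap)

theorem coef_apply (i j : Fin 2) (h : H) : ρ.coef i j h = coord k q i (ρ.act h (gen k q j)) := rfl

theorem act_gen (h : H) (j : Fin 2) : ρ.act h (gen k q j) = ∑ i, ρ.coef i j h • gen k q i :=
  eq_sum_coord (ρ.act_mem h 1 _ (gen_mem_grading j))

theorem isCorep_coef : IsCorep ρ.coef where
  mul i j h h' := by
    rw [coef_apply, map_mul, Module.End.mul_apply, act_gen ρ h' j, map_sum, map_sum]
    refine Finset.sum_congr rfl fun l _ => ?_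
    rw [map_smul, map_smul, smul_eq_mul, mul_comm, ← coef_apply]
  one i j := by rw [coef_apply, map_one, Module.End.one_apply, coord_gen]

theorem tensorRep_gen (h : H) (a b : Fin 2) :
    tensorRep ρ.act ρ.act h (gen k q a ⊗ₜ gen k q b) =
      ∑ i, ∑ j, (ρ.coef i a * ρ.coef j b) h • (gen k q i ⊗ₜ[k] gen k q j) := by
  rw [tensorRep_apply _ _ (Coalgebra.Repr.arbitrary k h)]
  simp only [act_gen, Coalgebra.Repr.convMul_apply (Coalgebra.Repr.arbitrary k h),
    TensorProduct.sum_tmul, TensorProduct.tmul_sum, TensorProduct.smul_tmul_smul, Finset.sum_smul]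
  rw [Finset.sum_comm]
  refine Eq.trans (Finset.sum_congr rfl fun i _ => ?_) Finset.sum_comm
  rw [Finset.sum_comm]

theorem act_gen_mul_gen (h : H) (a b : Fin 2) : ρ.act h (gen k q a * gen k q b) =
    ∑ i, ∑ j, (ρ.coef i a * ρ.coef j b) h • (gen k q i * gen k q j) := by
  rw [ρ.act_mul, tensorRep_gen]
  simp

variable {ρ} {α : k} (hα : α * α = q) (hq : q * q = 1)

/-- The character by which `H` acts on the relation. -/
noncomputable def relationChar (ρ : GradedHopfAction k H (SkewPlane.grading k q)) :
    ConvDual k H := ρ.coef 1 1 * ρ.coef 0 0 - q • (ρ.coef 1 0 * ρ.coef 0 1)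

include hα hq in
/-- Since `A₁ ⊗ A₁ → A₂` is equivariant, `H` preserves its kernel, the line of the relation. This is
the statement in coordinates. -/
theorem coef_relation (h : H) (i j : Fin 2) :
    (ρ.coef i 1 * ρ.coef j 0 - q • (ρ.coef i 0 * ρ.coef j 1)) h =
      ρ.relationChar h * (!![0, -q; 1, 0] : Matrix (Fin 2) (Fin 2) k) i j := by
  have h1 : ρ.act h (gen k q 1 * gen k q 0 - q • (gen k q 0 * gen k q 1)) = 0 := by
    rw [gen_one_mul_gen_zero, sub_self, map_zero]
  rw [map_sub, map_smul, act_gen_mul_gen, act_gen_mul_gen, Finset.smul_sum,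
    ← Finset.sum_sub_distrib] at h1
  simp only [Finset.smul_sum, ← Finset.sum_sub_distrib, smul_smul, ← sub_smul] at h1
  obtain ⟨h00, h11, h01⟩ := sum_gen_mul_gen_eq_zero hα hq h1
  have e : ∀ a b : Fin 2, (ρ.coef a 1 * ρ.coef b 0 - q • (ρ.coef a 0 * ρ.coef b 1)) h =
      (ρ.coef a 1 * ρ.coef b 0) h - q * (ρ.coef a 0 * ρ.coef b 1) h := fun a b => rfl
  rw [relationChar, e, e]
  fin_cases i <;> fin_cases j <;>
    simp only [Fin.zero_eta, Fin.mk_one, Matrix.of_apply, Matrix.cons_val_zero,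
      Matrix.cons_val_one, Matrix.cons_val', Matrix.cons_val_fin_one]
  · linear_combination h00
  · linear_combination h01
  · ring
  · linear_combination h11

include hα hq in
/-- `H` acts on the relation by `relationChar`. -/
theorem tensorRep_relation (h : H) :
    tensorRep ρ.act ρ.act h (relation k q) = ρ.relationChar h • relation k q := by
  rw [relation, map_sub, map_smul, tensorRep_gen, tensorRep_gen]
  have key : ∀ i j : Fin 2, (ρ.coef i 1 * ρ.coef j 0) h • (gen k q i ⊗ₜ[k] gen k q j) -
      q • (ρ.coef i 0 * ρ.coef j 1) h • (gen k q i ⊗ₜ[k] gen k q j) =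
      (ρ.relationChar h * (!![0, -q; 1, 0] : Matrix (Fin 2) (Fin 2) k) i j) •
        (gen k q i ⊗ₜ[k] gen k q j) := by
    intro i j
    rw [← coef_relation hα hq, ← mul_smul, ← sub_smul]
    rfl
  have k00 := key 0 0
  have k01 := key 0 1
  have k10 := key 1 0
  have k11 := key 1 1
  simp only [Matrix.of_apply, Matrix.cons_val_zero, Matrix.cons_val_one, Matrix.cons_val',
    Matrix.cons_val_fin_one] at k00 k01 k10 k11
  simp only [Fin.sum_univ_two]
  linear_combination (norm := module) k00 + k01 + k10 + k11

include hα hq in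
theorem relationChar_mul (h h' : H) :
    ρ.relationChar (h * h') = ρ.relationChar h * ρ.relationChar h' := by
  have e : ∀ x, ρ.relationChar x = (ρ.coef 1 1 * ρ.coef 0 0) x -
      q * (ρ.coef 1 0 * ρ.coef 0 1) x := fun x => rfl
  have hK := ρ.isCorep_coef.kronecker ρ.isCorep_coef
  have h1 := hK.mul (1, 0) (1, 0) h h'
  have h2 := hK.mul (1, 0) (0, 1) h h'
  simp only [Matrix.of_apply] at h1 h2
  have e' : ∀ a b : Fin 2, (ρ.coef a 1 * ρ.coef b 0 - q • (ρ.coef a 0 * ρ.coef b 1)) h' =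
      (ρ.coef a 1 * ρ.coef b 0) h' - q * (ρ.coef a 0 * ρ.coef b 1) h' := fun a b => rfl
  have r := fun i j => coef_relation (ρ := ρ) hα hq h' i j
  simp only [e'] at r
  rw [e, e h, h1, h2]
  simp only [Fintype.sum_prod_type, Fin.sum_univ_two]
  have r00 := r 0 0
  have r01 := r 0 1
  have r10 := r 1 0
  have r11 := r 1 1
  simp only [Matrix.of_apply, Matrix.cons_val_zero, Matrix.cons_val_one, Matrix.cons_val',
    Matrix.cons_val_fin_one] at r00 r01 r10 r11
  linear_combination (ρ.coef 1 0 * ρ.coef 0 0) h * r00 + (ρ.coef 1 0 * ρ.coef 0 1) h * r01 +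
    (ρ.coef 1 1 * ρ.coef 0 0) h * r10 + (ρ.coef 1 1 * ρ.coef 0 1) h * r11

theorem relationChar_one : ρ.relationChar (1 : H) = 1 := by
  have hK := ρ.isCorep_coef.kronecker ρ.isCorep_coef
  have h1 := hK.one (1, 0) (1, 0)
  have h2 := hK.one (1, 0) (0, 1)
  simp only [Matrix.of_apply] at h1 h2
  have e : ρ.relationChar (1 : H) = (ρ.coef 1 1 * ρ.coef 0 0) (1 : H) -
      q * (ρ.coef 1 0 * ρ.coef 0 1) (1 : H) := rfl
  rw [e, h1, h2]
  simp

/-- A character is determined by its composite with the square of the antipode: both are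
convolution inverses of its composite with the antipode. -/
theorem _root_.ConvDual.eq_one_of_antipode_antipode {θ : ConvDual k H}
    (hm : ∀ h h', θ (h * h') = θ h * θ h') (h1 : θ (1 : H) = 1)
    (hS : ∀ h, θ (HopfAlgebra.antipode k (HopfAlgebra.antipode k h)) =
      Coalgebra.counit (R := k) h) : θ = 1 := by
  have inv : ∀ φ : ConvDual k H, (∀ h h', φ (h * h') = φ h * φ h') → φ (1 : H) = 1 →
      φ.antipode * φ = 1 ∧ φ * φ.antipode = 1 := by
    intro φ hφ hφ1
    constructor <;> ext h <;>
      rw [Coalgebra.Repr.convMul_apply (Coalgebra.Repr.arbitrary k h)]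
    · have := congrArg φ
        (HopfAlgebra.sum_antipode_mul_eq_smul (Coalgebra.Repr.arbitrary k h))
      rw [map_sum, map_smul, hφ1] at this
      simp only [hφ] at this
      exact this.trans (mul_one _)
    · have := congrArg φ
        (HopfAlgebra.sum_mul_antipode_eq_smul (Coalgebra.Repr.arbitrary k h))
      rw [map_sum, map_smul, hφ1] at this
      simp only [hφ] at this
      exact this.trans (mul_one _)
  have hm' : ∀ h h', θ.antipode (h * h') = θ.antipode h * θ.antipode h' := by
    intro h h'
    show θ (HopfAlgebra.antipode k (h * h')) =
      θ (HopfAlgebra.antipode k h) * θ (HopfAlgebra.antipode k h')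
    rw [HopfAlgebra.antipode_mul_antidistrib, hm, mul_comm]
  have h1' : θ.antipode (1 : H) = 1 := by
    show θ (HopfAlgebra.antipode k (1 : H)) = 1
    rw [HopfAlgebra.antipode_one, h1]
  have hSS : θ.antipode.antipode = 1 := WithConv.ext (LinearMap.ext hS)
  have h2 := (inv _ hm' h1').1
  rw [hSS, one_mul] at h2
  have h3 := (inv _ hm h1).1
  rwa [h2, one_mul] at h3

include hα hq in
/-- If the homological determinant is trivial, then `H` acts trivially on the relation. -/
theorem relationChar_eq_one (hd : ρ.HasTrivialHomologicalDet (augmentation k q)) :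
    ρ.relationChar = 1 := by
  obtain ⟨f, hf, hf', η, hη, hχ⟩ := hd
  have h0 : f (relation k q) ≠ 0 := fun h0 => hf' (mem_barCoboundaries hf h0)
  refine ConvDual.eq_one_of_antipode_antipode (relationChar_mul hα hq) (relationChar_one)
    fun h => ?_
  have h1 := coboundary_relation (hη (HopfAlgebra.antipode k h))
  rw [LinearMap.sub_apply, LinearMap.smul_apply, ← hχ, barAct, LinearMap.comp_apply,
    tensorRep_relation hα hq, map_smul, ← sub_smul, smul_eq_zero] at h1
  exact sub_eq_zero.1 (h1.resolve_right h0)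

end GradedHopfAction


/-! ### The relations of `SL_q(2)` and inner faithfulness -/

section TwoByTwo

variable {k D : Type*} [Field k] [Ring D] [Algebra k D] {q : k} (hq : q * q = 1) {a b c d : D}

include hq in
/-- The invariance of the relation makes the quantum adjugate a right inverse. -/
theorem mul_quantumAdjugate (h00 : b * a - q • (a * b) = 0)
    (h01 : b * c - q • (a * d) = algebraMap k D (-q)) (h10 : d * a - q • (c * b) = 1)
    (h11 : d * c - q • (c * d) = 0) : !![a, b; c, d] * !![d, -(q • b); -(q • c), a] = 1 := by
  have hqq : ∀ x : D, q • q • x = x := fun x => by rw [smul_smul, hq, one_smul]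
  rw [Algebra.algebraMap_eq_smul_one] at h01
  have h01' := congrArg (q • ·) h01
  have h11' := congrArg (q • ·) h11
  simp only [smul_sub, hqq, neg_smul, smul_neg, smul_zero] at h01' h11'
  rw [Matrix.mul_fin_two, Matrix.one_fin_two]
  simp only [mul_neg, mul_smul_comm]
  congr 1
  refine funext fun i => funext fun j => ?_
  fin_cases i <;> fin_cases j
  · show a * d + -(q • (b * c)) = 1
    rw [← neg_inj, ← h01']; abel
  · show -(q • (a * b)) + b * a = 0
    rw [← h00]; abel
  · show c * d + -(q • (d * c)) = 0
    rw [← neg_inj, neg_zero, ← h11']; abel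
  · show -(q • (c * b)) + d * a = 1
    rw [← h10]; abel

/-- The relations of the coordinate ring of the quantum group `SL_q(2)`, for `q = ±1`: the entries
commute up to powers of `q`, and the quantum determinant is `1`. -/
structure QuantumSLRelations (q : k) (X : Fin 2 → Fin 2 → D) : Prop where
  comm : ∀ i j l m : Fin 2, X i j * X l m = q ^ ((i : ℕ) + j + l + m) • (X l m * X i j)
  det : X 0 0 * X 1 1 - q • (X 0 1 * X 1 0) = 1

include hq in
/-- The relations say that the quantum adjugate is a two-sided inverse; for `q = ±1` this makes the
entries commute up to sign. -/
theorem quantumSLRelations_of_mul {X : Fin 2 → Fin 2 → D}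
    (h1 : !![X 0 0, X 0 1; X 1 0, X 1 1] * !![X 1 1, -(q • X 0 1); -(q • X 1 0), X 0 0] = 1)
    (h2 : !![X 1 1, -(q • X 0 1); -(q • X 1 0), X 0 0] * !![X 0 0, X 0 1; X 1 0, X 1 1] = 1) :
    QuantumSLRelations q X := by
  have hqq : ∀ x : D, q • q • x = x := fun x => by rw [smul_smul, hq, one_smul]
  rw [Matrix.mul_fin_two, Matrix.one_fin_two] at h1 h2
  have e1 := fun i j : Fin 2 => congrFun (congrFun h1 i) j
  have e2 := fun i j : Fin 2 => congrFun (congrFun h2 i) j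
  have a1 : X 0 0 * X 1 1 + X 0 1 * -(q • X 1 0) = 1 := e1 0 0
  have a2 : X 0 0 * -(q • X 0 1) + X 0 1 * X 0 0 = 0 := e1 0 1
  have a3 : X 1 0 * X 1 1 + X 1 1 * -(q • X 1 0) = 0 := e1 1 0
  have a4 : X 1 0 * -(q • X 0 1) + X 1 1 * X 0 0 = 1 := e1 1 1
  have b1 : X 1 1 * X 0 0 + -(q • X 0 1) * X 1 0 = 1 := e2 0 0
  have b2 : X 1 1 * X 0 1 + -(q • X 0 1) * X 1 1 = 0 := e2 0 1
  have b3 : -(q • X 1 0) * X 0 0 + X 0 0 * X 1 0 = 0 := e2 1 0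
  have b4 : -(q • X 1 0) * X 0 1 + X 0 0 * X 1 1 = 1 := e2 1 1
  simp only [mul_neg, neg_mul, mul_smul_comm, smul_mul_assoc] at a1 a2 a3 a4 b1 b2 b3 b4
  have c1 : X 0 1 * X 0 0 = q • (X 0 0 * X 0 1) := by rw [← sub_eq_zero, ← a2]; abel
  have c2 : X 1 0 * X 1 1 = q • (X 1 1 * X 1 0) := by rw [← sub_eq_zero, ← a3]; abel
  have c3 : X 1 1 * X 0 1 = q • (X 0 1 * X 1 1) := by rw [← sub_eq_zero, ← b2]; abel
  have c4 : X 0 0 * X 1 0 = q • (X 1 0 * X 0 0) := by rw [← sub_eq_zero, ← b3]; abel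
  have c5 : X 0 0 * X 1 1 = X 1 1 * X 0 0 := by
    rw [← sub_eq_zero, ← sub_self (1 : D)]
    nth_rw 1 [← a1]
    rw [← b1]; abel
  have c6 : X 0 1 * X 1 0 = X 1 0 * X 0 1 := by
    have : q • (X 0 1 * X 1 0) = q • (X 1 0 * X 0 1) := by
      rw [← sub_eq_zero, ← sub_self (1 : D)]
      nth_rw 1 [← a4]
      rw [← b1]; abel
    have := congrArg (q • ·) this
    simpa only [hqq] using this
  have q2 : q ^ 2 = 1 := by rw [pow_two, hq]
  have q3 : q ^ 3 = q := by rw [pow_succ, q2, one_mul]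
  have q4 : q ^ 4 = 1 := by rw [pow_succ, q3, hq]
  refine ⟨fun i j l m => ?_, by rw [sub_eq_add_neg, a1]⟩
  fin_cases i <;> fin_cases j <;> fin_cases l <;> fin_cases m <;>
    simp [q2, q3, q4, c1, c2, c3, c4, c5, c6, hqq]

end TwoByTwo

namespace GradedHopfAction

open SkewPlane

variable {k H : Type*} [Field k] [Ring H] [HopfAlgebra k H] {q : k}
  {ρ : GradedHopfAction k H (SkewPlane.grading k q)} {α : k} (hα : α * α = q) (hq : q * q = 1)
  (hθ : ρ.relationChar = 1)

include hα hq hθ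

/-- Triviality of the homological determinant, in matrix form: the corepresentation preserves the
bilinear form given by the relation. -/
theorem coef_relation_eq (i j : Fin 2) :
    ρ.coef i 1 * ρ.coef j 0 - q • (ρ.coef i 0 * ρ.coef j 1) =
      algebraMap k (ConvDual k H) ((!![0, -q; 1, 0] : Matrix (Fin 2) (Fin 2) k) i j) := by
  ext h
  refine (coef_relation hα hq h i j).trans ?_
  rw [hθ, ConvDual.one_apply, mul_comm]
  rfl

theorem coef_mul_adjugate : ρ.coef *
    !![ρ.coef 1 1, -(q • ρ.coef 0 1); -(q • ρ.coef 1 0), ρ.coef 0 0] = 1 := by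
  rw [Matrix.eta_fin_two ρ.coef]
  refine mul_quantumAdjugate hq ?_ ?_ ?_ ?_
  · exact (coef_relation_eq hα hq hθ 0 0).trans (map_zero _)
  · exact coef_relation_eq hα hq hθ 0 1
  · exact (coef_relation_eq hα hq hθ 1 0).trans (map_one _)
  · exact (coef_relation_eq hα hq hθ 1 1).trans (map_zero _)

/-- The antipode on the matrix coefficients. -/
theorem antipode_coef : ρ.coef.map ConvDual.antipode =
    !![ρ.coef 1 1, -(q • ρ.coef 0 1); -(q • ρ.coef 1 0), ρ.coef 0 0] :=
  left_inv_eq_right_inv ρ.isCorep_coef.antipode_mul (coef_mul_adjugate hα hq hθ)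

/-- As the inverse given by the antipode is two-sided, the matrix coefficients satisfy the
relations of `SL_q(2)`. -/
theorem quantumSLRelations_coef : QuantumSLRelations q ρ.coef := by
  have h1 := coef_mul_adjugate hα hq hθ
  have h2 := ρ.isCorep_coef.antipode_mul
  rw [antipode_coef hα hq hθ] at h2
  rw [Matrix.eta_fin_two ρ.coef] at h1 h2
  exact quantumSLRelations_of_mul hq h1 h2

end GradedHopfAction

namespace GradedHopfAction

open SkewPlane

variable {k H : Type*} [Field k] [Ring H] [HopfAlgebra k H] {q : k}

/-- The subalgebra of `H^*` generated by the matrix coefficients on `A₁`. -/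
noncomputable def coefAlgebra (ρ : GradedHopfAction k H (SkewPlane.grading k q)) :
    Subalgebra k (ConvDual k H) :=
  Algebra.adjoin k (Set.range fun p : Fin 2 × Fin 2 => ρ.coef p.1 p.2)

theorem coef_mem_coefAlgebra (ρ : GradedHopfAction k H (SkewPlane.grading k q)) (i j : Fin 2) :
    ρ.coef i j ∈ ρ.coefAlgebra := Algebra.subset_adjoin ⟨(i, j), rfl⟩

variable {ρ : GradedHopfAction k H (SkewPlane.grading k q)} {α : k} (hα : α * α = q)
  (hq : q * q = 1) (hθ : ρ.relationChar = 1)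

include hα hq hθ in
/-- A product of matrix coefficients is an entry of a corepresentation with entries in the
coefficient algebra, whose inverse also has entries there. -/
theorem exists_isCorep {c : ConvDual k H}
    (hc : c ∈ Submonoid.closure (Set.range fun p : Fin 2 × Fin 2 => ρ.coef p.1 p.2)) :
    ∃ (ι : Type) (_ : Fintype ι) (_ : DecidableEq ι) (X : Matrix ι ι (ConvDual k H)) (i j : ι),
      IsCorep X ∧ (∀ a b, X a b ∈ ρ.coefAlgebra) ∧
      (∀ a b, (X a b).antipode ∈ ρ.coefAlgebra) ∧ X i j = c := by
  induction hc using Submonoid.closure_induction with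
  | mem c hc =>
    obtain ⟨p, rfl⟩ := hc
    refine ⟨Fin 2, inferInstance, inferInstance, ρ.coef, p.1, p.2, ρ.isCorep_coef,
      ρ.coef_mem_coefAlgebra, fun a b => ?_, rfl⟩
    have h1 := congrFun (congrFun (antipode_coef hα hq hθ) a) b
    have h2 : (ρ.coef a b).antipode = _ := h1
    rw [h2]
    have m := ρ.coef_mem_coefAlgebra
    fin_cases a <;> fin_cases b
    · exact m 1 1
    · exact neg_mem (Subalgebra.smul_mem _ (m 0 1) q)
    · exact neg_mem (Subalgebra.smul_mem _ (m 1 0) q)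
    · exact m 0 0
  | one =>
    refine ⟨Unit, inferInstance, inferInstance, _, (), (), IsCorep.unit, fun _ _ => one_mem _,
      fun _ _ => ?_, rfl⟩
    convert one_mem ρ.coefAlgebra using 1
    exact WithConv.ext (LinearMap.ext fun h => HopfAlgebra.counit_antipode h)
  | mul c d _ _ hc hd =>
    obtain ⟨ι, _, _, X, i, j, hX, hm, hs, rfl⟩ := hc
    obtain ⟨κ, _, _, Y, l, m, hY, hm', hs', rfl⟩ := hd
    refine ⟨ι × κ, inferInstance, inferInstance, _, (i, l), (j, m), hX.kronecker hY,
      fun a b => mul_mem (hm _ _) (hm' _ _), fun a b => ?_, rfl⟩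
    rw [Matrix.of_apply, hX.antipode_kronecker hY]
    exact mul_mem (hs' _ _) (hs _ _)

theorem mem_span_closure {c : ConvDual k H} (hc : c ∈ ρ.coefAlgebra) : c ∈ Submodule.span k
    (Submonoid.closure (Set.range fun p : Fin 2 × Fin 2 => ρ.coef p.1 p.2) :
      Set (ConvDual k H)) := by
  rwa [← Algebra.adjoin_eq_span]

include hα hq hθ in
/-- The annihilator of the coefficient algebra is stable under multiplication by `H` and under the
antipode. -/
theorem coefAlgebra_annihilator {x : H} (hx : ∀ c ∈ ρ.coefAlgebra, c x = 0)
    {c : ConvDual k H} (hc : c ∈ ρ.coefAlgebra) (h : H) :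
    c (h * x) = 0 ∧ c (x * h) = 0 ∧ c (HopfAlgebra.antipode k x) = 0 := by
  replace hc := mem_span_closure hc
  induction hc using Submodule.span_induction with
  | mem c hc =>
    obtain ⟨ι, _, _, X, i, j, hX, hm, hs, rfl⟩ := exists_isCorep hα hq hθ hc
    refine ⟨?_, ?_, hx _ (hs i j)⟩
    · rw [hX.mul]
      exact Finset.sum_eq_zero fun l _ => by rw [hx _ (hm l j), mul_zero]
    · rw [hX.mul]
      exact Finset.sum_eq_zero fun l _ => by rw [hx _ (hm i l), zero_mul]
  | zero => exact ⟨rfl, rfl, rfl⟩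
  | add c d _ _ hc' hd' =>
    exact ⟨(congrArg₂ (· + ·) hc'.1 hd'.1).trans (add_zero 0),
      (congrArg₂ (· + ·) hc'.2.1 hd'.2.1).trans (add_zero 0),
      (congrArg₂ (· + ·) hc'.2.2 hd'.2.2).trans (add_zero 0)⟩
  | smul a c _ hc' =>
    exact ⟨(congrArg (a * ·) hc'.1).trans (mul_zero a),
      (congrArg (a * ·) hc'.2.1).trans (mul_zero a), (congrArg (a * ·) hc'.2.2).trans (mul_zero a)⟩

/-- The action of `H` on each element of `A` is expressed through the coefficient algebra. -/
theorem exists_act_eq_sum (a : SkewPlane k q) : ∃ (n : ℕ) (c : Fin n → ConvDual k H)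
    (x : Fin n → SkewPlane k q), (∀ l, c l ∈ ρ.coefAlgebra) ∧
      ∀ h, ρ.act h a = ∑ l, c l h • x l := by
  -- allowing arbitrary finite index types makes closure under sums and products immediate
  let P : SkewPlane k q → Prop := fun a => ∃ (ι : Type) (_ : Fintype ι) (c : ι → ConvDual k H)
    (x : ι → SkewPlane k q), (∀ l, c l ∈ ρ.coefAlgebra) ∧ ∀ h, ρ.act h a = ∑ l, c l h • x l
  let S : Subalgebra k (SkewPlane k q) :=
    { carrier := {a | P a}
      add_mem' := by
        rintro a b ⟨ι, _, c, x, hc, ha⟩ ⟨κ, _, d, y, hd, hb⟩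
        refine ⟨ι ⊕ κ, inferInstance, Sum.elim c d, Sum.elim x y, ?_, fun h => ?_⟩
        · rintro (l | l)
          exacts [hc l, hd l]
        · rw [map_add, ha, hb, Fintype.sum_sum_type]; rfl
      mul_mem' := by
        rintro a b ⟨ι, _, c, x, hc, ha⟩ ⟨κ, _, d, y, hd, hb⟩
        refine ⟨ι × κ, inferInstance, fun p => c p.1 * d p.2, fun p => x p.1 * y p.2,
          fun p => mul_mem (hc _) (hd _), fun h => ?_⟩
        rw [ρ.act_mul, tensorRep_apply _ _ (Coalgebra.Repr.arbitrary k h)]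
        simp only [ha, hb, map_sum, LinearMap.mul'_apply, Finset.sum_mul_sum, smul_mul_smul_comm,
          Coalgebra.Repr.convMul_apply (Coalgebra.Repr.arbitrary k h), Finset.sum_smul,
          Fintype.sum_prod_type]
        rw [Finset.sum_comm]
        exact Finset.sum_congr rfl fun i _ => Finset.sum_comm
      algebraMap_mem' := fun r => by
        refine ⟨Unit, inferInstance, fun _ => 1, fun _ => algebraMap k _ r, fun _ => one_mem _,
          fun h => ?_⟩
        rw [Algebra.algebraMap_eq_smul_one, map_smul, ρ.act_one, Fintype.sum_unique,
          ConvDual.one_apply, Algebra.algebraMap_eq_smul_one, smul_comm] }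
  have hS : S = ⊤ := eq_top_of_gen_mem S fun i => ⟨Fin 2, inferInstance, fun l => ρ.coef l i,
    gen k q, fun l => ρ.coef_mem_coefAlgebra l i, fun h => ρ.act_gen h i⟩
  obtain ⟨ι, _, c, x, hc, ha⟩ : a ∈ S := by rw [hS]; trivial
  let e := Fintype.equivFin ι
  refine ⟨_, c ∘ e.symm, x ∘ e.symm, fun l => hc _, fun h => ?_⟩
  rw [ha]
  exact (Equiv.sum_comp e.symm (fun l => c l h • x l)).symm

include hα hq hθ in
/-- Inner faithfulness, in terms of matrix coefficients: they separate the points of `H`, since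
their common kernel is a Hopf ideal that annihilates `A`. -/
theorem eq_zero_of_coefAlgebra (hif : ρ.InnerFaithful) {x : H}
    (hx : ∀ c ∈ ρ.coefAlgebra, c x = 0) : x = 0 := by
  let I : Ideal H :=
    { carrier := {x | ∀ c ∈ ρ.coefAlgebra, c x = 0}
      add_mem' := fun {x y} hx hy c hc => by
        rw [map_add, hx c hc, hy c hc, add_zero]
      zero_mem' := fun c _ => map_zero c.ofConv
      smul_mem' := fun h x hx c hc => (coefAlgebra_annihilator hα hq hθ hx hc h).1 }
  have htwo : I.IsTwoSided := ⟨fun h hx c hc => (coefAlgebra_annihilator hα hq hθ hx hc h).2.1⟩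
  have hhopf : I.IsHopfIdeal k :=
    { counit_eq_zero := fun x hx => hx 1 (one_mem _)
      map_mkQ_comul_eq_zero := fun x hx => by
        -- the functionals of the coefficient algebra descend to the quotient
        let E : Set ((H ⧸ I.restrictScalars k) →ₗ[k] k) :=
          {e | ∃ c ∈ ρ.coefAlgebra, e ∘ₗ (I.restrictScalars k).mkQ = c.ofConv}
        have hE : ∀ v, (∀ e ∈ E, e v = 0) → v = 0 := by
          intro v hv
          obtain ⟨y, rfl⟩ := (I.restrictScalars k).mkQ_surjective v
          refine (Submodule.Quotient.mk_eq_zero _).2 fun c hc => ?_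
          have hle : I.restrictScalars k ≤ LinearMap.ker c.ofConv := fun z hz => hz c hc
          exact hv ((I.restrictScalars k).liftQ c.ofConv hle)
            ⟨c, hc, Submodule.liftQ_mkQ _ _ _⟩
        refine TensorProduct.eq_zero_of_separating hE hE ?_
        rintro e ⟨c, hc, he⟩ f ⟨d, hd, hf⟩
        have h1 := hx (c * d) (mul_mem hc hd)
        rw [LinearMap.convMul_apply, ← he, ← hf, TensorProduct.map_comp] at h1
        exact h1
      antipode_mem := fun x hx c hc => (coefAlgebra_annihilator hα hq hθ hx hc 1).2.2 }
  have hI := hif I htwo hhopf fun x hx => by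
    refine LinearMap.ext fun a => ?_
    obtain ⟨n, c, y, hc, ha⟩ := exists_act_eq_sum (ρ := ρ) a
    rw [ha, LinearMap.zero_apply]
    exact Finset.sum_eq_zero fun l _ => by rw [hx _ (hc l), zero_smul]
  have : x ∈ I := hx
  rwa [hI, Submodule.mem_bot] at this

end GradedHopfAction


/-! ### Lifts of group elements to `SL₂` -/

/-- A nonzero matrix `P` that is symmetric of rank one up to signs `w s ^ 2 * w t ^ 2` is a twisted
square `w s ⁻¹ w t m s m t`. -/
theorem exists_twisted_square {k ι : Type*} [Field k] [IsAlgClosed k] {w : ι → k}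
    (hw : ∀ s, w s ^ 4 = 1) {P : ι → ι → k}
    (h2 : ∀ s t s' t', P s t * P s' t' = w t ^ 2 * w s' ^ 2 * (P s s' * P t t'))
    (h1 : ∀ s t, P s t = w s ^ 2 * w t ^ 2 * P t s) (h0 : ∃ s t, P s t ≠ 0) :
    ∃ m : ι → k, ∀ s t, P s t = (w s)⁻¹ * w t * (m s * m t) := by
  have hw0 : ∀ s, w s ≠ 0 := fun s h => by simpa [h] using hw s
  obtain ⟨s, hs⟩ : ∃ s, P s s ≠ 0 := by
    by_contra! hP
    obtain ⟨s, t, hst⟩ := h0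
    have h3 := h2 s s t t
    rw [hP s, zero_mul, eq_comm, mul_eq_zero] at h3
    rcases h3 with h3 | h3
    · exact mul_ne_zero (pow_ne_zero _ (hw0 s)) (pow_ne_zero _ (hw0 t)) h3
    · exact hst (mul_self_eq_zero.1 h3)
  obtain ⟨r, hr⟩ := IsAlgClosed.exists_pow_nat_eq (P s s) (n := 2) (by norm_num)
  have hr0 : r ≠ 0 := fun h => hs (by rw [← hr, h]; ring)
  refine ⟨fun t => w s * (w t)⁻¹ * P s t / r, fun t t' => ?_⟩
  have h3 := h2 t s s t'
  have h4 := h2 s s t t'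
  have h5 := h1 t s
  have e : P s s * P t t' = w s ^ 2 * w t ^ 2 * (P s t * P s t') := by
    linear_combination h2 s s t t'
  have e' : P t t' = w s ^ 2 * w t ^ 2 * (P s t * P s t') / r ^ 2 := by
    rw [hr, eq_div_iff hs, ← e, mul_comm]
  have hw' := hw0 t'
  have hwt := hw0 t
  rw [e']
  field_simp
  linear_combination (P s t * P s t') * (w s) ^ 2 * hw t

/-- A matrix in `SL₂` is determined up to sign by the products of two of its entries. -/
theorem SLTwo.eq_or_eq_neg_of_mul_eq {k : Type*} [Field k]
    {M N : Matrix.SpecialLinearGroup (Fin 2) k}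
    (h : ∀ i j l m : Fin 2, SLTwo.mat M i j * SLTwo.mat M l m =
      SLTwo.mat N i j * SLTwo.mat N l m) : M = N ∨ M = -N := by
  obtain ⟨i, j, hij⟩ : ∃ i j, mat M i j ≠ 0 := by
    by_contra! h0
    have hd := SLTwo.det_mat M
    rw [Matrix.det_fin_two] at hd
    simp [h0] at hd
  have hsq : (mat M i j - mat N i j) * (mat M i j + mat N i j) = 0 := by
    linear_combination h i j i j
  rcases mul_eq_zero.1 hsq with h1 | h1
  · left
    refine mat_injective (Matrix.ext fun l m => mul_left_cancel₀ hij ?_)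
    rw [h, sub_eq_zero.1 h1]
  · right
    refine mat_injective (Matrix.ext fun l m => mul_left_cancel₀ hij ?_)
    rw [h, eq_neg_of_add_eq_zero_left h1, mat_neg, Matrix.neg_apply, neg_mul_neg]

section CentralExtension

variable {k H Γ : Type*} [Field k] [Ring H] [HopfAlgebra k H] [Group Γ] {g : H}
  {π : H →ₐc[k] MonoidAlgebra k Γ}

namespace IsCentralExtension

theorem exists_section (hπ : IsCentralExtension g π) (x : Γ) :
    ∃ h : H, π h = MonoidAlgebra.single x 1 := hπ.2.2.2.2.1 _

theorem map_g (hπ : IsCentralExtension g π) : π g = 1 := by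
  have := (hπ.2.2.2.2.2 (g - 1)).2 ⟨1, (one_mul _).symm⟩
  rwa [map_sub, map_one, sub_eq_zero] at this

/-- A linear map invariant under translation by `g` factors through `π`. -/
theorem apply_eq (hπ : IsCentralExtension g π) {V : Type*} [AddCommGroup V] [Module k V]
    {F : H →ₗ[k] V} (hF : ∀ h, F (h * g) = F h) {h h' : H} (e : π h = π h') : F h = F h' := by
  rw [← sub_eq_zero, ← map_sub] at e ⊢
  obtain ⟨y, hy⟩ := (hπ.2.2.2.2.2 _).1 e
  rw [hy, mul_sub, mul_one, map_sub, hF, sub_self]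

/-- Convolution of linear maps that factor through `π`, evaluated at a group element. -/
theorem conv_apply (hπ : IsCentralExtension g π) {B : Type*} [Ring B] [Algebra k B]
    {F F' : WithConv (H →ₗ[k] B)} (hF : ∀ h, F (h * g) = F h) (hF' : ∀ h, F' (h * g) = F' h)
    {x : Γ} {h : H} (e : π h = MonoidAlgebra.single x 1) : (F * F') h = F h * F' h := by
  obtain ⟨s, hs⟩ := π.toCoalgHom.toLinearMap.exists_rightInverse_of_surjective
    (LinearMap.range_eq_top.2 hπ.2.2.2.2.1)
  have hs' : ∀ y, π (s y) = y := fun y => LinearMap.congr_fun hs y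
  have hfac : ∀ {F : WithConv (H →ₗ[k] B)}, (∀ h, F (h * g) = F h) →
      F.ofConv = (F.ofConv ∘ₗ s) ∘ₗ π.toCoalgHom.toLinearMap := fun {F} hF =>
    LinearMap.ext fun h => hπ.apply_eq hF (hs' (π h)).symm
  have hΔ : TensorProduct.map π.toCoalgHom.toLinearMap π.toCoalgHom.toLinearMap
      (Coalgebra.comul (R := k) h) =
      MonoidAlgebra.single x (1 : k) ⊗ₜ MonoidAlgebra.single x (1 : k) := by
    refine (CoalgHomClass.map_comp_comul_apply π h).trans ?_
    rw [e, MonoidAlgebra.comul_single]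
    simp
  rw [LinearMap.convMul_apply, hfac hF, hfac hF', TensorProduct.map_comp, LinearMap.comp_apply,
    hΔ, TensorProduct.map_tmul, LinearMap.mul'_apply]
  simp only [LinearMap.comp_apply]
  rw [show π.toCoalgHom.toLinearMap h = MonoidAlgebra.single x 1 from e]

end IsCentralExtension

end CentralExtension

namespace GradedHopfAction

open SkewPlane

variable {k H : Type*} [Field k] [Ring H] [HopfAlgebra k H] {q : k}
  {ρ : GradedHopfAction k H (SkewPlane.grading k q)} {α : k} (hα : α * α = q)
  (hq : q * q = 1) {Γ : Type*} [Group Γ] {g : H} {π : H →ₐc[k] MonoidAlgebra k Γ}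

/-- The element `g` of `H` acts on `A₁` by `-1`. -/
def ActsByNegOne (ρ : GradedHopfAction k H (SkewPlane.grading k q)) (g : H) : Prop :=
  ∀ i j, ρ.coef i j g = if i = j then -1 else 0

theorem ActsByNegOne.coef_mul (hg : ρ.ActsByNegOne g) (i j : Fin 2) (h : H) :
    ρ.coef i j (h * g) = - ρ.coef i j h := by
  rw [ρ.isCorep_coef.mul]
  simp only [hg _ _, mul_ite, mul_zero, mul_neg, mul_one, Finset.sum_ite_eq', Finset.mem_univ,
    if_true]

theorem _root_.ConvDual.mul_apply_mul_of_isGroupLike {c d : ConvDual k H}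
    (hg : IsGroupLikeElem k g) (h : H) {a b : k} (hc : ∀ h, c (h * g) = a * c h)
    (hd : ∀ h, d (h * g) = b * d h) : (c * d) (h * g) = a * b * (c * d) h := by
  let r := Coalgebra.Repr.arbitrary k h
  let s : Coalgebra.Repr k g Unit :=
    { index := Finset.univ, left := fun _ => g, right := fun _ => g,
      eq := by simp [hg.comul_eq_tmul_self] }
  rw [ConvDual.mul_apply_mul _ _ r s, Coalgebra.Repr.convMul_apply r, Finset.mul_sum]
  refine Finset.sum_congr rfl fun i _ => ?_
  simp only [s, Finset.univ_unique, Finset.sum_singleton, hc, hd]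
  ring

theorem ActsByNegOne.coef_coef_mul (hg : ρ.ActsByNegOne g) (hgl : IsGroupLikeElem k g)
    (i j l m : Fin 2) (h : H) :
    (ρ.coef i j * ρ.coef l m) (h * g) = (ρ.coef i j * ρ.coef l m) h := by
  rw [ConvDual.mul_apply_mul_of_isGroupLike hgl h (a := -1) (b := -1)]
  · ring
  · intro h; rw [hg.coef_mul, neg_one_mul]
  · intro h; rw [hg.coef_mul, neg_one_mul]

/-- The twist between the matrix coefficients on `A₁` and those of a matrix. -/
def twist (α : k) (i j : Fin 2) : k := α ^ (i : ℕ) * α⁻¹ ^ (j : ℕ)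

/-- `M` is one of the two matrices by which the group element `x` acts on `A^(2)`: the products of
two matrix coefficients on `A₁` take at `x` the values of the corresponding products of entries of
`M`, up to the twist. -/
def IsLift (ρ : GradedHopfAction k H (SkewPlane.grading k q)) (α : k)
    (π : H →ₐc[k] MonoidAlgebra k Γ) (x : Γ) (M : Matrix.SpecialLinearGroup (Fin 2) k) : Prop :=
  ∀ h, π h = MonoidAlgebra.single x 1 → ∀ i j l m, (ρ.coef i j * ρ.coef l m) h =
    (twist α i j)⁻¹ * twist α l m * (SLTwo.mat M i j * SLTwo.mat M l m)

include hα hq in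
theorem twist_sq (i j : Fin 2) : twist α i j ^ 2 = q ^ ((i : ℕ) + j) := by
  have h0 := ne_zero_of_sq hα hq
  have h2 : α⁻¹ ^ 2 = q := by
    rw [inv_pow, pow_two, hα]
    exact inv_eq_of_mul_eq_one_left hq
  rw [twist, mul_pow, ← pow_mul, ← pow_mul, mul_comm (i : ℕ), mul_comm (j : ℕ), pow_mul, pow_mul,
    h2, pow_two, hα, pow_add]

include hα hq in
theorem twist_ne_zero (i j : Fin 2) : twist α i j ≠ 0 := by
  have h0 := ne_zero_of_sq hα hq
  exact mul_ne_zero (pow_ne_zero _ h0) (pow_ne_zero _ (inv_ne_zero h0))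

include hα hq in
theorem twist_mul_twist (i j l : Fin 2) : twist α i j * twist α j l = twist α i l := by
  have h0 := ne_zero_of_sq hα hq
  have : α⁻¹ ^ (j : ℕ) * α ^ (j : ℕ) = 1 := by rw [← mul_pow, inv_mul_cancel₀ h0, one_pow]
  simp only [twist]
  linear_combination α ^ (i : ℕ) * α⁻¹ ^ (l : ℕ) * this

include hα hq in
theorem twist_self (i : Fin 2) : twist α i i = 1 := by
  have h0 := ne_zero_of_sq hα hq
  rw [twist, ← mul_pow, mul_inv_cancel₀ h0, one_pow]

include hα hq in
/-- At an element of `H` over a group element, the products of two matrix coefficients form a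
symmetric matrix of rank one, up to signs, because these products commute. Hence they are twisted
products of two entries of a single matrix `M`, and `det M = 1` is the relation for the quantum
determinant. -/
theorem exists_isLift [IsAlgClosed k] (hc : QuantumSLRelations q ρ.coef) (hg : ρ.ActsByNegOne g)
    (hπ : IsCentralExtension g π) (x : Γ) : ∃ M, ρ.IsLift α π x M := by
  obtain ⟨h, hh⟩ := hπ.exists_section x
  let c : Fin 2 × Fin 2 → ConvDual k H := fun s => ρ.coef s.1 s.2
  let w : Fin 2 × Fin 2 → k := fun s => twist α s.1 s.2
  have hq2 : q ^ 2 = 1 := by rw [pow_two, hq]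
  have hw : ∀ s, w s ^ 4 = 1 := fun s => by
    rw [show 4 = 2 * 2 by norm_num, pow_mul, twist_sq hα hq, ← pow_mul, mul_comm, pow_mul, hq2,
      one_pow]
  have hcomm : ∀ s t, c s * c t = (w s ^ 2 * w t ^ 2) • (c t * c s) := fun s t => by
    rw [twist_sq hα hq, twist_sq hα hq, ← pow_add, ← add_assoc]
    exact hc.comm _ _ _ _
  have heven := fun s t : Fin 2 × Fin 2 => hg.coef_coef_mul hπ.1 s.1 s.2 t.1 t.2
  obtain ⟨m, hm⟩ := exists_twisted_square hw (P := fun s t => (c s * c t) h)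
    (fun s t s' t' => by
      rw [← hπ.conv_apply (heven s t) (heven s' t') hh,
        ← hπ.conv_apply (heven s s') (heven t t') hh]
      have : c s * c t * (c s' * c t') =
          (w t ^ 2 * w s' ^ 2) • (c s * c s' * (c t * c t')) := by
        rw [mul_assoc, ← mul_assoc (c t), hcomm t s', smul_mul_assoc, mul_smul_comm]
        simp only [mul_assoc]
      exact congrArg (fun d : ConvDual k H => d h) this)
    (fun s t => congrArg (fun d : ConvDual k H => d h) (hcomm s t))
    (by
      by_contra! h0
      have hdet := congrArg (fun d : ConvDual k H => d h) hc.det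
      have h1 : (1 : ConvDual k H) h = 1 := by
        rw [ConvDual.one_apply, ← CoalgHomClass.counit_comp_apply π h, hh]
        simp
      have h2 : (c (0, 0) * c (1, 1)) h - q * (c (0, 1) * c (1, 0)) h = 1 := hdet.trans h1
      have e1 : (c (0, 0) * c (1, 1)) h = 0 := h0 (0, 0) (1, 1)
      have e2 : (c (0, 1) * c (1, 0)) h = 0 := h0 (0, 1) (1, 0)
      rw [e1, e2] at h2
      simp at h2)
  have hdet := congrArg (fun d : ConvDual k H => d h) hc.det
  have h1 : (1 : ConvDual k H) h = 1 := by
    rw [ConvDual.one_apply, ← CoalgHomClass.counit_comp_apply π h, hh]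
    simp
  have h2 : (c (0, 0) * c (1, 1)) h - q * (c (0, 1) * c (1, 0)) h = 1 := hdet.trans h1
  have e1 := hm (0, 0) (1, 1)
  have e2 := hm (0, 1) (1, 0)
  have hd : (Matrix.of fun i j => m (i, j)).det = 1 := by
    have h0 := ne_zero_of_sq hα hq
    rw [e1, e2] at h2
    simp only [w, twist_self hα hq, Matrix.det_fin_two, Matrix.of_apply] at h2 ⊢
    simp only [twist, Fin.val_zero, Fin.val_one, pow_zero, pow_one, one_mul, mul_one, inv_inv,
      inv_one, ← mul_assoc] at h2
    rw [mul_assoc q, hα, hq] at h2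
    linear_combination h2
  refine ⟨⟨Matrix.of fun i j => m (i, j), hd⟩, fun h' hh' i j l m' => ?_⟩
  rw [hπ.apply_eq (heven (i, j) (l, m')) (hh'.trans hh.symm)]
  exact hm (i, j) (l, m')

end GradedHopfAction


/-! ### The binary cover formed by the lifts -/

namespace GradedHopfAction

open SkewPlane

variable {k H : Type*} [Field k] [Ring H] [HopfAlgebra k H] {q : k}
  {ρ : GradedHopfAction k H (SkewPlane.grading k q)} {α : k} (hα : α * α = q)
  (hq : q * q = 1) {Γ : Type*} [Group Γ] {g : H} {π : H →ₐc[k] MonoidAlgebra k Γ}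

namespace IsLift

theorem neg {x : Γ} {M : Matrix.SpecialLinearGroup (Fin 2) k} (hM : ρ.IsLift α π x M) :
    ρ.IsLift α π x (-M) := by
  intro h hh i j l m
  rw [hM h hh, SLTwo.mat_neg, Matrix.neg_apply, Matrix.neg_apply, neg_mul_neg]

include hα hq in
theorem eq_or_eq_neg (hπ : IsCentralExtension g π) {x : Γ}
    {M N : Matrix.SpecialLinearGroup (Fin 2) k} (hM : ρ.IsLift α π x M) (hN : ρ.IsLift α π x N) :
    M = N ∨ M = -N := by
  obtain ⟨h, hh⟩ := hπ.exists_section x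
  refine SLTwo.eq_or_eq_neg_of_mul_eq fun i j l m => ?_
  have h1 := (hM h hh i j l m).symm.trans (hN h hh i j l m)
  exact mul_left_cancel₀ (mul_ne_zero (inv_ne_zero (twist_ne_zero hα hq i j))
    (twist_ne_zero hα hq l m)) h1

include hα hq in
theorem mul (hg : ρ.ActsByNegOne g) (hπ : IsCentralExtension g π) {x y : Γ}
    {M N : Matrix.SpecialLinearGroup (Fin 2) k} (hM : ρ.IsLift α π x M) (hN : ρ.IsLift α π y N) :
    ρ.IsLift α π (x * y) (M * N) := by
  intro h hh i j l m
  obtain ⟨a, ha⟩ := hπ.exists_section x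
  obtain ⟨b, hb⟩ := hπ.exists_section y
  have hab : π h = π (a * b) := by
    rw [hh, map_mul, ha, hb, MonoidAlgebra.single_mul_single, one_mul]
  rw [hπ.apply_eq (hg.coef_coef_mul hπ.1 i j l m) hab]
  refine ((ρ.isCorep_coef.kronecker ρ.isCorep_coef).mul (i, l) (j, m) a b).trans ?_
  simp only [Matrix.of_apply, Fintype.sum_prod_type, hM a ha, hN b hb, map_mul, Matrix.mul_apply]
  rw [Finset.sum_mul_sum, Finset.mul_sum]
  refine Finset.sum_congr rfl fun s _ => ?_
  rw [Finset.mul_sum]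
  refine Finset.sum_congr rfl fun t _ => ?_
  rw [← twist_mul_twist hα hq i s j, ← twist_mul_twist hα hq l t m, mul_inv]
  ring

/-- A matrix lifts at most one group element: it determines the values of all even products of
matrix coefficients, and these separate the points of `k Γ`. -/
theorem unique [NeZero (2 : k)] (hg : ρ.ActsByNegOne g) (hπ : IsCentralExtension g π)
    (hsep : ∀ x : H, (∀ c ∈ ρ.coefAlgebra, c x = 0) → x = 0) {x y : Γ}
    {M : Matrix.SpecialLinearGroup (Fin 2) k} (hM : ρ.IsLift α π x M) (hN : ρ.IsLift α π y M) :
    x = y := by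
  obtain ⟨a, ha⟩ := hπ.exists_section x
  obtain ⟨b, hb⟩ := hπ.exists_section y
  have h2 : (2 : k) ≠ 0 := NeZero.ne 2
  -- even products agree at `x` and `y`, and odd ones do after multiplication by a coefficient
  have hword : ∀ c ∈ Submonoid.closure (Set.range fun p : Fin 2 × Fin 2 => ρ.coef p.1 p.2),
      ((∀ h, c (h * g) = 1 * c h) ∧ c a = c b) ∨
      ((∀ h, c (h * g) = -1 * c h) ∧ ∀ i j, (ρ.coef i j * c) a = (ρ.coef i j * c) b) := by
    intro c hc
    induction hc using Submonoid.closure_induction_left with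
    | one =>
      left
      have hΓ : ∀ {z : H} {w : Γ}, π z = MonoidAlgebra.single w 1 → (1 : ConvDual k H) z = 1 := by
        intro z w hz
        rw [ConvDual.one_apply, ← CoalgHomClass.counit_comp_apply π z, hz]
        simp
      refine ⟨fun h => ?_, by rw [hΓ ha, hΓ hb]⟩
      rw [one_mul, ConvDual.one_apply, Bialgebra.counit_mul, hπ.1.counit_eq_one, mul_one]
      rfl
    | mul_left d hd c _ ih =>
      obtain ⟨⟨i, j⟩, rfl⟩ := hd
      have hodd : ∀ i j h, ρ.coef i j (h * g) = -1 * ρ.coef i j h := fun i j h => by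
        rw [hg.coef_mul, neg_one_mul]
      rcases ih with ⟨h1, h2⟩ | ⟨h1, h2⟩
      · right
        refine ⟨fun h => (ConvDual.mul_apply_mul_of_isGroupLike hπ.1 h (hodd i j) h1).trans
          (by rw [mul_one]), fun l m => ?_⟩
        have he := hg.coef_coef_mul hπ.1 l m i j
        have h1' : ∀ h, c (h * g) = c h := fun h => by rw [h1, one_mul]
        rw [← mul_assoc, hπ.conv_apply he h1' ha, hπ.conv_apply he h1' hb, h2, hM a ha, hN b hb]
      · left
        refine ⟨fun h => (ConvDual.mul_apply_mul_of_isGroupLike hπ.1 h (hodd i j) h1).trans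
          (by ring), h2 i j⟩
  have hz : a * (1 + g) = b * (1 + g) := by
    rw [← sub_eq_zero, ← sub_mul]
    refine hsep _ fun c hc => ?_
    replace hc := mem_span_closure hc
    induction hc using Submodule.span_induction with
    | mem c hc =>
      rw [mul_add, mul_one, map_add]
      rcases hword c hc with ⟨h1, h2⟩ | ⟨h1, -⟩
      · rw [h1, map_sub, h2]; ring
      · rw [h1]; ring
    | zero => rfl
    | add c d _ _ hc hd => exact (congrArg₂ (· + ·) hc hd).trans (add_zero 0)
    | smul r c _ hc => exact (congrArg (r * ·) hc).trans (mul_zero r)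
  have h3 := congrArg π hz
  rw [map_mul, map_mul, map_add, map_one, hπ.map_g, ha, hb, mul_add, mul_add, mul_one, mul_one,
    ← two_smul k, ← two_smul k] at h3
  exact MonoidAlgebra.of_injective (R := k) (smul_right_injective _ h2 h3)

end IsLift

variable (ρ) in
/-- The lifts of the elements of `Γ` form a binary cover of `Γ`. -/
theorem exists_binaryCover [IsAlgClosed k] [NeZero (2 : k)] (hα : α * α = q) (hq : q * q = 1)
    (hc : QuantumSLRelations q ρ.coef)
    (hsep : ∀ x : H, (∀ c ∈ ρ.coefAlgebra, c x = 0) → x = 0)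
    (hg : ρ.ActsByNegOne g) (hπ : IsCentralExtension g π) :
    ∃ (Γ₀ : Subgroup (Matrix.SpecialLinearGroup (Fin 2) k)) (p₀ : Γ₀ →* Γ),
      IsBinaryCover Γ₀ p₀ ∧ ∀ M : Γ₀, ρ.IsLift α π (p₀ M) M := by
  have hone : ρ.IsLift α π (1 : Γ) 1 := by
    obtain ⟨M, hM⟩ := exists_isLift hα hq hc hg hπ (1 : Γ)
    -- the lift of `1` is `±1`, as its square is also a lift of `1`
    have hMM := hM.mul hα hq hg hπ hM
    rw [mul_one] at hMM
    rcases hMM.eq_or_eq_neg hα hq hπ hM with h | h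
    · rw [mul_eq_left] at h
      rwa [h] at hM
    · have h1 : M = -1 := by
        apply mul_left_cancel (a := M)
        rw [h, mul_neg, mul_one]
      have := hM.neg
      rwa [h1, neg_neg] at this
  have hinv : ∀ {x : Γ} {M}, ρ.IsLift α π x M → ρ.IsLift α π x⁻¹ M⁻¹ := by
    intro x M hM
    obtain ⟨N, hN⟩ := exists_isLift hα hq hc hg hπ x⁻¹
    have hMN := hM.mul hα hq hg hπ hN
    rw [mul_inv_cancel] at hMN
    rcases hMN.eq_or_eq_neg hα hq hπ hone with h | h
    · rwa [eq_inv_of_mul_eq_one_right h] at hN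
    · have h1 : M * -N = 1 := by rw [mul_neg, h, neg_neg]
      have := hN.neg
      rwa [eq_inv_of_mul_eq_one_right h1] at this
  let Γ₀ : Subgroup (Matrix.SpecialLinearGroup (Fin 2) k) :=
    { carrier := {M | ∃ x : Γ, ρ.IsLift α π x M}
      one_mem' := ⟨1, hone⟩
      mul_mem' := fun ⟨x, hx⟩ ⟨y, hy⟩ => ⟨x * y, hx.mul hα hq hg hπ hy⟩
      inv_mem' := fun ⟨x, hx⟩ => ⟨x⁻¹, hinv hx⟩ }
  choose p hp using fun M : Γ₀ => M.2
  let p₀ : Γ₀ →* Γ :=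
    { toFun := p
      map_one' := (hp 1).unique hg hπ hsep hone
      map_mul' := fun M N => (hp (M * N)).unique hg hπ hsep
        ((hp M).mul hα hq hg hπ (hp N)) }
  refine ⟨Γ₀, p₀, ⟨⟨1, hone.neg⟩, fun x => ?_, fun M => ?_⟩, hp⟩
  · obtain ⟨M, hM⟩ := exists_isLift hα hq hc hg hπ x
    exact ⟨⟨M, x, hM⟩, (hp ⟨M, x, hM⟩).unique hg hπ hsep hM⟩
  · constructor
    · intro h
      have h1 : ρ.IsLift α π (1 : Γ) M := by
        have := hp M
        rwa [show p M = 1 from h] at this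
      exact h1.eq_or_eq_neg hα hq hπ hone
    · intro h
      have h1 : ρ.IsLift α π (1 : Γ) M := by
        rcases h with h | h <;> rw [h]
        exacts [hone, hone.neg]
      exact (hp M).unique hg hπ hsep h1

end GradedHopfAction


/-! ### The action of `SL₂` on polynomials -/

section SubstAct

open MvPolynomial Matrix

variable {k : Type*} [Field k]

theorem substAct_X (M : SpecialLinearGroup (Fin 2) k) (j : Fin 2) :
    substAct M (X j) = ∑ i, C (SLTwo.mat M i j) * X i := by
  simp [substAct, SLTwo.mat_apply]

theorem substAct_mul (M N : SpecialLinearGroup (Fin 2) k) :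
    substAct (M * N) = (substAct M).comp (substAct N) := by
  refine MvPolynomial.algHom_ext fun j => ?_
  rw [AlgHom.comp_apply, substAct_X, substAct_X, map_sum]
  simp only [map_mul, Matrix.mul_apply, map_sum, Finset.sum_mul]
  rw [Finset.sum_comm]
  refine Finset.sum_congr rfl fun i _ => ?_
  rw [substAct_X, Finset.mul_sum]
  refine Finset.sum_congr rfl fun l _ => ?_
  have : substAct M (C (SLTwo.mat N i j)) = C (SLTwo.mat N i j) := AlgHom.commutes _ _
  rw [this]; ring

theorem substAct_one : substAct (1 : SpecialLinearGroup (Fin 2) k) = AlgHom.id k _ := by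
  refine MvPolynomial.algHom_ext fun j => ?_
  rw [substAct_X, map_one]
  simp [Matrix.one_apply]

theorem substAct_mem (M : SpecialLinearGroup (Fin 2) k) {n : ℕ} {f : MvPolynomial (Fin 2) k}
    (hf : f ∈ homogeneousSubmodule (Fin 2) k n) :
    substAct M f ∈ homogeneousSubmodule (Fin 2) k n := by
  have := IsHomogeneous.aeval (n := 1) hf (fun j => ∑ i, C (M i j) * X i) (fun j => by
    refine IsHomogeneous.sum _ _ _ fun i _ => ?_
    simpa using (isHomogeneous_C _ _).mul (isHomogeneous_X k i))
  rwa [one_mul] at this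

theorem substAct_mem_iff (M : SpecialLinearGroup (Fin 2) k) {n : ℕ} {f : MvPolynomial (Fin 2) k} :
    substAct M f ∈ homogeneousSubmodule (Fin 2) k n ↔ f ∈ homogeneousSubmodule (Fin 2) k n := by
  refine ⟨fun h => ?_, substAct_mem M⟩
  have := substAct_mem M⁻¹ h
  rwa [← AlgHom.comp_apply, ← substAct_mul, inv_mul_cancel, substAct_one] at this

theorem coeff_substAct_neg_one (f : MvPolynomial (Fin 2) k) (d : Fin 2 →₀ ℕ) :
    coeff d (substAct (-1 : SpecialLinearGroup (Fin 2) k) f) = (-1) ^ d.degree * coeff d f := by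
  have h : ∀ j : Fin 2, substAct (-1 : SpecialLinearGroup (Fin 2) k) (X j) = (-1 : k) • X j := by
    intro j
    rw [substAct_X, SLTwo.mat_neg, map_one]
    simp [Matrix.one_apply]
  have hm : ∀ (e : Fin 2 →₀ ℕ) (c : k), substAct (-1 : SpecialLinearGroup (Fin 2) k)
      (monomial e c) = (-1 : k) ^ e.degree • monomial e c := by
    intro e c
    have hC : substAct (-1 : SpecialLinearGroup (Fin 2) k) (C c) = C c := AlgHom.commutes _ _
    rw [monomial_eq, map_mul, hC, Finsupp.prod_fintype _ _ (fun _ => pow_zero _), Fin.prod_univ_two,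
      map_mul, map_pow, map_pow, h, h, smul_pow, smul_pow, smul_mul_smul_comm, ← pow_add,
      mul_smul_comm, Finsupp.degree_eq_sum, Fin.sum_univ_two]
  induction f using MvPolynomial.induction_on' with
  | monomial e c =>
    rw [hm, coeff_smul, smul_eq_mul, coeff_monomial]
    split_ifs with he
    · rw [he]
    · rw [mul_zero, mul_zero]
  | add f f' hf hf' => rw [map_add, coeff_add, coeff_add, hf, hf', mul_add]

theorem substAct_neg_one {n : ℕ} {f : MvPolynomial (Fin 2) k}
    (hf : f ∈ homogeneousSubmodule (Fin 2) k n) :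
    substAct (-1 : SpecialLinearGroup (Fin 2) k) f = (-1 : k) ^ n • f := by
  ext d
  rw [coeff_substAct_neg_one, coeff_smul, smul_eq_mul]
  by_cases hd : coeff d f = 0
  · rw [hd, mul_zero, mul_zero]
  · have h : d.degree = n := by
      rw [← hf hd, Finsupp.degree_eq_weight_one]
      rfl
    rw [h]

theorem substAct_mem_polyVeronese (M : SpecialLinearGroup (Fin 2) k) {f : MvPolynomial (Fin 2) k}
    (hf : f ∈ polyVeronese k) : substAct M f ∈ polyVeronese k := by
  have hle : (⨆ n : ℕ, homogeneousSubmodule (Fin 2) k (n * 2)) ≤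
      (⨆ n : ℕ, homogeneousSubmodule (Fin 2) k (n * 2)).comap (substAct M).toLinearMap :=
    iSup_le fun n f hf => Submodule.mem_iSup_of_mem n (substAct_mem M hf)
  exact hle hf

theorem substAct_neg_one_of_mem {f : MvPolynomial (Fin 2) k} (hf : f ∈ polyVeronese k) :
    substAct (-1 : SpecialLinearGroup (Fin 2) k) f = f := by
  have hle : (⨆ n : ℕ, homogeneousSubmodule (Fin 2) k (n * 2)) ≤
      LinearMap.eqLocus (substAct (-1)).toLinearMap LinearMap.id :=
    iSup_le fun n f hf => by
      rw [LinearMap.mem_eqLocus]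
      exact (substAct_neg_one hf).trans (by rw [mul_comm, pow_mul]; simp)
  exact hle hf

/-- A polynomial fixed by `-1` is even. -/
theorem mem_polyVeronese_of_substAct_neg_one [NeZero (2 : k)] {f : MvPolynomial (Fin 2) k}
    (hf : substAct (-1 : SpecialLinearGroup (Fin 2) k) f = f) : f ∈ polyVeronese k := by
  have h2 : (2 : k) ≠ 0 := NeZero.ne 2
  rw [← sum_homogeneousComponent f]
  refine Subalgebra.sum_mem _ fun n _ => ?_
  rcases Nat.even_or_odd' n with ⟨m, rfl | rfl⟩
  · exact Submodule.mem_iSup_of_mem (p := fun n : ℕ => homogeneousSubmodule (Fin 2) k (n * 2)) m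
      (by rw [mul_comm]; exact homogeneousComponent_mem _ _)
  · convert Subalgebra.zero_mem (polyVeronese k)
    ext d
    rw [coeff_homogeneousComponent, coeff_zero, ite_eq_right_iff]
    intro hd
    have h := congrArg (coeff d) hf
    rw [coeff_substAct_neg_one, hd, pow_succ, pow_mul] at h
    have h3 : 2 * coeff d f = 0 := by linear_combination -h
    exact (mul_eq_zero.1 h3).resolve_left h2

/-- The substitution action on the second Veronese ring. -/
noncomputable def substVeronese :
    SpecialLinearGroup (Fin 2) k →* (polyVeronese k ≃ₐ[k] polyVeronese k) :=
  let F : SpecialLinearGroup (Fin 2) k → (polyVeronese k →ₐ[k] polyVeronese k) := fun M =>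
    ((substAct M).comp (polyVeronese k).val).codRestrict (polyVeronese k)
      fun f => substAct_mem_polyVeronese M f.2
  have hF : ∀ M N f, F (M * N) f = F M (F N f) := fun M N f => Subtype.ext (by
    show substAct (M * N) _ = substAct M (substAct N _)
    rw [substAct_mul]; rfl)
  have hF1 : ∀ f, F 1 f = f := fun f => Subtype.ext (by
    show substAct 1 _ = _
    rw [substAct_one]; rfl)
  { toFun := fun M => AlgEquiv.ofAlgHom (F M) (F M⁻¹)
      (AlgHom.ext fun f => by
        rw [AlgHom.comp_apply, ← hF, mul_inv_cancel, hF1]; rfl)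
      (AlgHom.ext fun f => by
        rw [AlgHom.comp_apply, ← hF, inv_mul_cancel, hF1]; rfl)
    map_one' := AlgEquiv.ext hF1
    map_mul' := fun M N => AlgEquiv.ext (hF M N) }

theorem substVeronese_neg (M : SpecialLinearGroup (Fin 2) k) :
    substVeronese (-M) = substVeronese M := by
  have h : substVeronese (-1 : SpecialLinearGroup (Fin 2) k) = 1 :=
    AlgEquiv.ext fun f => Subtype.ext (substAct_neg_one_of_mem f.2)
  rw [← mul_neg_one M, map_mul, h, mul_one]

end SubstAct

namespace SkewPlane

variable {k : Type*} [Field k] {q : k}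

/-- The second Veronese ring is generated by the products of two generators. -/
theorem veronese_algHom_ext {B : Type*} [Ring B] [Algebra k B]
    {f f' : veronese (grading k q) 2 →ₐ[k] B}
    (h : ∀ i j, f ⟨gen k q i * gen k q j, gen_mul_gen_mem i j⟩ =
      f' ⟨gen k q i * gen k q j, gen_mul_gen_mem i j⟩) : f = f' := by
  let E : Subalgebra k (SkewPlane k q) := (AlgHom.equalizer f f').map (veronese (grading k q) 2).val
  have h2 : Submodule.span k (Set.range (gen k q)) ^ 2 ≤ Subalgebra.toSubmodule E := by
    rw [pow_two, Submodule.span_mul_span, Submodule.span_le]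
    rintro _ ⟨_, ⟨i, rfl⟩, _, ⟨j, rfl⟩, rfl⟩
    exact ⟨⟨_, gen_mul_gen_mem i j⟩, h i j, rfl⟩
  have hn : ∀ n : ℕ, grading k q (n * 2) ≤ Subalgebra.toSubmodule E := by
    intro n
    rw [grading, mul_comm, pow_mul]
    induction n with
    | zero => rw [pow_zero, Submodule.one_le]; exact E.one_mem
    | succ n ih =>
      rw [pow_succ]
      exact Submodule.mul_le.2 fun x hx y hy => E.mul_mem (ih hx) (h2 hy)
  refine AlgHom.ext fun a => ?_
  have ha : (a : SkewPlane k q) ∈ (⨆ n : ℕ, grading k q (n * 2)) := a.2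
  obtain ⟨b, hb, hba⟩ := iSup_le hn ha
  have : b = a := Subtype.ext hba
  rw [← this]
  exact hb

end SkewPlane


/-! ### Invariants of a central extension of a group algebra -/

namespace GradedHopfAction

open SkewPlane

variable {k H : Type*} [Field k] [Ring H] [HopfAlgebra k H] {q : k}
  {ρ : GradedHopfAction k H (SkewPlane.grading k q)} {Γ : Type*} [Group Γ] {g : H}
  {π : H →ₐc[k] MonoidAlgebra k Γ}

theorem act_mul_of_isGroupLike (hgl : IsGroupLikeElem k g) (a b : SkewPlane k q) :
    ρ.act g (a * b) = ρ.act g a * ρ.act g b := by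
  let s : Coalgebra.Repr k g Unit :=
    { index := Finset.univ, left := fun _ => g, right := fun _ => g,
      eq := by simp [hgl.comul_eq_tmul_self] }
  rw [ρ.act_mul, tensorRep_apply _ _ s]
  simp [s]

theorem ActsByNegOne.act_gen (hg : ρ.ActsByNegOne g) (i : Fin 2) :
    ρ.act g (gen k q i) = - gen k q i := by
  rw [GradedHopfAction.act_gen]
  simp [hg _ _]

theorem ActsByNegOne.act_of_mem_grading (hg : ρ.ActsByNegOne g) (hgl : IsGroupLikeElem k g)
    (n : ℕ) {a : SkewPlane k q} (ha : a ∈ grading k q n) : ρ.act g a = (-1 : k) ^ n • a := by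
  induction n generalizing a with
  | zero =>
    rw [grading, pow_zero] at ha
    obtain ⟨r, rfl⟩ := Submodule.mem_one.1 ha
    rw [Algebra.algebraMap_eq_smul_one, map_smul, ρ.act_one, hgl.counit_eq_one, map_one, pow_zero,
      one_smul]
  | succ n ih =>
    have hle := grading_succ_le (n := n)
      (N := LinearMap.eqLocus (ρ.act g) ((-1 : k) ^ (n + 1) • LinearMap.id)) (q := q)
      (fun i b hb => by
        rw [LinearMap.mem_eqLocus, act_mul_of_isGroupLike hgl, ih hb, hg.act_gen]
        simp [pow_succ])
    exact hle ha

theorem ActsByNegOne.act_of_mem_veronese (hg : ρ.ActsByNegOne g) (hgl : IsGroupLikeElem k g)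
    {a : SkewPlane k q} (ha : a ∈ veronese (grading k q) 2) : ρ.act g a = a := by
  have hle : (⨆ n : ℕ, grading k q (n * 2)) ≤ LinearMap.eqLocus (ρ.act g) LinearMap.id :=
    iSup_le fun n f hf => by
      rw [LinearMap.mem_eqLocus]
      exact (hg.act_of_mem_grading hgl _ hf).trans (by rw [mul_comm, pow_mul]; simp)
  exact hle ha

theorem ActsByNegOne.mem_veronese_of_act [NeZero (2 : k)] (hg : ρ.ActsByNegOne g)
    (hgl : IsGroupLikeElem k g) {a : SkewPlane k q} (ha : ρ.act g a = a) :
    a ∈ veronese (grading k q) 2 := by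
  have h2 : (2 : k) ≠ 0 := NeZero.ne 2
  obtain ⟨b, hb, c, hc, rfl⟩ := exists_even_add_odd a
  have hle : (⨆ n : ℕ, grading k q (n * 2 + 1)) ≤ LinearMap.eqLocus (ρ.act g) (-LinearMap.id) :=
    iSup_le fun n f hf => by
      rw [LinearMap.mem_eqLocus]
      exact (hg.act_of_mem_grading hgl _ hf).trans (by rw [pow_succ, mul_comm n, pow_mul]; simp)
  have hc' : ρ.act g c = -c := hle hc
  rw [map_add, hg.act_of_mem_veronese hgl hb, hc', add_right_inj] at ha
  have h3 : (2 : k) • c = 0 := by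
    rw [two_smul]
    nth_rw 1 [← ha]
    exact neg_add_cancel c
  rw [(smul_eq_zero.1 h3).resolve_left h2, add_zero]
  exact hb

theorem act_mem_veronese (h : H) {a : SkewPlane k q} (ha : a ∈ veronese (grading k q) 2) :
    ρ.act h a ∈ veronese (grading k q) 2 := by
  have hle : (⨆ n : ℕ, grading k q (n * 2)) ≤
      (⨆ n : ℕ, grading k q (n * 2)).comap (ρ.act h) :=
    iSup_le fun n f hf => Submodule.mem_iSup_of_mem n (ρ.act_mem h _ f hf)
  exact hle ha

/-- The action on an even element, as a linear map in the element of `H`. -/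
noncomputable def actOn (ρ : GradedHopfAction k H (SkewPlane.grading k q)) (a : SkewPlane k q) :
    WithConv (H →ₗ[k] SkewPlane k q) :=
  WithConv.toConv (LinearMap.applyₗ a ∘ₗ ρ.act.toLinearMap)

theorem actOn_apply (a : SkewPlane k q) (h : H) : ρ.actOn a h = ρ.act h a := rfl

theorem actOn_mul (a b : SkewPlane k q) : ρ.actOn (a * b) = ρ.actOn a * ρ.actOn b := by
  ext h
  show ρ.act h (a * b) = _
  rw [ρ.act_mul, tensorRep_apply _ _ (Coalgebra.Repr.arbitrary k h), map_sum]
  rw [Coalgebra.Repr.convMul_apply (Coalgebra.Repr.arbitrary k h)]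
  rfl

theorem ActsByNegOne.actOn_mul_g (hg : ρ.ActsByNegOne g) (hgl : IsGroupLikeElem k g)
    {a : SkewPlane k q} (ha : a ∈ veronese (grading k q) 2) (h : H) :
    ρ.actOn a (h * g) = ρ.actOn a h := by
  rw [actOn_apply, map_mul, Module.End.mul_apply, hg.act_of_mem_veronese hgl ha, actOn_apply]

/-- The action of an element of `H` over a group element on the second Veronese ring is an algebra
homomorphism. -/
noncomputable def actVeronese (hg : ρ.ActsByNegOne g) (hπ : IsCentralExtension g π) {x : Γ} {h : H}
    (hx : π h = MonoidAlgebra.single x 1) :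
    veronese (grading k q) 2 →ₐ[k] veronese (grading k q) 2 :=
  AlgHom.ofLinearMap
    ((ρ.act h).restrict (p := Subalgebra.toSubmodule (veronese (grading k q) 2))
      (q := Subalgebra.toSubmodule (veronese (grading k q) 2)) fun _ ha => act_mem_veronese h ha)
    (Subtype.ext (by
      show ρ.act h 1 = 1
      rw [ρ.act_one, ← CoalgHomClass.counit_comp_apply π h, hx]
      simp))
    (fun a b => Subtype.ext (by
      show ρ.act h (a * b) = ρ.act h a * ρ.act h b
      have := hπ.conv_apply (hg.actOn_mul_g hπ.1 a.2) (hg.actOn_mul_g hπ.1 b.2) hx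
      rwa [← actOn_mul] at this))

theorem coe_actVeronese (hg : ρ.ActsByNegOne g) (hπ : IsCentralExtension g π) {x : Γ} {h : H}
    (hx : π h = MonoidAlgebra.single x 1) (a : veronese (grading k q) 2) :
    (actVeronese hg hπ hx a : SkewPlane k q) = ρ.act h a := rfl

/-- On the second Veronese ring a group element acts as the substitution by any of its lifts. -/
theorem IsLift.veroneseEquiv_act {α : k} (hα : α * α = q) (hq : q * q = 1)
    (hg : ρ.ActsByNegOne g) (hπ : IsCentralExtension g π)
    {x : Γ} {M : Matrix.SpecialLinearGroup (Fin 2) k} (hM : ρ.IsLift α π x M) {h : H}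
    (hx : π h = MonoidAlgebra.single x 1) (a : veronese (grading k q) 2) :
    veroneseEquiv hα hq (actVeronese hg hπ hx a) = substVeronese M (veroneseEquiv hα hq a) := by
  have h0 := ne_zero_of_sq hα hq
  have hαi : ∀ n : ℕ, α ^ n * α⁻¹ ^ n = 1 := fun n => by
    rw [← mul_pow, mul_inv_cancel₀ h0, one_pow]
  have key : ((veroneseEquiv hα hq).toAlgHom.comp (actVeronese hg hπ hx)) =
      ((substVeronese M).toAlgHom.comp (veroneseEquiv hα hq).toAlgHom) := by
    refine veronese_algHom_ext fun i j => Subtype.ext ?_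
    show polyEquiv hα hq (ρ.act h (gen k q i * gen k q j)) =
      substAct M (polyEquiv hα hq (gen k q i * gen k q j))
    rw [act_gen_mul_gen, polyEquiv_gen_mul_gen, map_mul (substAct M), map_mul (substAct M),
      substAct_X, substAct_X]
    have hC : ∀ c, substAct M (MvPolynomial.C c) = MvPolynomial.C c := fun c => AlgHom.commutes _ c
    rw [hC, map_sum, Finset.sum_mul_sum, Finset.mul_sum]
    refine Finset.sum_congr rfl fun s _ => ?_
    rw [map_sum, Finset.mul_sum]
    refine Finset.sum_congr rfl fun t _ => ?_
    rw [map_smul, hM h hx, polyEquiv_gen_mul_gen, MvPolynomial.smul_eq_C_mul, ← mul_assoc,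
      ← map_mul]
    have e : (twist α s i)⁻¹ * twist α t j * (SLTwo.mat M s i * SLTwo.mat M t j) *
        (α ^ (s : ℕ) * α⁻¹ ^ (t : ℕ)) =
        α ^ (i : ℕ) * α⁻¹ ^ (j : ℕ) * SLTwo.mat M s i * SLTwo.mat M t j := by
      have h1 : (twist α s i)⁻¹ * α ^ (s : ℕ) = α ^ (i : ℕ) := by
        rw [inv_mul_eq_iff_eq_mul₀ (twist_ne_zero hα hq _ _), twist, mul_assoc,
          mul_comm (α⁻¹ ^ _), hαi, mul_one]
      have h2 : twist α t j * α⁻¹ ^ (t : ℕ) = α⁻¹ ^ (j : ℕ) := by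
        rw [twist, mul_right_comm, hαi, one_mul]
      linear_combination (SLTwo.mat M s i * SLTwo.mat M t j) * (twist α t j * α⁻¹ ^ (t : ℕ)) * h1 +
        (SLTwo.mat M s i * SLTwo.mat M t j) * α ^ (i : ℕ) * h2
    rw [e]
    simp only [map_mul]
    ring
  exact AlgHom.congr_fun key a

/-- Transport along an isomorphism of groups. -/
theorem _root_.IsCentralExtension.mapDomain {Γ' : Type*} [Group Γ'] (hπ : IsCentralExtension g π)
    (θ : Γ ≃* Γ') :
    IsCentralExtension g ((MonoidAlgebra.mapDomainBialgHom k θ.toMonoidHom).comp π) := by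
  have hinj : Function.Injective (MonoidAlgebra.mapDomainBialgHom k θ.toMonoidHom) :=
    MonoidAlgebra.mapDomain_injective θ.injective
  have hsurj : Function.Surjective (MonoidAlgebra.mapDomainBialgHom k θ.toMonoidHom) := fun y => by
    refine ⟨MonoidAlgebra.mapDomainBialgHom k θ.symm.toMonoidHom y, ?_⟩
    rw [MonoidAlgebra.mapDomainBialgHom_mapDomainBialgHom]
    have : θ.toMonoidHom.comp θ.symm.toMonoidHom = MonoidHom.id Γ' := MonoidHom.ext fun x => by simp
    rw [this, MonoidAlgebra.mapDomainBialgHom_id]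
    rfl
  refine ⟨hπ.1, hπ.2.1, hπ.2.2.1, hπ.2.2.2.1, hsurj.comp hπ.2.2.2.2.1, fun x => ?_⟩
  rw [← hπ.2.2.2.2.2 x]
  exact map_eq_zero_iff _ hinj

/-- A linear map invariant under translation by `g` is determined by its values over the group
elements. -/
theorem _root_.IsCentralExtension.apply_eq_sum (hπ : IsCentralExtension g π) {V : Type*}
    [AddCommGroup V] [Module k V] {F : H →ₗ[k] V} (hF : ∀ h, F (h * g) = F h) {σ : Γ → H}
    (hσ : ∀ x, π (σ x) = MonoidAlgebra.single x 1) (h : H) :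
    F h = (π h).coeff.sum fun x c => c • F (σ x) := by
  have e : π h = π ((π h).coeff.sum fun x c => c • σ x) := by
    rw [Finsupp.sum, map_sum]
    simp only [map_smul, hσ, MonoidAlgebra.smul_single, smul_eq_mul, mul_one]
    exact (MonoidAlgebra.sum_coeff_single (π h)).symm
  rw [hπ.apply_eq hF e, Finsupp.sum, map_sum]
  simp only [map_smul]
  rfl

/-- A central extension `H → k Γ` by a grouplike that acts on `A₁` by `-1`, for a polyhedral group
`Γ` whose binary covers are all conjugate, makes `A^H` the Kleinian singularity of `Γ`. -/
theorem isKleinianAction [IsAlgClosed k] [NeZero (2 : k)] {α : k} (hα : α * α = q)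
    (hq : q * q = 1) (hc : QuantumSLRelations q ρ.coef)
    (hsep : ∀ x : H, (∀ c ∈ ρ.coefAlgebra, c x = 0) → x = 0)
    (hg : ρ.ActsByNegOne g) (hπ : IsCentralExtension g π) (hΓ : HasUniqueBinaryCover k Γ) :
    IsKleinianAction ρ Γ := by
  obtain ⟨Γ₀, p₀, h₀, hlift⟩ := ρ.exists_binaryCover hα hq hc hsep hg hπ
  refine ⟨⟨Γ₀, p₀, h₀⟩, fun Γt p hp => ?_⟩
  obtain ⟨θ, s, hs⟩ := hΓ Γ₀ p₀ Γt p h₀ hp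
  -- `β` is the action of `Γ` on even polynomials, through any preimages in `Γt`
  choose N hN using hp.2.1
  have hβ : ∀ M M' : Γt, p M = p M' → substVeronese (k := k) M = substVeronese (M' : _) := by
    intro M M' h
    rcases hp.eq_or_eq_neg h with h | h
    · rw [h]
    · rw [h]
      exact substVeronese_neg _
  let β : Γ →* (polyVeronese k ≃ₐ[k] polyVeronese k) :=
    { toFun := fun x => substVeronese (N x : Matrix.SpecialLinearGroup (Fin 2) k)
      map_one' := by
        rw [hβ (N 1) 1 (by rw [hN, map_one])]
        exact map_one substVeronese
      map_mul' := fun x y => by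
        rw [hβ (N (x * y)) (N x * N y) (by rw [map_mul, hN, hN, hN])]
        exact map_mul substVeronese _ _ }
  let φ : veronese (grading k q) 2 ≃ₐ[k] polyVeronese k :=
    (veroneseEquiv hα hq).trans (substVeronese s)
  let γ : Γ →* (veronese (grading k q) 2 ≃ₐ[k] veronese (grading k q) 2) :=
    { toFun := fun x => (φ.trans (β x)).trans φ.symm
      map_one' := by
        refine AlgEquiv.ext fun a => ?_
        simp
      map_mul' := fun x y => by
        refine AlgEquiv.ext fun a => ?_
        simp }
  have hφγ : ∀ x a, φ (γ x a) = β x (φ a) := fun x a => φ.apply_symm_apply _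
  -- the action of `H` over a group element
  have hact : ∀ (x : Γ) (h : H), π h = MonoidAlgebra.single x 1 →
      ∀ a : veronese (grading k q) 2, ρ.act h a = (γ (θ x) a : SkewPlane k q) := by
    intro x h hx a
    obtain ⟨M, rfl⟩ := h₀.2.1 x
    obtain ⟨M', hM', hpM'⟩ := hs M
    rw [← coe_actVeronese hg hπ hx]
    refine congrArg Subtype.val (φ.injective ?_)
    rw [hφγ]
    show substVeronese s (veroneseEquiv hα hq _) = substVeronese (N _ : _) (substVeronese s _)
    rw [(hlift M).veroneseEquiv_act hα hq hg hπ hx, hβ (N (θ (p₀ M))) M' (by rw [hN, hpM']), hM']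
    rw [map_mul, map_mul]
    simp only [AlgEquiv.mul_apply]
    rw [← AlgEquiv.mul_apply (substVeronese s⁻¹), ← map_mul, inv_mul_cancel, map_one]
    rfl
  have hgr : GradedAlgIso (grading k q) (MvPolynomial.homogeneousSubmodule (Fin 2) k) φ := by
    intro n a
    show (a : SkewPlane k q) ∈ _ ↔ substAct s (polyEquiv hα hq a) ∈ _
    rw [substAct_mem_iff, mem_grading_iff hα hq]
  -- sections of `π` give the action of a general element
  choose σ hσ using hπ.exists_section
  have hsum : ∀ (h : H) (a : veronese (grading k q) 2),
      ρ.act h a = (π h).coeff.sum fun x c => c • (γ (θ x) a : SkewPlane k q) := by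
    intro h a
    refine (hπ.apply_eq_sum (hg.actOn_mul_g hπ.1 a.2) hσ h).trans ?_
    exact Finset.sum_congr rfl fun x _ => congrArg _ (hact x _ (hσ x) a)
  refine ⟨⟨g, (MonoidAlgebra.mapDomainBialgHom k θ.toMonoidHom).comp π, hπ.mapDomain θ,
    γ, β, φ, fun h a => ?_, fun M f => ?_, hgr, hφγ⟩, ?_⟩
  · rw [hsum]
    exact (Finsupp.sum_mapDomain_index (f := θ) (s := (π h).coeff)
      (h := fun x c => c • (γ x a : SkewPlane k q)) (fun _ => zero_smul _ _)
      (fun _ _ _ => add_smul _ _ _)).symm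
  · show (substVeronese (N (p M) : _) f : MvPolynomial (Fin 2) k) = _
    rw [hβ (N (p M)) M (hN _)]
    rfl
  · -- both invariant rings are even, and correspond under `φ`
    have hβp : ∀ (M : Γt) (f : polyVeronese k),
        (β (p M) f : MvPolynomial (Fin 2) k) = substAct (M : _) f := fun M f => by
      show (substVeronese (N (p M) : _) f : MvPolynomial (Fin 2) k) = _
      rw [hβ (N (p M)) M (hN _)]
      rfl
    have hfix : ∀ a : veronese (grading k q) 2,
        (a : SkewPlane k q) ∈ ρ.fixedSubring ↔
          (φ a : MvPolynomial (Fin 2) k) ∈ polyInvariants Γt := by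
      intro a
      constructor
      · intro ha M hM
        obtain ⟨x, hx⟩ := θ.surjective (p ⟨M, hM⟩)
        have h1 : γ (θ x) a = a := Subtype.ext (by
          rw [← hact x _ (hσ x) a, ha (σ x), ← CoalgHomClass.counit_comp_apply π, hσ]
          simp)
        rw [← hβp ⟨M, hM⟩, ← hx, ← hφγ, h1]
      · intro ha
        let F : H →ₗ[k] SkewPlane k q := (ρ.actOn a).ofConv -
          (Coalgebra.counit (R := k) (A := H)).smulRight (a : SkewPlane k q)
        have hF : ∀ h, F (h * g) = F h := fun h => by
          show ρ.actOn a (h * g) - Coalgebra.counit (R := k) (h * g) • (a : SkewPlane k q) =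
            ρ.actOn a h - Coalgebra.counit (R := k) h • (a : SkewPlane k q)
          rw [hg.actOn_mul_g hπ.1 a.2, Bialgebra.counit_mul, hπ.1.counit_eq_one, mul_one]
        have hF0 : ∀ x, F (σ x) = 0 := fun x => by
          have h1 : γ (θ x) a = a := φ.injective (by
            rw [hφγ]
            obtain ⟨M, hM⟩ := hp.2.1 (θ x)
            refine Subtype.ext ?_
            rw [← hM, hβp]
            exact ha M M.2)
          show ρ.act (σ x) a - Coalgebra.counit (R := k) (σ x) • (a : SkewPlane k q) = 0
          rw [hact x _ (hσ x) a, h1, ← CoalgHomClass.counit_comp_apply π, hσ]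
          simp
        intro h
        have h1 := hπ.apply_eq_sum hF hσ h
        simp only [hF0, smul_zero, Finsupp.sum, Finset.sum_const_zero] at h1
        exact sub_eq_zero.1 h1
    have hmem : ∀ a : ρ.fixedSubring, (a : SkewPlane k q) ∈ veronese (grading k q) 2 := fun a =>
      hg.mem_veronese_of_act hπ.1 ((a.2 g).trans (by rw [hπ.1.counit_eq_one, one_smul]))
    let ι : ρ.fixedSubring →ₐ[k] veronese (grading k q) 2 :=
      (ρ.fixedSubring.val).codRestrict _ hmem
    let F : ρ.fixedSubring →ₐ[k] polyInvariants Γt :=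
      ((polyVeronese k).val.comp (φ.toAlgHom.comp ι)).codRestrict _
        fun a => (hfix (ι a)).1 a.2
    have hF : Function.Bijective F := by
      constructor
      · intro a b hab
        have h0 := congrArg Subtype.val hab
        have h1 : φ (ι a) = φ (ι b) := Subtype.ext h0
        have h2 := congrArg Subtype.val (φ.injective h1)
        exact Subtype.ext h2
      · intro f
        have hf : (f : MvPolynomial (Fin 2) k) ∈ polyVeronese k :=
          mem_polyVeronese_of_substAct_neg_one (f.2 _ hp.1)
        have h1 : ((φ.symm ⟨f, hf⟩ : veronese (grading k q) 2) : SkewPlane k q) ∈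
            ρ.fixedSubring := (hfix _).2 (by rw [φ.apply_symm_apply]; exact f.2)
        refine ⟨⟨_, h1⟩, Subtype.ext ?_⟩
        show (φ (φ.symm ⟨f, hf⟩) : MvPolynomial (Fin 2) k) = f
        rw [φ.apply_symm_apply]
    exact ⟨AlgEquiv.ofBijective F hF, fun n a => hgr n (ι a)⟩

end GradedHopfAction


/-! ### The Hopf algebra `B(D̃₂ₙ)` -/

namespace DihedralGroup

/-- The reduction `D₂ₘₙ → D₂ₙ` of dihedral groups. -/
def reduce (m n : ℕ) (h : n ∣ m) : DihedralGroup m →* DihedralGroup n where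
  toFun
    | .r i => .r (ZMod.castHom h _ i)
    | .sr i => .sr (ZMod.castHom h _ i)
  map_one' := congrArg DihedralGroup.r (map_zero _)
  map_mul' := by
    rintro (i | i) (j | j) <;> simp [-ZMod.castHom_apply]

end DihedralGroup

namespace BDihedral

variable (k : Type*) [Field k] (n : ℕ)

theorem of_injective : Function.Injective (of k n) := MonoidAlgebra.of_injective

theorem a_mem_center : a k n ∈ Subring.center (BDihedral k n) := by
  rw [Subring.mem_center_iff]
  have h : LinearMap.mulRight k (a k n) = LinearMap.mulLeft k (a k n) :=
    linearMap_ext k n fun x => by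
      rw [LinearMap.mulRight_apply, LinearMap.mulLeft_apply, a_comm]
  exact fun x => LinearMap.congr_fun h x

theorem a_ne_one [NeZero n] : a k n ≠ 1 := by
  intro h
  have h1 := of_injective k n (h.trans (map_one (of k n)).symm)
  rw [DihedralGroup.one_def, DihedralGroup.r.injEq, ZMod.natCast_eq_zero_iff] at h1
  have := Nat.le_of_dvd (Nat.pos_of_ne_zero (NeZero.ne n)) h1
  have := NeZero.pos n
  omega

/-- The group homomorphism `D₄ₙ → D₂ₙ` that sends `a` to `1`. -/
def reduce : DihedralGroup (2 * n) →* DihedralGroup n :=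
  DihedralGroup.reduce (2 * n) n ⟨2, mul_comm _ _⟩

theorem reduce_eq_one_iff (x : DihedralGroup (2 * n)) :
    reduce n x = 1 ↔ x = 1 ∨ x = .r (n : ZMod (2 * n)) := by
  rcases x with i | i
  · show DihedralGroup.r (ZMod.castHom _ _ i) = DihedralGroup.r 0 ↔
      DihedralGroup.r i = DihedralGroup.r 0 ∨ _
    rw [DihedralGroup.r.injEq, DihedralGroup.r.injEq, DihedralGroup.r.injEq]
    obtain ⟨j, rfl⟩ := ZMod.intCast_surjective i
    rw [map_intCast, ZMod.intCast_zmod_eq_zero_iff_dvd, ZMod.intCast_zmod_eq_zero_iff_dvd,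
      ← Int.cast_natCast (R := ZMod (2 * n)) n, ZMod.intCast_eq_intCast_iff_dvd_sub]
    push_cast
    constructor
    · rintro ⟨c, rfl⟩
      rcases Int.even_or_odd' c with ⟨d, rfl | rfl⟩
      · exact Or.inl ⟨d, by ring⟩
      · exact Or.inr ⟨-d, by ring⟩
    · rintro (⟨d, rfl⟩ | ⟨d, h⟩)
      · exact ⟨2 * d, by ring⟩
      · exact ⟨1 - 2 * d, by linear_combination -h⟩
  · constructor
    · intro h
      exact absurd h (by rintro ⟨⟩)
    · rintro (h | h) <;> exact absurd h (by rintro ⟨⟩)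

variable [CharZero k]

theorem isGroupLikeElem_a : IsGroupLikeElem k (a k n) where
  counit_eq_one := counitAlg_of k n _
  comul_eq_tmul_self := comulAlg_a k n

theorem lift_e₀_e₁ : lift k n ((MonoidAlgebra.of k _).comp (reduce n)) (e₀ k n) = 1 ∧
    lift k n ((MonoidAlgebra.of k _).comp (reduce n)) (e₁ k n) = 0 := by
  have ha : lift k n ((MonoidAlgebra.of k _).comp (reduce n)) (a k n) = 1 := by
    rw [a, lift_of, MonoidHom.comp_apply, (reduce_eq_one_iff n _).2 (Or.inr rfl), map_one]
  have h2 : (2⁻¹ : k) • ((1 : MonoidAlgebra k (DihedralGroup n)) + 1) = 1 := by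
    rw [← two_smul k, smul_smul, inv_mul_cancel₀ two_ne_zero, one_smul]
  rw [e₀, e₁, map_smul, map_smul, map_add, map_sub, map_one, ha, sub_self, smul_zero]
  exact ⟨h2, rfl⟩

/-- The Hopf algebra map `B(D̃₂ₙ) → k D₂ₙ`. -/
noncomputable def toGroupAlgebra : BDihedral k n →ₐc[k] MonoidAlgebra k (DihedralGroup n) :=
  BialgHom.ofAlgHom (lift k n ((MonoidAlgebra.of k _).comp (reduce n)))
    (AlgHom.toLinearMap_injective (linearMap_ext k n fun x => by
      show Coalgebra.counit (R := k)
        (lift k n ((MonoidAlgebra.of k (DihedralGroup n)).comp (reduce n)) (of k n x)) =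
          counitAlg k n (of k n x)
      rw [lift_of, counitAlg_of]
      simp))
    (AlgHom.toLinearMap_injective (linearMap_ext k n fun x => by
      show Algebra.TensorProduct.map (lift k n ((MonoidAlgebra.of k _).comp (reduce n)))
        (lift k n ((MonoidAlgebra.of k _).comp (reduce n))) (comulAlg k n (of k n x)) =
        Coalgebra.comul (R := k) (lift k n ((MonoidAlgebra.of k _).comp (reduce n)) (of k n x))
      rw [comulAlg_of, lift_of, map_add, Algebra.TensorProduct.map_tmul,
        Algebra.TensorProduct.map_tmul, map_mul, map_mul, (lift_e₀_e₁ k n).1, (lift_e₀_e₁ k n).2,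
        lift_of, one_mul, zero_mul, TensorProduct.tmul_zero, add_zero]
      simp))

theorem toGroupAlgebra_of (x : DihedralGroup (2 * n)) :
    toGroupAlgebra k n (of k n x) = MonoidAlgebra.of k _ (reduce n x) :=
  lift_of k n ((MonoidAlgebra.of k _).comp (reduce n)) x

theorem reduce_surjective : Function.Surjective (reduce n) := by
  have h := ZMod.castHom_surjective (m := n) (n := 2 * n) ⟨2, mul_comm _ _⟩
  rintro (i | i)
  · obtain ⟨j, rfl⟩ := h i
    exact ⟨.r j, rfl⟩
  · obtain ⟨j, rfl⟩ := h i
    exact ⟨.sr j, rfl⟩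

theorem isCentralExtension [NeZero n] : IsCentralExtension (a k n) (toGroupAlgebra k n) := by
  have ha : toGroupAlgebra k n (a k n) = 1 := by
    rw [a, toGroupAlgebra_of, (reduce_eq_one_iff n _).2 (Or.inr rfl), map_one]
  choose s hs using reduce_surjective n
  let T : MonoidAlgebra k (DihedralGroup n) →ₗ[k] BDihedral k n :=
    Finsupp.linearCombination k (fun y => of k n (s y)) ∘ₗ
      (MonoidAlgebra.coeffLinearEquiv k).toLinearMap
  have hT : ∀ y, T (MonoidAlgebra.of k _ y) = of k n (s y) := fun y => by
    refine (Finsupp.linearCombination_single k (1 : k) y).trans ?_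
    exact one_smul _ _
  refine ⟨isGroupLikeElem_a k n, a_mem_center k n, a_ne_one k n, a_sq k n, fun y => ?_, fun x => ?_⟩
  · refine ⟨T y, ?_⟩
    have h : (toGroupAlgebra k n).toCoalgHom.toLinearMap ∘ₗ T = LinearMap.id := by
      refine MonoidAlgebra.lhom_ext' fun y => LinearMap.ext_ring ?_
      show toGroupAlgebra k n (T (MonoidAlgebra.of k _ y)) = MonoidAlgebra.of k _ y
      rw [hT, toGroupAlgebra_of, hs]
    exact LinearMap.congr_fun h y
  · constructor
    · intro hx
      -- modulo `H (a - 1)` every element is congruent to the image under the section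
      let I : Submodule k (BDihedral k n) := LinearMap.range (LinearMap.mulRight k (a k n - 1))
      have h : I.mkQ = I.mkQ ∘ₗ T ∘ₗ (toGroupAlgebra k n).toCoalgHom.toLinearMap := by
        refine linearMap_ext k n fun x => ?_
        show I.mkQ (of k n x) = I.mkQ (T (toGroupAlgebra k n (of k n x)))
        rw [toGroupAlgebra_of, hT]
        have h1 : reduce n (x⁻¹ * s (reduce n x)) = 1 := by
          rw [map_mul, hs, map_inv, inv_mul_cancel]
        rcases (reduce_eq_one_iff n _).1 h1 with h1 | h1
        · rw [inv_mul_eq_one] at h1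
          rw [← h1]
        · rw [inv_mul_eq_iff_eq_mul] at h1
          rw [h1, map_mul, ← sub_eq_zero, ← map_sub]
          refine (Submodule.Quotient.mk_eq_zero _).2 ⟨-of k n x, ?_⟩
          rw [LinearMap.mulRight_apply, mul_sub, mul_one, neg_mul, a]
          abel
      have h2 := LinearMap.congr_fun h x
      have h3 : I.mkQ x = 0 := by
        rw [h2]
        show I.mkQ (T (toGroupAlgebra k n x)) = 0
        rw [hx, map_zero, map_zero]
      obtain ⟨y, hy⟩ := (Submodule.Quotient.mk_eq_zero _).1 h3
      exact ⟨y, hy.symm⟩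
    · rintro ⟨y, rfl⟩
      rw [map_mul, map_sub, ha, map_one, sub_self, mul_zero]

/-- Two by two matrices `A, S, T` that satisfy the relations of `a, s₊, s₋` and preserve the form
of the relation `v u + u v` through the coproducts of `a` and `s₊`: either `A` is scalar, or `S` and
`T` are `±1, ±A`, which the coproduct of `s₊` excludes. -/
theorem _root_.Matrix.eq_neg_one_of_bDihedral {k : Type*} [Field k] (h2 : (2 : k) ≠ 0) {n : ℕ}
    {A S T : Matrix (Fin 2) (Fin 2) k} (hA : A * A = 1) (hS : S * S = 1) (hT : T * T = 1)
    (hAS : A * S = S * A) (hAT : A * T = T * A) (hn : (S * T) ^ n = A) (hA1 : A ≠ 1)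
    (hr : A * !![0, 1; 1, 0] * A.transpose = !![0, 1; 1, 0])
    (hs : S * !![0, 1; 1, 0] * ((1 + A) * S).transpose +
      T * !![0, 1; 1, 0] * ((1 - A) * S).transpose = (2 : k) • !![0, 1; 1, 0]) : A = -1 := by
  by_contra hA2
  have hAr : A * !![0, 1; 1, 0] = !![0, 1; 1, 0] * A.transpose := by
    have h := congrArg (· * A.transpose) hr
    simpa only [mul_assoc, ← Matrix.transpose_mul, hA, Matrix.transpose_one, mul_one] using h
  -- as `A² = 1` and `A` preserves the form, `A` is antidiagonal unless it is scalar
  obtain ⟨y, z, rfl, hyz⟩ : ∃ y z, A = !![0, y; z, 0] ∧ y * z = 1 := by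
    have e1 := congrFun (congrFun hAr 0) 1
    have e2 := fun i j : Fin 2 => congrFun (congrFun hA i) j
    rw [Matrix.eta_fin_two A] at e1
    simp [Matrix.mul_apply] at e1
    simp only [Matrix.mul_apply, Fin.sum_univ_two, Matrix.one_apply] at e2
    have e00 := e2 0 0
    have e01 := e2 0 1
    have e10 := e2 1 0
    simp only [if_true, Fin.isValue, zero_ne_one, one_ne_zero, if_false, ← e1] at e00 e01 e10
    have h01 : A 0 0 * A 0 1 = 0 := by
      refine (mul_eq_zero.1 (?_ : 2 * (A 0 0 * A 0 1) = 0)).resolve_left h2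
      linear_combination e01
    have h10 : A 0 0 * A 1 0 = 0 := by
      refine (mul_eq_zero.1 (?_ : 2 * (A 0 0 * A 1 0) = 0)).resolve_left h2
      linear_combination e10
    by_cases h0 : A 0 0 = 0
    · refine ⟨A 0 1, A 1 0, ?_, ?_⟩
      · conv_lhs => rw [Matrix.eta_fin_two A, ← e1, h0]
      · rw [h0] at e00
        linear_combination e00
    · have h01' := (mul_eq_zero.1 h01).resolve_left h0
      have h10' := (mul_eq_zero.1 h10).resolve_left h0
      rw [h01', zero_mul, add_zero, mul_self_eq_one_iff] at e00
      rcases e00 with e | e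
      · refine absurd ?_ hA1
        rw [Matrix.eta_fin_two A, ← e1, h01', h10', e, Matrix.one_fin_two]
      · refine absurd ?_ hA2
        rw [Matrix.eta_fin_two A, ← e1, h01', h10', e, Matrix.one_fin_two]
        ext i j; fin_cases i <;> fin_cases j <;> simp
  set A : Matrix (Fin 2) (Fin 2) k := !![0, y; z, 0] with hAdef
  -- the square roots of `1` that commute with `A`
  have key : ∀ P, P * P = 1 → A * P = P * A → (P = 1 ∨ P = -1) ∨ P = A ∨ P = -A := by
    intro P hP hAP
    have e1 := fun i j : Fin 2 => congrFun (congrFun hAP i) j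
    have e2 := fun i j : Fin 2 => congrFun (congrFun hP i) j
    have e00 := e1 0 0
    have e01 := e1 0 1
    have f00 := e2 0 0
    have f01 := e2 0 1
    simp [hAdef, Matrix.mul_apply] at e00 e01 f00 f01
    have hy : y ≠ 0 := left_ne_zero_of_mul_eq_one hyz
    have h11 : P 1 1 = P 0 0 := mul_left_cancel₀ hy (by linear_combination e01)
    have h10 : P 1 0 = P 0 1 * z * z := by linear_combination z * e00 - P 1 0 * hyz
    have hPA : P = P 0 0 • (1 : Matrix (Fin 2) (Fin 2) k) + (P 0 1 * z) • A := by
      ext i j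
      fin_cases i <;> fin_cases j <;> simp [hAdef, h11, h10]
      linear_combination -P 0 1 * hyz
    have h0 : P 0 0 * P 0 1 = 0 := by
      refine (mul_eq_zero.1 (?_ : 2 * (P 0 0 * P 0 1) = 0)).resolve_left h2
      rw [h11] at f01
      linear_combination f01
    have h1 : P 0 0 * P 0 0 + (P 0 1 * z) * (P 0 1 * z) = 1 := by
      rw [h10] at f00
      linear_combination f00
    rcases mul_eq_zero.1 h0 with h0 | h0
    · rw [h0, zero_mul, zero_add, mul_self_eq_one_iff] at h1
      right
      rcases h1 with h1 | h1 <;> rw [hPA, h0, h1] <;> simp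
    · rw [h0, zero_mul, zero_mul, add_zero, mul_self_eq_one_iff] at h1
      left
      rcases h1 with h1 | h1 <;> rw [hPA, h0, h1] <;> simp
  have hneg : -A ≠ A := fun h => by
    have h1 := congrFun (congrFun h 0) 1
    have h1 : -y = y := by simpa [hAdef] using h1
    have : 2 * y = 0 := by linear_combination -h1
    exact left_ne_zero_of_mul_eq_one hyz ((mul_eq_zero.1 this).resolve_left h2)
  have hcomm : S * T = T * S := by
    rcases key S hS hAS with (h | h) | h | h <;> rw [h] <;> simp [hAT]
  -- `S T` is `±1` or `±A`, and of these only `A` has `A` as its `n`-th power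
  have hP : S * T = A := by
    have hPP : S * T * (S * T) = 1 := by
      rw [mul_assoc, ← mul_assoc T, ← hcomm, mul_assoc S, hT, mul_one, hS]
    have hPA : A * (S * T) = S * T * A := by rw [← mul_assoc, hAS, mul_assoc, hAT, mul_assoc]
    have hpow : A ^ n = 1 ∨ A ^ n = A := by
      rcases Nat.even_or_odd' n with ⟨m, rfl | rfl⟩
      · exact Or.inl (by rw [pow_mul, pow_two, hA, one_pow])
      · exact Or.inr (by rw [pow_succ, pow_mul, pow_two, hA, one_pow, one_mul])
    rcases key _ hPP hPA with (h | h) | h | h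
    · rw [h, one_pow] at hn
      exact absurd hn.symm hA1
    · rw [h] at hn
      rcases neg_one_pow_eq_or (Matrix (Fin 2) (Fin 2) k) n with h' | h' <;> rw [h'] at hn
      · exact absurd hn.symm hA1
      · exact absurd hn.symm hA2
    · exact h
    · rw [h, neg_pow] at hn
      rcases neg_one_pow_eq_or (Matrix (Fin 2) (Fin 2) k) n with h' | h' <;>
        rcases hpow with h'' | h'' <;> rw [h', h''] at hn
      · exact absurd (by simpa using hn.symm) hA1
      · rcases Nat.even_or_odd n with h3 | ⟨m, rfl⟩
        · obtain ⟨m, rfl⟩ := h3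
          rw [← two_mul, pow_mul, pow_two, hA, one_pow] at h''
          exact absurd h''.symm hA1
        · rw [pow_succ, pow_mul, neg_one_sq, one_pow, one_mul] at h'
          rw [← one_mul A, ← h', neg_one_mul] at hn
          exact absurd (by simpa [h'] using hn) hneg
      · exact absurd (by simpa using hn.symm) hA2
      · exact absurd (by simpa using hn) hneg
  -- hence `T = S A`, and the condition from the coproduct of `s₊` becomes one on `S` and `A`
  have hT' : T = S * A := by rw [← hP, ← mul_assoc, hS, one_mul]
  have hfin : S * (A * !![0, 1; 1, 0]) * S.transpose = !![0, 1; 1, 0] := by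
    have e : S * !![0, 1; 1, 0] * ((1 + A) * S).transpose +
        S * A * !![0, 1; 1, 0] * ((1 - A) * S).transpose =
        (2 : k) • (S * (A * !![0, 1; 1, 0]) * S.transpose) := by
      have e1 : ((1 + A) * S).transpose = (1 + A.transpose) * S.transpose := by
        rw [add_mul, hAS, one_mul, Matrix.transpose_add, Matrix.transpose_mul, add_mul, one_mul]
      have e2 : ((1 - A) * S).transpose = (1 - A.transpose) * S.transpose := by
        rw [sub_mul, hAS, one_mul, Matrix.transpose_sub, Matrix.transpose_mul, sub_mul, one_mul]
      have e3 : !![0, 1; 1, 0] * (1 + A.transpose) + A * !![0, 1; 1, 0] * (1 - A.transpose) =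
          (2 : k) • (A * !![0, 1; 1, 0]) := by
        rw [mul_add, mul_sub, hr, ← hAr, mul_one, mul_one, two_smul]
        abel
      rw [e1, e2, mul_assoc S, mul_assoc S, mul_assoc S, ← mul_add, ← mul_assoc, ← mul_assoc,
        ← add_mul, e3, smul_mul_assoc, mul_smul_comm, mul_assoc S]
    rw [hT', e] at hs
    exact smul_right_injective _ h2 hs
  have hfin' : A * !![0, 1; 1, 0] = !![0, 1; 1, 0] := by
    rcases key S hS hAS with (h | h) | h | h <;> rw [h] at hfin
    · rwa [one_mul, Matrix.transpose_one, mul_one] at hfin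
    · rwa [Matrix.transpose_neg, Matrix.transpose_one, neg_one_mul, mul_neg_one, neg_neg] at hfin
    · rwa [← mul_assoc, hA, one_mul, ← hAr] at hfin
    · rwa [Matrix.transpose_neg, mul_neg, neg_mul, neg_mul, neg_neg, ← mul_assoc, hA, one_mul,
        ← hAr] at hfin
  refine hA1 ?_
  have hR : (!![0, 1; 1, 0] : Matrix (Fin 2) (Fin 2) k) * !![0, 1; 1, 0] = 1 := by
    simp [Matrix.one_fin_two]
  rw [← mul_one A, ← hR, ← mul_assoc, hfin', hR]

section Action

open GradedHopfAction SkewPlane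

variable {k : Type*} [Field k] [CharZero k] {n : ℕ}
  {ρ : GradedHopfAction k (BDihedral k n) (SkewPlane.grading k (-1))} {α : k} (hα : α * α = -1)
  (hθ : ρ.relationChar = 1)

/-- If `a` fixed `A₁`, then the action would not be inner faithful. -/
theorem exists_coef_a_ne [NeZero n] (hsep : ∀ x, (∀ c ∈ ρ.coefAlgebra, c x = 0) → x = 0) :
    ∃ i j, ρ.coef i j (a k n) ≠ if i = j then 1 else 0 := by
  by_contra! h
  refine a_ne_one k n (sub_eq_zero.1 (hsep _ fun c hc => ?_))
  have key : ∀ h : BDihedral k n, c (h * a k n) = 1 * c h := by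
    replace hc := mem_span_closure hc
    induction hc using Submodule.span_induction with
    | mem c hc =>
      induction hc using Submonoid.closure_induction with
      | mem c hc =>
        obtain ⟨p, rfl⟩ := hc
        intro x
        show ρ.coef p.1 p.2 (x * a k n) = _
        rw [ρ.isCorep_coef.mul]
        simp [h]
      | one =>
        intro x
        rw [one_mul, ConvDual.one_apply, Bialgebra.counit_mul,
          (isGroupLikeElem_a k n).counit_eq_one, mul_one]
        rfl
      | mul c d _ _ hc hd =>
        intro x
        rw [ConvDual.mul_apply_mul_of_isGroupLike (isGroupLikeElem_a k n) x hc hd, mul_one]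
    | zero => intro x; exact (one_mul _).symm
    | add c d _ _ hc hd =>
      intro x
      exact (congrArg₂ (· + ·) (hc x) (hd x)).trans (mul_add 1 (c x) (d x)).symm
    | smul r c _ hc =>
      intro x
      exact (congrArg (r * ·) (hc x)).trans (mul_left_comm _ _ _)
  have h1 := key 1
  rw [one_mul, one_mul] at h1
  rw [map_sub, h1, sub_self]

/-- The matrix of an element of `B(D̃₂ₙ)` on `A₁`. -/
noncomputable def coefMatrix (ρ : GradedHopfAction k (BDihedral k n) (SkewPlane.grading k (-1)))
    (h : BDihedral k n) : Matrix (Fin 2) (Fin 2) k := Matrix.of fun i j => ρ.coef i j h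

theorem coefMatrix_mul (h h' : BDihedral k n) :
    coefMatrix ρ (h * h') = coefMatrix ρ h * coefMatrix ρ h' := by
  ext i j
  rw [Matrix.mul_apply]
  exact ρ.isCorep_coef.mul i j h h'

theorem coefMatrix_one : coefMatrix ρ 1 = 1 := by
  ext i j
  rw [Matrix.one_apply]
  exact ρ.isCorep_coef.one i j

theorem coefMatrix_pow (h : BDihedral k n) (m : ℕ) :
    coefMatrix ρ (h ^ m) = coefMatrix ρ h ^ m := by
  induction m with
  | zero => rw [pow_zero, pow_zero, coefMatrix_one]
  | succ m ih => rw [pow_succ, pow_succ, coefMatrix_mul, ih]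

include hα hθ in
/-- The invariance of the relation `v u + u v`, in matrix form. -/
theorem coefMatrix_relation {ι : Type*} {h : BDihedral k n} (r : Coalgebra.Repr k h ι) :
    ∑ l ∈ r.index, coefMatrix ρ (r.left l) * !![0, 1; 1, 0] *
      (coefMatrix ρ (r.right l)).transpose =
    Coalgebra.counit (R := k) h • !![0, 1; 1, 0] := by
  ext i j
  have h1 := congrArg (fun c : ConvDual k _ => c h)
    (coef_relation_eq hα (by ring) hθ i j)
  have h2 : (ρ.coef i 1 * ρ.coef j 0) h - (-1) * (ρ.coef i 0 * ρ.coef j 1) h =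
      (!![0, -(-1); 1, 0] : Matrix (Fin 2) (Fin 2) k) i j * Coalgebra.counit (R := k) h := h1
  rw [neg_neg, Coalgebra.Repr.convMul_apply r, Coalgebra.Repr.convMul_apply r] at h2
  rw [Matrix.sum_apply, Matrix.smul_apply, smul_eq_mul, mul_comm, ← h2, neg_one_mul, sub_neg_eq_add,
    ← Finset.sum_add_distrib]
  refine Finset.sum_congr rfl fun l _ => ?_
  simp [coefMatrix, Matrix.mul_apply, Fin.sum_univ_two]

include hα hθ in
/-- The grouplike `a` acts on `A₁` by `-1`, whatever the inner faithful action with trivial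
homological determinant. -/
theorem actsByNegOne_a [NeZero n] (hsep : ∀ x, (∀ c ∈ ρ.coefAlgebra, c x = 0) → x = 0) :
    ρ.ActsByNegOne (a k n) := by
  have h2 : (2 : k) ≠ 0 := two_ne_zero
  have hm := fun x y : BDihedral k n => coefMatrix_mul (ρ := ρ) x y
  have hneg : coefMatrix ρ (a k n) = -1 := by
    refine Matrix.eq_neg_one_of_bDihedral h2 (n := n) (S := coefMatrix ρ (sPlus k n))
      (T := coefMatrix ρ (sMinus k n)) ?_ ?_ ?_ ?_ ?_ ?_ ?_ ?_ ?_
    · rw [← hm, a_sq, coefMatrix_one]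
    · rw [← hm, sPlus_sq, coefMatrix_one]
    · rw [← hm, sMinus_sq, coefMatrix_one]
    · rw [← hm, ← hm, sPlus, a_comm]
    · rw [← hm, ← hm, sMinus, a_comm]
    · rw [← hm, ← coefMatrix_pow, sPlus_sMinus_pow]
    · intro h
      obtain ⟨i, j, hij⟩ := exists_coef_a_ne hsep
      exact hij ((congrFun (congrFun h i) j).trans (Matrix.one_apply ..))
    · let r : Coalgebra.Repr k (a k n) Unit :=
        { index := Finset.univ, left := fun _ => a k n, right := fun _ => a k n,
          eq := by simp [(isGroupLikeElem_a k n).comul_eq_tmul_self] }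
      have h := coefMatrix_relation hα hθ r
      rw [(isGroupLikeElem_a k n).counit_eq_one, one_smul] at h
      simpa [r] using h
    · let r : Coalgebra.Repr k (sPlus k n) (Fin 2) :=
        { index := Finset.univ, left := ![sPlus k n, sMinus k n],
          right := ![e₀ k n * sPlus k n, e₁ k n * sPlus k n],
          eq := by simp [comul_sPlus, Fin.sum_univ_two] }
      have h := coefMatrix_relation hα hθ r
      have hc : Coalgebra.counit (R := k) (sPlus k n) = 1 := counitAlg_of k n _
      have e0 : (2 : k) • coefMatrix ρ (e₀ k n * sPlus k n) =
          (1 + coefMatrix ρ (a k n)) * coefMatrix ρ (sPlus k n) := by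
        rw [add_mul, one_mul, ← hm, e₀, smul_mul_assoc, add_mul, one_mul]
        ext i j
        simp [coefMatrix]
        field_simp
      have e1 : (2 : k) • coefMatrix ρ (e₁ k n * sPlus k n) =
          (1 - coefMatrix ρ (a k n)) * coefMatrix ρ (sPlus k n) := by
        rw [sub_mul, one_mul, ← hm, e₁, smul_mul_assoc, sub_mul, one_mul]
        ext i j
        simp [coefMatrix]
      rw [hc, one_smul] at h
      rw [← e0, ← e1, Matrix.transpose_smul, Matrix.transpose_smul, mul_smul_comm,
        mul_smul_comm, ← smul_add]
      refine Eq.trans ?_ (congrArg ((2 : k) • ·) h)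
      simp only [r, Fin.sum_univ_two, Matrix.cons_val_zero, Matrix.cons_val_one]
  intro i j
  refine (congrFun (congrFun hneg i) j).trans ?_
  rw [Matrix.neg_apply, Matrix.one_apply]
  split <;> simp

/-- The fixed subring of an inner faithful action of `B(D̃₂ₙ)` is a Kleinian singularity. -/
theorem isKleinianAction [IsAlgClosed k] (hn : 2 ≤ n) (hif : ρ.InnerFaithful)
    (hd : ρ.HasTrivialHomologicalDet (augmentation k (-1))) :
    IsKleinianAction ρ (DihedralGroup n) := by
  have : NeZero n := ⟨by omega⟩
  obtain ⟨α, hα⟩ := IsAlgClosed.exists_pow_nat_eq (-1 : k) (n := 2) (by norm_num)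
  rw [pow_two] at hα
  have hq : (-1 : k) * -1 = 1 := by ring
  have hθ := relationChar_eq_one hα hq hd
  have hsep := fun x hx => eq_zero_of_coefAlgebra hα hq hθ hif (x := x) hx
  exact GradedHopfAction.isKleinianAction hα hq (quantumSLRelations_coef hα hq hθ) hsep
    (actsByNegOne_a hα hθ hsep) (isCentralExtension k n) (.dihedralGroup k n hn)

end Action

end BDihedral


/-! ### Simple modules and their characters -/

section Representation

variable {k H : Type*} [Field k] [Ring H] [Algebra k H]

/-- A representation on a finite-dimensional space without proper invariant subspaces is isomorphic
to the chosen representative of a class of simple modules. -/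
theorem SimpleClass.exists_equiv {W : Type*} [AddCommGroup W] [Module k W] [Module.Finite k W]
    [Nontrivial W] (σ : H →ₐ[k] Module.End k W)
    (hσ : ∀ U : Submodule k W, (∀ h, ∀ x ∈ U, σ h x ∈ U) → U = ⊥ ∨ U = ⊤) :
    ∃ (i : SimpleClass k H) (f : W ≃ₗ[k] (Fin (Quotient.out i).dim → k)),
      ∀ h w, f (σ h w) = (Quotient.out i).rep h (f w) := by
  let b := (Module.finBasis k W).equivFun
  let R : SimpleRep k H :=
    { dim := Module.finrank k W
      rep := ((LinearEquiv.conjAlgEquiv k b).toAlgHom).comp σ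
      dim_pos := Module.finrank_pos
      simple := fun U hU => by
        have e : ∀ h x, ((LinearEquiv.conjAlgEquiv k b).toAlgHom).comp σ h (b x) = b (σ h x) := by
          intro h x
          show b (σ h (b.symm (b x))) = _
          rw [LinearEquiv.symm_apply_apply]
        have hU' : ∀ h, ∀ x ∈ U.comap b.toLinearMap, σ h x ∈ U.comap b.toLinearMap := by
          intro h x hx
          show b (σ h x) ∈ U
          rw [← e]
          exact hU h (b x) hx
        rcases hσ _ hU' with h | h
        · left
          rw [← Submodule.map_comap_eq_of_surjective b.surjective U, h, Submodule.map_bot]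
        · right
          rw [← Submodule.map_comap_eq_of_surjective b.surjective U, h, Submodule.map_top]
          exact LinearMap.range_eq_top.2 b.surjective }
  obtain ⟨f, hf⟩ := Quotient.exact (Quotient.out_eq (Quotient.mk (SimpleRep.setoid k H) R))
  refine ⟨Quotient.mk _ R, b.trans f.symm, fun h w => ?_⟩
  rw [LinearEquiv.trans_apply, LinearEquiv.symm_apply_eq, hf, LinearEquiv.trans_apply,
    LinearEquiv.apply_symm_apply]
  show _ = b (σ h (b.symm (b w)))
  rw [LinearEquiv.symm_apply_apply]

/-- Complete reducibility: every finite-dimensional representation of a semisimple algebra is a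
direct sum of the chosen simple ones. -/
theorem exists_equiv_pi_simple [IsSemisimpleRing H] {V : Type*} [AddCommGroup V] [Module k V]
    [Module.Finite k V] (σ : H →ₐ[k] Module.End k V) :
    ∃ (n : ℕ) (i : Fin n → SimpleClass k H)
      (E : V ≃ₗ[k] ∀ t, (Fin (Quotient.out (i t)).dim → k)),
      ∀ h v t, E (σ h v) t = (Quotient.out (i t)).rep h (E v t) := by
  let : Module H V := Module.compHom V σ.toRingHom
  have hsmul : ∀ (h : H) (v : V), h • v = σ h v := fun _ _ => rfl
  have : IsScalarTower k H V := ⟨fun c h v => by rw [hsmul, hsmul, map_smul]; rfl⟩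
  have : Module.Finite H V := Module.Finite.of_restrictScalars_finite k H V
  obtain ⟨n, S, e, hS⟩ := IsSemisimpleModule.exists_linearEquiv_fin_dfinsupp H V
  have key : ∀ t, ∃ (i : SimpleClass k H) (f : S t ≃ₗ[k] (Fin (Quotient.out i).dim → k)),
      ∀ (h : H) (w : S t), f (h • w) = (Quotient.out i).rep h (f w) := by
    intro t
    have := hS t
    have := IsSimpleModule.nontrivial H (S t)
    have : Module.Finite k (S t) :=
      Module.Finite.of_injective ((S t).subtype.restrictScalars k) Subtype.val_injective
    let τ : H →ₐ[k] Module.End k (S t) := Algebra.lsmul k k (S t)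
    refine SimpleClass.exists_equiv τ fun U hU => ?_
    let U' : Submodule H (S t) := { U with smul_mem' := fun h x hx => hU h x hx }
    rcases eq_bot_or_eq_top U' with h | h
    · left
      exact SetLike.coe_injective (congrArg (fun X : Submodule H (S t) => (X : Set (S t))) h)
    · right
      exact SetLike.coe_injective (congrArg (fun X : Submodule H (S t) => (X : Set (S t))) h)
  choose i f hf using key
  let e' : V ≃ₗ[H] ∀ t, S t := e.trans DFinsupp.linearEquivFunOnFintype
  refine ⟨n, i, (e'.restrictScalars k).trans (LinearEquiv.piCongrRight f), fun h v t => ?_⟩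
  show f t (e' (h • v) t) = (Quotient.out (i t)).rep h (f t (e' v t))
  rw [map_smul, Pi.smul_apply, hf]

/-- Schur's lemma. -/
theorem finrank_intertwiners_simple [IsAlgClosed k] [DecidableEq (SimpleClass k H)]
    (i j : SimpleClass k H) :
    Module.finrank k (intertwiners (Quotient.out i).rep (Quotient.out j).rep) =
      if i = j then 1 else 0 := by
  have hker : ∀ {R S : SimpleRep k H} {f}, f ∈ intertwiners R.rep S.rep → f ≠ 0 →
      LinearMap.ker f = ⊥ := by
    intro R S f hf h0
    refine (R.simple (LinearMap.ker f) fun h x hx => ?_).resolve_right fun h =>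
      h0 (LinearMap.ker_eq_top.1 h)
    rw [LinearMap.mem_ker] at hx ⊢
    rw [hf, hx, map_zero]
  split_ifs with h
  · subst h
    set R := Quotient.out i
    have : Nonempty (Fin R.dim) := ⟨⟨0, R.dim_pos⟩⟩
    let id' : intertwiners R.rep R.rep := ⟨LinearMap.id, fun _ _ => rfl⟩
    refine finrank_eq_one id' (fun h => ?_) fun f => ?_
    · have h := congrArg Subtype.val h
      have h' : (LinearMap.id : (Fin R.dim → k) →ₗ[k] _) = 0 := h
      have := LinearMap.congr_fun h' 1
      exact one_ne_zero this
    · obtain ⟨c, hc⟩ := Module.End.exists_eigenvalue (f : Module.End k (Fin R.dim → k))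
      refine ⟨c, ?_⟩
      by_contra hne
      have h1 := hker (f - c • id').2 fun h => hne (sub_eq_zero.1 (Subtype.ext h)).symm
      obtain ⟨v, hv⟩ := hc.exists_hasEigenvector
      refine hv.2 ((Submodule.mem_bot k).1 (h1 ▸ LinearMap.mem_ker.2 ?_))
      show (f : _ →ₗ[k] _) v - c • v = 0
      rw [hv.apply_eq_smul, sub_self]
  · rw [Submodule.finrank_eq_zero]
    refine (Submodule.eq_bot_iff _).2 fun f hf => ?_
    by_contra h0
    have h1 := hker hf h0
    have h2 : LinearMap.range f = ⊤ := by
      refine ((Quotient.out j).simple (LinearMap.range f) ?_).resolve_left fun h =>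
        h0 (LinearMap.range_eq_bot.1 h)
      rintro h _ ⟨x, rfl⟩
      exact ⟨_, hf h x⟩
    have h3 : Quotient.out i ≈ Quotient.out j :=
      ⟨LinearEquiv.ofBijective f ⟨LinearMap.ker_eq_bot.1 h1, LinearMap.range_eq_top.1 h2⟩, hf⟩
    exact h (by rw [← Quotient.out_eq i, ← Quotient.out_eq j, Quotient.sound h3])

section Multiplicity

variable {V : Type*} [AddCommGroup V] [Module k V] (σ : H →ₐ[k] Module.End k V) {n : ℕ}
  {i : Fin n → SimpleClass k H} (E : V ≃ₗ[k] ∀ t, (Fin (Quotient.out (i t)).dim → k))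
  (hE : ∀ h v t, E (σ h v) t = (Quotient.out (i t)).rep h (E v t))

include hE

theorem finrank_intertwiners_eq_card [IsAlgClosed k] [DecidableEq (SimpleClass k H)]
    (j : SimpleClass k H) :
    Module.finrank k (intertwiners (Quotient.out j).rep σ) = Fintype.card {t // i t = j} := by
  let e : intertwiners (Quotient.out j).rep σ ≃ₗ[k]
      ∀ t, intertwiners (Quotient.out j).rep (Quotient.out (i t)).rep :=
    { toFun := fun f t => ⟨LinearMap.proj t ∘ₗ E.toLinearMap ∘ₗ f.1, fun h v => by
        show E (f.1 _) t = _
        rw [f.2, hE]; rfl⟩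
      map_add' := fun f g => funext fun t => Subtype.ext (LinearMap.ext fun v => by
        show E (f.1 v + g.1 v) t = E (f.1 v) t + E (g.1 v) t
        rw [map_add]; rfl)
      map_smul' := fun c f => funext fun t => Subtype.ext (LinearMap.ext fun v => by
        show E (c • f.1 v) t = c • E (f.1 v) t
        rw [map_smul]; rfl)
      invFun := fun f => ⟨E.symm.toLinearMap ∘ₗ LinearMap.pi fun t => (f t).1, fun h v => by
        refine E.injective (funext fun t => ?_)
        rw [hE]
        simp only [LinearMap.comp_apply, LinearEquiv.coe_coe, LinearEquiv.apply_symm_apply]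
        exact (f t).2 h v⟩
      left_inv := fun f => Subtype.ext (LinearMap.ext fun v => E.symm_apply_apply (f.1 v))
      right_inv := fun f => funext fun t => Subtype.ext (LinearMap.ext fun v =>
        congrFun (E.apply_symm_apply fun t => (f t).1 v) t) }
  rw [e.finrank_eq, Module.finrank_pi_fintype]
  simp only [finrank_intertwiners_simple]
  rw [Fintype.card_subtype, Finset.card_filter]
  exact Finset.sum_congr rfl fun t _ => by simp only [eq_comm]

theorem trace_eq_sum_trace (h : H) :
    LinearMap.trace k V (σ h) = ∑ t, LinearMap.trace k _ ((Quotient.out (i t)).rep h) := by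
  classical
  have : Module.Finite k V := Module.Finite.equiv E.symm
  let ι : ∀ t, (Fin (Quotient.out (i t)).dim → k) →ₗ[k] V := fun t =>
    E.symm.toLinearMap ∘ₗ LinearMap.single k (fun t => Fin (Quotient.out (i t)).dim → k) t
  let p : ∀ t, V →ₗ[k] (Fin (Quotient.out (i t)).dim → k) := fun t =>
    LinearMap.proj t ∘ₗ E.toLinearMap
  have hid : σ h = ∑ t, ι t ∘ₗ p t ∘ₗ σ h := by
    refine LinearMap.ext fun v => E.injective ?_
    rw [LinearMap.sum_apply, map_sum]
    simp only [ι, p, LinearMap.comp_apply, LinearEquiv.coe_coe, LinearEquiv.apply_symm_apply]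
    exact (LinearMap.sum_single_apply _ (E (σ h v))).symm
  rw [hid, map_sum]
  refine Finset.sum_congr rfl fun t _ => ?_
  rw [LinearMap.trace_comp_comm']
  congr 1
  refine LinearMap.ext fun v => ?_
  show E (σ h (E.symm (Pi.single t v))) t = _
  rw [hE, LinearEquiv.apply_symm_apply, Pi.single_eq_same]

end Multiplicity

/-- The character of a simple module. -/
noncomputable def SimpleClass.character (i : SimpleClass k H) : ConvDual k H :=
  WithConv.toConv (LinearMap.trace k _ ∘ₗ (Quotient.out i).rep.toLinearMap)

theorem SimpleClass.character_apply (i : SimpleClass k H) (h : H) :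
    i.character h = LinearMap.trace k _ ((Quotient.out i).rep h) := rfl

/-- The character of a representation is the sum of the simple characters, with multiplicities. -/
theorem trace_eq_sum_finrank_mul_character [IsSemisimpleRing H] [IsAlgClosed k]
    [Fintype (SimpleClass k H)] {V : Type*} [AddCommGroup V] [Module k V] [Module.Finite k V]
    (σ : H →ₐ[k] Module.End k V) (h : H) :
    LinearMap.trace k V (σ h) = ∑ j : SimpleClass k H,
      (Module.finrank k (intertwiners (Quotient.out j).rep σ) : k) * j.character h := by
  classical
  obtain ⟨n, i, E, hE⟩ := exists_equiv_pi_simple σ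
  rw [trace_eq_sum_trace σ E hE]
  simp only [finrank_intertwiners_eq_card σ E hE, Fintype.card_subtype, ← nsmul_eq_mul,
    ← Finset.sum_const, Finset.sum_filter]
  rw [Finset.sum_comm]
  refine Finset.sum_congr rfl fun t _ => ?_
  rw [Finset.sum_ite_eq]
  simp only [Finset.mem_univ, if_true]
  rfl

end Representation


/-! ### The grouplike element of a bipartite McKay quiver -/

section Translation

variable {k H : Type*} [Field k] [Ring H] [Bialgebra k H]

/-- The functional `x ↦ c (h x)`. -/
noncomputable def ConvDual.translate (h : H) (c : ConvDual k H) : ConvDual k H :=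
  WithConv.toConv (c.ofConv ∘ₗ LinearMap.mulLeft k h)

theorem ConvDual.translate_mul {ι : Type*} {h : H} (r : Coalgebra.Repr k h ι)
    (c d : ConvDual k H) :
    (c * d).translate h = ∑ l ∈ r.index, c.translate (r.left l) * d.translate (r.right l) := by
  ext x
  rw [ConvDual.sum_apply]
  simp only [Coalgebra.Repr.convMul_apply (Coalgebra.Repr.arbitrary k x)]
  exact ConvDual.mul_apply_mul c d r (Coalgebra.Repr.arbitrary k x)

theorem ConvDual.translate_mem_mul {M N : Submodule k (ConvDual k H)}
    (hM : ∀ h, ∀ c ∈ M, c.translate h ∈ M) (hN : ∀ h, ∀ c ∈ N, c.translate h ∈ N) (h : H)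
    {c : ConvDual k H} (hc : c ∈ M * N) : c.translate h ∈ M * N := by
  induction hc using Submodule.mul_induction_on' with
  | mem_mul_mem c hc d hd =>
    rw [ConvDual.translate_mul (Coalgebra.Repr.arbitrary k h)]
    exact Submodule.sum_mem _ fun l _ => Submodule.mul_mem_mul (hM _ _ hc) (hN _ _ hd)
  | add c _ d _ hc hd => exact Submodule.add_mem _ hc hd

end Translation

theorem Module.finite_of_injective_dual {k V W : Type*} [Field k] [AddCommGroup V] [Module k V]
    [AddCommGroup W] [Module k W] [Module.Finite k W] (F : V →ₗ[k] Module.Dual k W)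
    (hF : Function.Injective F) : Module.Finite k V := Module.Finite.of_injective F hF

namespace GradedHopfAction

open SkewPlane

variable {k H : Type*} [Field k] [Ring H] [HopfAlgebra k H] {q : k}
  {ρ : GradedHopfAction k H (SkewPlane.grading k q)}

/-- A semisimple Hopf algebra whose points are separated by the coefficient algebra of `A₁` is
finite-dimensional: the common kernels of the coefficients of degree at most `n` form a decreasing
chain of left ideals with zero intersection. -/
theorem module_finite [IsArtinianRing H]
    (hsep : ∀ x : H, (∀ c ∈ ρ.coefAlgebra, c x = 0) → x = 0) : Module.Finite k H := by
  let G : Set (ConvDual k H) := insert 1 (Set.range fun p : Fin 2 × Fin 2 => ρ.coef p.1 p.2)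
  let V : Submodule k (ConvDual k H) := Submodule.span k G
  have h1V : 1 ∈ V := Submodule.subset_span (Set.mem_insert _ _)
  have hcV : ∀ i j, ρ.coef i j ∈ V := fun i j =>
    Submodule.subset_span (Set.mem_insert_of_mem _ ⟨(i, j), rfl⟩)
  have hV : ∀ h, ∀ c ∈ V, ConvDual.translate h c ∈ V := by
    intro h c hc
    induction hc using Submodule.span_induction with
    | mem c hc =>
      rcases hc with rfl | ⟨p, rfl⟩
      · have e : ConvDual.translate h (1 : ConvDual k H) =
            Coalgebra.counit (R := k) h • (1 : ConvDual k H) := by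
          ext x
          exact Bialgebra.counit_mul h x
        rw [e]
        exact Submodule.smul_mem _ _ h1V
      · have e : ConvDual.translate h (ρ.coef p.1 p.2) =
            ∑ l, ρ.coef p.1 l h • ρ.coef l p.2 := by
          ext x
          rw [ConvDual.sum_apply]
          exact ρ.isCorep_coef.mul p.1 p.2 h x
        show ConvDual.translate h (ρ.coef p.1 p.2) ∈ V
        rw [e]
        exact Submodule.sum_mem _ fun l _ => Submodule.smul_mem _ _ (hcV _ _)
    | zero => exact Submodule.zero_mem _
    | add c d _ _ hc hd => exact Submodule.add_mem _ hc hd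
    | smul a c _ hc => exact Submodule.smul_mem _ a hc
  have hVn : ∀ n : ℕ, ∀ h, ∀ c ∈ V ^ n, ConvDual.translate h c ∈ V ^ n := by
    intro n
    induction n with
    | zero =>
      intro h c hc
      rw [Submodule.pow_zero, Submodule.mem_one] at hc ⊢
      obtain ⟨a, rfl⟩ := hc
      refine ⟨a * Coalgebra.counit (R := k) h, ?_⟩
      ext x
      rw [Algebra.algebraMap_eq_smul_one, Algebra.algebraMap_eq_smul_one]
      show a * _ * Coalgebra.counit (R := k) x = a * Coalgebra.counit (R := k) (h * x)
      rw [Bialgebra.counit_mul, mul_assoc]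
    | succ n ih =>
      intro h c hc
      rw [Submodule.pow_succ] at hc ⊢
      exact ConvDual.translate_mem_mul ih hV h hc
  have hmono : Monotone fun n : ℕ => V ^ n := monotone_nat_of_le_succ fun n => by
    rw [Submodule.pow_succ]
    intro c hc
    rw [← mul_one c]
    exact Submodule.mul_mem_mul hc h1V
  let I : ℕ →o (Submodule H H)ᵒᵈ :=
    { toFun := fun n => OrderDual.toDual
        { carrier := {x | ∀ c ∈ V ^ n, c x = 0}
          add_mem' := fun {x y} hx hy c hc => by rw [map_add, hx c hc, hy c hc, add_zero]
          zero_mem' := fun c _ => map_zero c.ofConv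
          smul_mem' := fun h x hx c hc => hx _ (hVn n h c hc) }
      monotone' := fun m n hmn x hx c hc => hx c (hmono hmn hc) }
  obtain ⟨n, hn⟩ := IsArtinian.monotone_stabilizes I
  have hzero : ∀ x : H, (∀ c ∈ V ^ n, c x = 0) → x = 0 := by
    intro x hx
    have hx' : ∀ m, n ≤ m → ∀ c ∈ V ^ m, c x = 0 := by
      intro m hm
      have h1 : x ∈ OrderDual.ofDual (I n) := hx
      rw [hn m hm] at h1
      exact h1
    refine hsep x fun c hc => ?_
    replace hc := mem_span_closure hc
    induction hc using Submodule.span_induction with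
    | mem c hc =>
      have : ∃ m, c ∈ V ^ m := by
        induction hc using Submonoid.closure_induction with
        | mem c hc =>
          obtain ⟨p, rfl⟩ := hc
          exact ⟨1, by rw [pow_one]; exact hcV _ _⟩
        | one => exact ⟨0, by rw [pow_zero]; exact Submodule.one_le.1 le_rfl⟩
        | mul c d _ _ hc hd =>
          obtain ⟨m, hc⟩ := hc
          obtain ⟨m', hd⟩ := hd
          exact ⟨m + m', by rw [pow_add]; exact Submodule.mul_mem_mul hc hd⟩
      obtain ⟨m, hm⟩ := this
      exact hx' (max m n) (le_max_right _ _) c (hmono (le_max_left _ _) hm)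
    | zero => rfl
    | add c d _ _ hc hd => exact (congrArg₂ (· + ·) hc hd).trans (add_zero 0)
    | smul r c _ hc => exact (congrArg (r * ·) hc).trans (mul_zero r)
  have hfg : (V ^ n).FG := Submodule.FG.pow
    (Submodule.fg_span ((Set.finite_range _).insert _)) n
  have hfin : FiniteDimensional k (V ^ n : Submodule k (ConvDual k H)) := Module.Finite.iff_fg.2 hfg
  let F : H →ₗ[k] Module.Dual k (V ^ n : Submodule k (ConvDual k H)) :=
    { toFun := fun x =>
        { toFun := fun c => (c : ConvDual k H) x
          map_add' := fun _ _ => rfl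
          map_smul' := fun _ _ => rfl }
      map_add' := fun x y => LinearMap.ext fun c => map_add (c : ConvDual k H).ofConv x y
      map_smul' := fun a x => LinearMap.ext fun c => map_smul (c : ConvDual k H).ofConv a x }
  have hF : Function.Injective F := (injective_iff_map_eq_zero F).2 fun x hx =>
    hzero x fun c hc => LinearMap.congr_fun hx ⟨c, hc⟩
  exact Module.finite_of_injective_dual (W := (V ^ n : Submodule k (ConvDual k H))) F hF

end GradedHopfAction

section TrivialClass

variable {k H : Type*} [Field k] [Ring H] [Bialgebra k H]

/-- The class `i` is that of the trivial module. -/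
def SimpleClass.IsTrivial (i : SimpleClass k H) : Prop :=
  (Quotient.out i).dim = 1 ∧
    ∀ h v, (Quotient.out i).rep h v = Coalgebra.counit (R := k) h • v

variable (k H) in
theorem SimpleClass.exists_isTrivial : ∃ i : SimpleClass k H, i.IsTrivial := by
  obtain ⟨i, f, hf⟩ := SimpleClass.exists_equiv
    ((Algebra.lsmul k k k).comp (Bialgebra.counitAlgHom k H))
    fun U _ => eq_bot_or_eq_top U
  refine ⟨i, ?_, fun h v => ?_⟩
  · have := f.finrank_eq
    rwa [Module.finrank_self, Module.finrank_fin_fun, eq_comm] at this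
  · obtain ⟨w, rfl⟩ := f.surjective v
    rw [← hf, ← map_smul]
    rfl

/-- A simple module with a nonzero invariant vector is trivial. -/
theorem SimpleClass.IsTrivial.eq [IsAlgClosed k] {i j : SimpleClass k H} (hi : i.IsTrivial)
    {v : Fin (Quotient.out j).dim → k} (hv : v ≠ 0)
    (h : ∀ h, (Quotient.out j).rep h v = Coalgebra.counit (R := k) h • v) : j = i := by
  classical
  by_contra hne
  have h1 := finrank_intertwiners_simple i j
  rw [if_neg (Ne.symm hne), Submodule.finrank_eq_zero, Submodule.eq_bot_iff] at h1
  let a : Fin (Quotient.out i).dim := ⟨0, (Quotient.out i).dim_pos⟩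
  have h2 := h1 ((LinearMap.toSpanSingleton k _ v) ∘ₗ LinearMap.proj a) fun x w => by
    rw [hi.2, LinearMap.comp_apply, LinearMap.comp_apply, LinearMap.toSpanSingleton_apply,
      LinearMap.toSpanSingleton_apply, map_smul, map_smul]
    refine Eq.trans ?_ (congrArg _ (h x)).symm
    rw [smul_assoc, smul_comm]
  have h3 := LinearMap.congr_fun h2 (Pi.single a 1)
  rw [LinearMap.comp_apply, LinearMap.proj_apply, Pi.single_eq_same,
    LinearMap.toSpanSingleton_apply, one_smul] at h3
  exact hv h3

end TrivialClass

theorem mcKayArrows_ne_zero {k H Y : Type*} [Field k] [Ring H] [Bialgebra k H] [AddCommGroup Y]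
    [Module k Y] [Module.Finite k Y] (σ : H →ₐ[k] Module.End k Y) {i j : SimpleClass k H}
    (h : intertwiners (Quotient.out i).rep (tensorRep σ (Quotient.out j).rep) ≠ ⊥) :
    mcKayArrows σ i j ≠ 0 := fun h0 => h (Submodule.finrank_eq_zero.1 h0)

section Sign

variable {k H : Type*} [Field k] [Ring H] [Algebra k H] {n : ℕ} {i : Fin n → SimpleClass k H}
  (E : H ≃ₗ[k] ∀ t, (Fin (Quotient.out (i t)).dim → k))
  (hE : ∀ h x t, E (h * x) t = (Quotient.out (i t)).rep h (E x t)) (sgn : SimpleClass k H → k)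

/-- The element of a semisimple algebra that acts on each simple module `S` by the scalar
`sgn S`. -/
noncomputable def signElement : H := E.symm fun t => sgn (i t) • E 1 t

include hE

/-- The sign element acts by the scalar `c` on a module if all its simple submodules have the
sign `c`. -/
theorem signElement_act {V : Type*} [AddCommGroup V] [Module k V] (σ : H →ₐ[k] Module.End k V)
    {c : k} (hc : ∀ j, intertwiners (Quotient.out j).rep σ ≠ ⊥ → sgn j = c) (v : V) :
    σ (signElement E sgn) v = c • v := by
  classical
  let φ : H →ₗ[k] V := LinearMap.applyₗ v ∘ₗ σ.toLinearMap
  have hφ : ∀ h x, φ (h * x) = σ h (φ x) := fun h x => by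
    show σ (h * x) v = σ h (σ x v)
    rw [map_mul]; rfl
  let φ' : ∀ t, (Fin (Quotient.out (i t)).dim → k) →ₗ[k] V := fun t =>
    φ ∘ₗ E.symm.toLinearMap ∘ₗ LinearMap.single k (fun t => Fin (Quotient.out (i t)).dim → k) t
  have hsum : ∀ y, φ (E.symm y) = ∑ t, φ' t (y t) := fun y => by
    conv_lhs => rw [← LinearMap.sum_single_apply (fun t => Fin (Quotient.out (i t)).dim → k) y]
    rw [map_sum, map_sum]
    rfl
  have hφ' : ∀ t, φ' t ∈ intertwiners (Quotient.out (i t)).rep σ := by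
    intro t h w
    show φ (E.symm _) = σ h (φ (E.symm _))
    rw [← hφ]
    congr 1
    refine E.injective (funext fun s => ?_)
    rw [hE, LinearEquiv.apply_symm_apply, LinearEquiv.apply_symm_apply]
    by_cases hst : s = t
    · subst hst
      rw [LinearMap.single_apply, LinearMap.single_apply, Pi.single_eq_same, Pi.single_eq_same]
    · rw [LinearMap.single_apply, LinearMap.single_apply, Pi.single_eq_of_ne hst,
        Pi.single_eq_of_ne hst, map_zero]
  have hscal : ∀ t w, sgn (i t) • φ' t w = c • φ' t w := by
    intro t w
    by_cases h : intertwiners (Quotient.out (i t)).rep σ = ⊥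
    · have h0 := hφ' t
      rw [h, Submodule.mem_bot] at h0
      rw [h0, LinearMap.zero_apply, smul_zero, smul_zero]
    · rw [hc _ h]
  have h1 : φ 1 = v := by
    show σ 1 v = v
    rw [map_one]; rfl
  show φ (E.symm fun t => sgn (i t) • E 1 t) = c • v
  rw [hsum]
  simp only [map_smul, hscal]
  rw [← Finset.smul_sum, ← hsum fun t => E 1 t]
  show c • φ (E.symm (E 1)) = c • v
  rw [LinearEquiv.symm_apply_apply, h1]

theorem signElement_act_simple [IsAlgClosed k] (j : SimpleClass k H)
    (v : Fin (Quotient.out j).dim → k) :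
    (Quotient.out j).rep (signElement E sgn) v = sgn j • v := by
  classical
  refine signElement_act E hE sgn _ (fun l hl => ?_) v
  have h1 := finrank_intertwiners_simple l j
  by_contra hne
  rw [if_neg fun h => hne (by rw [h]), Submodule.finrank_eq_zero] at h1
  exact hl h1

theorem signElement_mul [IsAlgClosed k] (x : H) :
    E (signElement E sgn * x) = fun t => sgn (i t) • E x t :=
  funext fun t => by rw [hE, signElement_act_simple E hE]

theorem signElement_comm [IsAlgClosed k] (x : H) :
    signElement E sgn * x = x * signElement E sgn := by
  refine E.injective ?_
  rw [signElement_mul E hE]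
  refine funext fun t => ?_
  rw [hE, signElement, LinearEquiv.apply_symm_apply, map_smul, ← hE, mul_one]

theorem signElement_mul_self [IsAlgClosed k] (hs : ∀ j, sgn j * sgn j = 1) :
    signElement E sgn * signElement E sgn = 1 := by
  refine E.injective ?_
  rw [signElement_mul E hE]
  refine funext fun t => ?_
  rw [signElement, LinearEquiv.apply_symm_apply, smul_smul, hs, one_smul]

end Sign

namespace GradedHopfAction

open SkewPlane

variable {k H : Type*} [Field k] [Ring H] [HopfAlgebra k H] {q : k}
  (ρ : GradedHopfAction k H (SkewPlane.grading k q))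

instance : Module.Finite k (SkewPlane.grading k q 1) := by
  refine Module.Finite.iff_fg.2 ?_
  rw [grading, Submodule.pow_one]
  exact Submodule.fg_span (Set.finite_range _)

/-- A matrix coefficient of the tensor product of `A₁` with a representation. -/
theorem coef_mul_matrixCoef_apply {V : Type*} [AddCommGroup V] [Module k V]
    (σ : H →ₐ[k] Module.End k V) (a b : Fin 2) (f : V →ₗ[k] k) (v : V) (h : H) :
    (ρ.coef a b * WithConv.toConv (f ∘ₗ LinearMap.applyₗ v ∘ₗ σ.toLinearMap)) h =
      LinearMap.mul' k k (TensorProduct.map (coord k q a ∘ₗ (SkewPlane.grading k q 1).subtype) f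
        (tensorRep (ρ.component 1) σ h (⟨gen k q b, gen_mem_grading b⟩ ⊗ₜ v))) := by
  rw [tensorRep_apply _ _ (Coalgebra.Repr.arbitrary k h), map_sum, map_sum,
    Coalgebra.Repr.convMul_apply (Coalgebra.Repr.arbitrary k h)]
  exact Finset.sum_congr rfl fun l _ => rfl

variable {ρ}

/-- If the arrows of the McKay quiver of `A₁` reverse a sign that is `1` on the trivial module, then
the element that acts by this sign is a central grouplike that acts on `A₁` by `-1`. -/
theorem exists_isGroupLikeElem [IsSemisimpleRing H] [IsAlgClosed k]
    (hsep : ∀ x : H, (∀ c ∈ ρ.coefAlgebra, c x = 0) → x = 0) {sgn : SimpleClass k H → k}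
    (hs : ∀ j, sgn j * sgn j = 1)
    (hodd : ∀ i j, mcKayArrows (ρ.component 1) i j ≠ 0 → sgn i = -sgn j)
    {i₀ : SimpleClass k H} (h₀ : i₀.IsTrivial) (hs₀ : sgn i₀ = 1) :
    ∃ g : H, IsGroupLikeElem k g ∧ g ∈ Subring.center H ∧ g * g = 1 ∧ ρ.ActsByNegOne g ∧
      ∀ (j : SimpleClass k H) v, (Quotient.out j).rep g v = sgn j • v := by
  classical
  have hfin := module_finite hsep
  obtain ⟨n, i, E, hE⟩ := exists_equiv_pi_simple (Algebra.lmul k H)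
  replace hE : ∀ h x t, E (h * x) t = (Quotient.out (i t)).rep h (E x t) := hE
  have hact := fun j v => signElement_act_simple E hE sgn j v
  set g := signElement E sgn with hg
  have hcounit : Coalgebra.counit (R := k) g = 1 := by
    let a : Fin (Quotient.out i₀).dim := ⟨0, (Quotient.out i₀).dim_pos⟩
    have h1 := congrFun (hact i₀ (Pi.single a 1)) a
    rw [h₀.2, hs₀] at h1
    simpa using h1
  -- the key point: left multiplication by a coefficient of `A₁` acts at `g` as a scalar
  have key : ∀ (a b : Fin 2) (c : ConvDual k H),
      (ρ.coef a b * c) g = -(if a = b then 1 else 0) * c g := by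
    intro a b c
    let ψ : ∀ t, (Fin (Quotient.out (i t)).dim → k) →ₗ[k] k := fun t =>
      c.ofConv ∘ₗ E.symm.toLinearMap ∘ₗ
        LinearMap.single k (fun t => Fin (Quotient.out (i t)).dim → k) t
    have hsum : ∀ y, c (E.symm y) = ∑ t, ψ t (y t) := fun y => by
      conv_lhs =>
        rw [← LinearMap.sum_single_apply (fun t => Fin (Quotient.out (i t)).dim → k) y]
      rw [map_sum, map_sum]
      rfl
    have hc : c = ∑ t, WithConv.toConv
        (ψ t ∘ₗ LinearMap.applyₗ (E 1 t) ∘ₗ (Quotient.out (i t)).rep.toLinearMap) := by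
      ext x
      rw [ConvDual.sum_apply, ← E.symm_apply_apply x, hsum, E.symm_apply_apply]
      refine Finset.sum_congr rfl fun t _ => congrArg (ψ t) ?_
      rw [← mul_one x, hE, mul_one]
      rfl
    have hterm : ∀ t, (ρ.coef a b * WithConv.toConv
        (ψ t ∘ₗ LinearMap.applyₗ (E 1 t) ∘ₗ (Quotient.out (i t)).rep.toLinearMap)) g =
        -(if a = b then 1 else 0) * ψ t (sgn (i t) • E 1 t) := by
      intro t
      have h1 := signElement_act E hE sgn
        (tensorRep (ρ.component 1) (Quotient.out (i t)).rep) (c := -sgn (i t))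
        (fun j hj => hodd j (i t) (mcKayArrows_ne_zero _ hj))
        (⟨gen k q b, gen_mem_grading b⟩ ⊗ₜ E 1 t)
      refine (coef_mul_matrixCoef_apply ρ _ a b (ψ t) (E 1 t) g).trans ?_
      refine (congrArg (fun x => LinearMap.mul' k k (TensorProduct.map
        (coord k q a ∘ₗ (SkewPlane.grading k q 1).subtype) (ψ t) x)) h1).trans ?_
      rw [map_smul, map_smul, TensorProduct.map_tmul, LinearMap.mul'_apply, LinearMap.comp_apply,
        Submodule.subtype_apply, coord_gen, map_smul, smul_eq_mul, smul_eq_mul]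
      ring
    have hgs : c g = ∑ t, ψ t (sgn (i t) • E 1 t) := hsum _
    rw [hgs, Finset.mul_sum, ← Finset.sum_congr rfl fun t _ => hterm t]
    conv_lhs => rw [hc, Finset.mul_sum]
    exact ConvDual.sum_apply _ _ _
  have hcoef : ρ.ActsByNegOne g := by
    intro a b
    have h1 := key a b 1
    rw [mul_one, ConvDual.one_apply, hcounit, mul_one] at h1
    rw [h1]
    split_ifs <;> simp
  have hmul : ∀ c ∈ ρ.coefAlgebra, ∀ d : ConvDual k H, (c * d) g = c g * d g := by
    intro c hc
    replace hc := mem_span_closure hc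
    induction hc using Submodule.span_induction with
    | mem c hc =>
      induction hc using Submonoid.closure_induction_left with
      | one =>
        intro d
        rw [one_mul, ConvDual.one_apply, hcounit, one_mul]
      | mul_left x hx c _ ih =>
        intro d
        obtain ⟨p, rfl⟩ := hx
        rw [mul_assoc, key, ih, key, mul_assoc]
    | zero =>
      intro d
      rw [zero_mul]
      exact (zero_mul _).symm
    | add c c' _ _ hc hc' =>
      intro d
      rw [add_mul]
      exact (congrArg₂ (· + ·) (hc d) (hc' d)).trans (add_mul (c g) (c' g) (d g)).symm
    | smul a c _ hc =>
      intro d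
      rw [smul_mul_assoc]
      exact (congrArg (a * ·) (hc d)).trans (mul_assoc a (c g) (d g)).symm
  refine ⟨g, ⟨hcounit, ?_⟩, Subring.mem_center_iff.2 fun x => (signElement_comm E hE sgn x).symm,
    signElement_mul_self E hE sgn hs, hcoef, hact⟩
  rw [← sub_eq_zero]
  -- the functionals `c ⊗ d` separate the points of `H ⊗ H`, and take the same value on `Δ(g)` and
  -- `g ⊗ g`
  refine TensorProduct.eq_zero_of_separating (E := WithConv.ofConv '' (ρ.coefAlgebra : Set _))
    (F := WithConv.ofConv '' (ρ.coefAlgebra : Set _))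
    (fun v hv => hsep v fun c hc => hv _ ⟨c, hc, rfl⟩)
    (fun v hv => hsep v fun c hc => hv _ ⟨c, hc, rfl⟩) ?_
  rintro _ ⟨c, hc, rfl⟩ _ ⟨d, hd, rfl⟩
  rw [map_sub, map_sub, TensorProduct.map_tmul, LinearMap.mul'_apply, sub_eq_zero]
  exact (LinearMap.convMul_apply c d g).symm.trans (hmul c hc d)

end GradedHopfAction


/-! ### Cocommutative Hopf algebras are group algebras -/

section Cocommutative

variable {k K : Type*} [Field k] [Ring K]

/-- A finite-dimensional bialgebra in characteristic zero has no nonzero primitive element `p`: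
contracting `Δ(μ(p)) = 0`, for the minimal polynomial `μ` of degree `n ≥ 2`, with a functional that
is `1` at `p` and `0` at the other powers of degree less than `n` would give a relation
`μ'(p) + c = 0` of smaller degree. -/
theorem eq_zero_of_isPrimitive [Bialgebra k K] [Module.Finite k K] [CharZero k] {p : K}
    (hp : Coalgebra.comul (R := k) p = p ⊗ₜ 1 + 1 ⊗ₜ p) : p = 0 := by
  rcases subsingleton_or_nontrivial K with hK | hK
  · exact Subsingleton.elim _ _
  have hint : IsIntegral k p := Algebra.IsIntegral.isIntegral p
  set μ := minpoly k p with hμ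
  set n := μ.natDegree with hn
  have hε : Coalgebra.counit (R := k) p = 0 := by
    have h := Coalgebra.rTensor_counit_comul (R := k) p
    rw [hp, map_add, LinearMap.rTensor_tmul, LinearMap.rTensor_tmul, Bialgebra.counit_one] at h
    have h2 := congrArg (LinearMap.mul' k k ∘ₗ
      TensorProduct.map LinearMap.id (Coalgebra.counit (R := k) (A := K))) h
    simpa using h2
  rcases Nat.lt_or_ge n 2 with h2 | h2
  · have h1 : n = 1 := by
      have : 0 < n := minpoly.natDegree_pos hint
      omega
    obtain ⟨c, rfl⟩ := minpoly.natDegree_eq_one_iff.1 h1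
    rw [Bialgebra.counit_algebraMap] at hε
    rw [hε, map_zero]
  exfalso
  have hli := linearIndependent_pow (K := k) p
  obtain ⟨F, hF⟩ := LinearMap.exists_leftInverse_of_injective
    (Finsupp.linearCombination k fun i : Fin n => p ^ (i : ℕ)) (LinearMap.ker_eq_bot.2 hli)
  let f : K →ₗ[k] k := Finsupp.lapply ⟨1, h2⟩ ∘ₗ F
  have hf : ∀ i, i < n → f (p ^ i) = if i = 1 then 1 else 0 := by
    intro i hi
    have h := LinearMap.congr_fun hF (Finsupp.single ⟨i, hi⟩ 1)
    rw [LinearMap.comp_apply, Finsupp.linearCombination_single, one_smul] at h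
    show F (p ^ i) ⟨1, h2⟩ = _
    rw [h, LinearMap.id_apply, Finsupp.single_apply]
    simp
  -- contraction of the coproduct with `f`
  let R : K →ₗ[k] K := (TensorProduct.rid k K).toLinearMap ∘ₗ f.lTensor K ∘ₗ Coalgebra.comul
  have hR : ∀ m, R (p ^ m) = ∑ i ∈ Finset.range (m + 1), ((m.choose i : k) * f (p ^ i)) •
      p ^ (m - i) := by
    intro m
    have hcomm : Commute ((1 : K) ⊗ₜ[k] p) (p ⊗ₜ[k] (1 : K)) := by
      show _ * _ = _ * _
      simp
    show TensorProduct.rid k K (f.lTensor K (Coalgebra.comul (R := k) (p ^ m))) = _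
    rw [Bialgebra.comul_pow, hp, add_comm, hcomm.add_pow, map_sum, map_sum]
    refine Finset.sum_congr rfl fun i _ => ?_
    rw [Algebra.TensorProduct.tmul_pow, Algebra.TensorProduct.tmul_pow, one_pow, one_pow,
      Algebra.TensorProduct.tmul_mul_tmul, one_mul, mul_one, ← nsmul_eq_mul', map_nsmul, map_nsmul,
      LinearMap.lTensor_tmul, TensorProduct.rid_tmul, mul_smul, Nat.cast_smul_eq_nsmul]
  have hRlt : ∀ m, m < n → R (p ^ m) = (m : k) • p ^ (m - 1) := by
    intro m hm
    rw [hR]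
    rcases Nat.eq_zero_or_pos m with rfl | h0
    · rw [Finset.sum_range_one, hf 0 hm]
      simp
    · rw [Finset.sum_eq_single 1]
      · rw [hf 1 (by omega)]
        simp
      · intro i hi h1
        rw [hf i (by rw [Finset.mem_range] at hi; omega), if_neg h1, mul_zero, zero_smul]
      · intro h
        rw [Finset.mem_range] at h
        omega
  have hRn : R (p ^ n) = (n : k) • p ^ (n - 1) + f (p ^ n) • 1 := by
    rw [hR, Finset.sum_range_succ, Finset.sum_eq_single 1]
    · rw [hf 1 h2]
      simp
    · intro i hi h1
      rw [hf i (Finset.mem_range.1 hi), if_neg h1, mul_zero, zero_smul]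
    · intro h
      rw [Finset.mem_range] at h
      omega
  have hmonic : μ.Monic := minpoly.monic hint
  have haeval : Polynomial.aeval p μ = 0 := minpoly.aeval k p
  have hd : Polynomial.aeval p (Polynomial.derivative μ) =
      ∑ i ∈ Finset.range n, μ.coeff i • (i : k) • p ^ (i - 1) + (n : k) • p ^ (n - 1) := by
    conv_lhs => rw [μ.as_sum_range, ← hn]
    rw [map_sum, map_sum, Finset.sum_range_succ]
    simp only [Polynomial.derivative_monomial, Polynomial.aeval_monomial, ← Algebra.smul_def,
      mul_smul]
    rw [show μ.coeff n = 1 from hmonic.coeff_natDegree, one_smul]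
  have h0 : Polynomial.aeval p (Polynomial.derivative μ + Polynomial.C (f (p ^ n))) = 0 := by
    have h1 := congrArg R haeval
    rw [map_zero, Polynomial.aeval_eq_sum_range, map_sum, Finset.sum_range_succ, ← hn, map_smul,
      hRn, show μ.coeff n = 1 from hmonic.coeff_natDegree, one_smul, ← add_assoc] at h1
    rw [← h1, map_add, Polynomial.aeval_C, Algebra.algebraMap_eq_smul_one, hd]
    congr 2
    refine Finset.sum_congr rfl fun i hi => ?_
    rw [map_smul, hRlt i (Finset.mem_range.1 hi)]
  have hdeg : (Polynomial.derivative μ + Polynomial.C (f (p ^ n))).natDegree < μ.natDegree := by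
    refine lt_of_le_of_lt (Polynomial.natDegree_add_le _ _) (max_lt ?_ ?_)
    · exact Polynomial.natDegree_derivative_lt (by omega)
    · rw [Polynomial.natDegree_C]
      omega
  have hzero := Polynomial.eq_zero_of_dvd_of_natDegree_lt (minpoly.dvd k p h0) hdeg
  have hcoeff := congrArg (fun Q : Polynomial k => Q.coeff (n - 1)) hzero
  simp only [Polynomial.coeff_add, Polynomial.coeff_derivative, Polynomial.coeff_zero] at hcoeff
  rw [Polynomial.coeff_C_of_ne_zero (by omega), Nat.sub_add_cancel (by omega),
    show μ.coeff n = 1 from hmonic.coeff_natDegree, one_mul, add_zero] at hcoeff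
  have : ((n - 1 : ℕ) : k) + 1 = (n : k) := by
    rw [← Nat.cast_add_one, Nat.sub_add_cancel (by omega)]
  rw [this, Nat.cast_eq_zero] at hcoeff
  omega

/-- An algebra map `K^* → k` is the evaluation at a grouplike element. -/
theorem exists_isGroupLikeElem_of_algHom [Bialgebra k K] [Module.Finite k K]
    (x : ConvDual k K →ₐ[k] k) : ∃ y : K, IsGroupLikeElem k y ∧ ∀ b, x b = b y := by
  let y := (Module.evalEquiv k K).symm
    (x.toLinearMap ∘ₗ (WithConv.linearEquiv k (K →ₗ[k] k)).symm.toLinearMap)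
  have hy : ∀ b, x b = b y := fun b =>
    (LinearMap.congr_fun ((Module.evalEquiv k K).apply_symm_apply (x.toLinearMap ∘ₗ
      (WithConv.linearEquiv k (K →ₗ[k] k)).symm.toLinearMap)) b.ofConv).symm
  refine ⟨y, ⟨?_, ?_⟩, hy⟩
  · rw [← ConvDual.one_apply (k := k) y, ← hy, map_one]
  · rw [← sub_eq_zero]
    refine TensorProduct.eq_zero_of_separating (E := Set.univ) (F := Set.univ)
      (fun v hv => (Module.forall_dual_apply_eq_zero_iff k v).1 fun f => hv f trivial)
      (fun v hv => (Module.forall_dual_apply_eq_zero_iff k v).1 fun f => hv f trivial) ?_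
    intro e _ f _
    have h := map_mul x (WithConv.toConv e) (WithConv.toConv f)
    rw [hy, hy, hy] at h
    rw [map_sub, map_sub, TensorProduct.map_tmul, LinearMap.mul'_apply, sub_eq_zero]
    exact h

variable [HopfAlgebra k K] [Module.Finite k K] [CharZero k]

/-- `K^*` has no nonzero point derivations: one at the grouplike element `y` is the evaluation at
`y p` for a primitive element `p`, and `p = 0`. -/
theorem eq_zero_of_pointDerivation {y : K} (hy : IsGroupLikeElem k y) {δ : ConvDual k K →ₗ[k] k}
    (hδ : ∀ b c : ConvDual k K, δ (b * c) = b y * δ c + δ b * c y) : δ = 0 := by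
  let z := (Module.evalEquiv k K).symm
    (δ ∘ₗ (WithConv.linearEquiv k (K →ₗ[k] k)).symm.toLinearMap)
  have hz : ∀ b, δ b = b z := fun b =>
    (LinearMap.congr_fun ((Module.evalEquiv k K).apply_symm_apply (δ ∘ₗ
      (WithConv.linearEquiv k (K →ₗ[k] k)).symm.toLinearMap)) b.ofConv).symm
  have hΔ : Coalgebra.comul (R := k) z = y ⊗ₜ z + z ⊗ₜ y := by
    rw [← sub_eq_zero]
    refine TensorProduct.eq_zero_of_separating (E := Set.univ) (F := Set.univ)
      (fun v hv => (Module.forall_dual_apply_eq_zero_iff k v).1 fun f => hv f trivial)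
      (fun v hv => (Module.forall_dual_apply_eq_zero_iff k v).1 fun f => hv f trivial) ?_
    intro e _ f _
    have h := hδ (WithConv.toConv e) (WithConv.toConv f)
    rw [hz, hz, hz] at h
    rw [map_sub, map_sub, map_add, map_add, TensorProduct.map_tmul, LinearMap.mul'_apply,
      TensorProduct.map_tmul, LinearMap.mul'_apply, sub_eq_zero]
    exact h
  have hp : HopfAlgebra.antipode k y * z = 0 := eq_zero_of_isPrimitive (k := k) (by
    rw [Bialgebra.comul_mul, hy.antipode.comul_eq_tmul_self, hΔ, mul_add,
      Algebra.TensorProduct.tmul_mul_tmul, Algebra.TensorProduct.tmul_mul_tmul,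
      hy.antipode_mul_cancel, add_comm])
  have hz0 : z = 0 := by
    rw [← one_mul z, ← hy.mul_antipode_cancel (R := k), mul_assoc, hp, mul_zero]
  refine LinearMap.ext fun b => ?_
  rw [hz, hz0, map_zero, LinearMap.zero_apply]

variable [Coalgebra.IsCocomm k K] [IsAlgClosed k]

omit [CharZero k] in
/-- Over an algebraically closed field the maximal ideals of `K^*` are kernels of algebra maps to
`k`. -/
theorem exists_algHom_of_isMaximal (m : Ideal (ConvDual k K)) [m.IsMaximal] :
    ∃ x : ConvDual k K →ₐ[k] k, ∀ b, b ∈ m ↔ x b = 0 := by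
  have : Module.Finite k (ConvDual k K) :=
    Module.Finite.equiv (WithConv.linearEquiv k (K →ₗ[k] k)).symm
  have : Module.Finite k (ConvDual k K ⧸ m) :=
    Module.Finite.of_surjective (Ideal.Quotient.mkₐ k m).toLinearMap
      (Ideal.Quotient.mkₐ_surjective k m)
  let := Ideal.Quotient.field m
  have hbij : Function.Bijective (algebraMap k (ConvDual k K ⧸ m)) :=
    IsAlgClosed.algebraMap_bijective_of_isIntegral
  let e : k ≃ₐ[k] (ConvDual k K ⧸ m) := AlgEquiv.ofBijective (Algebra.ofId k _) hbij
  refine ⟨(e.symm : _ →ₐ[k] k).comp (Ideal.Quotient.mkₐ k m), fun b => ?_⟩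
  rw [← Ideal.Quotient.eq_zero_iff_mem]
  exact (map_eq_zero_iff e.symm e.symm.injective).symm

/-- As all point derivations vanish, each maximal ideal of `K^*` is idempotent, hence generated by
an idempotent. -/
theorem exists_isIdempotentElem_of_isMaximal (m : Ideal (ConvDual k K)) [m.IsMaximal] :
    ∃ e : ConvDual k K, e * e = e ∧ m = Ideal.span {e} := by
  have : Module.Finite k (ConvDual k K) :=
    Module.Finite.equiv (WithConv.linearEquiv k (K →ₗ[k] k)).symm
  have : IsNoetherianRing (ConvDual k K) := IsNoetherianRing.of_finite k _
  obtain ⟨x, hx⟩ := exists_algHom_of_isMaximal m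
  obtain ⟨y, hy, hxy⟩ := exists_isGroupLikeElem_of_algHom x
  have hm : m * m = m := by
    refine le_antisymm Ideal.mul_le_right fun b₀ hb₀ => ?_
    by_contra hb
    obtain ⟨δ, hδ, hδm⟩ := Submodule.exists_le_ker_of_notMem (p := (m * m).restrictScalars k) hb
    let δ' : ConvDual k K →ₗ[k] k :=
      δ ∘ₗ (LinearMap.id - (Algebra.linearMap k _) ∘ₗ x.toLinearMap)
    have h0 : δ' = 0 := eq_zero_of_pointDerivation hy fun b c => by
      have h1 : ∀ b, b - algebraMap k _ (x b) ∈ m := fun b => (hx _).2 (by simp)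
      have h2 : δ ((b - algebraMap k _ (x b)) * (c - algebraMap k _ (x c))) = 0 :=
        hδm (Ideal.mul_mem_mul (h1 b) (h1 c))
      show δ (b * c - algebraMap k _ (x (b * c))) = b y * δ (c - algebraMap k _ (x c)) +
        δ (b - algebraMap k _ (x b)) * c y
      have h3 : b * c - algebraMap k _ (x (b * c)) =
          (b - algebraMap k _ (x b)) * (c - algebraMap k _ (x c)) +
            (x b • (c - algebraMap k _ (x c)) + x c • (b - algebraMap k _ (x b))) := by
        rw [map_mul, Algebra.smul_def, Algebra.smul_def, map_mul]
        ring
      rw [← hxy, ← hxy, h3, map_add, map_add, map_smul, map_smul, h2, smul_eq_mul, smul_eq_mul]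
      ring
    have h1 := LinearMap.congr_fun h0 b₀
    refine hδ (Eq.trans ?_ h1)
    show δ b₀ = δ (b₀ - algebraMap k _ (x b₀))
    rw [(hx b₀).1 hb₀, map_zero, sub_zero]
  obtain ⟨e, he, hme⟩ := (Ideal.isIdempotentElem_iff_of_fg m
    (IsNoetherian.noetherian m)).1 hm
  exact ⟨e, he, hme⟩

/-- The Jacobson radical of `K^*` vanishes: if `b` is in the maximal ideal `m`, generated by the
idempotent `e`, then `1 - e` annihilates `b`, so that the annihilator of `b` is not in `m`. -/
theorem eq_zero_of_mem_isMaximal {b : ConvDual k K}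
    (hb : ∀ m : Ideal (ConvDual k K), m.IsMaximal → b ∈ m) : b = 0 := by
  have h : Ideal.torsionOf (ConvDual k K) (ConvDual k K) b = ⊤ := by
    by_contra h
    obtain ⟨m, hm, hle⟩ := Ideal.exists_le_maximal _ h
    obtain ⟨e, he, hme⟩ := exists_isIdempotentElem_of_isMaximal m
    have hbm := hb m hm
    rw [hme, Ideal.mem_span_singleton'] at hbm
    obtain ⟨c, rfl⟩ := hbm
    have h1 : 1 - e ∈ m := hle ((Ideal.mem_torsionOf_iff _ _).2 (by
      rw [smul_eq_mul]
      linear_combination -c * he))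
    have h2 : e ∈ m := by rw [hme]; exact Ideal.mem_span_singleton_self e
    exact hm.ne_top ((Ideal.eq_top_iff_one m).2 (by simpa using m.add_mem h1 h2))
  have h1 := (Ideal.mem_torsionOf_iff (R := ConvDual k K) b 1).1 (h ▸ Submodule.mem_top)
  rwa [one_smul] at h1

variable (k K)

/-- The grouplike elements span `K`: a functional that vanishes on them lies in every maximal ideal
of `K^*`. -/
theorem span_groupLike_eq_top :
    Submodule.span k (Set.range (GroupLike.val (R := k) (A := K))) = ⊤ := by
  by_contra h
  obtain ⟨f, hf, hle⟩ := Submodule.exists_le_ker_of_lt_top _ (lt_top_iff_ne_top.2 h)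
  refine hf (congrArg WithConv.ofConv (eq_zero_of_mem_isMaximal (b := WithConv.toConv f)
    fun m hm => ?_))
  obtain ⟨x, hx⟩ := exists_algHom_of_isMaximal m
  obtain ⟨y, hy, hxy⟩ := exists_isGroupLikeElem_of_algHom x
  rw [hx, hxy]
  exact hle (Submodule.subset_span ⟨⟨y, hy⟩, rfl⟩)

/-- A finite-dimensional cocommutative Hopf algebra over an algebraically closed field of
characteristic zero is the group algebra of its grouplike elements. -/
theorem bijective_liftGroupLikeBialgHom :
    Function.Bijective (MonoidAlgebra.liftGroupLikeBialgHom (R := k) (A := K)) := by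
  have h : ∀ y, MonoidAlgebra.liftGroupLikeBialgHom (R := k) (A := K) y =
      Finsupp.linearCombination k (GroupLike.val (R := k) (A := K))
        (MonoidAlgebra.coeffLinearEquiv k y) := by
    have e : (MonoidAlgebra.liftGroupLikeBialgHom (R := k) (A := K)).toCoalgHom.toLinearMap =
        Finsupp.linearCombination k (GroupLike.val (R := k) (A := K)) ∘ₗ
          (MonoidAlgebra.coeffLinearEquiv k).toLinearMap := by
      refine MonoidAlgebra.lhom_ext' fun y => LinearMap.ext_ring ?_
      refine (MonoidAlgebra.lift_single _ _ _).trans ?_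
      exact (Finsupp.linearCombination_single k (1 : k) y).symm
    exact fun y => LinearMap.congr_fun e y
  constructor
  · intro y z hyz
    rw [h, h] at hyz
    exact (MonoidAlgebra.coeffLinearEquiv k).injective
      ((linearIndep_groupLikeVal (R := k) (A := K)) hyz)
  · intro z
    have hz : z ∈ Submodule.span k (Set.range (GroupLike.val (R := k) (A := K))) := by
      rw [span_groupLike_eq_top]
      trivial
    obtain ⟨c, hc⟩ := (Finsupp.mem_span_range_iff_exists_finsupp).1 hz
    refine ⟨(MonoidAlgebra.coeffLinearEquiv k).symm c, ?_⟩
    rw [h, LinearEquiv.apply_symm_apply]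
    exact hc

end Cocommutative


/-! ### The quotient by the central grouplike element -/

/-- For `q = ±1` the products of two entries commute, since the signs cancel. -/
theorem QuantumSLRelations.commute_mul {k D : Type*} [Field k] [Ring D] [Algebra k D] {q : k}
    (hq : q * q = 1) {X : Fin 2 → Fin 2 → D} (hX : QuantumSLRelations q X)
    (s t s' t' : Fin 2 × Fin 2) :
    Commute (X s.1 s.2 * X t.1 t.2) (X s'.1 s'.2 * X t'.1 t'.2) := by
  have hq2 : ∀ n : ℕ, q ^ n * q ^ n = 1 := fun n => by rw [← mul_pow, hq, one_pow]
  have h1 : ∀ r : Fin 2 × Fin 2, X s.1 s.2 * X t.1 t.2 * X r.1 r.2 =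
      q ^ ((s.1 : ℕ) + s.2 + t.1 + t.2) • (X r.1 r.2 * (X s.1 s.2 * X t.1 t.2)) := by
    intro r
    rw [mul_assoc, hX.comm t.1 t.2 r.1 r.2, mul_smul_comm, ← mul_assoc, hX.comm s.1 s.2 r.1 r.2,
      smul_mul_assoc, smul_smul, mul_assoc]
    congr 1
    have e : q ^ ((t.1 : ℕ) + t.2 + r.1 + r.2) * q ^ ((s.1 : ℕ) + s.2 + r.1 + r.2) =
        q ^ ((s.1 : ℕ) + s.2 + t.1 + t.2) *
          (q ^ ((r.1 : ℕ) + r.2) * q ^ ((r.1 : ℕ) + r.2)) := by ring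
    rw [e, hq2, mul_one]
  show _ * _ = _ * _
  rw [← mul_assoc, h1, smul_mul_assoc, mul_assoc (X s'.1 s'.2), h1, mul_smul_comm, smul_smul, hq2,
    one_smul, mul_assoc]

section Quotient

variable {k H : Type*} [Field k] [Ring H] [HopfAlgebra k H] {g : H}

theorem isTwoSided_span_sub_one (hc : g ∈ Subring.center H) :
    (Ideal.span {g - 1}).IsTwoSided := ⟨fun {x} y hx => by
  obtain ⟨z, rfl⟩ := Ideal.mem_span_singleton'.1 hx
  refine Ideal.mem_span_singleton'.2 ⟨z * y, ?_⟩
  rw [mul_assoc, mul_assoc, mul_sub, sub_mul, Subring.mem_center_iff.1 hc, mul_one, one_mul]⟩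

/-- For a central grouplike `g` of order two, `H (g - 1)` is a Hopf ideal. -/
theorem isHopfIdeal_span_sub_one (hg : IsGroupLikeElem k g) (hc : g ∈ Subring.center H)
    (hgg : g * g = 1) : (Ideal.span {g - 1}).IsHopfIdeal k where
  counit_eq_zero := fun x hx => by
    obtain ⟨z, rfl⟩ := Ideal.mem_span_singleton'.1 hx
    rw [Bialgebra.counit_mul, map_sub, hg.counit_eq_one, Bialgebra.counit_one, sub_self, mul_zero]
  map_mkQ_comul_eq_zero := fun x hx => by
    obtain ⟨z, rfl⟩ := Ideal.mem_span_singleton'.1 hx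
    have h1 : ∀ x, ((Ideal.span {g - 1}).restrictScalars k).mkQ (x * g) =
        ((Ideal.span {g - 1}).restrictScalars k).mkQ x := fun x => by
      rw [← sub_eq_zero, ← map_sub]
      exact (Submodule.Quotient.mk_eq_zero _).2
        (Ideal.mem_span_singleton'.2 ⟨x, by rw [mul_sub, mul_one]⟩)
    have h2 : ∀ t : H ⊗[k] H, TensorProduct.map ((Ideal.span {g - 1}).restrictScalars k).mkQ
        ((Ideal.span {g - 1}).restrictScalars k).mkQ (t * (g ⊗ₜ g)) =
        TensorProduct.map ((Ideal.span {g - 1}).restrictScalars k).mkQ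
          ((Ideal.span {g - 1}).restrictScalars k).mkQ t := by
      intro t
      induction t using TensorProduct.induction_on with
      | zero => rw [zero_mul]
      | tmul x y =>
        rw [Algebra.TensorProduct.tmul_mul_tmul, TensorProduct.map_tmul, TensorProduct.map_tmul,
          h1, h1]
      | add x y hx hy => rw [add_mul, map_add, map_add, hx, hy]
    rw [Bialgebra.comul_mul, map_sub, hg.comul_eq_tmul_self, Bialgebra.comul_one, mul_sub, mul_one,
      map_sub, h2, sub_self]
  antipode_mem := fun x hx => by
    obtain ⟨z, rfl⟩ := Ideal.mem_span_singleton'.1 hx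
    have hS : HopfAlgebra.antipode k g = g := by
      rw [← mul_one (HopfAlgebra.antipode k g), ← hgg, ← mul_assoc, hg.antipode_mul_cancel, one_mul]
    refine Ideal.mem_span_singleton'.2 ⟨HopfAlgebra.antipode k z, ?_⟩
    rw [HopfAlgebra.antipode_mul_antidistrib, map_sub, hS, HopfAlgebra.antipode_one, mul_sub,
      sub_mul, Subring.mem_center_iff.1 hc, mul_one, one_mul]

end Quotient

namespace GradedHopfAction

open SkewPlane

variable {k H : Type*} [Field k] [Ring H] [HopfAlgebra k H] {q : k}
  {ρ : GradedHopfAction k H (SkewPlane.grading k q)} {g : H}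

/-- The products of an even number of matrix coefficients on `A₁`. -/
noncomputable def evenWords (ρ : GradedHopfAction k H (SkewPlane.grading k q)) :
    Submonoid (ConvDual k H) :=
  Submonoid.closure (Set.range fun p : (Fin 2 × Fin 2) × (Fin 2 × Fin 2) =>
    ρ.coef p.1.1 p.1.2 * ρ.coef p.2.1 p.2.2)

theorem commute_of_mem_evenWords (hq : q * q = 1) (hc : QuantumSLRelations q ρ.coef)
    {c d : ConvDual k H} (hce : c ∈ ρ.evenWords) (hde : d ∈ ρ.evenWords) : Commute c d := by
  induction hce using Submonoid.closure_induction with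
  | mem c hcm =>
    obtain ⟨p, rfl⟩ := hcm
    induction hde using Submonoid.closure_induction with
    | mem d hdm =>
      obtain ⟨p', rfl⟩ := hdm
      exact hc.commute_mul hq _ _ _ _
    | one => exact Commute.one_right _
    | mul d d' _ _ h h' => exact h.mul_right h'
  | one => exact Commute.one_left _
  | mul c c' _ _ h h' => exact h.mul_left h'

/-- The even words factor through the quotient of `H` by `g - 1`. -/
theorem evenWords_mul (hg : ρ.ActsByNegOne g) (hgl : IsGroupLikeElem k g) {c : ConvDual k H}
    (hc : c ∈ ρ.evenWords) (h : H) : c (h * g) = 1 * c h := by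
  induction hc using Submonoid.closure_induction generalizing h with
  | mem c hc =>
    obtain ⟨p, rfl⟩ := hc
    exact (hg.coef_coef_mul hgl _ _ _ _ h).trans (one_mul _).symm
  | one =>
    rw [one_mul, ConvDual.one_apply, Bialgebra.counit_mul, hgl.counit_eq_one, mul_one]
    rfl
  | mul c d _ _ hc hd => rw [ConvDual.mul_apply_mul_of_isGroupLike hgl h hc hd, mul_one]

/-- The even words separate the points of `H / H (g - 1)`. -/
theorem mem_span_of_evenWords [NeZero (2 : k)] (hg : ρ.ActsByNegOne g)
    (hgl : IsGroupLikeElem k g) (hsep : ∀ x : H, (∀ c ∈ ρ.coefAlgebra, c x = 0) → x = 0) {x : H}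
    (hx : ∀ c ∈ ρ.evenWords, c x = 0) : x ∈ Ideal.span {g - 1} := by
  have hword : ∀ c ∈ Submonoid.closure (Set.range fun p : Fin 2 × Fin 2 => ρ.coef p.1 p.2),
      c ∈ ρ.evenWords ∨ ((∀ h, c (h * g) = -1 * c h) ∧ ∀ i j, ρ.coef i j * c ∈ ρ.evenWords) := by
    intro c hc
    induction hc using Submonoid.closure_induction_left with
    | one => exact Or.inl (one_mem _)
    | mul_left d hd c _ ih =>
      obtain ⟨p, rfl⟩ := hd
      rcases ih with h1 | ⟨-, h2⟩
      · right
        refine ⟨fun h => (ConvDual.mul_apply_mul_of_isGroupLike hgl h (a := -1) (b := 1)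
          (fun h => ?_) fun h => evenWords_mul hg hgl h1 h).trans (by rw [mul_one]), fun i j => ?_⟩
        · rw [hg.coef_mul, neg_one_mul]
        · rw [← mul_assoc]
          exact mul_mem (Submonoid.subset_closure ⟨((i, j), p), rfl⟩) h1
      · exact Or.inl (h2 _ _)
  -- on `x + x g` the odd words vanish as well
  have hz : x + x * g = 0 := by
    refine hsep _ fun c hc => ?_
    replace hc := mem_span_closure hc
    induction hc using Submodule.span_induction with
    | mem c hc =>
      rw [map_add]
      rcases hword c hc with h1 | ⟨h1, -⟩
      · rw [evenWords_mul hg hgl h1, hx c h1]; ring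
      · rw [h1]; ring
    | zero => rfl
    | add c d _ _ hc hd => exact (congrArg₂ (· + ·) hc hd).trans (add_zero 0)
    | smul r c _ hc => exact (congrArg (r * ·) hc).trans (mul_zero r)
  refine Ideal.mem_span_singleton'.2 ⟨(-(2 : k)⁻¹) • x, ?_⟩
  have h2 : (2 : k) ≠ 0 := NeZero.ne 2
  rw [smul_mul_assoc, mul_sub, mul_one, eq_neg_of_add_eq_zero_right hz,
    show -x - x = (-2 : k) • x by module, smul_smul]
  rw [show -(2 : k)⁻¹ * -2 = 1 by field_simp, one_smul]

/-- The quotient of `H` by a central grouplike that acts on `A₁` by `-1` is a group algebra: the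
even words commute, so that it is cocommutative. -/
theorem exists_isCentralExtension.{u, v} {k : Type u} {H : Type v} [Field k] [Ring H]
    [HopfAlgebra k H] {q : k} {ρ : GradedHopfAction k H (SkewPlane.grading k q)} {g : H}
    [IsAlgClosed k] [CharZero k] [Module.Finite k H] (hq : q * q = 1)
    (hc : QuantumSLRelations q ρ.coef) (hsep : ∀ x : H, (∀ c ∈ ρ.coefAlgebra, c x = 0) → x = 0)
    (hg : ρ.ActsByNegOne g) (hgl : IsGroupLikeElem k g) (hcen : g ∈ Subring.center H)
    (hgg : g * g = 1) :
    ∃ (G : Type v) (_ : Group G) (_ : Finite G) (π : H →ₐc[k] MonoidAlgebra k G),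
      IsCentralExtension g π := by
  have h2 : (2 : k) ≠ 0 := two_ne_zero
  have := isTwoSided_span_sub_one hcen
  have := isHopfIdeal_span_sub_one (k := k) hgl hcen hgg
  let K := H ⧸ Ideal.span {g - 1}
  have : Module.Finite k K :=
    Module.Finite.of_surjective (Ideal.Quotient.mkₐ k _).toLinearMap
      (Ideal.Quotient.mkₐ_surjective k (Ideal.span {g - 1}))
  let mk : H →ₗ[k] K := (Ideal.Quotient.mkₐ k (Ideal.span {g - 1})).toLinearMap
  have hmk : Function.Surjective mk := Ideal.Quotient.mkₐ_surjective k (Ideal.span {g - 1})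
  let E : Set (K →ₗ[k] k) := {e | ∃ c ∈ ρ.evenWords, e ∘ₗ mk = c.ofConv}
  have hE : ∀ v, (∀ e ∈ E, e v = 0) → v = 0 := by
    intro v hv
    obtain ⟨x, rfl⟩ := hmk v
    refine Ideal.Quotient.eq_zero_iff_mem.2 (mem_span_of_evenWords hg hgl hsep fun c hc => ?_)
    have hle : (Ideal.span {g - 1}).restrictScalars k ≤ LinearMap.ker c.ofConv := by
      intro z hz
      obtain ⟨y, rfl⟩ := Ideal.mem_span_singleton'.1 hz
      rw [LinearMap.mem_ker, mul_sub, mul_one, map_sub, evenWords_mul hg hgl hc, one_mul, sub_self]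
    exact hv (((Ideal.span {g - 1}).restrictScalars k).liftQ c.ofConv hle)
      ⟨c, hc, Submodule.liftQ_mkQ _ _ _⟩
  have hcocomm : Coalgebra.IsCocomm k K := ⟨by
    refine LinearMap.ext fun v => ?_
    obtain ⟨x, rfl⟩ := hmk v
    rw [← sub_eq_zero]
    refine TensorProduct.eq_zero_of_separating hE hE ?_
    rintro e ⟨c, hce, he⟩ f ⟨d, hde, hf⟩
    have h1 : ∀ {e f : K →ₗ[k] k} {c d : ConvDual k H}, e ∘ₗ mk = c.ofConv → f ∘ₗ mk = d.ofConv →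
        LinearMap.mul' k k (TensorProduct.map e f (Coalgebra.comul (R := k) (mk x))) =
          (c * d) x := by
      intro e f c d he hf
      rw [LinearMap.convMul_apply, ← he, ← hf, TensorProduct.map_comp]
      rfl
    have h3 : ∀ t : K ⊗[k] K, LinearMap.mul' k k (TensorProduct.map e f
        (TensorProduct.comm k K K t)) = LinearMap.mul' k k (TensorProduct.map f e t) := by
      intro t
      induction t using TensorProduct.induction_on with
      | zero => simp
      | tmul x y => simp [mul_comm]
      | add x y hx hy => rw [map_add, map_add, map_add, hx, hy, map_add, map_add]
    rw [map_sub, map_sub, sub_eq_zero]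
    refine (h3 _).trans ?_
    rw [h1 hf he, h1 he hf, (commute_of_mem_evenWords hq hc hde hce).eq]⟩
  let Φ := BialgEquiv.ofBijective _ (bijective_liftGroupLikeBialgHom k K)
  have hfinG : Finite (GroupLike k K) :=
    (linearIndep_groupLikeVal (R := k) (A := K)).finite_of_isNoetherian
  refine ⟨GroupLike k K, inferInstance, hfinG,
    (Φ.symm : K →ₐc[k] _).comp (Bialgebra.Quotient.mkBialgHom (Ideal.span {g - 1})), hgl, hcen, ?_,
    hgg, ?_, fun x => ?_⟩
  · rintro rfl
    have h1 := hg 0 0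
    rw [ρ.isCorep_coef.one, if_pos rfl, if_pos rfl] at h1
    exact h2 (by linear_combination h1)
  · exact Φ.symm.surjective.comp hmk
  · refine Iff.trans (map_eq_zero_iff Φ.symm Φ.symm.injective) ?_
    refine Ideal.Quotient.eq_zero_iff_mem.trans (Ideal.mem_span_singleton'.trans ?_)
    simp only [eq_comm]

end GradedHopfAction


/-! ### Finite groups determined by their squared traces -/

/-- The function `t` on a group has the properties of `x ↦ tr(M)²`, for the lifts `M` of the
elements `x` to a binary cover. -/
structure IsTraceSq {k Γ : Type*} [Field k] [Group Γ] (t : Γ → k) : Prop where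
  eq_four_iff : ∀ x, t x = 4 ↔ x = 1
  eq_one_iff : ∀ x, t x = 1 ↔ orderOf x = 3
  eq_zero_iff : ∀ x, t x = 0 ↔ orderOf x = 2
  pow_four : ∀ x, t x = 2 → x ^ 4 = 1
  pow_five : ∀ x, t x ^ 2 - 3 * t x + 1 = 0 → x ^ 5 = 1

/-- By the Cayley–Hamilton theorem the trace of an element of `SL₂` decides whether a power of it is
`±1`; finiteness of `Γ` excludes unipotent elements. -/
theorem IsBinaryCover.isTraceSq {k Γ : Type*} [Field k] [CharZero k] [Group Γ] [Finite Γ]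
    {Γt : Subgroup (Matrix.SpecialLinearGroup (Fin 2) k)} {p : Γt →* Γ} (h : IsBinaryCover Γt p)
    {s : Γ → Γt} (hs : ∀ x, p (s x) = x) :
    IsTraceSq fun x => SLTwo.tr (s x : Matrix.SpecialLinearGroup (Fin 2) k) ^ 2 := by
  have h4 : ∀ x : Γ, SLTwo.tr (s x : Matrix.SpecialLinearGroup (Fin 2) k) ^ 2 = 4 ↔ x = 1 := by
    intro x
    conv_rhs => rw [← hs x, h.eq_one_iff]
    constructor
    · intro h1
      have h2 : p (s x) ^ orderOf x = 1 := by rw [hs, pow_orderOf_eq_one]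
      exact SLTwo.eq_of_tr_sq_eq_four (orderOf_pos x).ne' h1 ((h.pow_eq_one_iff _ _).1 h2)
    · rintro (h1 | h1) <;> rw [h1]
      · rw [SLTwo.tr_one]; norm_num
      · rw [SLTwo.tr_neg, SLTwo.tr_one]; norm_num
  have hpow : ∀ (x : Γ) (n : ℕ), ((s x : Matrix.SpecialLinearGroup (Fin 2) k) ^ n = 1 ∨
      (s x : Matrix.SpecialLinearGroup (Fin 2) k) ^ n = -1) → x ^ n = 1 := fun x n h1 => by
    rw [← hs x]; exact (h.pow_eq_one_iff _ n).2 h1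
  refine ⟨h4, fun x => ?_, fun x => ?_, fun x h1 => ?_, fun x h1 => ?_⟩
  · rw [orderOf_eq_prime_iff]
    constructor
    · refine fun h1 => ⟨hpow x 3 (SLTwo.pow_three_of_tr h1), fun h2 => ?_⟩
      have h3 := (h4 x).2 h2
      rw [h1] at h3
      norm_num at h3
    · rintro ⟨h1, h2⟩
      exact h.tr_of_pow_three (s x) (by rwa [hs]) (by rwa [hs])
  · rw [orderOf_eq_prime_iff]
    constructor
    · refine fun h1 => ⟨hpow x 2 (Or.inr (SLTwo.sq_eq_neg_one
        (pow_eq_zero_iff two_ne_zero |>.1 h1))), fun h2 => ?_⟩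
      have h3 := (h4 x).2 h2
      rw [h1] at h3
      norm_num at h3
    · rintro ⟨h1, h2⟩
      have h3 := h.tr_of_sq (s x) (by rwa [hs]) (by rwa [hs])
      rw [h3, zero_pow two_ne_zero]
  · exact hpow x 4 (Or.inr (SLTwo.pow_four_of_tr h1))
  · refine hpow x 5 (SLTwo.pow_five_of_tr ?_)
    linear_combination h1

theorem Finset.sum_eq_mul_natCard {G k : Type*} [Fintype G] [Field k] {F : G → k} {c : k}
    {p : G → Prop} (h1 : ∀ x, p x → F x = c) (h0 : ∀ x, ¬ p x → F x = 0) :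
    ∑ x, F x = c * (Nat.card {x // p x} : k) := by
  classical
  rw [Nat.card_eq_fintype_card, Fintype.card_subtype, ← nsmul_eq_mul', ← Finset.sum_const,
    Finset.sum_filter]
  refine Finset.sum_congr rfl fun x _ => ?_
  split_ifs with h
  exacts [h1 x h, h0 x h]

section Counting

variable {k G : Type*} [Field k] [Group G] [Fintype G] {t : G → k} (ht : IsTraceSq t)

include ht

/-- The sum of a function that vanishes where `t ≠ 4` is its value at `1`. -/
theorem IsTraceSq.sum_eq {F : G → k} {c : k} (h1 : ∀ x, t x = 4 → F x = c)
    (h0 : ∀ x, F x = 0 ∨ t x - 4 = 0) : ∑ x, F x = c := by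
  rw [Finset.sum_eq_mul_natCard (c := c) (p := fun x : G => x = 1)
    (fun x hx => h1 x ((ht.eq_four_iff x).2 hx))
    (fun x hx => (h0 x).resolve_right fun h => hx ((ht.eq_four_iff x).1 (sub_eq_zero.1 h)))]
  simp

theorem IsTraceSq.sum_eq_order_three {F : G → k} {c : k} (h1 : ∀ x, t x = 1 → F x = c)
    (h0 : ∀ x, F x = 0 ∨ t x - 1 = 0) :
    ∑ x, F x = c * (Nat.card {x : G // orderOf x = 3} : k) :=
  Finset.sum_eq_mul_natCard (fun x hx => h1 x ((ht.eq_one_iff x).2 hx))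
    fun x hx => (h0 x).resolve_right fun h => hx ((ht.eq_one_iff x).1 (sub_eq_zero.1 h))

theorem IsTraceSq.sum_eq_order_two {F : G → k} {c : k} (h1 : ∀ x, t x = 0 → F x = c)
    (h0 : ∀ x, F x = 0 ∨ t x = 0) :
    ∑ x, F x = c * (Nat.card {x : G // orderOf x = 2} : k) :=
  Finset.sum_eq_mul_natCard (fun x hx => h1 x ((ht.eq_zero_iff x).2 hx))
    fun x hx => (h0 x).resolve_right fun h => hx ((ht.eq_zero_iff x).1 h)

variable [CharZero k]

/-- In type `Ẽ₆` the relations of the even characters leave only the values `0`, `1`, `4` for the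
trace squares, and orthogonality to the trivial character gives the first moments `1`, `1`, `2` of
their distribution, which determine it. -/
theorem IsTraceSq.alternatingGroup_four {u p v w : G → k} (hu : ∀ x, u x = 1)
    (h1 : ∀ x, t x * u x = p x + u x) (h2 : ∀ x, t x * v x = p x + v x)
    (h3 : ∀ x, t x * w x = p x + w x) (h4 : ∀ x, t x * p x = 3 * p x + u x + v x + w x)
    (sp : ∑ x, p x = 0) (sv : ∑ x, v x = 0) (sw : ∑ x, w x = 0) :
    Nonempty (G ≃* alternatingGroup (Fin 4)) := by
  have su : ∑ x, u x = Nat.card G := by simp [hu, Nat.card_eq_fintype_card]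
  have hp : ∀ x, p x = t x - 1 := fun x => by linear_combination -h1 x + (t x - 1) * hu x
  have hpol : ∀ x, t x * (t x - 1) * (t x - 4) = 0 := fun x => by
    linear_combination (t x - 1) * h4 x - (t x - 1) * (t x - 3) * hp x + h2 x + h3 x +
      (t x - 1) * hu x + 2 * hp x
  have e1 : ∑ x, t x * (t x - 1) = 12 := ht.sum_eq (fun x hx => by rw [hx]; norm_num) fun x =>
    mul_eq_zero.1 (hpol x)
  have e2 : ∑ x, t x * (t x - 4) = -3 * (Nat.card {x : G // orderOf x = 3} : k) :=
    ht.sum_eq_order_three (fun x hx => by rw [hx]; norm_num) fun x =>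
      mul_eq_zero.1 (by linear_combination hpol x)
  have f1 : ∑ x, t x * (t x - 1) = (Nat.card G : k) := by
    rw [Finset.sum_congr rfl fun x _ => show t x * (t x - 1) = 3 * p x + u x + v x + w x by
      linear_combination h4 x - t x * hp x]
    simp only [Finset.sum_add_distrib, ← Finset.mul_sum, su, sp, sv, sw]
    ring
  have f2 : ∑ x, t x * (t x - 4) = -2 * Nat.card G := by
    rw [Finset.sum_congr rfl fun x _ => show t x * (t x - 4) = -2 * u x + v x + w x by
      linear_combination h4 x - (t x - 3) * hp x + 3 * hu x]
    simp only [Finset.sum_add_distrib, ← Finset.mul_sum, su, sv, sw]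
    ring
  have hN : Nat.card G = 12 := by exact_mod_cast f1.symm.trans e1
  have hn : 3 * (Nat.card {x : G // orderOf x = 3} : k) = 24 := by
    rw [hN] at f2
    push_cast at f2
    linear_combination e2 - f2
  have hn' : 3 * Nat.card {x : G // orderOf x = 3} = 24 := by exact_mod_cast hn
  exact FiniteGroup.nonempty_mulEquiv_alternatingGroup_four hN (by omega)

/-- In type `Ẽ₇` the values of the trace squares are `0`, `1`, `2`, `4`, and the moments are
`1`, `1`, `2`, `5`. -/
theorem IsTraceSq.perm_four {u b c d e : G → k} (hu : ∀ x, u x = 1)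
    (h1 : ∀ x, t x * u x = u x + b x) (h2 : ∀ x, t x * b x = u x + 2 * b x + c x + e x)
    (h3 : ∀ x, t x * c x = b x + 2 * c x + d x + e x) (h4 : ∀ x, t x * d x = c x + d x)
    (h5 : ∀ x, t x * e x = b x + c x + e x)
    (sb : ∑ x, b x = 0) (sc : ∑ x, c x = 0) (sd : ∑ x, d x = 0) (se : ∑ x, e x = 0) :
    Nonempty (G ≃* Equiv.Perm (Fin 4)) := by
  have su : ∑ x, u x = Nat.card G := by simp [hu, Nat.card_eq_fintype_card]
  have k1 : ∀ x, t x = u x + b x := fun x => by linear_combination h1 x - t x * hu x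
  have k2 : ∀ x, t x ^ 2 = 2 * u x + 3 * b x + c x + e x := fun x => by
    linear_combination t x * k1 x + h1 x + h2 x
  have k3 : ∀ x, t x ^ 3 = 5 * u x + 10 * b x + 6 * c x + d x + 5 * e x := fun x => by
    linear_combination t x * k2 x + 2 * h1 x + 3 * h2 x + h3 x + h5 x
  have hpol : ∀ x, t x * (t x - 1) * (t x - 2) * (t x - 4) = 0 := fun x => by
    have hb : b x = t x - 1 := by linear_combination -k1 x - hu x
    have hce : c x + e x = t x ^ 2 - 3 * t x + 1 := by
      linear_combination -k2 x - 2 * hu x - 3 * hb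
    have hc : t x * c x = t x ^ 3 - 4 * t x ^ 2 + 3 * t x := by
      linear_combination t x * hce - h5 x - hb - hce
    have hd : t x * d x = t x ^ 4 - 6 * t x ^ 3 + 9 * t x ^ 2 - 3 * t x := by
      linear_combination -t x * h3 x + (t x - 1) * hc - t x * hb - t x * hce
    have h6 : t x * (t x * (t x - 1) * (t x - 2) * (t x - 4)) = 0 := by
      linear_combination t x * h4 x - (t x - 1) * hd + hc
    rcases mul_eq_zero.1 h6 with h | h
    · rw [h]; ring
    · exact h
  have e1 : ∑ x, t x * (t x - 1) * (t x - 2) = 24 :=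
    ht.sum_eq (fun x hx => by rw [hx]; norm_num) fun x => mul_eq_zero.1 (hpol x)
  have e2 : ∑ x, t x * (t x - 2) * (t x - 4) = 3 * (Nat.card {x : G // orderOf x = 3} : k) :=
    ht.sum_eq_order_three (fun x hx => by rw [hx]; norm_num) fun x =>
      mul_eq_zero.1 (by linear_combination hpol x)
  have f1 : ∑ x, t x * (t x - 1) * (t x - 2) = (Nat.card G : k) := by
    rw [Finset.sum_congr rfl fun x _ => show t x * (t x - 1) * (t x - 2) =
        u x + 3 * b x + 3 * c x + d x + 2 * e x by
      linear_combination k3 x - 3 * k2 x + 2 * k1 x]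
    simp only [Finset.sum_add_distrib, ← Finset.mul_sum, su, sb, sc, sd, se]
    ring
  have f2 : ∑ x, t x * (t x - 2) * (t x - 4) = (Nat.card G : k) := by
    rw [Finset.sum_congr rfl fun x _ => show t x * (t x - 2) * (t x - 4) =
        u x + 0 * b x + 0 * c x + d x + (-1) * e x by
      linear_combination k3 x - 6 * k2 x + 8 * k1 x]
    simp only [Finset.sum_add_distrib, ← Finset.mul_sum, su, sb, sc, sd, se]
    ring
  have hN : Nat.card G = 24 := by exact_mod_cast f1.symm.trans e1
  have hn : 3 * Nat.card {x : G // orderOf x = 3} = 24 := by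
    rw [← hN]; exact_mod_cast e2.symm.trans f2
  refine FiniteGroup.nonempty_mulEquiv_perm_four hN (by omega) fun x => ?_
  rcases mul_eq_zero.1 (hpol x) with h | h
  · rcases mul_eq_zero.1 h with h | h
    · rcases mul_eq_zero.1 h with h | h
      · right
        rw [show 4 = 2 * 2 from rfl, pow_mul, ← (ht.eq_zero_iff x).1 h, pow_orderOf_eq_one, one_pow]
      · left
        rw [← (ht.eq_one_iff x).1 (sub_eq_zero.1 h), pow_orderOf_eq_one]
    · exact Or.inr (ht.pow_four x (sub_eq_zero.1 h))
  · rw [(ht.eq_four_iff x).1 (sub_eq_zero.1 h)]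
    simp

/-- In type `Ẽ₈` the values of the trace squares are `0`, `1`, `4` and the two roots of
`X² - 3 X + 1`, and the moments are `1`, `1`, `2`, `5`, `14`. -/
theorem IsTraceSq.alternatingGroup_five {u b c d f : G → k} (hu : ∀ x, u x = 1)
    (h1 : ∀ x, t x * u x = u x + b x) (h2 : ∀ x, t x * b x = u x + 2 * b x + c x)
    (h3 : ∀ x, t x * c x = b x + 2 * c x + d x + f x)
    (h4 : ∀ x, t x * d x = c x + 2 * d x + f x) (h5 : ∀ x, t x * f x = c x + d x + f x)
    (sb : ∑ x, b x = 0) (sc : ∑ x, c x = 0) (sd : ∑ x, d x = 0) (sf : ∑ x, f x = 0) :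
    Nonempty (G ≃* alternatingGroup (Fin 5)) := by
  have su : ∑ x, u x = Nat.card G := by simp [hu, Nat.card_eq_fintype_card]
  have k1 : ∀ x, t x = u x + b x := fun x => by linear_combination h1 x - t x * hu x
  have k2 : ∀ x, t x ^ 2 = 2 * u x + 3 * b x + c x := fun x => by
    linear_combination t x * k1 x + h1 x + h2 x
  have k3 : ∀ x, t x ^ 3 = 5 * u x + 9 * b x + 5 * c x + d x + f x := fun x => by
    linear_combination t x * k2 x + 2 * h1 x + 3 * h2 x + h3 x
  have k4 : ∀ x, t x ^ 4 = 14 * u x + 28 * b x + 21 * c x + 8 * d x + 7 * f x := fun x => by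
    linear_combination t x * k3 x + 5 * h1 x + 9 * h2 x + 5 * h3 x + h4 x + h5 x
  have hpol : ∀ x, t x * (t x - 1) * (t x - 4) * (t x ^ 2 - 3 * t x + 1) = 0 := fun x => by
    have hb : b x = t x - 1 := by linear_combination -k1 x - hu x
    have hc : c x = t x ^ 2 - 3 * t x + 1 := by linear_combination -k2 x - 2 * hu x - 3 * hb
    have hS : d x + f x = t x ^ 3 - 5 * t x ^ 2 + 6 * t x - 1 := by
      linear_combination -h3 x - hb + (t x - 2) * hc
    have hd : d x = (t x - 2) * (t x ^ 3 - 5 * t x ^ 2 + 6 * t x - 1) -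
        2 * (t x ^ 2 - 3 * t x + 1) := by
      linear_combination -h4 x - h5 x + (t x - 2) * hS - 2 * hc
    linear_combination h4 x - (t x - 1) * hd + hc + hS
  have e1 : ∑ x, t x * (t x - 1) * (t x ^ 2 - 3 * t x + 1) = 60 :=
    ht.sum_eq (fun x hx => by rw [hx]; norm_num) fun x =>
      mul_eq_zero.1 (by linear_combination hpol x)
  have e2 : ∑ x, t x * (t x - 4) * (t x ^ 2 - 3 * t x + 1) =
      3 * (Nat.card {x : G // orderOf x = 3} : k) :=
    ht.sum_eq_order_three (fun x hx => by rw [hx]; norm_num) fun x =>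
      mul_eq_zero.1 (by linear_combination hpol x)
  have e3 : ∑ x, (t x - 1) * (t x - 4) * (t x ^ 2 - 3 * t x + 1) =
      4 * (Nat.card {x : G // orderOf x = 2} : k) :=
    ht.sum_eq_order_two (fun x hx => by rw [hx]; norm_num) fun x =>
      mul_eq_zero.1 (by linear_combination hpol x)
  have f1 : ∑ x, t x * (t x - 1) * (t x ^ 2 - 3 * t x + 1) = (Nat.card G : k) := by
    rw [Finset.sum_congr rfl fun x _ => show t x * (t x - 1) * (t x ^ 2 - 3 * t x + 1) =
        u x + 3 * b x + 5 * c x + 4 * d x + 3 * f x by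
      linear_combination k4 x - 4 * k3 x + 4 * k2 x - k1 x]
    simp only [Finset.sum_add_distrib, ← Finset.mul_sum, su, sb, sc, sd, sf]
    ring
  have f2 : ∑ x, t x * (t x - 4) * (t x ^ 2 - 3 * t x + 1) = (Nat.card G : k) := by
    rw [Finset.sum_congr rfl fun x _ => show t x * (t x - 4) * (t x ^ 2 - 3 * t x + 1) =
        u x + 0 * b x + (-1) * c x + d x + 0 * f x by
      linear_combination k4 x - 7 * k3 x + 13 * k2 x - 4 * k1 x]
    simp only [Finset.sum_add_distrib, ← Finset.mul_sum, su, sb, sc, sd, sf]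
    ring
  have f3 : ∑ x, (t x - 1) * (t x - 4) * (t x ^ 2 - 3 * t x + 1) = (Nat.card G : k) := by
    rw [Finset.sum_congr rfl fun x _ => show (t x - 1) * (t x - 4) * (t x ^ 2 - 3 * t x + 1) =
        u x + (-1) * b x + c x + 0 * d x + (-1) * f x by
      linear_combination k4 x - 8 * k3 x + 20 * k2 x - 17 * k1 x - 4 * hu x]
    simp only [Finset.sum_add_distrib, ← Finset.mul_sum, su, sb, sc, sd, sf]
    ring
  have hN : Nat.card G = 60 := by exact_mod_cast f1.symm.trans e1
  have hn : 3 * Nat.card {x : G // orderOf x = 3} = 60 := by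
    rw [← hN]; exact_mod_cast e2.symm.trans f2
  have hm : 4 * Nat.card {x : G // orderOf x = 2} = 60 := by
    rw [← hN]; exact_mod_cast e3.symm.trans f3
  refine FiniteGroup.nonempty_mulEquiv_alternatingGroup_five hN (by omega) (by omega) fun x => ?_
  rcases mul_eq_zero.1 (hpol x) with h | h
  · rcases mul_eq_zero.1 h with h | h
    · rcases mul_eq_zero.1 h with h | h
      · left
        rw [← (ht.eq_zero_iff x).1 h, pow_orderOf_eq_one]
      · right; left
        rw [← (ht.eq_one_iff x).1 (sub_eq_zero.1 h), pow_orderOf_eq_one]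
    · rw [(ht.eq_four_iff x).1 (sub_eq_zero.1 h)]
      simp
  · exact Or.inr (Or.inr (ht.pow_five x h))

end Counting


/-! ### The McKay quiver in the character ring -/

/-- The character of a tensor product is the convolution product of the characters. -/
theorem trace_tensorRep {k H V W : Type*} [Field k] [Ring H] [Bialgebra k H] [AddCommGroup V]
    [Module k V] [AddCommGroup W] [Module k W] [Module.Finite k V] [Module.Finite k W]
    (σ : H →ₐ[k] Module.End k V) (τ : H →ₐ[k] Module.End k W) (h : H) :
    LinearMap.trace k _ (tensorRep σ τ h) =
      ((WithConv.toConv (LinearMap.trace k V ∘ₗ σ.toLinearMap) : ConvDual k H) *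
        WithConv.toConv (LinearMap.trace k W ∘ₗ τ.toLinearMap)) h := by
  have e : tensorRep σ τ h = ∑ l ∈ (Coalgebra.Repr.arbitrary k h).index,
      TensorProduct.map (σ ((Coalgebra.Repr.arbitrary k h).left l))
        (τ ((Coalgebra.Repr.arbitrary k h).right l)) := by
    refine TensorProduct.ext' fun v w => ?_
    rw [tensorRep_apply _ _ (Coalgebra.Repr.arbitrary k h), LinearMap.sum_apply]
    rfl
  rw [e, map_sum, Coalgebra.Repr.convMul_apply (Coalgebra.Repr.arbitrary k h)]
  refine Finset.sum_congr rfl fun l _ => ?_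
  rw [LinearMap.trace_tensorProduct']
  rfl

namespace GradedHopfAction

open SkewPlane

section Trace

variable {k H : Type*} [Field k] [Ring H] [HopfAlgebra k H] {q : k}
  (ρ : GradedHopfAction k H (SkewPlane.grading k q)) {α : k} (hα : α * α = q) (hq : q * q = 1)

/-- The character of the module `A₁`. -/
noncomputable def traceCoef : ConvDual k H := ρ.coef 0 0 + ρ.coef 1 1

include hα hq in
theorem trace_component_one (h : H) :
    LinearMap.trace k _ (ρ.component 1 h) = ρ.traceCoef h := by
  have hspan : Submodule.span k (Set.range (gen k q)) = SkewPlane.grading k q 1 := by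
    rw [grading, Submodule.pow_one]
  let b : Module.Basis (Fin 2) k (SkewPlane.grading k q 1) :=
    (Module.Basis.span (linearIndependent_gen hα hq)).map (LinearEquiv.ofEq _ _ hspan)
  have hb : ∀ j, (b j : SkewPlane k q) = gen k q j := fun j => by
    rw [Module.Basis.map_apply, LinearEquiv.coe_ofEq_apply, Module.Basis.span_apply]
  have hact : ∀ j, ρ.component 1 h (b j) = ∑ i, ρ.coef i j h • b i := fun j => by
    apply Subtype.ext
    rw [Submodule.coe_sum]
    refine (congrArg (ρ.act h) (hb j)).trans ((ρ.act_gen h j).trans ?_)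
    refine Finset.sum_congr rfl fun i _ => ?_
    rw [Submodule.coe_smul, hb]
  rw [LinearMap.trace_eq_matrix_trace k b, Matrix.trace_fin_two, LinearMap.toMatrix_apply,
    LinearMap.toMatrix_apply, hact, hact]
  simp only [Fin.sum_univ_two, map_add, map_smul, Module.Basis.repr_self]
  simp
  rfl

include hα hq in
/-- Multiplication by the class of `A₁` in the character ring is the adjacency matrix of the McKay
quiver. -/
theorem traceCoef_mul_character [IsSemisimpleRing H] [IsAlgClosed k] [Fintype (SimpleClass k H)]
    (j : SimpleClass k H) : ρ.traceCoef * j.character =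
      ∑ i, (mcKayArrows (ρ.component 1) i j : k) • i.character := by
  ext h
  have h1 := trace_eq_sum_finrank_mul_character
    (tensorRep (ρ.component 1) (Quotient.out j).rep) h
  rw [trace_tensorRep] at h1
  have h2 : (WithConv.toConv (LinearMap.trace k _ ∘ₗ (ρ.component 1).toLinearMap) : ConvDual k H) =
      ρ.traceCoef := by
    ext x
    exact ρ.trace_component_one hα hq x
  rw [h2] at h1
  refine h1.trans ?_
  rw [ConvDual.sum_apply]
  rfl

include hα hq in
/-- The dimensions form an eigenvector of the adjacency matrix for the eigenvalue `dim A₁ = 2`. -/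
theorem two_mul_dim [IsSemisimpleRing H] [IsAlgClosed k] [CharZero k] [Fintype (SimpleClass k H)]
    (j : SimpleClass k H) : 2 * (Quotient.out j).dim =
      ∑ i, mcKayArrows (ρ.component 1) i j * (Quotient.out i).dim := by
  have h1 : ∀ i : SimpleClass k H, i.character 1 = ((Quotient.out i).dim : k) := fun i => by
    rw [SimpleClass.character_apply, map_one, LinearMap.trace_one, Module.finrank_fin_fun]
  have h2 : (ρ.traceCoef * j.character) 1 = ρ.traceCoef 1 * j.character 1 := by
    rw [LinearMap.convMul_apply, Bialgebra.comul_one]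
    rfl
  have h3 : ρ.traceCoef 1 = 2 := by
    refine (congrArg₂ (· + ·) (ρ.isCorep_coef.one 0 0) (ρ.isCorep_coef.one 1 1)).trans ?_
    norm_num
  have h4 := congrArg (fun c : ConvDual k H => c 1) (ρ.traceCoef_mul_character hα hq j)
  replace h4 : (ρ.traceCoef * j.character) 1 = (∑ i, (mcKayArrows (ρ.component 1) i j : k) •
    i.character : ConvDual k H) 1 := h4
  rw [h2, h3, h1, ConvDual.sum_apply] at h4
  have h5 : (2 : k) * (Quotient.out j).dim =
      ∑ i, (mcKayArrows (ρ.component 1) i j : k) * (Quotient.out i).dim :=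
    h4.trans (Finset.sum_congr rfl fun i _ => congrArg _ (h1 i))
  exact_mod_cast h5

variable {ρ} {Γ : Type*} [Group Γ] {g : H} {π : H →ₐc[k] MonoidAlgebra k Γ}

theorem ActsByNegOne.traceCoef_mul (hg : ρ.ActsByNegOne g) (h : H) :
    ρ.traceCoef (h * g) = -1 * ρ.traceCoef h := by
  refine (congrArg₂ (· + ·) (hg.coef_mul 0 0 h) (hg.coef_mul 1 1 h)).trans ?_
  rw [← neg_add, neg_one_mul]
  rfl

include hα hq in
/-- At an element over `x`, the square of the character of `A₁` is the squared trace of a lift of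
`x`. -/
theorem IsLift.traceCoef_sq {x : Γ} {M : Matrix.SpecialLinearGroup (Fin 2) k}
    (hM : ρ.IsLift α π x M) {h : H} (hx : π h = MonoidAlgebra.single x 1) :
    (ρ.traceCoef * ρ.traceCoef) h = SLTwo.tr M ^ 2 := by
  have h1 : ∀ i l : Fin 2, (ρ.coef i i * ρ.coef l l) h = SLTwo.mat M i i * SLTwo.mat M l l :=
    fun i l => by rw [hM h hx, twist_self hα hq, twist_self hα hq, inv_one, one_mul, one_mul]
  have h2 : ρ.traceCoef * ρ.traceCoef = ∑ p : Fin 2 × Fin 2, ρ.coef p.1 p.1 * ρ.coef p.2 p.2 := by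
    rw [traceCoef, Fintype.sum_prod_type, Fin.sum_univ_two, Fin.sum_univ_two, Fin.sum_univ_two]
    simp only [add_mul, mul_add]
    abel
  rw [h2, ConvDual.sum_apply, Finset.sum_congr rfl fun p _ => h1 p.1 p.2, Fintype.sum_prod_type]
  simp only [Fin.sum_univ_two]
  rw [SLTwo.tr, Matrix.trace_fin_two]
  ring

/-- The values of a nontrivial simple character that factors through the quotient by `g` sum to
zero. -/
theorem _root_.IsCentralExtension.sum_character [IsAlgClosed k] [Fintype Γ]
    (hπ : IsCentralExtension g π) {σ : Γ → H} (hσ : ∀ x, π (σ x) = MonoidAlgebra.single x 1)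
    {i j : SimpleClass k H} (hi : i.IsTrivial) (hne : j ≠ i)
    (hj : ∀ v, (Quotient.out j).rep g v = v) : ∑ x, j.character (σ x) = 0 := by
  set τ := (Quotient.out j).rep with hτ
  have hg1 : τ g = 1 := LinearMap.ext hj
  have hmul : ∀ h, τ (h * g) = τ h := fun h => by rw [map_mul, hg1, mul_one]
  have hε : ∀ h, Coalgebra.counit (R := k) (π h) = Coalgebra.counit (R := k) h := fun h =>
    CoalgHomClass.counit_comp_apply π h
  let T := ∑ x, τ (σ x)
  let D : H →ₗ[k] Module.End k (Fin (Quotient.out j).dim → k) :=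
    LinearMap.mulRight k T ∘ₗ τ.toLinearMap - (Coalgebra.counit (R := k) (A := H)).smulRight T
  have hD : ∀ h, D h = τ h * T - Coalgebra.counit (R := k) h • T := fun h => rfl
  have hDg : ∀ h, D (h * g) = D h := fun h => by
    rw [hD, hD, hmul, ← hε (h * g), map_mul π, hπ.map_g, mul_one, hε]
  have hD0 : ∀ x, D (σ x) = 0 := fun y => by
    rw [hD, ← hε, hσ, sub_eq_zero, MonoidAlgebra.counit_single, CommSemiring.counit_apply, one_smul,
      Finset.mul_sum]
    refine Fintype.sum_equiv (Equiv.mulLeft y) _ _ fun x => ?_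
    rw [← map_mul]
    refine hπ.apply_eq (F := τ.toLinearMap) hmul ?_
    rw [map_mul, hσ, hσ, hσ, MonoidAlgebra.single_mul_single, mul_one]
    rfl
  have hT : ∀ h, τ h * T = Coalgebra.counit (R := k) h • T := fun h => by
    rw [← sub_eq_zero, ← hD, hπ.apply_eq_sum hDg hσ]
    simp [hD0]
  have hT0 : T = 0 := by
    by_contra h0
    obtain ⟨v, hv⟩ : ∃ v, T v ≠ 0 := by
      by_contra! h
      exact h0 (LinearMap.ext h)
    exact hne (hi.eq hv fun h => LinearMap.congr_fun (hT h) v)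
  have h1 : ∑ x, j.character (σ x) = LinearMap.trace k _ T :=
    (map_sum (LinearMap.trace k _) (fun x => τ (σ x)) Finset.univ).symm
  rw [h1, hT0, map_zero]

end Trace

/-- If the McKay quiver of `A₁` is bipartite with the trivial module on the even side, then `H` is a
central extension of a finite group, on which the even simple characters become functions: they are
multiplied by the trace squares by two steps in the quiver, and are orthogonal to the trivial
character. -/
theorem exists_evenCharacters.{u, v} {k : Type u} {H : Type v} [Field k] [Ring H]
    [HopfAlgebra k H] [IsSemisimpleRing H] [IsAlgClosed k] [CharZero k] {q : k}
    {ρ : GradedHopfAction k H (SkewPlane.grading k q)} {α : k} (hα : α * α = q) (hq : q * q = 1)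
    (hc : QuantumSLRelations q ρ.coef) (hsep : ∀ x : H, (∀ c ∈ ρ.coefAlgebra, c x = 0) → x = 0)
    {ι : Type*} [Fintype ι] (e : SimpleClass k H ≃ ι) {A : Matrix ι ι ℕ}
    (hA : ∀ i j, mcKayArrows (ρ.component 1) i j = A (e i) (e j)) {sgn : ι → ℤ}
    (hs : ∀ j, sgn j * sgn j = 1) (hodd : ∀ i j, A i j ≠ 0 → sgn i = -sgn j)
    {o : ι} (ho : (e.symm o).IsTrivial) (hso : sgn o = 1) :
    ∃ (G : Type v) (_ : Group G) (_ : Fintype G) (g : H) (π : H →ₐc[k] MonoidAlgebra k G),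
      IsCentralExtension g π ∧ ρ.ActsByNegOne g ∧
      ∃ (t : G → k) (χ : ι → G → k), IsTraceSq t ∧ (∀ x, χ o x = 1) ∧
        (∀ j, sgn j = 1 → j ≠ o → ∑ x, χ j x = 0) ∧
        ∀ j, sgn j = 1 → ∀ x, t x * χ j x = ∑ i, ((A * A) i j : k) * χ i x := by
  classical
  have hfin := module_finite hsep
  let _ : Fintype (SimpleClass k H) := Fintype.ofEquiv ι e.symm
  obtain ⟨g, hgl, hcen, hgg, hg, hact⟩ := exists_isGroupLikeElem hsep
    (sgn := fun j => (sgn (e j) : k)) (fun j => by exact_mod_cast hs _)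
    (fun i j h => by rw [hA] at h; exact_mod_cast hodd _ _ h) ho
    (by rw [e.apply_symm_apply, hso, Int.cast_one])
  obtain ⟨G, hG, hGfin, π, hπ⟩ := exists_isCentralExtension hq hc hsep hg hgl hcen hgg
  let _ : Fintype G := Fintype.ofFinite G
  obtain ⟨Γ₀, p₀, h₀, hlift⟩ := ρ.exists_binaryCover hα hq hc hsep hg hπ
  choose σ hσ using hπ.exists_section
  choose s hs using h₀.2.1
  have heven : ∀ j, sgn j = 1 → ∀ v, (Quotient.out (e.symm j)).rep g v = v := fun j hj v => by
    rw [hact, e.apply_symm_apply, hj, Int.cast_one, one_smul]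
  refine ⟨G, hG, inferInstance, g, π, hπ, hg, _, fun j x => (e.symm j).character (σ x),
    h₀.isTraceSq hs, fun x => ?_, fun j hj hne => ?_, fun j hj x => ?_⟩
  · have h1 : (Quotient.out (e.symm o)).rep (σ x) = 1 := LinearMap.ext fun v => by
      rw [ho.2, ← CoalgHomClass.counit_comp_apply π, hσ, MonoidAlgebra.counit_single,
        CommSemiring.counit_apply, one_smul]
      rfl
    refine (SimpleClass.character_apply _ _).trans ?_
    rw [h1, LinearMap.trace_one, Module.finrank_fin_fun, ho.1,
      Nat.cast_one]
  · exact hπ.sum_character hσ ho (fun h => hne (e.symm.injective h)) (heven j hj)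
  · have hlift' : ρ.IsLift α π x (s x) := by
      have := hlift (s x)
      rwa [hs] at this
    have h1 := ρ.traceCoef_mul_character hα hq
    have h2 : ρ.traceCoef * ρ.traceCoef * (e.symm j).character =
        ∑ i, ((A * A) i j : k) • (e.symm i).character := by
      rw [mul_assoc, h1, Finset.mul_sum, ← Equiv.sum_comp e.symm]
      simp only [mul_smul_comm, h1]
      simp only [← Equiv.sum_comp e.symm (fun i => _ • SimpleClass.character i), hA,
        e.apply_symm_apply, Finset.smul_sum, smul_smul]
      rw [Finset.sum_comm]
      refine Finset.sum_congr rfl fun i _ => ?_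
      rw [← Finset.sum_smul, Matrix.mul_apply]
      push_cast
      simp only [mul_comm]
    have h3 : (ρ.traceCoef * ρ.traceCoef * (e.symm j).character) (σ x) =
        (ρ.traceCoef * ρ.traceCoef) (σ x) * (e.symm j).character (σ x) := by
      refine hπ.conv_apply (fun h => ?_) (fun h => ?_) (hσ x)
      · rw [ConvDual.mul_apply_mul_of_isGroupLike hgl h hg.traceCoef_mul hg.traceCoef_mul]
        ring
      · rw [SimpleClass.character_apply, SimpleClass.character_apply, map_mul,
          show (Quotient.out (e.symm j)).rep g = 1 from LinearMap.ext (heven j hj), mul_one]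
    rw [hlift'.traceCoef_sq hα hq (hσ x), h2, ConvDual.sum_apply] at h3
    exact h3.symm

end GradedHopfAction


/-! ### The McKay quivers of types `Ẽ₆`, `Ẽ₇` and `Ẽ₈` -/

namespace GradedHopfAction

/-- The numerical content of the McKay quiver: the dimensions of the simple modules form a positive
vector with `A d = 2 d`, whose entry at the vertex of the trivial module is `1`. -/
theorem exists_dimensions {k H : Type*} [Field k] [Ring H] [HopfAlgebra k H] [IsSemisimpleRing H]
    [IsAlgClosed k] [CharZero k] {q : k} {ρ : GradedHopfAction k H (SkewPlane.grading k q)} {α : k}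
    (hα : α * α = q) (hq : q * q = 1) {ι : Type*} [Fintype ι] {G : SimpleGraph ι}
    {A : Matrix ι ι ℕ} (hA : ∀ i j, (A i j = 1 ∧ G.Adj i j) ∨ (A i j = 0 ∧ ¬ G.Adj i j))
    (h : HasMcKayGraph (ρ.component 1) G) :
    ∃ e : SimpleClass k H ≃ ι, (∀ i j, mcKayArrows (ρ.component 1) i j = A (e i) (e j)) ∧
      ∃ (d : ι → ℕ) (o : ι), (∀ i, 0 < d i) ∧ (∀ j, 2 * d j = ∑ i, A i j * d i) ∧ d o = 1 ∧
        (e.symm o).IsTrivial := by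
  obtain ⟨e, he⟩ := h
  have heA : ∀ i j, mcKayArrows (ρ.component 1) i j = A (e i) (e j) := fun i j => by
    rw [he]
    rcases hA (e i) (e j) with ⟨h1, h2⟩ | ⟨h1, h2⟩
    · rw [if_pos h2, h1]
    · rw [if_neg h2, h1]
  let _ : Fintype (SimpleClass k H) := Fintype.ofEquiv ι e.symm
  obtain ⟨i₀, h₀⟩ := SimpleClass.exists_isTrivial k H
  refine ⟨e, heA, fun i => (Quotient.out (e.symm i)).dim, e i₀, fun i =>
    (Quotient.out (e.symm i)).dim_pos, fun j => ?_, ?_, ?_⟩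
  · rw [ρ.two_mul_dim hα hq, ← Equiv.sum_comp e.symm]
    simp only [heA, e.apply_symm_apply]
  · have h1 : (Quotient.out (e.symm (e i₀))).dim = (Quotient.out i₀).dim :=
      congrArg (fun i : SimpleClass k H => (Quotient.out i).dim) (e.symm_apply_apply i₀)
    exact h1.trans h₀.1
  · rwa [e.symm_apply_apply]

section McKay

universe u v

variable {k : Type u} {H : Type v} [Field k] [Ring H] [HopfAlgebra k H] [IsSemisimpleRing H]
  [IsAlgClosed k] [CharZero k] {q : k} {ρ : GradedHopfAction k H (SkewPlane.grading k q)} {α : k}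
  (hα : α * α = q) (hq : q * q = 1) (hc : QuantumSLRelations q ρ.coef)
  (hsep : ∀ x : H, (∀ c ∈ ρ.coefAlgebra, c x = 0) → x = 0)

include hα hq hc hsep

/-- The positive vectors `d` with `A d = 2 d` are the multiples of the marks `1`, `2`, `3` of the
diagram, so that the trivial module is at the end of one of the three arms, all of which lie on the
even side. -/
theorem isKleinianAction_affineE6 (h : HasMcKayGraph (ρ.component 1) affineE6) :
    IsKleinianAction ρ (alternatingGroup (Fin 4)) := by
  let a : Fin 7 → Fin 7 → ℕ :=
    ![![0, 1, 0, 1, 0, 1, 0], ![1, 0, 1, 0, 0, 0, 0], ![0, 1, 0, 0, 0, 0, 0],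
      ![1, 0, 0, 0, 1, 0, 0], ![0, 0, 0, 1, 0, 0, 0], ![1, 0, 0, 0, 0, 0, 1],
      ![0, 0, 0, 0, 0, 1, 0]]
  have hA : ∀ i j, (a i j = 1 ∧ affineE6.Adj i j) ∨ (a i j = 0 ∧ ¬ affineE6.Adj i j) := by
    simp only [affineE6, SimpleGraph.fromEdgeSet_adj, Set.mem_insert_iff, Set.mem_singleton_iff]
    decide
  have hAA : Matrix.of a * Matrix.of a =
      !![3, 0, 1, 0, 1, 0, 1; 0, 2, 0, 1, 0, 1, 0; 1, 0, 1, 0, 0, 0, 0; 0, 1, 0, 2, 0, 1, 0; 1,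
        0, 0, 0, 1, 0, 0; 0, 1, 0, 1, 0, 2, 0; 1, 0, 0, 0, 0, 0, 1] := by
    decide
  let sgn : Fin 7 → ℤ := ![1, -1, 1, -1, 1, -1, 1]
  have hodd : ∀ i j, a i j ≠ 0 → sgn i = -sgn j := by decide
  obtain ⟨e, heA, d, o, hd, hdA, hdo, ho⟩ := exists_dimensions hα hq (A := Matrix.of a) hA h
  have hso : sgn o = 1 ∧ (o = 2 ∨ o = 4 ∨ o = 6) := by
    have hdA' := fun j => hdA j
    simp only [a, Matrix.of_apply, Fin.forall_fin_succ, Fin.sum_univ_succ] at hdA' hd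
    simp at hdA' hd
    fin_cases o <;> simp [sgn] at hdo ⊢ <;> omega
  obtain ⟨G, _, _, g, π, hπ, hg, t, χ, ht, hχo, hsum, hχ⟩ :=
    exists_evenCharacters hα hq hc hsep e heA (sgn := sgn) (by decide) hodd ho hso.1
  simp only [hAA] at hχ
  have h0 : ∀ x, t x * χ 0 x = 3 * χ 0 x + χ 2 x + χ 4 x + χ 6 x := fun x => by
    rw [hχ 0 rfl x]
    simp [Fin.sum_univ_succ]
    ring
  have h2 : ∀ x, t x * χ 2 x = χ 0 x + χ 2 x := fun x => by
    rw [hχ 2 rfl x]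
    simp [Fin.sum_univ_succ]
  have h4 : ∀ x, t x * χ 4 x = χ 0 x + χ 4 x := fun x => by
    rw [hχ 4 rfl x]
    simp [Fin.sum_univ_succ]
  have h6 : ∀ x, t x * χ 6 x = χ 0 x + χ 6 x := fun x => by
    rw [hχ 6 rfl x]
    simp [Fin.sum_univ_succ]
  obtain ⟨θ⟩ : Nonempty (G ≃* alternatingGroup (Fin 4)) := by
    rcases hso.2 with rfl | rfl | rfl
    · exact ht.alternatingGroup_four hχo h2 h4 h6 (fun x => by rw [h0]) (hsum 0 rfl (by decide))
        (hsum 4 rfl (by decide)) (hsum 6 rfl (by decide))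
    · exact ht.alternatingGroup_four hχo h4 h2 h6 (fun x => by rw [h0]; ring)
        (hsum 0 rfl (by decide)) (hsum 2 rfl (by decide)) (hsum 6 rfl (by decide))
    · exact ht.alternatingGroup_four hχo h6 h2 h4 (fun x => by rw [h0]; ring)
        (hsum 0 rfl (by decide)) (hsum 2 rfl (by decide)) (hsum 4 rfl (by decide))
  exact isKleinianAction hα hq hc hsep hg (hπ.mapDomain θ) (.alternatingGroup_four k)

/-- By the marks of the diagram the trivial module is at one of the ends of the long path, which are
exchanged by the symmetry of the diagram. -/
theorem isKleinianAction_affineE7 (h : HasMcKayGraph (ρ.component 1) affineE7) :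
    IsKleinianAction ρ (Equiv.Perm (Fin 4)) := by
  let a : Fin 8 → Fin 8 → ℕ :=
    ![![0, 1, 0, 0, 0, 0, 0, 0], ![1, 0, 1, 0, 0, 0, 0, 0], ![0, 1, 0, 1, 0, 0, 0, 0],
      ![0, 0, 1, 0, 1, 0, 0, 1], ![0, 0, 0, 1, 0, 1, 0, 0], ![0, 0, 0, 0, 1, 0, 1, 0],
      ![0, 0, 0, 0, 0, 1, 0, 0], ![0, 0, 0, 1, 0, 0, 0, 0]]
  have hA : ∀ i j, (a i j = 1 ∧ affineE7.Adj i j) ∨ (a i j = 0 ∧ ¬ affineE7.Adj i j) := by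
    simp only [affineE7, SimpleGraph.fromEdgeSet_adj, Set.mem_insert_iff, Set.mem_singleton_iff]
    decide
  have hAA : Matrix.of a * Matrix.of a =
      !![1, 0, 1, 0, 0, 0, 0, 0; 0, 2, 0, 1, 0, 0, 0, 0; 1, 0, 2, 0, 1, 0, 0, 1; 0, 1, 0, 3, 0,
        1, 0, 0; 0, 0, 1, 0, 2, 0, 1, 1; 0, 0, 0, 1, 0, 2, 0, 0; 0, 0, 0, 0, 1, 0, 1, 0; 0, 0, 1,
        0, 1, 0, 0, 1] := by
    decide
  let sgn : Fin 8 → ℤ := ![1, -1, 1, -1, 1, -1, 1, 1]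
  have hodd : ∀ i j, a i j ≠ 0 → sgn i = -sgn j := by decide
  obtain ⟨e, heA, d, o, hd, hdA, hdo, ho⟩ := exists_dimensions hα hq (A := Matrix.of a) hA h
  have hso : sgn o = 1 ∧ (o = 0 ∨ o = 6) := by
    have hdA' := fun j => hdA j
    simp only [a, Matrix.of_apply, Fin.forall_fin_succ, Fin.sum_univ_succ] at hdA' hd
    simp at hdA' hd
    fin_cases o <;> simp [sgn] at hdo ⊢ <;> omega
  obtain ⟨G, _, _, g, π, hπ, hg, t, χ, ht, hχo, hsum, hχ⟩ :=
    exists_evenCharacters hα hq hc hsep e heA (sgn := sgn) (by decide) hodd ho hso.1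
  simp only [hAA] at hχ
  have h0 : ∀ x, t x * χ 0 x = χ 0 x + χ 2 x := fun x => by
    rw [hχ 0 rfl x]
    simp [Fin.sum_univ_succ]
  have h2 : ∀ x, t x * χ 2 x = χ 0 x + 2 * χ 2 x + χ 4 x + χ 7 x := fun x => by
    rw [hχ 2 rfl x]
    simp [Fin.sum_univ_succ]
    ring
  have h4 : ∀ x, t x * χ 4 x = χ 2 x + 2 * χ 4 x + χ 6 x + χ 7 x := fun x => by
    rw [hχ 4 rfl x]
    simp [Fin.sum_univ_succ]
    ring
  have h6 : ∀ x, t x * χ 6 x = χ 4 x + χ 6 x := fun x => by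
    rw [hχ 6 rfl x]
    simp [Fin.sum_univ_succ]
  have h7 : ∀ x, t x * χ 7 x = χ 2 x + χ 4 x + χ 7 x := fun x => by
    rw [hχ 7 rfl x]
    simp [Fin.sum_univ_succ]
    ring
  obtain ⟨θ⟩ : Nonempty (G ≃* Equiv.Perm (Fin 4)) := by
    rcases hso.2 with rfl | rfl
    · exact ht.perm_four hχo h0 h2 h4 h6 h7 (hsum 2 rfl (by decide)) (hsum 4 rfl (by decide))
        (hsum 6 rfl (by decide)) (hsum 7 rfl (by decide))
    · exact ht.perm_four hχo (fun x => by rw [h6]; ring) (fun x => by rw [h4]; ring)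
        (fun x => by rw [h2]; ring) (fun x => by rw [h0]; ring) (fun x => by rw [h7]; ring)
        (hsum 4 rfl (by decide)) (hsum 2 rfl (by decide)) (hsum 0 rfl (by decide))
        (hsum 7 rfl (by decide))
  exact isKleinianAction hα hq hc hsep hg (hπ.mapDomain θ) (.perm_four k)

/-- By the marks of the diagram the trivial module is at the end of the longest arm. -/
theorem isKleinianAction_affineE8 (h : HasMcKayGraph (ρ.component 1) affineE8) :
    IsKleinianAction ρ (alternatingGroup (Fin 5)) := by
  let a : Fin 9 → Fin 9 → ℕ :=
    ![![0, 1, 0, 0, 0, 0, 0, 0, 0], ![1, 0, 1, 0, 0, 0, 0, 0, 0], ![0, 1, 0, 1, 0, 0, 0, 0, 0],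
      ![0, 0, 1, 0, 1, 0, 0, 0, 0], ![0, 0, 0, 1, 0, 1, 0, 0, 0], ![0, 0, 0, 0, 1, 0, 1, 0, 1],
      ![0, 0, 0, 0, 0, 1, 0, 1, 0], ![0, 0, 0, 0, 0, 0, 1, 0, 0], ![0, 0, 0, 0, 0, 1, 0, 0, 0]]
  have hA : ∀ i j, (a i j = 1 ∧ affineE8.Adj i j) ∨ (a i j = 0 ∧ ¬ affineE8.Adj i j) := by
    simp only [affineE8, SimpleGraph.fromEdgeSet_adj, Set.mem_insert_iff, Set.mem_singleton_iff]
    decide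
  have hAA : Matrix.of a * Matrix.of a =
      !![1, 0, 1, 0, 0, 0, 0, 0, 0; 0, 2, 0, 1, 0, 0, 0, 0, 0; 1, 0, 2, 0, 1, 0, 0, 0, 0; 0, 1,
        0, 2, 0, 1, 0, 0, 0; 0, 0, 1, 0, 2, 0, 1, 0, 1; 0, 0, 0, 1, 0, 3, 0, 1, 0; 0, 0, 0, 0, 1,
        0, 2, 0, 1; 0, 0, 0, 0, 0, 1, 0, 1, 0; 0, 0, 0, 0, 1, 0, 1, 0, 1] := by
    decide
  let sgn : Fin 9 → ℤ := ![1, -1, 1, -1, 1, -1, 1, -1, 1]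
  have hodd : ∀ i j, a i j ≠ 0 → sgn i = -sgn j := by decide
  obtain ⟨e, heA, d, o, hd, hdA, hdo, ho⟩ := exists_dimensions hα hq (A := Matrix.of a) hA h
  have hso : sgn o = 1 ∧ o = 0 := by
    have hdA' := fun j => hdA j
    simp only [a, Matrix.of_apply, Fin.forall_fin_succ, Fin.sum_univ_succ] at hdA' hd
    simp at hdA' hd
    fin_cases o <;> simp [sgn] at hdo ⊢ <;> omega
  obtain ⟨G, _, _, g, π, hπ, hg, t, χ, ht, hχo, hsum, hχ⟩ :=
    exists_evenCharacters hα hq hc hsep e heA (sgn := sgn) (by decide) hodd ho hso.1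
  simp only [hAA] at hχ
  have h0 : ∀ x, t x * χ 0 x = χ 0 x + χ 2 x := fun x => by
    rw [hχ 0 rfl x]
    simp [Fin.sum_univ_succ]
  have h2 : ∀ x, t x * χ 2 x = χ 0 x + 2 * χ 2 x + χ 4 x := fun x => by
    rw [hχ 2 rfl x]
    simp [Fin.sum_univ_succ]
    ring
  have h4 : ∀ x, t x * χ 4 x = χ 2 x + 2 * χ 4 x + χ 6 x + χ 8 x := fun x => by
    rw [hχ 4 rfl x]
    simp [Fin.sum_univ_succ]
    ring
  have h6 : ∀ x, t x * χ 6 x = χ 4 x + 2 * χ 6 x + χ 8 x := fun x => by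
    rw [hχ 6 rfl x]
    simp [Fin.sum_univ_succ]
    ring
  have h8 : ∀ x, t x * χ 8 x = χ 4 x + χ 6 x + χ 8 x := fun x => by
    rw [hχ 8 rfl x]
    simp [Fin.sum_univ_succ]
    ring
  obtain ⟨θ⟩ : Nonempty (G ≃* alternatingGroup (Fin 5)) := by
    obtain rfl := hso.2
    exact ht.alternatingGroup_five hχo h0 h2 h4 h6 h8 (hsum 2 rfl (by decide))
      (hsum 4 rfl (by decide)) (hsum 6 rfl (by decide)) (hsum 8 rfl (by decide))
  exact isKleinianAction hα hq hc hsep hg (hπ.mapDomain θ) (.alternatingGroup_five k)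

end McKay

end GradedHopfAction

theorem mainTheorem3 (k : Type*) [Field k] [IsAlgClosed k] [CharZero k] :
    (∀ (H : Type*) [Ring H] [HopfAlgebra k H] [IsSemisimpleRing H] (q : k) (_ : q = 1 ∨ q = -1)
      (ρ : GradedHopfAction k H (SkewPlane.grading k q)),
      ρ.InnerFaithful → ρ.HasTrivialHomologicalDet (SkewPlane.augmentation k q) →
        (HasMcKayGraph (ρ.component 1) affineE6 →
          IsKleinianAction ρ (alternatingGroup (Fin 4))) ∧
        (HasMcKayGraph (ρ.component 1) affineE7 →
          IsKleinianAction ρ (Equiv.Perm (Fin 4))) ∧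
        (HasMcKayGraph (ρ.component 1) affineE8 →
          IsKleinianAction ρ (alternatingGroup (Fin 5)))) ∧
    (∀ (n : ℕ) (_ : 2 ≤ n)
      (ρ : GradedHopfAction k (BDihedral k n) (SkewPlane.grading k (-1))),
      ρ.InnerFaithful → ρ.HasTrivialHomologicalDet (SkewPlane.augmentation k (-1)) →
        IsKleinianAction ρ (DihedralGroup n)) := by
  refine ⟨fun H _ _ _ q hq ρ hif hd => ?_,
    fun n hn ρ hif hd => BDihedral.isKleinianAction hn hif hd⟩
  have hqq : q * q = 1 := by rcases hq with rfl | rfl <;> ring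
  -- the square root of `q` that untwists the even part of `k_q[u,v]`
  obtain ⟨α, hα⟩ := IsAlgClosed.exists_pow_nat_eq q two_pos
  rw [pow_two] at hα
  have hc := ρ.quantumSLRelations_coef hα hqq (ρ.relationChar_eq_one hα hqq hd)
  have hsep : ∀ x : H, (∀ c ∈ ρ.coefAlgebra, c x = 0) → x = 0 := fun x hx =>
    GradedHopfAction.eq_zero_of_coefAlgebra hα hqq (ρ.relationChar_eq_one hα hqq hd) hif hx
  exact ⟨GradedHopfAction.isKleinianAction_affineE6 hα hqq hc hsep,
    GradedHopfAction.isKleinianAction_affineE7 hα hqq hc hsep,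
    GradedHopfAction.isKleinianAction_affineE8 hα hqq hc hsep⟩
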